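/- **Setting.** Let $k$ be a commutative ring. A *potential* is a polynomial $W\in k[x]=k[x_1,\dots,x_n]$ such that $\partial_{x_1}W,\dots,\partial_{x_n}W$ is a quasi-regular sequence, $k[x]/(\partial_{x_1}W,\dots,\partial_{x_n}W)$ is a finitely generated free $k$-module, and the Koszul complex of $\partial_{x_1}W,\dots,\partial_{x_n}W$ is exact outside degree $0$. A linear factorisation of $w\in A$ is a $\mathbb Z/2$-graded $A$-module with an odd $A$-linear endomorphism $d$, $d^2=w$; it is a matrix factorisation if the module is graded free. Morphisms are even $A$-linear maps commuting with $d$, taken up to homotopy. The bicategory $\mathcal{LG}_k$ has the potentials as objects. The 1-morphisms from $W\in R=k[x_1,\dots,x_n]$ to $V\in S=k[z_1,\dots,z_m]$ are the matrix factorisations of $V-W$ over $k[x,z]$ (possibly of infinite rank) that are direct summands, in the homotopy category, of matrix factorisations of finite rank; the 2-morphisms are homotopy classes of morphisms. The composite of $X:W\to V$ and $Y:V\to U$ is $Y\otimes_S X$ with $d_{Y\otimes X}=d_Y\otimes 1+1\otimes d_X$ (with the Koszul sign). The unit at $W$ is $\Delta_W=\bigwedge\bigl(\bigoplus_i k[x,x']\theta_i\bigr)$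 with differential $\sum_i\bigl(\partial_{[i]}W\cdot\theta_i+(x_i-x_i')\theta_i^*\bigr)$, where $$\partial_{[i]}f=\frac{f(x_1',\dots,x_{i-1}',x_i,\dots,x_n)-f(x_1',\dots,x_i',x_{i+1},\dots,x_n)}{x_i-x_i'},$$ and the unit actions $\Delta_V\otimes_S X\to X$ and $X\otimes_R\Delta_W\to X$ are induced by the projection of $\Delta$ to $\theta$-degree $0$ followed by multiplication. **Duals and shifts.** For $X$ of finite rank put $X^\vee=\operatorname{Hom}_{k[x,z]}(X,k[x,z])$ with differential $\nu\mapsto-(-1)^{|\nu|}\nu\circ d_X$, and $${}^\dagger X=X^\vee\otimes_S S[m],\qquad X^\dagger=R[n]\otimes_R X^\vee .$$ With the identifications $\nu\otimes 1\leftrightarrow\nu\leftrightarrow 1\otimes\nu$ these are $X^\vee$ with grading shifted by $m$, respectively $n$, and with differential $d_{X^\vee}$, respectively $(-1)^n d_{X^\vee}$. **Atiyah classes.** Let $T=K[t_1,\dots,t_r]$ and let $\Omega_K T$ be its algebra of noncommutative forms over $K$, with differential $\mathrm d$. Let $M$ be a free $\mathbb Z/2$-graded $T$-module with homogeneous basis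 $(b_j)$ and an odd operator $D b_j=\sum_i D_{ij}b_i$. The left Atiyah class is the operator $\operatorname{At}=\nabla D+D\nabla$ on $\Omega_K T\otimes_T M$, with $\nabla(\omega\otimes b_j)=\mathrm d\omega\otimes b_j$ and $D(\omega\otimes b_j)=(-1)^{|\omega|}\sum_i\omega D_{ij}\otimes b_i$. The right Atiyah class is $\nabla D+D\nabla$ on $M\otimes_T\Omega_K T$, with $\nabla(b_j\otimes\omega)=(-1)^{|b_j|}b_j\otimes\mathrm d\omega$ and $D(b_j\otimes\omega)=\sum_i b_i\otimes D_{ij}\omega$; write $\overleftarrow{\operatorname{At}}$ for its transport to $\Omega_K T\otimes_T M$ along $b\otimes\omega\mapsto(-1)^{|b||\omega|}\omega\otimes b$. For a composite $Y\otimes Z$ of 1-morphisms from an object with variables $t$ to itself, let $\operatorname{At}_{1}(Y\otimes Z)$ denote the class of $d_{Y\otimes Z}$ for $T=K[t]$, where $t$ are the variables of the first (outermost left) copy and $K$ is the polynomial ring in all other variables, including those, $t'$, of the last copy. Put $$\Psi(f_0\,\mathrm df_1\cdots\mathrm df_p)=\sum_{i_1<\dots<i_p}f_0\,\partial_{[i_1]}f_1\cdots\partial_{[i_p]}f_p\;\theta_{i_1}\cdots\theta_{i_p},$$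 let $\varepsilon$ take the coefficient of the top form $\theta_1\theta_2\cdots$, and write $\operatorname{Res}_{R/k}$, $\operatorname{Res}_{S/k}$ for the Grothendieck residue symbols, extended linearly over the other variables. **Theorem.** $\mathcal{LG}_k$ is well defined (composites of 1-morphisms are 1-morphisms, and the unit actions are invertible up to homotopy), and every 1-morphism of $\mathcal{LG}_k$ has a left adjoint and a right adjoint. Moreover, let $X:W\to V$ be a matrix factorisation of finite rank with $W\in R=k[x_1,\dots,x_n]$, $V\in S=k[z_1,\dots,z_m]$. Then ${}^\dagger X\dashv X\dashv X^\dagger$ in $\mathcal{LG}_k$. More precisely, let $(e_i)$ be any homogeneous basis of $X$ with dual basis $(e_i^*)$, and choose any odd $k[x,z]$-linear endomorphisms $\lambda_i,\mu_j$ of $X$ with $d_X\lambda_i+\lambda_id_X=\partial_{x_i}W$ $(1\le i\le n)$ and $d_X\mu_j+\mu_jd_X=\partial_{z_j}V$ $(1\le j\le m)$. Put $\Lambda^{(x)}=\lambda_1\cdots\lambda_n$, $\Lambda^{(z)}=\mu_1\cdots\mu_m$. Then: 1. the formulas $$\widetilde{\operatorname{coev}}_X(\gamma)=\sum_{l\ge0}\varepsilon\Bigl(\gamma\wedge(-1)^{l+nl}\,\Psi\overleftarrow{\operatorname{At}}_1(X^\dagger\otimes_S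 X)^l\Bigl(\sum_j(-1)^{|e_j|}e_j^*\otimes e_j\Bigr)\Bigr),$$ $$\widetilde{\operatorname{ev}}_X(\eta\otimes\nu)=\sum_{l\ge0}(-1)^{n+n|\eta|}\operatorname{Res}_{R/k}\left[\frac{\Psi\bigl\langle\operatorname{At}_1(X\otimes_R X^\vee)^l(\Lambda^{(x)}\eta\otimes\nu)\bigr\rangle\,\mathrm dx_1\cdots\mathrm dx_n}{\partial_{x_1}W,\dots,\partial_{x_n}W}\right],$$ where $\langle e_i\otimes e_j^*\rangle=(-1)^{|e_i||e_j|}\delta_{ij}$, define morphisms of linear factorisations $\Delta_W\to X^\dagger\otimes_S X$ and $X\otimes_R X^\dagger\to\Delta_V$, and their homotopy classes are the unit and the counit of an adjunction $X\dashv X^\dagger$; 2. the formulas $$\operatorname{coev}_X(\gamma')=\sum_{l\ge0}\varepsilon\Bigl(\gamma'\wedge(-1)^{m+l+ml}\,\Psi\overleftarrow{\operatorname{At}}_1(X\otimes_R{}^\dagger X)^l\Bigl(\sum_j e_j\otimes e_j^*\Bigr)\Bigr),$$ $$\operatorname{ev}_X(\nu\otimes\eta)=\sum_{l\ge0}(-1)^{m}\operatorname{Res}_{S/k}\left[\frac{\Psi\bigl\langle\operatorname{At}_1(X^\vee\otimes_S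 X)^l(\nu\Lambda^{(z)}\otimes\eta)\bigr\rangle\,\mathrm dz_1\cdots\mathrm dz_m}{\partial_{z_1}V,\dots,\partial_{z_m}V}\right],$$ where $\langle e_i^*\otimes e_j\rangle=\delta_{ij}$, define morphisms of linear factorisations $\Delta_V\to X\otimes_R{}^\dagger X$ and ${}^\dagger X\otimes_S X\to\Delta_W$, and their homotopy classes are the unit and the counit of an adjunction ${}^\dagger X\dashv X$. In particular, in both cases the Zorro moves (triangle identities) hold up to homotopy. -/

import Mathlib

open CategoryTheory TensorProduct

universe u

noncomputable section

namespace LGModels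

section LinearFactorisations

/-- A linear factorisation of `w ∈ A`: a `ℤ/2`-graded `A`-module with an odd `A`-linear endomorphism
`d` such that `d ∘ d = w`. The grading `X = X⁰ ⊕ X¹` is encoded by the projector `even` onto `X⁰`. -/
structure LinFact (A : Type u) [CommRing A] (w : A) where
  carrier : Type u
  [grp : AddCommGroup carrier]
  [mod : Module A carrier]
  even : carrier →ₗ[A] carrier
  even_even : ∀ x, even (even x) = even x
  d : carrier →ₗ[A] carrier
  d_odd : ∀ x, even (d x) + d (even x) = d x
  d_sq : ∀ x, d (d x) = w • x

attribute [instance] LinFact.grp LinFact.mod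

variable {A : Type u} [CommRing A] {w : A}

namespace LinFact

/-- The grading operator `x ↦ (-1)^{|x|} x`. -/
def sign (X : LinFact A w) : X.carrier →ₗ[A] X.carrier := X.even + X.even - LinearMap.id

lemma sign_apply (X : LinFact A w) (x : X.carrier) : X.sign x = X.even x + X.even x - x := rfl

lemma even_d (X : LinFact A w) (x : X.carrier) : X.even (X.d x) = X.d x - X.d (X.even x) :=
  eq_sub_of_add_eq (X.d_odd x)

lemma sign_sign (X : LinFact A w) (x : X.carrier) : X.sign (X.sign x) = x := by
  simp only [sign_apply, map_sub, map_add, X.even_even]; abel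

lemma sign_d (X : LinFact A w) (x : X.carrier) : X.sign (X.d x) = - X.d (X.sign x) := by
  simp only [sign_apply, map_sub, map_add, X.even_d]; abel

lemma even_sign (X : LinFact A w) (x : X.carrier) : X.even (X.sign x) = X.even x := by
  simp only [sign_apply, map_sub, map_add, X.even_even]; abel

lemma sign_even (X : LinFact A w) (x : X.carrier) : X.sign (X.even x) = X.even x := by
  simp only [sign_apply, X.even_even]; abel

/-- Morphisms of linear factorisations: even `A`-linear maps that commute with the differentials. -/
structure Hom (X Y : LinFact A w) where
  map : X.carrier →ₗ[A] Y.carrier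
  map_even : ∀ x, map (X.even x) = Y.even (map x)
  map_d : ∀ x, map (X.d x) = Y.d (map x)

namespace Hom

variable {X Y Z T : LinFact A w}

lemma ext' {f g : Hom X Y} (h : ∀ x, f.map x = g.map x) : f = g := by
  cases f; cases g; congr 1; exact LinearMap.ext h

lemma map_sign (f : Hom X Y) (x : X.carrier) : f.map (X.sign x) = Y.sign (f.map x) := by
  simp only [sign_apply, map_sub, map_add, f.map_even]

/-- The identity. -/
def id (X : LinFact A w) : Hom X X := ⟨LinearMap.id, fun _ => rfl, fun _ => rfl⟩

/-- Composition, first `f`, then `g`. -/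
def comp (f : Hom X Y) (g : Hom Y Z) : Hom X Z :=
  ⟨g.map ∘ₗ f.map, fun x => by simp [f.map_even, g.map_even], fun x => by simp [f.map_d, g.map_d]⟩

@[simp] lemma id_map (x : X.carrier) : (id X).map x = x := rfl

@[simp] lemma comp_map (f : Hom X Y) (g : Hom Y Z) (x : X.carrier) :
    (f.comp g).map x = g.map (f.map x) := rfl

/-- Two morphisms are homotopic if they differ by `d h + h d` for an odd `A`-linear map `h`. -/
def Homotopic (f g : Hom X Y) : Prop :=
  ∃ h : X.carrier →ₗ[A] Y.carrier, (∀ x, Y.even (h x) + h (X.even x) = h x) ∧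
    ∀ x, g.map x = f.map x + (Y.d (h x) + h (X.d x))

lemma Homotopic.refl (f : Hom X Y) : Homotopic f f := ⟨0, by simp, by simp⟩

lemma Homotopic.symm {f g : Hom X Y} (H : Homotopic f g) : Homotopic g f := by
  obtain ⟨h, h1, h2⟩ := H
  refine ⟨-h, fun x => ?_, fun x => ?_⟩
  · conv_rhs => rw [LinearMap.neg_apply, ← h1 x]
    simp only [LinearMap.neg_apply, map_neg]; abel
  · simp only [LinearMap.neg_apply, map_neg, h2]; abel

lemma Homotopic.trans {f g e : Hom X Y} (H : Homotopic f g) (H' : Homotopic g e) :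
    Homotopic f e := by
  obtain ⟨h, h1, h2⟩ := H
  obtain ⟨h', h1', h2'⟩ := H'
  refine ⟨h + h', fun x => ?_, fun x => ?_⟩
  · conv_rhs => rw [LinearMap.add_apply, ← h1 x, ← h1' x]
    simp only [LinearMap.add_apply, map_add]; abel
  · simp only [LinearMap.add_apply, map_add, h2, h2']; abel

lemma Homotopic.comp {f f' : Hom X Y} {g g' : Hom Y Z} (H : Homotopic f f') (H' : Homotopic g g') :
    Homotopic (f.comp g) (f'.comp g') := by
  obtain ⟨h, h1, h2⟩ := H
  obtain ⟨h', h1', h2'⟩ := H'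
  refine ⟨g.map ∘ₗ h + h' ∘ₗ f'.map, fun x => ?_, fun x => ?_⟩
  · have e1 := congrArg g.map (h1 x)
    have e2 := h1' (f'.map x)
    rw [map_add, g.map_even] at e1
    simp only [LinearMap.add_apply, LinearMap.comp_apply, map_add, f'.map_even]
    linear_combination (norm := abel) e1 + e2
  · have e1 := congrArg g.map (h2 x)
    have e2 := h2' (f'.map x)
    simp only [map_add, g.map_d] at e1
    simp only [comp_map, LinearMap.add_apply, LinearMap.comp_apply, map_add, f'.map_d]
    linear_combination (norm := abel) e1 + e2

/-- Homotopy as an equivalence relation. -/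
instance setoid (X Y : LinFact A w) : Setoid (Hom X Y) :=
  ⟨Homotopic, Homotopic.refl, Homotopic.symm, Homotopic.trans⟩

end Hom

/-- The homotopy category of linear factorisations of `w`. -/
instance : Category (LinFact A w) where
  Hom X Y := Quotient (Hom.setoid X Y)
  id X := ⟦Hom.id X⟧
  comp f g := Quotient.map₂ Hom.comp (fun _ _ H _ _ H' => Hom.Homotopic.comp H H') f g
  id_comp f := by induction f using Quotient.ind; rfl
  comp_id f := by induction f using Quotient.ind; rfl
  assoc f g h := by
    induction f using Quotient.ind; induction g using Quotient.ind; induction h using Quotient.ind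
    rfl

/-- The homotopy class of a morphism. -/
def cls {X Y : LinFact A w} (f : Hom X Y) : X ⟶ Y := Quotient.mk (Hom.setoid X Y) f

lemma cls_surj {X Y : LinFact A w} (f : X ⟶ Y) : ∃ f', cls f' = f := Quotient.exists_rep f

lemma cls_comp {X Y Z : LinFact A w} (f : Hom X Y) (g : Hom Y Z) :
    cls f ≫ cls g = cls (f.comp g) := rfl

lemma cls_id (X : LinFact A w) : 𝟙 X = cls (Hom.id X) := rfl

lemma cls_eq {X Y : LinFact A w} {f g : Hom X Y} (H : f.Homotopic g) : cls f = cls g :=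
  Quotient.sound H

/-- A homogeneous basis of (the module underlying) a linear factorisation: every basis vector is
even (`par i = 0`) or odd (`par i = 1`). -/
structure HomBasis (X : LinFact A w) (I : Type u) where
  basis : Module.Basis I A X.carrier
  par : I → ZMod 2
  even_basis : ∀ i, X.even (basis i) = if par i = 0 then basis i else 0

/-- A matrix factorisation is a linear factorisation whose underlying module is graded free. -/
def IsMF (X : LinFact A w) : Prop := ∃ I : Type u, Nonempty (HomBasis X I)

/-- Matrix factorisations of finite rank. -/
def IsFiniteRank (X : LinFact A w) : Prop := ∃ I : Type u, Finite I ∧ Nonempty (HomBasis X I)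

/-- Being a direct summand, in the homotopy category, of a finite-rank matrix factorisation. -/
def IsSummandOfFinite (X : LinFact A w) : Prop :=
  ∃ F : LinFact A w, F.IsFiniteRank ∧ ∃ (s : X ⟶ F) (r : F ⟶ X), s ≫ r = 𝟙 X

end LinFact
end LinearFactorisations

section TensorOfModules

/-- A `T ⊗ S`-module, seen as an `S`-module through the right-hand factor. -/
@[nolint unusedArguments]
def RMod (k T S : Type u) (M : Type u) [CommRing k] [CommRing T] [CommRing S] [Algebra k T]
    [Algebra k S] : Type u := M

/-- An `S ⊗ R`-module, seen as an `S`-module through the left-hand factor. -/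
@[nolint unusedArguments]
def LMod (k S R : Type u) (N : Type u) [CommRing k] [CommRing S] [CommRing R] [Algebra k S]
    [Algebra k R] : Type u := N

variable {k T S R : Type u} [CommRing k] [CommRing T] [CommRing S] [CommRing R]
  [Algebra k T] [Algebra k S] [Algebra k R]

instance (M : Type u) [AddCommGroup M] : AddCommGroup (RMod k T S M) :=
  inferInstanceAs (AddCommGroup M)

instance (N : Type u) [AddCommGroup N] : AddCommGroup (LMod k S R N) :=
  inferInstanceAs (AddCommGroup N)

instance (M : Type u) [AddCommGroup M] [Module (T ⊗[k] S) M] : Module S (RMod k T S M) :=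
  Module.compHom M (Algebra.TensorProduct.includeRight : S →ₐ[k] T ⊗[k] S).toRingHom

instance (N : Type u) [AddCommGroup N] [Module (S ⊗[k] R) N] : Module S (LMod k S R N) :=
  Module.compHom N (Algebra.TensorProduct.includeLeft : S →ₐ[k] S ⊗[k] R).toRingHom

/-- The tensor product `M ⊗_S N` of a `T ⊗ S`-module `M` and an `S ⊗ R`-module `N`. -/
def Tens (k T S R M N : Type u) [CommRing k] [CommRing T] [CommRing S] [CommRing R]
    [Algebra k T] [Algebra k S] [Algebra k R] [AddCommGroup M] [Module (T ⊗[k] S) M]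
    [AddCommGroup N] [Module (S ⊗[k] R) N] : Type u :=
  RMod k T S M ⊗[S] LMod k S R N

namespace Tens

section Basics

variable (k T S R)
variable {M N : Type u} [AddCommGroup M] [Module (T ⊗[k] S) M] [AddCommGroup N]
  [Module (S ⊗[k] R) N]

instance : AddCommGroup (Tens k T S R M N) :=
  inferInstanceAs (AddCommGroup (RMod k T S M ⊗[S] LMod k S R N))

/-- The pure tensor `m ⊗ n`, biadditive in `m` and `n`. -/
def tm : M →+ N →+ Tens k T S R M N :=
  AddMonoidHom.mk' (fun m => AddMonoidHom.mk'
    (fun n => TensorProduct.tmul S (m : RMod k T S M) (n : LMod k S R N))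
    (fun _ _ => TensorProduct.tmul_add _ _ _))
    (fun _ _ => AddMonoidHom.ext fun _ => TensorProduct.add_tmul _ _ _)

lemma tm_balanced (s : S) (m : M) (n : N) :
    tm k T S R (((1 : T) ⊗ₜ[k] s) • m) n = tm k T S R m ((s ⊗ₜ[k] (1 : R)) • n) :=
  TensorProduct.smul_tmul (R := S) (M := RMod k T S M) (N := LMod k S R N) s m n

variable {k T S R}

@[elab_as_elim]
lemma induction {P : Tens k T S R M N → Prop} (h : ∀ m n, P (tm k T S R m n))
    (ha : ∀ x y, P x → P y → P (x + y)) (x : Tens k T S R M N) : P x :=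
  TensorProduct.induction_on (motive := P) x
    (by have := h 0 0; rwa [map_zero] at this) h (fun x y => ha x y)

/-- Balanced biadditive maps factor over the tensor product. -/
def lift {P : Type u} [AddCommGroup P] (f : M →+ N →+ P)
    (hf : ∀ (s : S) m n, f (((1 : T) ⊗ₜ[k] s) • m) n = f m ((s ⊗ₜ[k] (1 : R)) • n)) :
    Tens k T S R M N →+ P :=
  TensorProduct.liftAddHom (R := S) (M := RMod k T S M) (N := LMod k S R N) f hf

@[simp] lemma lift_tm {P : Type u} [AddCommGroup P] (f : M →+ N →+ P)
    (hf : ∀ (s : S) m n, f (((1 : T) ⊗ₜ[k] s) • m) n = f m ((s ⊗ₜ[k] (1 : R)) • n)) (m : M)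
    (n : N) : lift f hf (tm k T S R m n) = f m n := rfl

lemma addHom_ext {P : Type u} [AddCommGroup P] {f g : Tens k T S R M N →+ P}
    (h : ∀ m n, f (tm k T S R m n) = g (tm k T S R m n)) : f = g := by
  ext x
  induction x using induction with
  | h m n => exact h m n
  | ha x y hx hy => rw [map_add, map_add, hx, hy]

/-- The operator `(t ⊗ 1) ⊗ (1 ⊗ r)` on `M ⊗_S N`. -/
def act₂ (t : T) (r : R) : Tens k T S R M N →+ Tens k T S R M N :=
  lift (AddMonoidHom.mk' (fun m => (tm k T S R ((t ⊗ₜ[k] (1 : S)) • m)).comp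
      (DistribSMul.toAddMonoidHom N ((1 : S) ⊗ₜ[k] r)))
      (fun m m' => by ext n; simp [smul_add]))
    (fun s m n => by
      simp only [AddMonoidHom.mk'_apply, AddMonoidHom.comp_apply, DistribSMul.toAddMonoidHom_apply]
      rw [smul_smul, smul_smul, mul_comm, mul_smul, tm_balanced, smul_smul, mul_comm])

@[simp] lemma act₂_tm (t : T) (r : R) (m : M) (n : N) : act₂ t r (tm k T S R m n) =
    tm k T S R ((t ⊗ₜ[k] (1 : S)) • m) (((1 : S) ⊗ₜ[k] r) • n) := rfl

/-- The additive action of `T ⊗ R` on `M ⊗_S N`. -/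
def act : T ⊗[k] R →+ AddMonoid.End (Tens k T S R M N) :=
  TensorProduct.liftAddHom (R := k)
    (AddMonoidHom.mk' (fun t => AddMonoidHom.mk' (fun r => (act₂ t r : AddMonoid.End _))
      (fun r r' => addHom_ext fun m n => by
        change act₂ t (r + r') (tm k T S R m n) =
          act₂ t r (tm k T S R m n) + act₂ t r' (tm k T S R m n)
        simp [tmul_add, add_smul]))
      (fun t t' => by
        ext1 r
        refine addHom_ext fun m n => ?_
        change act₂ (t + t') r (tm k T S R m n) =
          act₂ t r (tm k T S R m n) + act₂ t' r (tm k T S R m n)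
        simp [add_tmul, add_smul]))
    (fun c t r => by
      refine addHom_ext fun m n => ?_
      change act₂ (c • t) r (tm k T S R m n) = act₂ t (c • r) (tm k T S R m n)
      simp only [act₂_tm]
      have e1 : ((c • t) ⊗ₜ[k] (1 : S)) = ((1 : T) ⊗ₜ[k] (algebraMap k S c)) * (t ⊗ₜ[k] (1 : S)) := by
        rw [Algebra.TensorProduct.tmul_mul_tmul, one_mul, mul_one, smul_tmul,
          Algebra.algebraMap_eq_smul_one]
      have e2 : ((1 : S) ⊗ₜ[k] (c • r)) = (algebraMap k S c ⊗ₜ[k] (1 : R)) * ((1 : S) ⊗ₜ[k] r) := by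
        rw [Algebra.TensorProduct.tmul_mul_tmul, one_mul, mul_one, ← smul_tmul,
          Algebra.algebraMap_eq_smul_one]
      rw [e1, e2, mul_smul, mul_smul, tm_balanced])

lemma act_tmul (t : T) (r : R) (m : M) (n : N) : act (t ⊗ₜ[k] r) (tm k T S R m n) =
    tm k T S R ((t ⊗ₜ[k] (1 : S)) • m) (((1 : S) ⊗ₜ[k] r) • n) := rfl

lemma act_mul (a b : T ⊗[k] R) (x : Tens k T S R M N) : act (a * b) x = act a (act b x) := by
  induction a using TensorProduct.induction_on with
  | zero => simp [zero_mul]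
  | add a a' h h' => 
    rw [add_mul, map_add, map_add]
    exact congrArg₂ (· + ·) h h'
  | tmul t r =>
    induction b using TensorProduct.induction_on with
    | zero => simp
    | add b b' h h' =>
      rw [mul_add, map_add, map_add]
      exact (congrArg₂ (· + ·) h h').trans (map_add (act (t ⊗ₜ[k] r)) _ _).symm
    | tmul t' r' =>
      induction x using induction with
      | ha x y hx hy => rw [map_add, hx, hy, map_add, map_add]
      | h m n =>
        rw [Algebra.TensorProduct.tmul_mul_tmul, act_tmul, act_tmul, act_tmul, smul_smul, smul_smul,
          Algebra.TensorProduct.tmul_mul_tmul, Algebra.TensorProduct.tmul_mul_tmul, one_mul]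

/-- `M ⊗_S N` is a `T ⊗ R`-module, `T` acting on `M` and `R` acting on `N`. -/
instance : Module (T ⊗[k] R) (Tens k T S R M N) where
  smul a x := act a x
  one_smul x := by
    induction x using induction with
    | h m n =>
      change act ((1 : T) ⊗ₜ[k] (1 : R)) (tm k T S R m n) = _
      rw [act_tmul, ← Algebra.TensorProduct.one_def, ← Algebra.TensorProduct.one_def, one_smul,
        one_smul]
    | ha x y hx hy =>
      have := congrArg₂ (· + ·) hx hy
      exact (map_add (act (1 : T ⊗[k] R)) x y).trans this
  mul_smul := act_mul
  smul_zero a := map_zero (act a)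
  smul_add a := map_add (act a)
  add_smul a b x := by
    change act (a + b) x = act a x + act b x
    rw [map_add]; rfl
  zero_smul x := by
    change act 0 x = 0
    rw [map_zero]; rfl

@[simp] lemma smul_tm (t : T) (r : R) (m : M) (n : N) : (t ⊗ₜ[k] r) • tm k T S R m n =
    tm k T S R ((t ⊗ₜ[k] (1 : S)) • m) (((1 : S) ⊗ₜ[k] r) • n) := rfl

/-- An additive map on `M ⊗_S N` that is compatible with pure tensors is linear. -/
def toLin {P : Type u} [AddCommGroup P] [Module (T ⊗[k] R) P] (f : Tens k T S R M N →+ P)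
    (hf : ∀ (t : T) (r : R) m n, f (tm k T S R ((t ⊗ₜ[k] (1 : S)) • m) (((1 : S) ⊗ₜ[k] r) • n)) =
      (t ⊗ₜ[k] r) • f (tm k T S R m n)) : Tens k T S R M N →ₗ[T ⊗[k] R] P where
  toFun := f
  map_add' := map_add f
  map_smul' a x := by
    rw [RingHom.id_apply]
    induction x using induction with
    | ha x y hx hy => rw [smul_add, map_add, hx, hy, map_add, smul_add]
    | h m n =>
      induction a using TensorProduct.induction_on with
      | zero => rw [zero_smul, zero_smul, map_zero]
      | add a b ha hb => rw [add_smul, map_add, ha, hb, add_smul]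
      | tmul t r => rw [smul_tm, hf]

@[simp] lemma toLin_apply {P : Type u} [AddCommGroup P] [Module (T ⊗[k] R) P]
    (f : Tens k T S R M N →+ P)
    (hf : ∀ (t : T) (r : R) m n, f (tm k T S R ((t ⊗ₜ[k] (1 : S)) • m) (((1 : S) ⊗ₜ[k] r) • n)) =
      (t ⊗ₜ[k] r) • f (tm k T S R m n)) (x : Tens k T S R M N) : toLin f hf x = f x := rfl

end Basics

section Map

variable {M N M' N' : Type u} [AddCommGroup M] [Module (T ⊗[k] S) M] [AddCommGroup N]
  [Module (S ⊗[k] R) N] [AddCommGroup M'] [Module (T ⊗[k] S) M'] [AddCommGroup N']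
  [Module (S ⊗[k] R) N']

/-- The map `f ⊗ g`. -/
def map (f : M →ₗ[T ⊗[k] S] M') (g : N →ₗ[S ⊗[k] R] N') :
    Tens k T S R M N →ₗ[T ⊗[k] R] Tens k T S R M' N' :=
  toLin (lift (AddMonoidHom.mk' (fun m => (tm k T S R (f m)).comp g.toAddMonoidHom)
      (fun m m' => by ext n; simp))
    (fun s m n => by
      change tm k T S R (f _) (g n) = tm k T S R (f m) (g _)
      rw [f.map_smul, g.map_smul, tm_balanced]))
    (fun t r m n => by
      change tm k T S R (f _) (g _) = (t ⊗ₜ[k] r) • tm k T S R (f m) (g n)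
      rw [f.map_smul, g.map_smul, smul_tm])

@[simp] lemma map_tm (f : M →ₗ[T ⊗[k] S] M') (g : N →ₗ[S ⊗[k] R] N') (m : M) (n : N) :
    map f g (tm k T S R m n) = tm k T S R (f m) (g n) := rfl

end Map

end Tens
end TensorOfModules

section TensorOfFactorisations

variable {k T S R : Type u} [CommRing k] [CommRing T] [CommRing S] [CommRing R]
  [Algebra k T] [Algebra k S] [Algebra k R]

variable (k) in
/-- The potential `v - w`, that is `v ⊗ 1 - 1 ⊗ w`, in `T ⊗ S`. -/
abbrev pot (v : T) (w : S) : T ⊗[k] S := v ⊗ₜ[k] (1 : S) - (1 : T) ⊗ₜ[k] w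

namespace LinFact

lemma odd_sign {A : Type u} [CommRing A] {w : A} {X Y : LinFact A w}
    (h : X.carrier →ₗ[A] Y.carrier) (hh : ∀ x, Y.even (h x) + h (X.even x) = h x) (x : X.carrier) :
    Y.sign (h x) = - h (X.sign x) := by
  have := hh x
  simp only [sign_apply, map_sub, map_add]
  linear_combination (norm := abel) 2 • this

variable {v : T} {w : S} {u : R}

open Tens

/-- The tensor product `Y ⊗_S X` of linear factorisations of `v - w` and `w - u`, with differential
`d ⊗ 1 + 1 ⊗ d` (with the usual sign rule). -/
def tensor (Y : LinFact (T ⊗[k] S) (pot k v w)) (X : LinFact (S ⊗[k] R) (pot k w u)) :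
    LinFact (T ⊗[k] R) (pot k v u) where
  carrier := Tens k T S R Y.carrier X.carrier
  even := Tens.map Y.even X.even + Tens.map (LinearMap.id - Y.even) (LinearMap.id - X.even)
  even_even x := by
    induction x using Tens.induction with
    | ha x y hx hy => rw [map_add, map_add, hx, hy]
    | h y x =>
      simp only [LinearMap.add_apply, map_tm, LinearMap.sub_apply, LinearMap.id_apply, map_add,
        map_sub, Y.even_even, X.even_even, AddMonoidHom.sub_apply]
      abel
  d := Tens.map Y.d LinearMap.id + Tens.map Y.sign X.d
  d_odd x := by
    induction x using Tens.induction with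
    | ha x y hx hy =>
      rw [map_add, map_add, map_add, map_add]
      linear_combination (norm := abel) hx + hy
    | h y x =>
      simp only [LinearMap.add_apply, map_tm, LinearMap.sub_apply, LinearMap.id_apply, map_add,
        map_sub, Y.even_even, AddMonoidHom.sub_apply, even_d, sign_apply,
        AddMonoidHom.add_apply]
      abel
  d_sq x := by
    induction x using Tens.induction with
    | ha x y hx hy => rw [map_add, map_add, hx, hy, smul_add]
    | h y x =>
      simp only [LinearMap.add_apply, map_tm, LinearMap.id_apply, map_add,
        sign_sign, sign_d, Y.d_sq, X.d_sq, map_neg, AddMonoidHom.neg_apply]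
      simp only [sub_smul, map_sub, AddMonoidHom.sub_apply, tm_balanced, smul_tm]
      have h2 : ∀ x : X.carrier, ((1 : S) ⊗ₜ[k] (1 : R)) • x = x := one_smul _
      rw [h2, h2]
      abel

section

variable {Y Y' : LinFact (T ⊗[k] S) (pot k v w)} {X X' : LinFact (S ⊗[k] R) (pot k w u)}

/-- The pure tensor `y ⊗ x` in `Y ⊗_S X`. -/
def pt : Y.carrier →+ X.carrier →+ (tensor Y X).carrier := tm k T S R

/-- The tensor product of two linear maps. -/
def tmap (f : Y.carrier →ₗ[T ⊗[k] S] Y'.carrier) (g : X.carrier →ₗ[S ⊗[k] R] X'.carrier) :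
    (tensor Y X).carrier →ₗ[T ⊗[k] R] (tensor Y' X').carrier := Tens.map f g

@[elab_as_elim]
lemma tind {P : (tensor Y X).carrier → Prop} (h : ∀ y x, P (pt y x))
    (ha : ∀ a b, P a → P b → P (a + b)) (z : (tensor Y X).carrier) : P z :=
  Tens.induction h ha z

@[simp] lemma tmap_pt (f : Y.carrier →ₗ[T ⊗[k] S] Y'.carrier)
    (g : X.carrier →ₗ[S ⊗[k] R] X'.carrier) (y : Y.carrier) (x : X.carrier) :
    tmap f g (pt y x) = pt (f y) (g x) := rfl

lemma pt_balanced (s : S) (y : Y.carrier) (x : X.carrier) :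
    pt (((1 : T) ⊗ₜ[k] s) • y) x = pt y ((s ⊗ₜ[k] (1 : R)) • x) := tm_balanced k T S R s y x

lemma smul_pt (t : T) (r : R) (y : Y.carrier) (x : X.carrier) :
    (t ⊗ₜ[k] r) • pt y x = pt ((t ⊗ₜ[k] (1 : S)) • y) (((1 : S) ⊗ₜ[k] r) • x) := rfl

lemma even_pt (y : Y.carrier) (x : X.carrier) : (tensor Y X).even (pt y x) =
    pt (Y.even y) (X.even x) + pt (y - Y.even y) (x - X.even x) := rfl

lemma d_pt (y : Y.carrier) (x : X.carrier) : (tensor Y X).d (pt y x) =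
    pt (Y.d y) x + pt (Y.sign y) (X.d x) := rfl

lemma sign_pt (y : Y.carrier) (x : X.carrier) : (tensor Y X).sign (pt y x) =
    pt (Y.sign y) (X.sign x) := by
  rw [sign_apply, even_pt]
  simp only [sign_apply, map_add, map_sub, AddMonoidHom.add_apply, AddMonoidHom.sub_apply]
  abel

/-- Additive maps out of `Y ⊗_S X`. -/
def talift {P : Type u} [AddCommGroup P] (f : Y.carrier →+ X.carrier →+ P)
    (hf : ∀ (s : S) y x, f (((1 : T) ⊗ₜ[k] s) • y) x = f y ((s ⊗ₜ[k] (1 : R)) • x)) :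
    (tensor Y X).carrier →+ P := Tens.lift f hf

@[simp] lemma talift_pt {P : Type u} [AddCommGroup P] (f : Y.carrier →+ X.carrier →+ P)
    (hf : ∀ (s : S) y x, f (((1 : T) ⊗ₜ[k] s) • y) x = f y ((s ⊗ₜ[k] (1 : R)) • x))
    (y : Y.carrier) (x : X.carrier) : talift f hf (pt y x) = f y x := rfl

/-- Linear maps out of `Y ⊗_S X`. -/
def tlift {P : Type u} [AddCommGroup P] [Module (T ⊗[k] R) P] (f : Y.carrier →+ X.carrier →+ P)
    (hf : ∀ (s : S) y x, f (((1 : T) ⊗ₜ[k] s) • y) x = f y ((s ⊗ₜ[k] (1 : R)) • x))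
    (hl : ∀ (t : T) (r : R) y x, f ((t ⊗ₜ[k] (1 : S)) • y) (((1 : S) ⊗ₜ[k] r) • x) =
      (t ⊗ₜ[k] r) • f y x) : (tensor Y X).carrier →ₗ[T ⊗[k] R] P :=
  toLin (lift f hf) hl

@[simp] lemma tlift_pt {P : Type u} [AddCommGroup P] [Module (T ⊗[k] R) P]
    (f : Y.carrier →+ X.carrier →+ P)
    (hf : ∀ (s : S) y x, f (((1 : T) ⊗ₜ[k] s) • y) x = f y ((s ⊗ₜ[k] (1 : R)) • x))
    (hl : ∀ (t : T) (r : R) y x, f ((t ⊗ₜ[k] (1 : S)) • y) (((1 : S) ⊗ₜ[k] r) • x) =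
      (t ⊗ₜ[k] r) • f y x) (y : Y.carrier) (x : X.carrier) : tlift f hf hl (pt y x) = f y x := rfl

end

namespace Hom

variable {Y Y' Y'' : LinFact (T ⊗[k] S) (pot k v w)} {X X' X'' : LinFact (S ⊗[k] R) (pot k w u)}

/-- The tensor product of morphisms. -/
def tensor (f : Hom Y Y') (g : Hom X X') : Hom (LinFact.tensor Y X) (LinFact.tensor Y' X') where
  map := tmap f.map g.map
  map_even z := by
    induction z using tind with
    | ha a b ha hb => simp only [map_add, ha, hb]
    | h y x =>
      rw [even_pt, tmap_pt, even_pt]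
      simp only [map_add, tmap_pt, map_sub, f.map_even, g.map_even, AddMonoidHom.sub_apply]
  map_d z := by
    induction z using tind with
    | ha a b ha hb => simp only [map_add, ha, hb]
    | h y x =>
      rw [d_pt, tmap_pt, d_pt]
      simp only [map_add, tmap_pt, f.map_d, g.map_d, f.map_sign]

@[simp] lemma tensor_pt (f : Hom Y Y') (g : Hom X X') (y : Y.carrier) (x : X.carrier) :
    (tensor f g).map (pt y x) = pt (f.map y) (g.map x) := rfl

lemma tensor_ext {Z : LinFact (T ⊗[k] R) (pot k v u)} {f g : Hom (LinFact.tensor Y X) Z}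
    (h : ∀ y x, f.map (pt y x) = g.map (pt y x)) : f = g := by
  refine ext' fun z => ?_
  induction z using tind with
  | ha a b ha hb => rw [map_add, ha, hb, map_add]
  | h y x => exact h y x

lemma Homotopic.tensor {f f' : Hom Y Y'} {g g' : Hom X X'} (H : Homotopic f f')
    (H' : Homotopic g g') : Homotopic (f.tensor g) (f'.tensor g') := by
  obtain ⟨h, h1, h2⟩ := H
  obtain ⟨h', h1', h2'⟩ := H'
  have o1 := fun y => odd_sign h h1 y
  refine ⟨tmap h g.map + tmap (f'.map ∘ₗ Y.sign) h', fun z => ?_, fun z => ?_⟩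
  · induction z using tind with
    | ha a b ha hb =>
      rw [map_add, map_add, map_add, map_add]
      linear_combination (norm := abel) ha + hb
    | h y x =>
      have e1 : ∀ y, h (Y.even y) = h y - Y'.even (h y) :=
        fun y => eq_sub_of_add_eq' (h1 y)
      have e2 : ∀ x, h' (X.even x) = h' x - X'.even (h' x) :=
        fun x => eq_sub_of_add_eq' (h1' x)
      rw [LinearMap.add_apply, tmap_pt, tmap_pt, map_add, even_pt, even_pt, even_pt]
      simp only [LinearMap.add_apply, LinearMap.comp_apply, tmap_pt, map_add, map_sub, sign_even,
        ← f'.map_even, g.map_even, even_sign, e1, e2, AddMonoidHom.sub_apply]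
      abel
  · induction z using tind with
    | ha a b ha hb =>
      rw [map_add, map_add, map_add, map_add, map_add, map_add]
      linear_combination (norm := abel) ha + hb
    | h y x =>
      rw [LinearMap.add_apply, tmap_pt, tmap_pt, map_add, d_pt, d_pt, d_pt]
      have e1 := congrArg (fun a => (pt a (g.map x) : (LinFact.tensor Y' X').carrier)) (h2 y)
      have e2 := congrArg (fun a => (pt (f'.map y) a : (LinFact.tensor Y' X').carrier)) (h2' x)
      simp only [map_add, AddMonoidHom.add_apply] at e1 e2
      simp only [tensor_pt, LinearMap.add_apply, LinearMap.comp_apply, tmap_pt, map_add,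
        sign_sign, sign_d, ← f'.map_sign, ← f'.map_d, map_neg, AddMonoidHom.neg_apply, o1, g.map_d]
      linear_combination (norm := abel) e1 + e2

lemma tensor_id : (id Y).tensor (id X) = id (LinFact.tensor Y X) := tensor_ext fun _ _ => rfl

lemma tensor_comp (f : Hom Y Y') (f' : Hom Y' Y'') (g : Hom X X') (g' : Hom X' X'') :
    (f.comp f').tensor (g.comp g') = (f.tensor g).comp (f'.tensor g') := tensor_ext fun _ _ => rfl

end Hom

/-- The tensor product of homotopy classes. -/
def tensorCls {Y Y' : LinFact (T ⊗[k] S) (pot k v w)} {X X' : LinFact (S ⊗[k] R) (pot k w u)}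
    (f : Y ⟶ Y') (g : X ⟶ X') : tensor Y X ⟶ tensor Y' X' :=
  Quotient.map₂ Hom.tensor (fun _ _ H _ _ H' => Hom.Homotopic.tensor H H') f g

lemma tensorCls_id (Y : LinFact (T ⊗[k] S) (pot k v w)) (X : LinFact (S ⊗[k] R) (pot k w u)) :
    tensorCls (𝟙 Y) (𝟙 X) = 𝟙 (tensor Y X) := congrArg cls Hom.tensor_id

lemma tensorCls_comp {Y Y' Y'' : LinFact (T ⊗[k] S) (pot k v w)}
    {X X' X'' : LinFact (S ⊗[k] R) (pot k w u)} (f : Y ⟶ Y') (f' : Y' ⟶ Y'') (g : X ⟶ X')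
    (g' : X' ⟶ X'') : tensorCls (f ≫ f') (g ≫ g') = tensorCls f g ≫ tensorCls f' g' := by
  obtain ⟨f, rfl⟩ := cls_surj f; obtain ⟨g, rfl⟩ := cls_surj g
  obtain ⟨f', rfl⟩ := cls_surj f'; obtain ⟨g', rfl⟩ := cls_surj g'
  exact congrArg cls (Hom.tensor_comp f f' g g')

end LinFact

end TensorOfFactorisations

section Associator

variable {k Q T S R : Type u} [CommRing k] [CommRing Q] [CommRing T] [CommRing S] [CommRing R]
  [Algebra k Q] [Algebra k T] [Algebra k S] [Algebra k R] {q : Q} {v : T} {w : S} {u : R}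

namespace LinFact

lemma smul_pt_left {Y : LinFact (T ⊗[k] S) (pot k v w)} {X : LinFact (S ⊗[k] R) (pot k w u)}
    (t : T) (y : Y.carrier) (x : X.carrier) :
    (t ⊗ₜ[k] (1 : R)) • (pt y x : (tensor Y X).carrier) = pt ((t ⊗ₜ[k] (1 : S)) • y) x := by
  have h : ((1 : S) ⊗ₜ[k] (1 : R)) • x = x := one_smul _ x
  rw [smul_pt, h]

lemma smul_pt_right {Y : LinFact (T ⊗[k] S) (pot k v w)} {X : LinFact (S ⊗[k] R) (pot k w u)}
    (r : R) (y : Y.carrier) (x : X.carrier) :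
    ((1 : T) ⊗ₜ[k] r) • (pt y x : (tensor Y X).carrier) = pt y (((1 : S) ⊗ₜ[k] r) • x) := by
  have h : ((1 : T) ⊗ₜ[k] (1 : S)) • y = y := one_smul _ y
  rw [smul_pt, h]

variable (Z : LinFact (Q ⊗[k] T) (pot k q v)) (Y : LinFact (T ⊗[k] S) (pot k v w))
  (X : LinFact (S ⊗[k] R) (pot k w u))

/-- `z, y ↦ (x ↦ z ⊗ (y ⊗ x))`. -/
def assocAux₀ (z : Z.carrier) :
    Y.carrier →+ X.carrier →+ (tensor Z (tensor Y X)).carrier :=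
  AddMonoidHom.mk' (fun y => (pt z).comp (pt y))
    (fun y y' => by
      refine AddMonoidHom.ext fun x => ?_
      rw [AddMonoidHom.add_apply, AddMonoidHom.comp_apply, AddMonoidHom.comp_apply,
        AddMonoidHom.comp_apply, map_add, AddMonoidHom.add_apply, map_add])

lemma assocAux₀_apply (z : Z.carrier) (y : Y.carrier) (x : X.carrier) :
    assocAux₀ Z Y X z y x = pt z (pt y x) := rfl

/-- The biadditive map `z ⊗ y, x ↦ z ⊗ (y ⊗ x)`. -/
def assocAux : (tensor Z Y).carrier →+ X.carrier →+ (tensor Z (tensor Y X)).carrier :=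
  talift
    (AddMonoidHom.mk' (assocAux₀ Z Y X)
      (fun z z' => by
        refine AddMonoidHom.ext fun y => AddMonoidHom.ext fun x => ?_
        rw [AddMonoidHom.add_apply, AddMonoidHom.add_apply, assocAux₀_apply, assocAux₀_apply,
          assocAux₀_apply, map_add, AddMonoidHom.add_apply]))
    (fun t z y => by
      refine AddMonoidHom.ext fun x => ?_
      rw [AddMonoidHom.mk'_apply, assocAux₀_apply, assocAux₀_apply,
        pt_balanced, smul_pt_left])

lemma assocAux_pt (z : Z.carrier) (y : Y.carrier) (x : X.carrier) :
    assocAux Z Y X (pt z y) x = pt z (pt y x) := rfl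

/-- `(z ⊗ y) ⊗ x ↦ z ⊗ (y ⊗ x)`. -/
def assocMap : (tensor (tensor Z Y) X).carrier →ₗ[Q ⊗[k] R] (tensor Z (tensor Y X)).carrier :=
  tlift (assocAux Z Y X)
    (fun s zy x => by
      induction zy using tind with
      | ha a b ha hb =>
        rw [smul_add, map_add, map_add, AddMonoidHom.add_apply, AddMonoidHom.add_apply, ha, hb]
      | h z y => rw [smul_pt_right, assocAux_pt, assocAux_pt, pt_balanced])
    (fun a r zy x => by
      induction zy using tind with
      | ha b b' ha hb =>
        rw [smul_add, map_add, map_add, AddMonoidHom.add_apply, AddMonoidHom.add_apply, ha, hb,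
          smul_add]
      | h z y => rw [smul_pt_left, assocAux_pt, assocAux_pt, smul_pt, smul_pt_right])

lemma assocMap_pt (z : Z.carrier) (y : Y.carrier) (x : X.carrier) :
    assocMap Z Y X (pt (pt z y) x) = pt z (pt y x) := rfl

/-- `y, x ↦ (z ↦ (z ⊗ y) ⊗ x)`. -/
def assocInvAux₀ (y : Y.carrier) :
    X.carrier →+ Z.carrier →+ (tensor (tensor Z Y) X).carrier :=
  AddMonoidHom.mk' (fun x => ((pt (Y := tensor Z Y) (X := X)).flip x).comp ((pt (Y := Z)).flip y))
    (fun x x' => by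
      refine AddMonoidHom.ext fun z => ?_
      rw [AddMonoidHom.add_apply, AddMonoidHom.comp_apply, AddMonoidHom.comp_apply,
        AddMonoidHom.comp_apply, map_add, AddMonoidHom.add_apply])

lemma assocInvAux₀_apply (z : Z.carrier) (y : Y.carrier) (x : X.carrier) :
    assocInvAux₀ Z Y X y x z = pt (pt z y) x := rfl

/-- The biadditive map `y ⊗ x, z ↦ (z ⊗ y) ⊗ x`. -/
def assocInvAux : (tensor Y X).carrier →+ Z.carrier →+ (tensor (tensor Z Y) X).carrier :=
  talift
    (AddMonoidHom.mk' (assocInvAux₀ Z Y X)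
      (fun y y' => by
        refine AddMonoidHom.ext fun x => AddMonoidHom.ext fun z => ?_
        rw [AddMonoidHom.add_apply, AddMonoidHom.add_apply, assocInvAux₀_apply,
          assocInvAux₀_apply, assocInvAux₀_apply, map_add, map_add, AddMonoidHom.add_apply]))
    (fun s y x => by
      refine AddMonoidHom.ext fun z => ?_
      rw [AddMonoidHom.mk'_apply, assocInvAux₀_apply, assocInvAux₀_apply,
        ← pt_balanced, smul_pt_right])

lemma assocInvAux_pt (z : Z.carrier) (y : Y.carrier) (x : X.carrier) :
    assocInvAux Z Y X (pt y x) z = pt (pt z y) x := rfl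

/-- `z ⊗ (y ⊗ x) ↦ (z ⊗ y) ⊗ x`. -/
def assocInvMap : (tensor Z (tensor Y X)).carrier →ₗ[Q ⊗[k] R]
    (tensor (tensor Z Y) X).carrier :=
  tlift (assocInvAux Z Y X).flip
    (fun t z yx => by
      rw [AddMonoidHom.flip_apply, AddMonoidHom.flip_apply]
      induction yx using tind with
      | ha a b ha hb =>
        rw [smul_add, map_add, map_add, AddMonoidHom.add_apply, AddMonoidHom.add_apply, ha, hb]
      | h y x => rw [smul_pt_left, assocInvAux_pt, assocInvAux_pt, pt_balanced])
    (fun a r z yx => by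
      rw [AddMonoidHom.flip_apply, AddMonoidHom.flip_apply]
      induction yx using tind with
      | ha b b' ha hb =>
        rw [smul_add, map_add, map_add, AddMonoidHom.add_apply, AddMonoidHom.add_apply, ha, hb,
          smul_add]
      | h y x => rw [smul_pt_right, assocInvAux_pt, assocInvAux_pt, smul_pt, smul_pt_left])

lemma assocInvMap_pt (z : Z.carrier) (y : Y.carrier) (x : X.carrier) :
    assocInvMap Z Y X (pt z (pt y x)) = pt (pt z y) x := rfl

lemma tind₃ {P : (tensor (tensor Z Y) X).carrier → Prop} (h : ∀ z y x, P (pt (pt z y) x))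
    (ha : ∀ a b, P a → P b → P (a + b)) (t : (tensor (tensor Z Y) X).carrier) : P t := by
  induction t using tind with
  | ha a b h1 h2 => exact ha a b h1 h2
  | h zy x =>
    induction zy using tind with
    | ha a b h1 h2 => rw [map_add]; exact ha _ _ h1 h2
    | h z y => exact h z y x

lemma tind₃' {P : (tensor Z (tensor Y X)).carrier → Prop} (h : ∀ z y x, P (pt z (pt y x)))
    (ha : ∀ a b, P a → P b → P (a + b)) (t : (tensor Z (tensor Y X)).carrier) : P t := by
  induction t using tind with
  | ha a b h1 h2 => exact ha a b h1 h2
  | h z yx =>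
    induction yx using tind with
    | ha a b h1 h2 => rw [map_add]; exact ha _ _ h1 h2
    | h y x => exact h z y x

/-- The associativity isomorphism `(Z ⊗ Y) ⊗ X → Z ⊗ (Y ⊗ X)`. -/
def assocHom : Hom (tensor (tensor Z Y) X) (tensor Z (tensor Y X)) where
  map := assocMap Z Y X
  map_even t := by
    induction t using tind₃ with
    | ha a b h1 h2 => simp only [map_add, h1, h2]
    | h z y x =>
      rw [assocMap_pt, even_pt, even_pt, even_pt, even_pt]
      simp only [map_add, map_sub, AddMonoidHom.add_apply, AddMonoidHom.sub_apply, assocMap_pt]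
      abel
  map_d t := by
    induction t using tind₃ with
    | ha a b h1 h2 => simp only [map_add, h1, h2]
    | h z y x =>
      rw [assocMap_pt, d_pt, d_pt, d_pt, d_pt, sign_pt]
      simp only [map_add, AddMonoidHom.add_apply, assocMap_pt]
      abel

/-- The inverse of the associativity isomorphism. -/
def assocInv : Hom (tensor Z (tensor Y X)) (tensor (tensor Z Y) X) where
  map := assocInvMap Z Y X
  map_even t := by
    induction t using tind₃' with
    | ha a b h1 h2 => simp only [map_add, h1, h2]
    | h z y x =>
      rw [assocInvMap_pt, even_pt, even_pt, even_pt, even_pt]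
      simp only [map_add, map_sub, AddMonoidHom.add_apply, AddMonoidHom.sub_apply, assocInvMap_pt]
      abel
  map_d t := by
    induction t using tind₃' with
    | ha a b h1 h2 => simp only [map_add, h1, h2]
    | h z y x =>
      rw [assocInvMap_pt, d_pt, d_pt, d_pt, d_pt, sign_pt]
      simp only [map_add, AddMonoidHom.add_apply, assocInvMap_pt]
      abel

variable {Z Y X} in
lemma tensor_ext₃ {P : LinFact (Q ⊗[k] R) (pot k q u)} {f g : Hom (tensor (tensor Z Y) X) P}
    (h : ∀ z y x, f.map (pt (pt z y) x) = g.map (pt (pt z y) x)) : f = g := by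
  refine Hom.ext' fun t => ?_
  induction t using tind₃ with
  | ha a b h1 h2 => rw [map_add, h1, h2, map_add]
  | h z y x => exact h z y x

variable {Z Y X} in
lemma tensor_ext₃' {P : LinFact (Q ⊗[k] R) (pot k q u)} {f g : Hom (tensor Z (tensor Y X)) P}
    (h : ∀ z y x, f.map (pt z (pt y x)) = g.map (pt z (pt y x))) : f = g := by
  refine Hom.ext' fun t => ?_
  induction t using tind₃' with
  | ha a b h1 h2 => rw [map_add, h1, h2, map_add]
  | h z y x => exact h z y x

lemma assocHom_pt (z : Z.carrier) (y : Y.carrier) (x : X.carrier) :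
    (assocHom Z Y X).map (pt (pt z y) x) = pt z (pt y x) := rfl

lemma assocInv_pt (z : Z.carrier) (y : Y.carrier) (x : X.carrier) :
    (assocInv Z Y X).map (pt z (pt y x)) = pt (pt z y) x := rfl

/-- The associativity isomorphism in the homotopy category. -/
def assocIso : tensor (tensor Z Y) X ≅ tensor Z (tensor Y X) where
  hom := cls (assocHom Z Y X)
  inv := cls (assocInv Z Y X)
  hom_inv_id := congrArg cls (show (assocHom Z Y X).comp (assocInv Z Y X) = Hom.id _ from
    tensor_ext₃ fun z y x => by rw [Hom.comp_map, assocHom_pt, assocInv_pt, Hom.id_map])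
  inv_hom_id := congrArg cls (show (assocInv Z Y X).comp (assocHom Z Y X) = Hom.id _ from
    tensor_ext₃' fun z y x => by rw [Hom.comp_map, assocInv_pt, assocHom_pt, Hom.id_map])

lemma tensorCls_cls {Y Y' : LinFact (T ⊗[k] S) (pot k v w)}
    {X X' : LinFact (S ⊗[k] R) (pot k w u)} (f : Hom Y Y') (g : Hom X X') :
    tensorCls (cls f) (cls g) = cls (f.tensor g) := rfl

lemma assoc_natural {Z Z' : LinFact (Q ⊗[k] T) (pot k q v)}
    {Y Y' : LinFact (T ⊗[k] S) (pot k v w)} {X X' : LinFact (S ⊗[k] R) (pot k w u)} (h : Z ⟶ Z')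
    (g : Y ⟶ Y') (f : X ⟶ X') : tensorCls (tensorCls h g) f ≫ (assocIso Z' Y' X').hom =
      (assocIso Z Y X).hom ≫ tensorCls h (tensorCls g f) := by
  obtain ⟨h, rfl⟩ := cls_surj h; obtain ⟨g, rfl⟩ := cls_surj g; obtain ⟨f, rfl⟩ := cls_surj f
  rw [tensorCls_cls, tensorCls_cls, tensorCls_cls, tensorCls_cls, assocIso, assocIso, cls_comp,
    cls_comp]
  refine congrArg cls (tensor_ext₃ fun z y x => ?_)
  rw [Hom.comp_map, Hom.comp_map, assocHom_pt, Hom.tensor_pt, Hom.tensor_pt, Hom.tensor_pt,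
    Hom.tensor_pt, assocHom_pt]

lemma assoc_natural_right {X X' : LinFact (S ⊗[k] R) (pot k w u)} (f : X ⟶ X') :
    tensorCls (𝟙 (tensor Z Y)) f = (assocIso Z Y X).hom ≫ tensorCls (𝟙 Z) (tensorCls (𝟙 Y) f) ≫
      (assocIso Z Y X').inv := by
  rw [← Category.assoc, ← assoc_natural, tensorCls_id, Category.assoc, Iso.hom_inv_id,
    Category.comp_id]

lemma pentagon {O : Type u} [CommRing O] [Algebra k O] {o : O}
    (U : LinFact (O ⊗[k] Q) (pot k o q)) :
    tensorCls (𝟙 U) (assocIso Z Y X).inv ≫ (assocIso U (tensor Z Y) X).inv ≫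
      tensorCls (assocIso U Z Y).inv (𝟙 X) =
    (assocIso U Z (tensor Y X)).inv ≫ (assocIso (tensor U Z) Y X).inv := by
  simp only [assocIso, cls_id, tensorCls_cls, cls_comp]
  refine congrArg cls (Hom.tensor_ext fun p a => ?_)
  induction a using tind₃' with
  | ha a b h1 h2 => rw [map_add, map_add, h1, h2, map_add]
  | h z y x =>
    rw [Hom.comp_map, Hom.comp_map, Hom.comp_map, Hom.tensor_pt, assocInv_pt, assocInv_pt,
      Hom.tensor_pt, assocInv_pt, assocInv_pt, assocInv_pt, Hom.id_map, Hom.id_map]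

end LinFact

end Associator

section ExteriorAlgebra

variable {A : Type u} [CommRing A] {n : ℕ}

/-- The sign `(-1)^{#{j ∈ s, j < i}}`. -/
def sg (A : Type u) [CommRing A] {n : ℕ} (i : Fin n) (s : Finset (Fin n)) : A :=
  (-1) ^ (s.filter (· < i)).card

/-- Left multiplication by `θ_i` on the exterior algebra `⋀(⨁ A θ_i)`, whose elements are written
as families of coefficients with respect to the monomials `θ_s = θ_{s_1} ⋯ θ_{s_p}` for
`s = {s_1 < ⋯ < s_p}`. -/
def extMul (i : Fin n) : Module.End A (Finset (Fin n) → A) where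
  toFun f s := if i ∈ s then sg A i s * f (s.erase i) else 0
  map_add' f g := by ext s; simp only [Pi.add_apply]; split_ifs <;> ring
  map_smul' c f := by
    ext s; simp only [Pi.smul_apply, smul_eq_mul, RingHom.id_apply]; split_ifs <;> ring

/-- Contraction with `θ_i^*` on the exterior algebra, an antiderivation. -/
def extContr (i : Fin n) : Module.End A (Finset (Fin n) → A) where
  toFun f s := if i ∈ s then 0 else sg A i s * f (insert i s)
  map_add' f g := by ext s; simp only [Pi.add_apply]; split_ifs <;> ring
  map_smul' c f := by
    ext s; simp only [Pi.smul_apply, smul_eq_mul, RingHom.id_apply]; split_ifs <;> ring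

lemma extMul_apply (i : Fin n) (f : Finset (Fin n) → A) (s : Finset (Fin n)) :
    extMul i f s = if i ∈ s then sg A i s * f (s.erase i) else 0 := rfl

lemma extContr_apply (i : Fin n) (f : Finset (Fin n) → A) (s : Finset (Fin n)) :
    extContr i f s = if i ∈ s then 0 else sg A i s * f (insert i s) := rfl

lemma sg_mul_self (i : Fin n) (s : Finset (Fin n)) : sg A i s * sg A i s = 1 := by
  rw [sg, ← pow_add, ← two_mul, pow_mul]; simp

lemma sg_erase_self (i : Fin n) (s : Finset (Fin n)) : sg A i (s.erase i) = sg A i s := by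
  rw [sg, sg]; congr 2; ext j; simp only [Finset.mem_filter, Finset.mem_erase]
  constructor
  · rintro ⟨⟨_, h⟩, h'⟩; exact ⟨h, h'⟩
  · rintro ⟨h, h'⟩; exact ⟨⟨h'.ne, h⟩, h'⟩

lemma sg_insert_self (i : Fin n) (s : Finset (Fin n)) : sg A i (insert i s) = sg A i s := by
  rw [sg, sg, Finset.filter_insert, if_neg (lt_irrefl i)]

lemma sg_insert (i j : Fin n) (s : Finset (Fin n)) (h : j ∉ s) :
    sg A i (insert j s) = if j < i then - sg A i s else sg A i s := by
  rw [sg, sg, Finset.filter_insert]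
  split_ifs with hh
  · rw [Finset.card_insert_of_notMem (by simp [h]), pow_succ]; ring
  · rfl

lemma sg_erase (i j : Fin n) (s : Finset (Fin n)) (h : j ∈ s) :
    sg A i (s.erase j) = if j < i then - sg A i s else sg A i s := by
  have := sg_insert (A := A) i j (s.erase j) (Finset.notMem_erase j s)
  rw [Finset.insert_erase h] at this
  rw [this]; split_ifs <;> simp

lemma extMul_sq (i : Fin n) : (extMul i * extMul i : Module.End A (Finset (Fin n) → A)) = 0 := by
  ext1 f; ext s; simp [Module.End.mul_apply, extMul_apply]

lemma extContr_sq (i : Fin n) :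
    (extContr i * extContr i : Module.End A (Finset (Fin n) → A)) = 0 := by
  ext1 f; ext s; simp [Module.End.mul_apply, extContr_apply]

lemma extMul_extContr (i : Fin n) :
    (extMul i * extContr i + extContr i * extMul i : Module.End A (Finset (Fin n) → A)) = 1 := by
  refine LinearMap.ext fun f => funext fun s => ?_
  simp only [LinearMap.add_apply, Module.End.mul_apply, Pi.add_apply, Module.End.one_apply]
  rw [extMul_apply, extContr_apply]
  by_cases h : i ∈ s
  · rw [if_pos h, if_neg (Finset.notMem_erase i s), sg_erase_self, extContr_apply, if_pos h,
      Finset.insert_erase h, ← mul_assoc, sg_mul_self]; ring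
  · rw [if_neg h, extContr_apply, if_neg h, extMul_apply, if_pos (Finset.mem_insert_self i s), sg_insert_self,
      Finset.erase_insert h, ← mul_assoc, sg_mul_self]; ring

lemma extMul_anti {i j : Fin n} (h : i ≠ j) :
    (extMul i * extMul j + extMul j * extMul i : Module.End A (Finset (Fin n) → A)) = 0 := by
  refine LinearMap.ext fun f => funext fun s => ?_
  simp only [LinearMap.add_apply, Module.End.mul_apply, Pi.add_apply, LinearMap.zero_apply,
    Pi.zero_apply, extMul_apply, Finset.mem_erase]
  by_cases hi : i ∈ s <;> by_cases hj : j ∈ s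
  · simp only [hi, hj, h, h.symm, ne_eq, not_false_eq_true, and_self, if_true]
    rw [sg_erase j i s hi, sg_erase i j s hj, Finset.erase_right_comm]
    rcases lt_or_gt_of_ne h with h' | h'
    · rw [if_pos h', if_neg h'.not_gt]; ring
    · rw [if_neg h'.not_gt, if_pos h']; ring
  all_goals simp [hi, hj]

lemma extContr_anti {i j : Fin n} (h : i ≠ j) :
    (extContr i * extContr j + extContr j * extContr i : Module.End A (Finset (Fin n) → A)) = 0 := by
  refine LinearMap.ext fun f => funext fun s => ?_
  simp only [LinearMap.add_apply, Module.End.mul_apply, Pi.add_apply, LinearMap.zero_apply,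
    Pi.zero_apply, extContr_apply, Finset.mem_insert]
  by_cases hi : i ∈ s <;> by_cases hj : j ∈ s
  rotate_right
  · simp only [hi, hj, h, h.symm, or_self, if_false]
    rw [sg_insert j i s hi, sg_insert i j s hj, Finset.insert_comm]
    rcases lt_or_gt_of_ne h with h' | h'
    · rw [if_pos h', if_neg h'.not_gt]; ring
    · rw [if_neg h'.not_gt, if_pos h']; ring
  all_goals simp [hi, hj]

lemma extMul_extContr_anti {i j : Fin n} (h : i ≠ j) :
    (extMul i * extContr j + extContr j * extMul i : Module.End A (Finset (Fin n) → A)) = 0 := by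
  refine LinearMap.ext fun f => funext fun s => ?_
  simp only [LinearMap.add_apply, Module.End.mul_apply, Pi.add_apply, LinearMap.zero_apply,
    Pi.zero_apply, extContr_apply, extMul_apply, Finset.mem_insert, Finset.mem_erase]
  by_cases hi : i ∈ s <;> by_cases hj : j ∈ s
  · simp [hi, hj, h.symm]
  · simp only [hi, hj, h, or_true, and_false, if_false, if_true]
    rw [sg_erase j i s hi, sg_insert i j s hj, Finset.erase_insert_of_ne h.symm]
    rcases lt_or_gt_of_ne h with h' | h'
    · rw [if_pos h', if_neg h'.not_gt]; ring
    · rw [if_neg h'.not_gt, if_pos h']; ring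
  all_goals simp [hi, hj, h]

/-- `∑ᵢ (aᵢ θᵢ + bᵢ θᵢ^*)`. -/
def koszulD (a b : Fin n → A) : Module.End A (Finset (Fin n) → A) :=
  ∑ i, (a i • extMul i + b i • extContr i)

lemma koszulD_sq (a b : Fin n → A) : koszulD a b * koszulD a b =
    algebraMap A (Module.End A (Finset (Fin n) → A)) (∑ i, a i * b i) := by
  have h1 : ∀ i, (a i • extMul i + b i • extContr i) * (a i • extMul i + b i • extContr i) =
      algebraMap A (Module.End A (Finset (Fin n) → A)) (a i * b i) := fun i => by
    rw [Algebra.algebraMap_eq_smul_one, ← extMul_extContr i]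
    simp only [mul_add, add_mul, smul_mul_smul_comm, extMul_sq, extContr_sq, smul_zero, smul_add,
      mul_comm (b i) (a i)]
    abel
  have h2 : ∀ i j, i ≠ j →
      (a i • extMul i + b i • extContr i) * (a j • extMul j + b j • extContr j) +
      (a j • extMul j + b j • extContr j) * (a i • extMul i + b i • extContr i) =
      (0 : Module.End A (Finset (Fin n) → A)) := fun i j h => by
    have e1 := congrArg ((a i * a j) • ·) (extMul_anti (A := A) h)
    have e2 := congrArg ((b i * b j) • ·) (extContr_anti (A := A) h)
    have e3 := congrArg ((a i * b j) • ·) (extMul_extContr_anti (A := A) h)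
    have e4 := congrArg ((b i * a j) • ·) (extMul_extContr_anti (A := A) h.symm)
    simp only [smul_add, smul_zero] at e1 e2 e3 e4
    simp only [mul_add, add_mul, smul_mul_smul_comm, mul_comm (a j) (a i), mul_comm (b j) (b i),
      mul_comm (a j) (b i), mul_comm (b j) (a i)]
    linear_combination (norm := abel) e1 + e2 + e3 + e4
  rw [koszulD]
  induction (Finset.univ : Finset (Fin n)) using Finset.induction_on with
  | empty => simp
  | insert i s hi ih =>
    have h3 : (a i • extMul i + b i • extContr i) * (∑ j ∈ s, (a j • extMul j + b j • extContr j)) +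
        (∑ j ∈ s, (a j • extMul j + b j • extContr j)) * (a i • extMul i + b i • extContr i) =
        (0 : Module.End A (Finset (Fin n) → A)) := by
      rw [Finset.mul_sum, Finset.sum_mul, ← Finset.sum_add_distrib]
      exact Finset.sum_eq_zero fun j hj => h2 i j (fun h => hi (h ▸ hj))
    have key : ∀ x y : Module.End A (Finset (Fin n) → A), x * y + y * x = 0 →
        (x + y) * (x + y) = x * x + y * y := fun x y h => by
      rw [mul_add, add_mul, add_mul]; linear_combination (norm := abel) h
    rw [Finset.sum_insert hi, Finset.sum_insert hi, map_add, ← ih, ← h1 i, key _ _ h3]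

/-- The projector onto the part of the exterior algebra of even degree. -/
def extEven : Module.End A (Finset (Fin n) → A) where
  toFun f s := if Even s.card then f s else 0
  map_add' f g := by ext s; simp only [Pi.add_apply]; split_ifs <;> simp
  map_smul' c f := by ext s; simp

lemma extEven_apply (f : Finset (Fin n) → A) (s : Finset (Fin n)) :
    extEven f s = if Even s.card then f s else 0 := rfl

lemma extMul_odd (i : Fin n) (f : Finset (Fin n) → A) :
    extEven (extMul i f) + extMul i (extEven f) = extMul i f := by
  ext s
  rw [Pi.add_apply, extEven_apply, extMul_apply, extMul_apply, extEven_apply]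
  by_cases h : i ∈ s
  · have := Finset.card_erase_add_one h
    have h' : Even (s.erase i).card ↔ ¬ Even s.card := by rw [← this, Nat.even_add_one, not_not]
    rw [if_pos h, if_pos h]
    by_cases h'' : Even s.card
    · rw [if_pos h'', if_neg (by rwa [h', not_not]), mul_zero, add_zero]
    · rw [if_neg h'', if_pos (h'.2 h''), zero_add]
  · simp [h]

lemma extContr_odd (i : Fin n) (f : Finset (Fin n) → A) :
    extEven (extContr i f) + extContr i (extEven f) = extContr i f := by
  ext s
  rw [Pi.add_apply, extEven_apply, extContr_apply, extContr_apply, extEven_apply]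
  by_cases h : i ∈ s
  · simp [h]
  · have h' : Even (insert i s).card ↔ ¬ Even s.card := by
      rw [Finset.card_insert_of_notMem h, Nat.even_add_one]
    rw [if_neg h, if_neg h]
    by_cases h'' : Even s.card
    · rw [if_pos h'', if_neg (by rwa [h', not_not]), mul_zero, add_zero]
    · rw [if_neg h'', if_pos (h'.2 h''), zero_add]

lemma koszulD_odd (a b : Fin n → A) (f : Finset (Fin n) → A) :
    extEven (koszulD a b f) + koszulD a b (extEven f) = koszulD a b f := by
  simp only [koszulD, LinearMap.sum_apply, map_sum, ← Finset.sum_add_distrib]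
  refine Finset.sum_congr rfl fun i _ => ?_
  simp only [LinearMap.add_apply, LinearMap.smul_apply, map_add, map_smul]
  conv_rhs => rw [← extMul_odd i f, ← extContr_odd i f]
  simp only [smul_add]; abel

end ExteriorAlgebra

section DifferenceQuotients

open MvPolynomial

/-- The `i`-th difference quotient of a polynomial in the variables `x_1, …, x_n` between the points
`a` and `b`: the quotient of
`f(b_1, …, b_{i-1}, a_i, …, a_n) - f(b_1, …, b_i, a_{i+1}, …, a_n)` by `a_i - b_i`. -/
def diffQuot {n : ℕ} (K : Type u) {T : Type u} [CommRing K] [CommRing T] [Algebra K T]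
    (a b : Fin n → T) (i : Fin n) : MvPolynomial (Fin n) K →ₗ[K] T :=
  (basisMonomials (Fin n) K).constr K fun e => ∏ j, if j < i then b j ^ e j else
    if i < j then a j ^ e j else ∑ s ∈ Finset.range (e j), a j ^ s * b j ^ (e j - 1 - s)

variable {n : ℕ} {K T : Type u} [CommRing K] [CommRing T] [Algebra K T]

lemma diffQuot_mul (a b : Fin n → T) (i : Fin n) (f : MvPolynomial (Fin n) K) :
    (a i - b i) * diffQuot K a b i f =
      aeval (fun j => if j < i then b j else a j) f -
        aeval (fun j => if j ≤ i then b j else a j) f := by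
  have : (LinearMap.mulLeft K (a i - b i)) ∘ₗ diffQuot K a b i =
      (aeval (R := K) (fun j => if j < i then b j else a j)).toLinearMap -
        (aeval (R := K) (fun j => if j ≤ i then b j else a j)).toLinearMap := by
    refine (basisMonomials (Fin n) K).ext fun e => ?_
    rw [LinearMap.comp_apply, diffQuot, Module.Basis.constr_basis, LinearMap.sub_apply,
      coe_basisMonomials, AlgHom.toLinearMap_apply, AlgHom.toLinearMap_apply,
      LinearMap.mulLeft_apply, aeval_monomial, aeval_monomial, map_one, one_mul, one_mul,
      Finsupp.prod_fintype _ _ (fun _ => pow_zero _), Finsupp.prod_fintype _ _ (fun _ => pow_zero _),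
      Fintype.prod_eq_mul_prod_compl i, Fintype.prod_eq_mul_prod_compl i,
      Fintype.prod_eq_mul_prod_compl i]
    have h1 : ∏ j ∈ {i}ᶜ, (if j < i then b j ^ e j else if i < j then a j ^ e j else
        ∑ s ∈ Finset.range (e j), a j ^ s * b j ^ (e j - 1 - s)) =
        ∏ j ∈ {i}ᶜ, (if j < i then b j else a j) ^ e j := by
      refine Finset.prod_congr rfl fun j hj => ?_
      have hj : j ≠ i := by simpa using hj
      rcases lt_or_gt_of_ne hj with h | h
      · rw [if_pos h, if_pos h]
      · rw [if_neg h.not_gt, if_pos h, if_neg h.not_gt]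
    have h2 : ∏ j ∈ {i}ᶜ, (if j ≤ i then b j else a j) ^ e j =
        ∏ j ∈ {i}ᶜ, (if j < i then b j else a j) ^ e j := by
      refine Finset.prod_congr rfl fun j hj => ?_
      have hj : j ≠ i := by simpa using hj
      rcases lt_or_gt_of_ne hj with h | h
      · rw [if_pos h, if_pos h.le]
      · rw [if_neg h.not_gt, if_neg h.not_ge]
    rw [h1, h2, if_neg (lt_irrefl i), if_neg (lt_irrefl i), if_neg (lt_irrefl i),
      if_pos (le_refl i), ← mul_assoc, ← sub_mul, mul_comm (a i - b i), geom_sum₂_mul]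
  exact LinearMap.congr_fun this f

lemma sum_diffQuot (a b : Fin n → T) (f : MvPolynomial (Fin n) K) :
    ∑ i, diffQuot K a b i f * (a i - b i) = aeval a f - aeval b f := by
  have h : ∀ i : Fin n, diffQuot K a b i f * (a i - b i) =
      (fun m : ℕ => aeval (fun j : Fin n => if (j : ℕ) < m then b j else a j) f) i -
      (fun m : ℕ => aeval (fun j : Fin n => if (j : ℕ) < m then b j else a j) f) (i + 1) :=
    fun i => by
      rw [mul_comm, diffQuot_mul]
      simp only [Nat.lt_succ_iff, Fin.lt_def, Fin.le_def]
  rw [Finset.sum_congr rfl fun i _ => h i,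
    Fin.sum_univ_eq_sum_range (fun i => (fun m : ℕ => aeval (fun j : Fin n =>
      if (j : ℕ) < m then b j else a j) f) i - (fun m : ℕ => aeval (fun j : Fin n =>
      if (j : ℕ) < m then b j else a j) f) (i + 1)), Finset.sum_range_sub']
  simp

end DifferenceQuotients

section Potentials

open MvPolynomial

variable {k : Type u} [CommRing k]

/-- The ideal generated by the partial derivatives of `W`. -/
def jacobianIdeal {n : ℕ} (W : MvPolynomial (Fin n) k) : Ideal (MvPolynomial (Fin n) k) :=
  Ideal.span (Set.range fun i => pderiv i W)

/-- A potential: the partial derivatives `f_1, …, f_n` of `W` form a quasi-regular sequence, the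
quotient by the ideal `J` they generate is a finitely generated free `k`-module, and the Koszul
complex of `f_1, …, f_n` is exact outside degree `0`. -/
structure IsPotential {n : ℕ} (W : MvPolynomial (Fin n) k) : Prop where
  /-- If a form `F` of degree `d` satisfies `F(f_1, …, f_n) ∈ J ^ (d + 1)`, then its coefficients
  lie in `J`. -/
  quasiRegular : ∀ (d : ℕ) (F : MvPolynomial (Fin n) (MvPolynomial (Fin n) k)),
    F.IsHomogeneous d → aeval (fun i => pderiv i W) F ∈ jacobianIdeal W ^ (d + 1) →
      ∀ e, coeff e F ∈ jacobianIdeal W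
  finite : Module.Finite k (MvPolynomial (Fin n) k ⧸ jacobianIdeal W)
  free : Module.Free k (MvPolynomial (Fin n) k ⧸ jacobianIdeal W)
  /-- A Koszul cycle without component in degree `0` is a boundary. -/
  koszulExact : ∀ ω : Finset (Fin n) → MvPolynomial (Fin n) k, ω ∅ = 0 →
    (∑ i, pderiv i W • extContr i) ω = 0 → ∃ η, (∑ i, pderiv i W • extContr i) η = ω

variable (k) in
/-- Potentials `W ∈ k[x_1, …, x_n]`. -/
structure Obj where
  n : ℕ
  W : MvPolynomial (Fin n) k
  isPotential : IsPotential W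

/-- The ring `k[x_1, …, x_n]` of an object `(k[x_1, …, x_n], W)`. -/
abbrev Obj.ring (A : Obj k) : Type u := MvPolynomial (Fin A.n) k

/-- Linear factorisations of `V - W` over `k[z, x]`, for objects `A = (k[x], W)` and
`B = (k[z], V)`. The ring `k[z, x]` is presented as `k[z] ⊗ k[x]`. -/
abbrev Fact (A B : Obj k) : Type (u + 1) := LinFact (B.ring ⊗[k] A.ring) (pot k B.W A.W)

end Potentials

section Unit

open MvPolynomial

variable {k : Type u} [CommRing k]

variable (k) in
/-- The variables `x_i ⊗ 1`. -/
def varL {n : ℕ} (i : Fin n) : MvPolynomial (Fin n) k ⊗[k] MvPolynomial (Fin n) k := X i ⊗ₜ[k] 1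

variable (k) in
/-- The variables `x_i' = 1 ⊗ x_i`. -/
def varR {n : ℕ} (i : Fin n) : MvPolynomial (Fin n) k ⊗[k] MvPolynomial (Fin n) k := 1 ⊗ₜ[k] X i

lemma aeval_varL {n : ℕ} (f : MvPolynomial (Fin n) k) : aeval (varL k) f = f ⊗ₜ[k] 1 := by
  have : aeval (varL k) = (Algebra.TensorProduct.includeLeft :
      MvPolynomial (Fin n) k →ₐ[k] MvPolynomial (Fin n) k ⊗[k] MvPolynomial (Fin n) k) :=
    algHom_ext fun i => by rw [aeval_X]; rfl
  rw [this]; rfl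

lemma aeval_varR {n : ℕ} (f : MvPolynomial (Fin n) k) : aeval (varR k) f = 1 ⊗ₜ[k] f := by
  have : aeval (varR k) = (Algebra.TensorProduct.includeRight :
      MvPolynomial (Fin n) k →ₐ[k] MvPolynomial (Fin n) k ⊗[k] MvPolynomial (Fin n) k) :=
    algHom_ext fun i => by rw [aeval_X]; rfl
  rw [this]; rfl

/-- The unit `Δ_W`: the exterior algebra on `θ_1, …, θ_n` over `k[x, x']` with differential
`∑ᵢ (∂_{[i]} W · θ_i + (x_i - x_i') · θ_i^*)`. -/
def delta (A : Obj k) : Fact A A where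
  carrier := Finset (Fin A.n) → A.ring ⊗[k] A.ring
  even := extEven
  even_even f := by
    ext s; rw [extEven_apply, extEven_apply]; split_ifs <;> rfl
  d := koszulD (fun i => diffQuot k (varL k) (varR k) i A.W) (fun i => varL k i - varR k i)
  d_odd := koszulD_odd _ _
  d_sq f := by
    have := LinearMap.congr_fun (koszulD_sq (fun i => diffQuot k (varL k) (varR k) i A.W)
      (fun i : Fin A.n => (varL k i - varR k i : A.ring ⊗[k] A.ring))) f
    rw [Module.End.mul_apply, sum_diffQuot, aeval_varL, aeval_varR, Module.algebraMap_end_apply] at this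
    exact this

lemma deltaBasis_even {R : Type u} [CommRing R] {n : ℕ} (s : Finset (Fin n)) :
    extEven (((Pi.basisFun R (Finset (Fin n))).reindex (Equiv.ulift.{u}).symm) ⟨s⟩) =
      if ((s.card : ℕ) : ZMod 2) = 0 then
        ((Pi.basisFun R (Finset (Fin n))).reindex (Equiv.ulift.{u}).symm) ⟨s⟩ else 0 := by
  rw [Module.Basis.reindex_apply, Equiv.symm_symm, Equiv.ulift_apply]
  ext t
  rw [extEven_apply, Pi.basisFun_apply]
  simp only [ZMod.natCast_eq_zero_iff_even]
  by_cases h : t = s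
  · subst h; split_ifs <;> rfl
  · rw [Pi.single_eq_of_ne h]; split_ifs <;> simp [h]

/-- The basis `(θ_s)` of `Δ_W`. -/
def deltaBasis (A : Obj k) : (delta A).HomBasis (ULift.{u} (Finset (Fin A.n))) where
  basis := ((Pi.basisFun (A.ring ⊗[k] A.ring) (Finset (Fin A.n))).reindex Equiv.ulift.symm :
    Module.Basis _ _ (Finset (Fin A.n) → A.ring ⊗[k] A.ring))
  par s := s.down.card
  even_basis s := deltaBasis_even s.down

/-- The multiplication `S ⊗ S → S`. -/
abbrev mulMap (A : Obj k) : A.ring ⊗[k] A.ring →ₐ[k] A.ring := Algebra.TensorProduct.lmul' k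

lemma koszul_counit (A : Obj k) (a : Fin A.n → A.ring ⊗[k] A.ring)
    (ω : Finset (Fin A.n) → A.ring ⊗[k] A.ring) :
    mulMap A (koszulD a (fun i => varL k i - varR k i) ω ∅) = 0 := by
  rw [koszulD, LinearMap.sum_apply, Finset.sum_apply, map_sum]
  refine Finset.sum_eq_zero fun i _ => ?_
  rw [LinearMap.add_apply, Pi.add_apply, LinearMap.smul_apply, LinearMap.smul_apply, Pi.smul_apply,
    Pi.smul_apply, extMul_apply, if_neg (Finset.notMem_empty i), smul_zero, zero_add, smul_eq_mul,
    map_mul, map_sub, varL, varR, Algebra.TensorProduct.lmul'_apply_tmul,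
    Algebra.TensorProduct.lmul'_apply_tmul, mul_one, one_mul, sub_self, zero_mul]

namespace LinFact

/-- The projection `Δ → S`, of degree zero, to the degree-zero part of the exterior algebra followed
by multiplication. -/
def counit (A : Obj k) : (delta A).carrier →+ A.ring where
  toFun ω := mulMap A (ω ∅)
  map_zero' := map_zero (mulMap A)
  map_add' ω η := map_add (mulMap A) (ω ∅) (η ∅)

lemma counit_smul (A : Obj k) (s t : A.ring) (ω : (delta A).carrier) :
    counit A ((s ⊗ₜ[k] t) • ω) = s * t * counit A ω := by
  change mulMap A ((s ⊗ₜ[k] t) * ω ∅) = _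
  rw [map_mul, Algebra.TensorProduct.lmul'_apply_tmul]; rfl

lemma counit_d (A : Obj k) (ω : (delta A).carrier) : counit A ((delta A).d ω) = 0 :=
  koszul_counit A _ ω

lemma counit_even (A : Obj k) (ω : (delta A).carrier) :
    counit A ((delta A).even ω) = counit A ω := by
  change mulMap A (if Even (∅ : Finset (Fin A.n)).card then ω ∅ else 0) = _
  rw [if_pos (by simp)]; rfl

variable {A B : Obj k} (X : Fact A B)

/-- The biadditive map `ω, x ↦ ε(ω) x`. -/
def lamAux : (delta B).carrier →+ X.carrier →+ X.carrier :=
  AddMonoidHom.mk' (fun ω => DistribSMul.toAddMonoidHom X.carrier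
    (counit B ω ⊗ₜ[k] (1 : A.ring) : B.ring ⊗[k] A.ring)) (fun ω η => by
      ext x; simp [add_tmul, add_smul])

lemma zero_tmul_smul (x : X.carrier) :
    ((0 : B.ring) ⊗ₜ[k] (1 : A.ring) : B.ring ⊗[k] A.ring) • x = 0 :=
  (congrArg (· • x) (zero_tmul _ _)).trans (zero_smul (B.ring ⊗[k] A.ring) x)

lemma tmul_zero_smul (x : X.carrier) :
    ((1 : B.ring) ⊗ₜ[k] (0 : A.ring) : B.ring ⊗[k] A.ring) • x = 0 :=
  (congrArg (· • x) (tmul_zero _ _)).trans (zero_smul (B.ring ⊗[k] A.ring) x)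

lemma lamAux_apply (ω : (delta B).carrier) (x : X.carrier) :
    lamAux X ω x = (counit B ω ⊗ₜ[k] (1 : A.ring) : B.ring ⊗[k] A.ring) • x := rfl

/-- The left unit action `Δ_V ⊗ X → X`. -/
def lamMap : (tensor (delta B) X).carrier →ₗ[B.ring ⊗[k] A.ring] X.carrier :=
  tlift (lamAux X)
    (fun s ω x => by
      rw [lamAux_apply, lamAux_apply, counit_smul, one_mul, smul_smul,
        Algebra.TensorProduct.tmul_mul_tmul, one_mul, mul_comm])
    (fun t r ω x => by
      rw [lamAux_apply, lamAux_apply, counit_smul, mul_one, smul_smul, smul_smul,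
        Algebra.TensorProduct.tmul_mul_tmul, Algebra.TensorProduct.tmul_mul_tmul, mul_one,
        one_mul, mul_one])

lemma lamMap_pt (ω : (delta B).carrier) (x : X.carrier) : lamMap X (pt ω x) =
    (counit B ω ⊗ₜ[k] (1 : A.ring) : B.ring ⊗[k] A.ring) • x := rfl

/-- The left unit action `Δ_V ⊗ X → X`. -/
def lamHom : Hom (tensor (delta B) X) X where
  map := lamMap X
  map_even z := by
    induction z using tind with
    | ha a b ha hb => simp only [map_add, ha, hb]
    | h ω x =>
      rw [even_pt, lamMap_pt, map_add, lamMap_pt, lamMap_pt, map_sub, counit_even, sub_self,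
        zero_tmul_smul, add_zero, map_smul]
  map_d z := by
    induction z using tind with
    | ha a b ha hb => simp only [map_add, ha, hb]
    | h ω x =>
      rw [d_pt, lamMap_pt, map_add, lamMap_pt, lamMap_pt, sign_apply, map_sub, map_add, counit_even,
        counit_d, zero_tmul_smul, zero_add, map_smul, add_sub_cancel_right]

/-- The biadditive map `x, ω ↦ ε(ω) x`. -/
def rhoAux : X.carrier →+ (delta A).carrier →+ X.carrier :=
  (AddMonoidHom.mk' (fun ω => DistribSMul.toAddMonoidHom X.carrier
    ((1 : B.ring) ⊗ₜ[k] counit A ω : B.ring ⊗[k] A.ring)) (fun ω η => by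
      ext x; simp [tmul_add, add_smul])).flip

lemma rhoAux_apply (ω : (delta A).carrier) (x : X.carrier) :
    rhoAux X x ω = ((1 : B.ring) ⊗ₜ[k] counit A ω : B.ring ⊗[k] A.ring) • x := rfl

/-- The right unit action `X ⊗ Δ_W → X`. -/
def rhoMap : (tensor X (delta A)).carrier →ₗ[B.ring ⊗[k] A.ring] X.carrier :=
  tlift (rhoAux X)
    (fun s x ω => by
      rw [rhoAux_apply, rhoAux_apply, counit_smul, mul_one, smul_smul,
        Algebra.TensorProduct.tmul_mul_tmul, one_mul, mul_comm])
    (fun t r x ω => by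
      rw [rhoAux_apply, rhoAux_apply, counit_smul, one_mul, smul_smul, smul_smul,
        Algebra.TensorProduct.tmul_mul_tmul, Algebra.TensorProduct.tmul_mul_tmul, one_mul, mul_one,
        mul_one, mul_comm])

lemma rhoMap_pt (x : X.carrier) (ω : (delta A).carrier) : rhoMap X (pt x ω) =
    ((1 : B.ring) ⊗ₜ[k] counit A ω : B.ring ⊗[k] A.ring) • x := rfl

/-- The right unit action `X ⊗ Δ_W → X`. -/
def rhoHom : Hom (tensor X (delta A)) X where
  map := rhoMap X
  map_even z := by
    induction z using tind with
    | ha a b ha hb => simp only [map_add, ha, hb]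
    | h x ω =>
      rw [even_pt, rhoMap_pt, map_add, rhoMap_pt, rhoMap_pt, map_sub, counit_even, sub_self,
        tmul_zero_smul, add_zero, map_smul]
  map_d z := by
    induction z using tind with
    | ha a b ha hb => simp only [map_add, ha, hb]
    | h x ω =>
      rw [d_pt, rhoMap_pt, map_add, rhoMap_pt, rhoMap_pt, counit_d, tmul_zero_smul, add_zero,
        map_smul]

lemma lam_natural {X Y : Fact A B} (f : X ⟶ Y) :
    tensorCls (𝟙 (delta B)) f ≫ cls (lamHom Y) = cls (lamHom X) ≫ f := by
  obtain ⟨f, rfl⟩ := cls_surj f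
  rw [cls_id, tensorCls_cls, cls_comp, cls_comp]
  refine congrArg cls (Hom.tensor_ext fun ω x => ?_)
  rw [Hom.comp_map, Hom.comp_map, Hom.tensor_pt]
  change lamMap Y (pt ω _) = f.map (lamMap X (pt ω x))
  rw [lamMap_pt, lamMap_pt, map_smul]

lemma rho_natural {X Y : Fact A B} (f : X ⟶ Y) :
    tensorCls f (𝟙 (delta A)) ≫ cls (rhoHom Y) = cls (rhoHom X) ≫ f := by
  obtain ⟨f, rfl⟩ := cls_surj f
  rw [cls_id, tensorCls_cls, cls_comp, cls_comp]
  refine congrArg cls (Hom.tensor_ext fun x ω => ?_)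
  rw [Hom.comp_map, Hom.comp_map, Hom.tensor_pt]
  change rhoMap Y (pt _ ω) = f.map (rhoMap X (pt x ω))
  rw [rhoMap_pt, rhoMap_pt, map_smul]

lemma unit_triangle {C : Obj k} (Y : Fact B C) (X : Fact A B) :
    (assocIso Y (delta B) X).hom ≫ tensorCls (𝟙 Y) (cls (lamHom X)) =
      tensorCls (cls (rhoHom Y)) (𝟙 X) := by
  rw [cls_id, cls_id, tensorCls_cls, tensorCls_cls, assocIso, cls_comp]
  refine congrArg cls (tensor_ext₃ fun y ω x => ?_)
  rw [Hom.comp_map, assocHom_pt, Hom.tensor_pt, Hom.tensor_pt]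
  change pt y (lamMap X (pt ω x)) = pt (rhoMap Y (pt y ω)) x
  rw [lamMap_pt, rhoMap_pt, pt_balanced]

end LinFact

end Unit

section Bicategory

variable {k : Type u} [CommRing k]

/-- The 1-morphisms `W → V`: matrix factorisations of `V - W`, possibly of infinite rank, that are
direct summands, in the homotopy category, of matrix factorisations of finite rank. -/
structure OneMor (A B : Obj k) where
  fact : Fact A B
  isMF : fact.IsMF
  isSummand : fact.IsSummandOfFinite

/-- 2-morphisms are homotopy classes of morphisms of matrix factorisations. -/
instance (A B : Obj k) : Category (OneMor A B) where
  Hom X Y := X.fact ⟶ Y.fact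
  id X := 𝟙 X.fact
  comp f g := f ≫ g
  id_comp f := Category.id_comp f
  comp_id f := Category.comp_id f
  assoc f g h := Category.assoc f g h

/-- A matrix factorisation of finite rank as a 1-morphism. -/
def LinFact.IsFiniteRank.oneMor {A B : Obj k} {X : Fact A B} (h : X.IsFiniteRank) : OneMor A B where
  fact := X
  isMF := by obtain ⟨I, _, ⟨e⟩⟩ := h; exact ⟨I, ⟨e⟩⟩
  isSummand := ⟨X, h, 𝟙 X, 𝟙 X, Category.id_comp _⟩

variable (k) in
/-- The assertion that the data of the bicategory of Landau-Ginzburg models over `k` are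
well-defined: the tensor product `Y ⊗_S X` of composable 1-morphisms is again a 1-morphism, and
the unit actions are invertible up to homotopy. -/
structure LGWellDefined : Prop where
  isMF_tensor : ∀ {A B C : Obj k} (Y : OneMor B C) (X : OneMor A B),
    (LinFact.tensor Y.fact X.fact).IsMF
  isSummand_tensor : ∀ {A B C : Obj k} (Y : OneMor B C) (X : OneMor A B),
    (LinFact.tensor Y.fact X.fact).IsSummandOfFinite
  isIso_lam : ∀ {A B : Obj k} (X : OneMor A B), IsIso (LinFact.cls (LinFact.lamHom X.fact))
  isIso_rho : ∀ {A B : Obj k} (X : OneMor A B), IsIso (LinFact.cls (LinFact.rhoHom X.fact))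

/-- Isomorphisms of 1-morphisms are isomorphisms in the homotopy category. -/
def OneMor.mkIso {A B : Obj k} {X Y : OneMor A B} (f : X.fact ≅ Y.fact) : X ≅ Y where
  hom := f.hom
  inv := f.inv
  hom_inv_id := f.hom_inv_id
  inv_hom_id := f.inv_hom_id

/-- The unit 1-morphism `Δ_W`. -/
def OneMor.unit (A : Obj k) : OneMor A A :=
  LinFact.IsFiniteRank.oneMor (X := delta A) ⟨_, inferInstance, ⟨deltaBasis A⟩⟩

/-- The composition of 1-morphisms, the tensor product `Y ⊗_S X`. -/
def LGWellDefined.comp (h : LGWellDefined k) {A B C : Obj k} (Y : OneMor B C) (X : OneMor A B) :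
    OneMor A C where
  fact := LinFact.tensor Y.fact X.fact
  isMF := h.isMF_tensor Y X
  isSummand := h.isSummand_tensor Y X

/-- The left unit action as an isomorphism `Δ_V ⊗ X ≅ X`. -/
def LGWellDefined.lamIso (h : LGWellDefined k) {A B : Obj k} (X : OneMor A B) :
    LinFact.tensor (delta B) X.fact ≅ X.fact :=
  @asIso _ _ _ _ (LinFact.cls (LinFact.lamHom X.fact)) (h.isIso_lam X)

/-- The right unit action as an isomorphism `X ⊗ Δ_W ≅ X`. -/
def LGWellDefined.rhoIso (h : LGWellDefined k) {A B : Obj k} (X : OneMor A B) :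
    LinFact.tensor X.fact (delta A) ≅ X.fact :=
  @asIso _ _ _ _ (LinFact.cls (LinFact.rhoHom X.fact)) (h.isIso_rho X)

/-- The objects of the bicategory of Landau-Ginzburg models over `k`. -/
@[nolint unusedArguments]
structure LG (h : LGWellDefined k) where
  obj : Obj k

end Bicategory

section BicategoryInstance

variable {k : Type u} [CommRing k] (h : LGWellDefined k)

open LinFact

instance : CategoryStruct.{u + 1} (LG h) where
  Hom A B := OneMor A.obj B.obj
  id A := OneMor.unit A.obj
  comp X Y := h.comp Y X

/-- The bicategory of Landau-Ginzburg models: objects are potentials, 1-morphisms are (summands of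
finite-rank) matrix factorisations of `V - W`, 2-morphisms are homotopy classes of morphisms, the
composition of `X : W → V` and `Y : V → U` is `Y ⊗ X`, and the units are the `Δ_W`. -/
instance : Bicategory.{u, u + 1} (LG h) where
  homCategory A B := inferInstanceAs (Category.{u} (OneMor A.obj B.obj))
  whiskerLeft X _ _ η := tensorCls η (𝟙 X.fact)
  whiskerRight η Y := tensorCls (𝟙 Y.fact) η
  associator X Y Z := OneMor.mkIso (assocIso Z.fact Y.fact X.fact).symm
  leftUnitor X := OneMor.mkIso (h.rhoIso X)
  rightUnitor X := OneMor.mkIso (h.lamIso X)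
  whiskerLeft_id X Y := tensorCls_id Y.fact X.fact
  whiskerLeft_comp X _ _ _ η θ := by
    have := tensorCls_comp η θ (𝟙 X.fact) (𝟙 X.fact)
    rw [Category.comp_id] at this; exact this
  id_whiskerLeft {A B X Y} η := by
    have := rho_natural (X := X.fact) (Y := Y.fact) η
    exact ((Iso.eq_comp_inv (h.rhoIso Y)).2 this).trans (Category.assoc _ _ _)
  comp_whiskerLeft {A B C D} X Y Z Z' η := by
    have := assoc_natural η (𝟙 Y.fact) (𝟙 X.fact)
    rw [tensorCls_id] at this
    exact (Iso.eq_inv_comp (assocIso Z.fact Y.fact X.fact)).2 this.symm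
  id_whiskerRight X Y := tensorCls_id Y.fact X.fact
  comp_whiskerRight η θ Y := by
    have := tensorCls_comp (𝟙 Y.fact) (𝟙 Y.fact) η θ
    rw [Category.comp_id] at this; exact this
  whiskerRight_id {A B X Y} η := by
    have := lam_natural (X := X.fact) (Y := Y.fact) η
    exact ((Iso.eq_comp_inv (h.lamIso Y)).2 this).trans (Category.assoc _ _ _)
  whiskerRight_comp {A B C D X X'} η Y Z := by
    have := assoc_natural_right Z.fact Y.fact η
    exact this
  whisker_assoc {A B C D} X Y Y' η Z := by
    have := assoc_natural (𝟙 Z.fact) η (𝟙 X.fact)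
    exact (Iso.eq_inv_comp (assocIso Z.fact Y.fact X.fact)).2 this.symm
  whisker_exchange {A B C X X' Y Y'} η θ := by
    have h1 := tensorCls_comp θ (𝟙 Y'.fact) (𝟙 X.fact) η
    have h2 := tensorCls_comp (𝟙 Y.fact) θ η (𝟙 X'.fact)
    rw [Category.comp_id, Category.id_comp] at h1 h2
    exact h1.symm.trans h2
  pentagon X Y Z U := by
    have := LinFact.pentagon Z.fact Y.fact X.fact U.fact
    exact this
  triangle X Y := by
    have := unit_triangle Y.fact X.fact
    exact (Iso.inv_comp_eq (assocIso Y.fact (delta _) X.fact)).2 this.symm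

end BicategoryInstance

section Duals

namespace LinFact

variable {A : Type u} [CommRing A] {w : A}

/-- The dual `X^∨ = Hom_A(X, A)`, a linear factorisation of `-w`, with differential
`ν ↦ -(-1)^{|ν|} ν ∘ d`. -/
def dual (X : LinFact A w) : LinFact A (-w) where
  carrier := Module.Dual A X.carrier
  even := X.even.dualMap
  even_even ν := LinearMap.ext fun x => congrArg ν (X.even_even x)
  d := -(X.d.dualMap ∘ₗ X.sign.dualMap)
  d_odd ν := LinearMap.ext fun x => by
    simp only [LinearMap.add_apply, LinearMap.dualMap_apply, LinearMap.neg_apply,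
      LinearMap.comp_apply, X.sign_d, X.even_d, map_neg, map_sub, even_sign, sign_even]
    simp only [sign_apply, map_add, map_sub]
    abel
  d_sq ν := LinearMap.ext fun x => by
    simp only [LinearMap.dualMap_apply, LinearMap.neg_apply, LinearMap.comp_apply, X.sign_d,
      map_neg, LinearMap.smul_apply, X.sign_sign, X.d_sq, map_smul, neg_smul, neg_neg]

/-- Restriction of scalars along a ring isomorphism. -/
def restrict {A' : Type u} [CommRing A'] (φ : A' ≃+* A) {w' : A'} (X : LinFact A w)
    (hw : φ w' = w) : LinFact A' w' where
  carrier := X.carrier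
  mod := Module.compHom X.carrier φ.toRingHom
  even :=
    letI : Module A' X.carrier := Module.compHom X.carrier φ.toRingHom
    { toFun := X.even, map_add' := map_add X.even, map_smul' := fun c x => X.even.map_smul (φ c) x }
  even_even := X.even_even
  d :=
    letI : Module A' X.carrier := Module.compHom X.carrier φ.toRingHom
    { toFun := X.d, map_add' := map_add X.d, map_smul' := fun c x => X.d.map_smul (φ c) x }
  d_odd := X.d_odd
  d_sq x := (X.d_sq x).trans (congrArg (· • x) hw.symm)

/-- The tensor product `X ⊗_A A[m]` with the `m`-fold shift of `A`, identified with `X` through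
`x ⊗ 1 ↔ x`: the grading is shifted by `m`, the differential is unchanged. -/
def shiftR (m : ℕ) (X : LinFact A w) : LinFact A w where
  carrier := X.carrier
  even := if Even m then X.even else LinearMap.id - X.even
  even_even x := by split_ifs <;> simp [X.even_even]
  d := X.d
  d_odd x := by
    split_ifs
    · exact X.d_odd x
    · simp [X.even_d]
  d_sq := X.d_sq

/-- The tensor product `A[n] ⊗_A X` with the `n`-fold shift of `A`, identified with `X` through
`1 ⊗ x ↔ x`: the grading is shifted by `n`, the differential is multiplied by `(-1)^n`. -/
def shiftL (n : ℕ) (X : LinFact A w) : LinFact A w where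
  carrier := X.carrier
  even := if Even n then X.even else LinearMap.id - X.even
  even_even x := by split_ifs <;> simp [X.even_even]
  d := (-1 : A) ^ n • X.d
  d_odd x := by
    split_ifs
    · simp only [LinearMap.smul_apply, map_smul, ← smul_add, X.d_odd]
    · simp only [LinearMap.smul_apply, LinearMap.sub_apply, LinearMap.id_apply, map_smul, map_sub,
        X.even_d]
      rw [← smul_sub, ← smul_add]
      congr 1; abel
  d_sq x := by
    rw [LinearMap.smul_apply, LinearMap.smul_apply, map_smul, X.d_sq, smul_smul, ← pow_add,
      ← two_mul, pow_mul]
    simp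

namespace HomBasis

variable {X : LinFact A w} {I : Type u}

/-- The dual basis. -/
def dual [Finite I] (e : X.HomBasis I) : X.dual.HomBasis I where
  basis := by classical exact e.basis.dualBasis
  par := e.par
  even_basis i := by
    classical
    refine e.basis.ext fun j => ?_
    change e.basis.dualBasis i (X.even (e.basis j)) = (if e.par i = 0 then e.basis.dualBasis i else 0 :
      Module.Dual A X.carrier) (e.basis j)
    rw [e.even_basis, Module.Basis.coe_dualBasis]
    by_cases hij : i = j
    · subst hij; split_ifs <;> simp
    · have h0 : e.basis.coord i (e.basis j) = 0 := by simp [Ne.symm hij]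
      split_ifs <;> simp [h0]

/-- The same basis after restriction of scalars along an isomorphism. -/
def restrict {A' : Type u} [CommRing A'] (φ : A' ≃+* A) {w' : A'} (hw : φ w' = w)
    (e : X.HomBasis I) : (X.restrict φ hw).HomBasis I where
  basis :=
    letI : Module A' X.carrier := Module.compHom X.carrier φ.toRingHom
    e.basis.mapCoeffs φ.symm (fun c x => congrArg (· • x) (φ.apply_symm_apply c))
  par := e.par
  even_basis i := by
    let _ : Module A' X.carrier := Module.compHom X.carrier φ.toRingHom
    have h : ∀ i, e.basis.mapCoeffs φ.symm (fun c x => congrArg (· • x) (φ.apply_symm_apply c)) i =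
      e.basis i := fun i => Module.Basis.mapCoeffs_apply _ _ _ _
    change X.even (e.basis.mapCoeffs φ.symm _ i) = if e.par i = 0 then
      e.basis.mapCoeffs φ.symm _ i else 0
    rw [h, e.even_basis]

/-- The same basis with shifted parities. -/
def shiftR (m : ℕ) (e : X.HomBasis I) : (X.shiftR m).HomBasis I where
  basis := e.basis
  par i := e.par i + m
  even_basis i := by
    change (if Even m then X.even else LinearMap.id - X.even) (e.basis i) =
      if e.par i + m = 0 then e.basis i else 0
    by_cases hm : Even m
    · rw [if_pos hm, (ZMod.natCast_eq_zero_iff_even).2 hm, add_zero, e.even_basis]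
    · have h1 : (m : ZMod 2) = 1 := ZMod.natCast_eq_one_iff_odd.2 (Nat.not_even_iff_odd.1 hm)
      rw [if_neg hm, h1, LinearMap.sub_apply, e.even_basis, LinearMap.id_apply]
      have : ∀ p : ZMod 2, (p + 1 = 0) = ¬ (p = 0) := by decide
      simp only [this]
      by_cases hp : e.par i = 0 <;> simp [hp]

/-- The same basis with shifted parities. -/
def shiftL (n : ℕ) (e : X.HomBasis I) : (X.shiftL n).HomBasis I where
  basis := e.basis
  par i := e.par i + n
  even_basis := (e.shiftR n).even_basis

end HomBasis

end LinFact

section Adjoints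

variable {k : Type u} [CommRing k] {A B : Obj k}

lemma swap_pot (A B : Obj k) : (Algebra.TensorProduct.comm k A.ring B.ring).toRingEquiv
    (pot k A.W B.W) = - pot k B.W A.W := by
  change Algebra.TensorProduct.comm k A.ring B.ring (A.W ⊗ₜ[k] 1 - 1 ⊗ₜ[k] B.W) = _
  rw [map_sub, Algebra.TensorProduct.comm_tmul, Algebra.TensorProduct.comm_tmul, neg_sub]

/-- The dual `X^∨` of a factorisation of `V - W`, as a factorisation of `W - V`. -/
def dualFact (X : Fact A B) : Fact B A :=
  X.dual.restrict (Algebra.TensorProduct.comm k A.ring B.ring).toRingEquiv (swap_pot A B)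

/-- `X^† = R[n] ⊗_R X^∨`, where `R = k[x_1, …, x_n]` is the polynomial ring of the source. -/
def rightAdj (X : Fact A B) : Fact B A := (dualFact X).shiftL A.n

/-- `^†X = X^∨ ⊗_S S[m]`, where `S = k[z_1, …, z_m]` is the polynomial ring of the target. -/
def leftAdj (X : Fact A B) : Fact B A := (dualFact X).shiftR B.n

variable {X : Fact A B} {I : Type u}

/-- The dual basis of `X^∨`. -/
def dualFactBasis [Finite I] (e : X.HomBasis I) : (dualFact X).HomBasis I := e.dual.restrict _ _

/-- The dual basis of `X^†`. -/
def rightAdjBasis [Finite I] (e : X.HomBasis I) : (rightAdj X).HomBasis I :=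
  (dualFactBasis e).shiftL _

/-- The dual basis of `^†X`. -/
def leftAdjBasis [Finite I] (e : X.HomBasis I) : (leftAdj X).HomBasis I :=
  (dualFactBasis e).shiftR _

lemma rightAdj_isFiniteRank (h : X.IsFiniteRank) : (rightAdj X).IsFiniteRank := by
  obtain ⟨I, _, ⟨e⟩⟩ := h; exact ⟨I, inferInstance, ⟨rightAdjBasis e⟩⟩

lemma leftAdj_isFiniteRank (h : X.IsFiniteRank) : (leftAdj X).IsFiniteRank := by
  obtain ⟨I, _, ⟨e⟩⟩ := h; exact ⟨I, inferInstance, ⟨leftAdjBasis e⟩⟩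

/-- A linear form on `X` as an element of `X^∨`. -/
def toDual (ν : X.carrier →ₗ[B.ring ⊗[k] A.ring] B.ring ⊗[k] A.ring) : (dualFact X).carrier := ν

/-- A linear form on `X` as an element of `X^†`. -/
def toRight (ν : X.carrier →ₗ[B.ring ⊗[k] A.ring] B.ring ⊗[k] A.ring) : (rightAdj X).carrier := ν

/-- A linear form on `X` as an element of `^†X`. -/
def toLeft (ν : X.carrier →ₗ[B.ring ⊗[k] A.ring] B.ring ⊗[k] A.ring) : (leftAdj X).carrier := ν

end Adjoints

end Duals

section NoncommutativeForms

variable (K T : Type u) [CommRing K] [CommRing T] [Algebra K T]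

/-- The quotient module `T / K`. -/
abbrev BarMod : Type u := T ⧸ LinearMap.range (Algebra.linearMap K T)

/-- Noncommutative forms `Ω_K T = ⨁_l T ⊗ (T/K)^{⊗ l}`: the element `a ⊗ (b_1 ⋯ b_l)` stands for
`a db_1 ⋯ db_l`. -/
abbrev Forms : Type u := T ⊗[K] TensorAlgebra K (BarMod K T)

namespace Forms

variable {T}

/-- A function as a `0`-form. -/
def of (a : T) : Forms K T := a ⊗ₜ[K] 1

variable (T)

/-- The differential `a db_1 ⋯ db_l ↦ da db_1 ⋯ db_l`. -/
def d : Forms K T →ₗ[K] Forms K T :=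
  TensorProduct.lift (((LinearMap.mul K (TensorAlgebra K (BarMod K T))).compr₂
    (TensorProduct.mk K T (TensorAlgebra K (BarMod K T)) 1)) ∘ₗ
      ((TensorAlgebra.ι K) ∘ₗ (LinearMap.range (Algebra.linearMap K T)).mkQ))

lemma d_tmul (a : T) (t : TensorAlgebra K (BarMod K T)) : d K T (a ⊗ₜ t) =
    1 ⊗ₜ (TensorAlgebra.ι K (Submodule.Quotient.mk a) * t) := rfl

/-- Left multiplication by the `1`-form `db`, given by `db · ω = d(b ω) - b dω`. -/
def leftD : BarMod K T →ₗ[K] Module.End K (Forms K T) :=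
  Submodule.liftQ _
    (LinearMap.mk₂ K (fun (b : T) (ω : Forms K T) => d K T (b • ω) - b • d K T ω)
      (fun b b' ω => by simp only [add_smul, map_add]; abel)
      (fun c b ω => by simp only [smul_assoc, map_smul, smul_sub])
      (fun b ω ω' => by simp only [smul_add, map_add]; abel)
      (fun c b ω => by simp only [smul_comm b c, map_smul, smul_sub]))
    (by
      rintro _ ⟨c, rfl⟩
      rw [LinearMap.mem_ker]
      refine LinearMap.ext fun ω => ?_
      rw [LinearMap.mk₂_apply, Algebra.linearMap_apply, algebraMap_smul, algebraMap_smul, map_smul,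
        sub_self, LinearMap.zero_apply])

/-- The product of noncommutative forms, `(a db_1 ⋯ db_l) · ω = a (db_1 · (⋯ (db_l · ω)))`. -/
def mul : Forms K T →ₗ[K] Module.End K (Forms K T) :=
  TensorProduct.lift
    (LinearMap.mk₂ K (fun (a : T) (t : TensorAlgebra K (BarMod K T)) =>
      (Algebra.lsmul K K (Forms K T) a : Module.End K (Forms K T)) *
        TensorAlgebra.lift K (leftD K T) t)
      (fun a a' t => by simp only [map_add, add_mul])
      (fun c a t => by simp only [map_smul, smul_mul_assoc])
      (fun a t t' => by simp only [map_add, mul_add])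
      (fun c a t => by simp only [map_smul, mul_smul_comm]))

/-- The grading operator `ω ↦ (-1)^{|ω|} ω`. -/
def sign : Forms K T →ₗ[K] Forms K T :=
  LinearMap.lTensor T (TensorAlgebra.lift K (-TensorAlgebra.ι K)).toLinearMap

end Forms

variable {K T} {J : Type u} [Fintype J]

/-- The right Atiyah class `[∇, D]` on `X ⊗ Ω`, for a free module `X` with homogeneous basis
`(e_j)`, the odd operator `D e_j = ∑ᵢ e_i D_{ij}` and the connection `∇(e_j ω) = (-1)^{|e_j|} e_j dω`.
Elements of `X ⊗ Ω` are written as `∑ⱼ e_j ⊗ v_j`. -/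
def atiyahR (par : J → ZMod 2) (D : J → J → T) (v : J → Forms K T) : J → Forms K T :=
  fun i => (-1 : ℤ) ^ (par i).val • Forms.d K T (∑ j, D i j • v j) +
    ∑ j, D i j • ((-1 : ℤ) ^ (par j).val • Forms.d K T (v j))

/-- The graded twist `x ⊗ ω ↦ (-1)^{|x||ω|} ω ⊗ x` in coordinates; it is its own inverse. -/
def gradedTwist (par : J → ZMod 2) (v : J → Forms K T) : J → Forms K T :=
  fun j => if par j = 0 then v j else Forms.sign K T (v j)

/-- The right Atiyah class transported by the graded twist to an operator on `Ω ⊗ X`. -/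
def atiyahArrow (par : J → ZMod 2) (D : J → J → T) (v : J → Forms K T) : J → Forms K T :=
  gradedTwist par (atiyahR par D (gradedTwist par v))

/-- The left Atiyah class `[∇, D]` on `Ω ⊗ X`, for the connection `∇(ω ⊗ e_j) = dω ⊗ e_j` and
`D(ω ⊗ e_j) = ∑ᵢ (-1)^{|ω|} ω D_{ij} ⊗ e_i`. -/
def atiyahL (D : J → J → T) (v : J → Forms K T) : J → Forms K T :=
  fun i => Forms.d K T (∑ j, Forms.mul K T (Forms.sign K T (v j)) (Forms.of K (D i j))) +
    ∑ j, Forms.mul K T (Forms.sign K T (Forms.d K T (v j))) (Forms.of K (D i j))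

end NoncommutativeForms

section Psi

open MvPolynomial

variable {n : ℕ} {K : Type u} [CommRing K]

lemma diffQuot_algebraMap {T : Type u} [CommRing T] [Algebra K T] (a b : Fin n → T) (i : Fin n)
    (c : K) : diffQuot K a b i (C c) = 0 := by
  have h1 : (C c : MvPolynomial (Fin n) K) = c • monomial 0 1 := by
    rw [smul_monomial, smul_eq_mul, mul_one]; rfl
  have h2 : (monomial 0 1 : MvPolynomial (Fin n) K) = basisMonomials (Fin n) K 0 := rfl
  rw [h1, map_smul, h2, diffQuot, Module.Basis.constr_basis,
    Finset.prod_eq_zero (Finset.mem_univ i), smul_zero]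
  simp

/-- The difference quotient `∂_{[i]}` with respect to the variables `x` and the elements `x' = b`,
on `T / K` for `T = K[x_1, …, x_n]`. -/
def diffQuotBar (b : Fin n → MvPolynomial (Fin n) K) (i : Fin n) :
    BarMod K (MvPolynomial (Fin n) K) →ₗ[K] MvPolynomial (Fin n) K :=
  Submodule.liftQ _ (diffQuot K X b i) (by rintro _ ⟨c, rfl⟩; exact diffQuot_algebraMap X b i c)

/-- The coefficient of `θ_s` in `Ψ(df_1 ⋯ df_p)`: it is `∏ₖ ∂_{[i_k]} f_k` if
`s = {i_1 < ⋯ < i_p}`, and zero if `s` does not have `p` elements. -/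
def psiCoeff (b : Fin n → MvPolynomial (Fin n) K) (s : Finset (Fin n)) :
    TensorAlgebra K (BarMod K (MvPolynomial (Fin n) K)) →ₗ[K] MvPolynomial (Fin n) K :=
  PiTensorProduct.lift ((MultilinearMap.mkPiAlgebra K (Fin s.card) (MvPolynomial (Fin n) K)).compLinearMap
      fun l => diffQuotBar b (s.orderEmbOfFin rfl l)) ∘ₗ
    DirectSum.component K ℕ (fun p => ⨂[K]^p (BarMod K (MvPolynomial (Fin n) K))) s.card ∘ₗ
      TensorAlgebra.toDirectSum.toLinearMap

/-- The map `Ψ` from noncommutative forms to the exterior algebra,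
`r df_1 ⋯ df_p ↦ ∑_{i_1 < ⋯ < i_p} r (∏ₖ ∂_{[i_k]} f_k) θ_{i_1} ⋯ θ_{i_p}`. -/
def psi (b : Fin n → MvPolynomial (Fin n) K) (s : Finset (Fin n)) :
    Forms K (MvPolynomial (Fin n) K) →ₗ[K] MvPolynomial (Fin n) K :=
  TensorProduct.lift ((LinearMap.mul K (MvPolynomial (Fin n) K)).compl₂ (psiCoeff b s))

/-- The product of the exterior algebra. -/
def wedge {A : Type u} [CommRing A] (γ ω : Finset (Fin n) → A) (u : Finset (Fin n)) : A :=
  ∑ s ∈ u.powerset, (-1) ^ ((s ×ˢ (u \ s)).filter fun p => p.2 < p.1).card * (γ s * ω (u \ s))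

end Psi

section Residue

open MvPolynomial

variable {k : Type u} [CommRing k] {n : ℕ}

/-- The residue with denominators `p_1(x_1), …, p_n(x_n)` for monic polynomials `p_i`: the residue of
`x_1^{e_1} ⋯ x_n^{e_n}` is the product of the coefficients of `x_i^{-1}` in the expansions of
`x_i^{e_i} / p_i(x_i)` in powers of `x_i^{-1}`. -/
def resMonic (p : Fin n → Polynomial k) : MvPolynomial (Fin n) k →ₗ[k] k :=
  (basisMonomials (Fin n) k).constr k fun e =>
    ∏ i, ((Polynomial.X ^ e i : Polynomial k) %ₘ p i).coeff ((p i).natDegree - 1)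

open Classical in
/-- The residue `g ↦ Res_{k[x]/k} [g dx_1 ⋯ dx_n / f_1, …, f_n]`, for `f_1, …, f_n` such that
`k[x]/(f_1, …, f_n)` is finite over `k`. Then there are monic polynomials `p_i` with
`p_i(x_i) = ∑ⱼ C_{ij} f_j`, and by the transformation rule the residue of `g` is the residue of
`det(C) g` with denominators `p_1(x_1), …, p_n(x_n)`. -/
def residue (f : Fin n → MvPolynomial (Fin n) k) : MvPolynomial (Fin n) k →ₗ[k] k :=
  if h : ∃ pC : (Fin n → Polynomial k) × Matrix (Fin n) (Fin n) (MvPolynomial (Fin n) k),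
      (∀ i, (pC.1 i).Monic) ∧ ∀ i, Polynomial.aeval (X i) (pC.1 i) = ∑ j, pC.2 i j * f j then
    resMonic h.choose.1 ∘ₗ LinearMap.mulLeft k h.choose.2.det
  else 0

end Residue

section AdjunctionMaps

open MvPolynomial LinFact

variable {k : Type u} [CommRing k]

/-- The polynomial ring `O ⊗ M ⊗ O` of a composite `O ← M ← O` of 1-morphisms, as the polynomials in
the variables of the first factor over the ring `M ⊗ O`. -/
abbrev Tri (O M : Obj k) : Type u := MvPolynomial (Fin O.n) (M.ring ⊗[k] O.ring)

variable (O M : Obj k)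

/-- The inclusion of the first two tensor factors. -/
def embL : O.ring ⊗[k] M.ring →ₐ[k] Tri O M :=
  Algebra.TensorProduct.productMap (aeval X)
    ((IsScalarTower.toAlgHom k (M.ring ⊗[k] O.ring) (Tri O M)).comp
      Algebra.TensorProduct.includeLeft)

/-- The inclusion of the last two tensor factors. -/
def embR : M.ring ⊗[k] O.ring →ₐ[k] Tri O M := IsScalarTower.toAlgHom k (M.ring ⊗[k] O.ring) (Tri O M)

/-- The inclusion of the first and the last tensor factor. -/
def embOut : O.ring ⊗[k] O.ring →ₐ[k] Tri O M :=
  Algebra.TensorProduct.productMap (aeval X)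
    ((IsScalarTower.toAlgHom k (M.ring ⊗[k] O.ring) (Tri O M)).comp
      Algebra.TensorProduct.includeRight)

/-- The variables `x'` of the last tensor factor. -/
def varOut (i : Fin O.n) : Tri O M := C (1 ⊗ₜ[k] X i)

variable {O M} {I J : Type u} {Y : Fact M O} {Z : Fact O M}

section Matrix

variable [DecidableEq I] [DecidableEq J]

/-- The parities of the basis `e_p ⊗ f_q` of `Y ⊗ Z`. -/
def parProd (e : Y.HomBasis I) (f : Z.HomBasis J) (p : I × J) : ZMod 2 := e.par p.1 + f.par p.2

/-- The matrix of the differential of `Y ⊗ Z` in the basis `e_p ⊗ f_q`. -/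
def matProd (e : Y.HomBasis I) (f : Z.HomBasis J) (p q : I × J) : Tri O M :=
  (if p.2 = q.2 then embL O M (e.basis.repr (Y.d (e.basis q.1)) p.1) else 0) +
    if p.1 = q.1 then (-1) ^ (e.par q.1).val * embR O M (f.basis.repr (Z.d (f.basis q.2)) p.2) else 0

end Matrix

/-- The element `P · (y ⊗ z)` of `Y ⊗_M Z`, where `P` lies in the ring `O ⊗ M ⊗ O`. -/
def triSmul (P : Tri O M) (y : Y.carrier) (z : Z.carrier) : (tensor Y Z).carrier :=
  ∑ s ∈ P.support, pt (((monomial s 1 : O.ring) ⊗ₜ[k] (1 : M.ring) : O.ring ⊗[k] M.ring) • y)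
    (coeff s P • z)

/-- The residue `O ⊗ M ⊗ O → O ⊗ O` with respect to the variables of `M`, with the partial
derivatives of the potential of `M` as denominators. -/
def midRes (P : Tri O M) : O.ring ⊗[k] O.ring :=
  ∑ s ∈ P.support, (monomial s 1 : O.ring) ⊗ₜ[k] TensorProduct.lid k O.ring
    (LinearMap.rTensor O.ring (residue fun i => pderiv i M.W) (coeff s P))

variable [Fintype I] [DecidableEq I] [Fintype J] [DecidableEq J]

/-- The `θ_s`-coefficients, `s ⊆ {1, …, n}`, of `Ψ At^l(ι)`, where `At` is the right Atiyah class of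
`Y ⊗ Z` in the direction of the first factor, with forms on the left. The family `ι` consists of the
coordinates of an element of `Y ⊗ Z`. -/
def psiAt (e : Y.HomBasis I) (f : Z.HomBasis J) (ι : I × J → Tri O M) (l : ℕ) (p : I × J)
    (s : Finset (Fin O.n)) : Tri O M :=
  psi (varOut O M) s
    ((atiyahArrow (parProd e f) (matProd e f))^[l] (fun q => Forms.of (M.ring ⊗[k] O.ring) (ι q)) p)

/-- `∑_l ε(γ ∧ (-1)^{c + l + n l} Ψ At^l(ι))`, an element of `Y ⊗ Z` that depends on
`γ ∈ Δ`; here `ε` takes the coefficient of `θ_1 ⋯ θ_n`. -/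
def coevFormula (e : Y.HomBasis I) (f : Z.HomBasis J) (ι : I × J → Tri O M) (c : ℕ)
    (γ : Finset (Fin O.n) → O.ring ⊗[k] O.ring) : (tensor Y Z).carrier :=
  ∑ p : I × J, triSmul (∑ l ∈ Finset.range (O.n + 1), (-1) ^ (c + l + O.n * l) *
    wedge (fun s => embOut O M (γ s)) (psiAt e f ι l p) Finset.univ) (e.basis p.1) (f.basis p.2)

/-- `∑_l Res [Ψ⟨At^l(y ⊗ z)⟩ / ∂_1 U, …, ∂_r U] ∈ Δ`, where `U` is the potential of `M`, `At` is the
left Atiyah class of `Y ⊗ Z` in the direction of the first factor, and `⟨e_i ⊗ f_j⟩ = δ_{ij} c_i`. -/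
def evFormula (e : Y.HomBasis I) (f : Z.HomBasis I) (c : I → ℤ) (y : Y.carrier) (z : Z.carrier)
    (s : Finset (Fin O.n)) : O.ring ⊗[k] O.ring :=
  midRes (∑ l ∈ Finset.range (O.n + 1), psi (varOut O M) s (∑ i, c i • (atiyahL (matProd e f))^[l]
    (fun q => Forms.of (M.ring ⊗[k] O.ring)
      (embL O M (e.basis.repr y q.1) * embR O M (f.basis.repr z q.2))) (i, i)))

end AdjunctionMaps

section Adjunctions

open MvPolynomial LinFact

variable {k : Type u} [CommRing k] {A B : Obj k}

/-- A null-homotopy for the action of `f` on a linear factorisation: an odd map `h` with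
`d h + h d = f`. -/
structure IsNullHomotopy {R : Type u} [CommRing R] {w : R} (X : LinFact R w) (f : R)
    (h : Module.End R X.carrier) : Prop where
  odd : ∀ x, X.even (h x) + h (X.even x) = h x
  eq : ∀ x, X.d (h x) + h (X.d x) = f • x

variable (X : Fact A B) {I : Type u} [Fintype I] [DecidableEq I] (e : X.HomBasis I)

/-- `coev~_X : Δ_W → X^† ⊗_S X`, with `ι = ∑ⱼ (-1)^{|e_j|} e_j^* ⊗ e_j`. -/
def coevRight (γ : (delta A).carrier) : (tensor (rightAdj X) X).carrier :=
  coevFormula (rightAdjBasis e) e (fun p => if p.1 = p.2 then (-1) ^ (e.par p.1).val else 0) 0 γ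

/-- `ev~_X : X ⊗_R X^† → Δ_V` on `η ⊗ ν`, for `Λ = λ_1 ⋯ λ_n` with null-homotopies `λ_i` for the
action of `∂W/∂x_i` on `X`, with `⟨e_i ⊗ e_j^*⟩ = (-1)^{|e_i||e_j|} δ_{ij}` and the sign
`(-1)^{n + n|η|}`. -/
def evRight (Λ : Module.End (B.ring ⊗[k] A.ring) X.carrier) (η : X.carrier)
    (ν : X.carrier →ₗ[B.ring ⊗[k] A.ring] B.ring ⊗[k] A.ring) : (delta B).carrier :=
  ((-1 : ℤ) ^ A.n • evFormula (Y := X) (Z := dualFact X) e (dualFactBasis e)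
    (fun i => (-1) ^ (e.par i).val) (Λ ((X.sign)^[A.n] η)) (toDual ν) :
      Finset (Fin B.n) → B.ring ⊗[k] B.ring)

/-- `coev_X : Δ_V → X ⊗_R ^†X`, with `ι' = ∑ⱼ e_j ⊗ e_j^*`. -/
def coevLeft (γ : (delta B).carrier) : (tensor X (leftAdj X)).carrier :=
  coevFormula e (leftAdjBasis e) (fun p => if p.1 = p.2 then 1 else 0) B.n γ

/-- `ev_X : ^†X ⊗_S X → Δ_W` on `ν ⊗ η`, for `Λ = μ_1 ⋯ μ_m` with null-homotopies `μ_j` for the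
action of `∂V/∂z_j` on `X`, with `⟨e_i^* ⊗ e_j⟩ = δ_{ij}` and the sign `(-1)^m`. -/
def evLeft (Λ : Module.End (B.ring ⊗[k] A.ring) X.carrier)
    (ν : X.carrier →ₗ[B.ring ⊗[k] A.ring] B.ring ⊗[k] A.ring) (η : X.carrier) :
    (delta A).carrier :=
  ((-1 : ℤ) ^ B.n • evFormula (Y := dualFact X) (Z := X) (dualFactBasis e) e
    (fun _ => 1) (toDual (ν ∘ₗ Λ)) η : Finset (Fin A.n) → A.ring ⊗[k] A.ring)

end Adjunctions

section FiniteRank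

variable {k : Type u} [CommRing k] {h : LGWellDefined k}

/-- A factorisation with a finite homogeneous basis, as a 1-morphism. -/
def LG.mor {A B : LG h} {X : Fact A.obj B.obj} {I : Type u} [Finite I] (e : X.HomBasis I) : A ⟶ B :=
  LinFact.IsFiniteRank.oneMor (X := X) ⟨I, inferInstance, ⟨e⟩⟩

/-- `X^†` as a 1-morphism. -/
def LG.right {A B : LG h} {X : Fact A.obj B.obj} {I : Type u} [Finite I] (e : X.HomBasis I) :
    B ⟶ A := LG.mor (rightAdjBasis e)

/-- `^†X` as a 1-morphism. -/
def LG.left {A B : LG h} {X : Fact A.obj B.obj} {I : Type u} [Finite I] (e : X.HomBasis I) :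
    B ⟶ A := LG.mor (leftAdjBasis e)

end FiniteRank

end LGModels

end

noncomputable section

namespace LGModels

open AddMonoid.End (mulLeft mulRight)
open AddMonoidHom (mk'_apply finsetSum_apply)
open AlgHom (toLinearMap_apply)
open Algebra.TensorProduct (tmul_mul_tmul includeRight includeLeft lmul'_apply_tmul tmul_pow)
open Equiv (symm_symm ulift_apply)
open Fin (cons_succ)
open Finset (sum_congr univ mem_univ sum_add_distrib smul_sum sum_eq_zero sum_eq_single sum_comm
  mul_sum mem_filter sum_mul sum_const_zero sum_smul mem_range card_empty card_insert_of_notMem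
  sum_empty card_univ sum_insert card_erase_add_one sum_range_succ insert_erase)
open Finsupp (single_apply mapRange_apply mapRange_single)
open Fintype (card_fin)
open Function (update_self update_of_ne iterate_succ_apply')
open Int (units_mul_self)
open LinearEquiv (apply_symm_apply)
open LinearMap (toMatrixAlgEquiv mem_ker rTensor_tmul lsmul_apply mulLeft_apply
  toMatrixAlgEquiv_apply)
open List (prod_nil prod_cons ofFn_succ getElem_ofFn drop_of_length_le drop_zero)
open Matrix (mulVec_mulVec transpose_mul map_apply one_apply_ne smul_mulVec one_apply_eq
  diagonal_apply of_apply mulVec_smul diagonal_transpose transpose_one)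
open Module.Basis (constr_basis reindex_apply repr_self)
open MvPolynomial (smul_eq_C_mul algHom_ext ringHom_ext monomial_add_induction_on)
open Nat (cast_add)
open Polynomial (aeval_algHom_apply modByMonic_add_div monic_X_sub_C degree_eq_natDegree)
open Submodule (smul_mem_smul)
open Units (smul_def)
open ZMod (val_one)
open Finset (range)
open MvPolynomial (pderiv)
open LinearMap (ker)
open CategoryTheory.Category (assoc id_comp)
open Module (Basis)
open Module.End renaming mul_apply → emul_apply
open LinearMap renaming comp_apply → lcomp_apply, add_apply → ladd_apply, sub_apply → lsub_apply,
  sum_apply → lsum_apply, zero_apply → lzero_apply, id_apply → lid_apply, congr_fun → lcongr_fun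
open Algebra.TensorProduct renaming one_def → tone_def, comm_tmul → tcomm_tmul
open TensorProduct renaming induction_on → tmul_induction
open Matrix renaming mul_apply → mmul_apply, smul_apply → msmul_apply
open Polynomial renaming aeval → paeval
open Module renaming End → LEnd
open TensorAlgebra renaming ι → tι, lift → tlift, lift_ι_apply → tlift_ι
open Finsupp renaming smul_apply → fsmul_apply, add_apply → fadd_apply
open Units renaming neg_smul → uneg_smul

local notation:100 B:100 " ⊠[" k "] " A:101 => Obj.ring (k := k) B ⊗[k] Obj.ring (k := k) A
local notation "Pol(" m ", " k ")" => MvPolynomial (Fin m) k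
local notation "swap(" k ", " B ", " A ")" => Algebra.TensorProduct.comm k (Obj.ring B) (Obj.ring A)

namespace LinFact

variable {A : Type u} [CommRing A] {w : A}

section Homotopies

variable {X Y : LinFact A w}

/-- A homotopy need not be odd: its odd part is again a homotopy. -/
lemma Hom.homotopic_of_linear {f g : Hom X Y} (h : X.carrier →ₗ[A] Y.carrier)
    (H : ∀ x, g.map x = f.map x + (Y.d (h x) + h (X.d x))) : f.Homotopic g := by
  refine ⟨Y.even ∘ₗ h ∘ₗ (LinearMap.id - X.even) + (LinearMap.id - Y.even) ∘ₗ h ∘ₗ X.even, fun x => ?_, fun x => ?_⟩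
  · simp only [ladd_apply, lcomp_apply, lsub_apply, lid_apply, map_add, map_sub, X.even_even, Y.even_even]
    abel
  · have h1 := congrArg Y.even (H (X.even x))
    have h2 := H (x - X.even x)
    have h3 := congrArg Y.even h2
    have h4 := H x
    simp only [map_add, map_sub, f.map_even, g.map_even, Y.even_even, Y.even_d] at h1 h2 h3 h4
    simp only [ladd_apply, lcomp_apply, lsub_apply, lid_apply, map_add, map_sub, X.even_d]
    linear_combination (norm := abel) h4 - h3 - (h4 - h2) + h1

lemma cls_eq_of_linear {f g : Hom X Y} (h : X.carrier →ₗ[A] Y.carrier)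
    (H : ∀ x, g.map x = f.map x + (Y.d (h x) + h (X.d x))) : cls f = cls g :=
  cls_eq (Hom.homotopic_of_linear h H)

lemma homotopic_of_cls_eq {f g : Hom X Y} (H : cls f = cls g) : f.Homotopic g :=
  Quotient.exact H

/-- The endomorphism `1 - (d h + h d)`. -/
def perturb (h : X.carrier →ₗ[A] X.carrier) (hodd : ∀ x, X.even (h x) + h (X.even x) = h x) : Hom X X where
  map := LinearMap.id - (X.d ∘ₗ h + h ∘ₗ X.d)
  map_even x := by
    have e : ∀ x, h (X.even x) = h x - X.even (h x) := fun x => eq_sub_of_add_eq' (hodd x)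
    simp only [lsub_apply, ladd_apply, lcomp_apply, lid_apply, map_sub, map_add, X.even_d, e]
    have := e (X.d x)
    rw [X.even_d, map_sub] at this
    linear_combination (norm := abel) this
  map_d x := by
    simp only [lsub_apply, ladd_apply, lcomp_apply, lid_apply, map_sub, map_add, X.d_sq, map_smul]
    abel

lemma perturb_apply (h : X.carrier →ₗ[A] X.carrier) (hodd : ∀ x, X.even (h x) + h (X.even x) = h x) (x : X.carrier) :
    (perturb h hodd).map x = x - (X.d (h x) + h (X.d x)) := rfl

lemma cls_perturb (h : X.carrier →ₗ[A] X.carrier)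
    (hodd : ∀ x, X.even (h x) + h (X.even x) = h x) : cls (perturb h hodd) = 𝟙 X :=
  cls_eq_of_linear h fun x => by rw [perturb_apply]; exact (sub_add_cancel x _).symm

/-- Iterates of an endomorphism. -/
def Hom.iter (e : Hom X X) : ℕ → Hom X X
  | 0 => Hom.id X
  | n + 1 => e.comp (Hom.iter e n)

lemma Hom.iter_map (e : Hom X X) (n : ℕ) (x : X.carrier) : (e.iter n).map x = e.map^[n] x := by
  induction n generalizing x with
  | zero => rfl
  | succ n ih => exact ih (e.map x)

lemma cls_iter {e : Hom X X} (he : cls e = 𝟙 X) (n : ℕ) : cls (e.iter n) = 𝟙 X := by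
  induction n with
  | zero => rfl
  | succ n ih => change cls e ≫ cls (e.iter n) = _; rw [he, ih, id_comp]

/-- A perturbation lemma: a surjection `π` is a homotopy equivalence if `1 - (d h + h d)` is
nilpotent on its kernel, for some odd `h` with `π h = 0`. -/
lemma isIso_cls_of_contraction (π : Hom X Y) (ι : Y.carrier →ₗ[A] X.carrier)
    (hι : ∀ y, π.map (ι y) = y) (h : X.carrier →ₗ[A] X.carrier)
    (hodd : ∀ x, X.even (h x) + h (X.even x) = h x) (hπ : ∀ x, π.map (h x) = 0) (N : ℕ)
    (hN : ∀ x, π.map x = 0 → (perturb h hodd).map^[N] x = 0) : IsIso (cls π) := by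
  set e := perturb h hodd with he
  have key : ∀ x, (e.iter N).map (ι (π.map x)) = (e.iter N).map x := fun x => by
    have := hN (ι (π.map x) - x) (by rw [map_sub, hι, sub_self])
    rwa [← Hom.iter_map, map_sub, sub_eq_zero] at this
  have hπe : ∀ n x, π.map ((e.iter n).map x) = π.map x := fun n => by
    induction n with
    | zero => exact fun x => rfl
    | succ n ih =>
      intro x
      change π.map ((e.iter n).map (e.map x)) = _
      rw [ih, he, perturb_apply, map_sub, map_add, hπ, π.map_d, hπ, map_zero, add_zero, sub_zero]
  let τ : Hom Y X :=
    { map := (e.iter N).map ∘ₗ ι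
      map_even := fun y => by
        rw [lcomp_apply, lcomp_apply, ← Hom.map_even, ← key, ← key (X.even _), hι, π.map_even, hι]
      map_d := fun y => by
        rw [lcomp_apply, lcomp_apply, ← Hom.map_d, ← key, ← key (X.d _), hι, π.map_d, hι] }
  refine ⟨cls τ, ?_, ?_⟩
  · rw [← cls_iter (cls_perturb h hodd) N, cls_comp]
    exact congrArg cls (Hom.ext' fun x => key x)
  · rw [cls_comp, cls_id]
    refine congrArg cls (Hom.ext' fun y => ?_)
    rw [Hom.comp_map, Hom.id_map]
    change π.map ((e.iter N).map (ι y)) = y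
    rw [hπe, hι]

end Homotopies

section Retracts

/-- `X` is a direct summand of `Y` in the homotopy category. -/
def IsRetract (X Y : LinFact A w) : Prop := ∃ (s : X ⟶ Y) (r : Y ⟶ X), s ≫ r = 𝟙 X

lemma IsRetract.refl (X : LinFact A w) : IsRetract X X := ⟨𝟙 X, 𝟙 X, id_comp _⟩

lemma IsRetract.trans {X Y Z : LinFact A w} (h : IsRetract X Y) (h' : IsRetract Y Z) : IsRetract X Z := by
  obtain ⟨s, r, e⟩ := h
  obtain ⟨s', r', e'⟩ := h'
  exact ⟨s ≫ s', r' ≫ r, by rw [assoc, ← assoc s', e', id_comp, e]⟩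

/-- Commuting injective endomorphisms `P i` of a linear factorisation with linear left inverses
`h i` and null-homotopies `l i`. -/
structure Division (X : LinFact A w) {m : ℕ} (P h l : Fin m → LEnd A X.carrier) : Prop where
  P_even : ∀ i x, P i (X.even x) = X.even (P i x)
  h_even : ∀ i x, h i (X.even x) = X.even (h i x)
  l_odd : ∀ i x, X.even (l i x) + l i (X.even x) = l i x
  hP : ∀ i x, h i (P i x) = x
  h_P : ∀ i j x, i ≠ j → h i (P j x) = P j (h i x)
  h_h : ∀ i j x, h i (h j x) = h j (h i x)
  l_P : ∀ i j x, l i (P j x) = P j (l i x)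
  l_d : ∀ i x, X.d (l i x) + l i (X.d x) = P i x

namespace Division

variable {X : LinFact A w} {m : ℕ} {P h l : Fin (m + 1) → LEnd A X.carrier}
  (H : Division X P h l)
include H

lemma P_d (i : Fin (m + 1)) (x : X.carrier) : P i (X.d x) = X.d (P i x) := by
  rw [← H.l_d, ← H.l_d, map_add, X.d_sq, X.d_sq, map_smul, add_comm]

lemma P_P (i j : Fin (m + 1)) (x : X.carrier) : P i (P j x) = P j (P i x) := by
  rw [← H.l_d i, ← H.P_d, H.l_P, H.l_P, ← H.P_d, ← map_add, H.l_d]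

/-- The remainder of the division by `P 0`. -/
def rem : X.carrier →ₗ[A] ker (h 0) :=
  LinearMap.codRestrict _ (LinearMap.id - P 0 ∘ₗ h 0) fun x => by
    rw [mem_ker, lsub_apply, map_sub, lcomp_apply, H.hP, lid_apply, sub_self]

lemma rem_coe (x : X.carrier) : (H.rem x : X.carrier) = x - P 0 (h 0 x) := rfl

lemma rem_of_mem (x : ker (h 0)) : H.rem x = x := by
  ext; rw [H.rem_coe, mem_ker.1 x.2, map_zero, sub_zero]

lemma rem_P (x : X.carrier) : H.rem (P 0 x) = 0 := by
  ext; rw [H.rem_coe, H.hP, sub_self]; rfl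

lemma rem_rem (f : LEnd A X.carrier) (hf : ∀ x, f (P 0 x) = P 0 (f x)) (x : X.carrier) :
    H.rem (f (H.rem x)) = H.rem (f x) := by
  rw [H.rem_coe, map_sub, hf, map_sub, H.rem_P, sub_zero]

/-- The quotient by `P 0`, realised on the kernel of `h 0`. -/
def quot : LinFact A w where
  carrier := ker (h 0)
  even := X.even.restrict fun x hx => by
    rw [mem_ker] at hx ⊢; rw [H.h_even, hx, map_zero]
  even_even x := Subtype.ext (X.even_even _)
  d := H.rem ∘ₗ X.d ∘ₗ (ker (h 0)).subtype
  d_odd x := Subtype.ext <| by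
    change X.even (X.d x - P 0 (h 0 (X.d x))) + (X.d (X.even x) - P 0 (h 0 (X.d (X.even x)))) =
      X.d x - P 0 (h 0 (X.d x))
    rw [map_sub, ← H.P_even, ← H.h_even, X.even_d, map_sub, map_sub]; abel
  d_sq x := by
    change H.rem (X.d (H.rem (X.d x))) = w • x
    rw [H.rem_rem X.d (fun x => (H.P_d 0 x).symm), X.d_sq, map_smul, H.rem_of_mem]

/-- The inclusion of the kernel of `h 0`. -/
def incl : H.quot.carrier →ₗ[A] X.carrier := (ker (h 0)).subtype

lemma isRetract_quot : IsRetract X H.quot := by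
  let s : Hom X H.quot :=
    { map := H.rem
      map_even := fun x => Subtype.ext <| by
        change X.even x - P 0 (h 0 (X.even x)) = X.even (x - P 0 (h 0 x))
        rw [map_sub, H.h_even, H.P_even]
      map_d := fun x => (H.rem_rem X.d (fun x => (H.P_d 0 x).symm) x).symm }
  have l_h : ∀ x, l 0 (h 0 (X.d (H.rem x))) = l 0 (h 0 (X.d x)) - l 0 (X.d (h 0 x)) := fun x => by
    rw [H.rem_coe, map_sub, ← H.P_d, map_sub, H.hP, map_sub]
  have ld : ∀ x, l 0 (X.d x) = P 0 x - X.d (l 0 x) := fun x => eq_sub_of_add_eq' (H.l_d 0 x)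
  have le : ∀ x, l 0 (X.even x) = l 0 x - X.even (l 0 x) :=
    fun x => eq_sub_of_add_eq' (H.l_odd 0 x)
  let r : Hom H.quot X :=
    { map := (LinearMap.id - l 0 ∘ₗ h 0 ∘ₗ X.d) ∘ₗ (ker (h 0)).subtype
      map_even := fun (x : ker (h 0)) => by
        change X.even x - l 0 (h 0 (X.d (X.even x))) = X.even (x - l 0 (h 0 (X.d x)))
        have : X.d (X.even x) = X.d x - X.even (X.d x) := by rw [X.even_d]; abel
        rw [this, map_sub, map_sub, map_sub, H.h_even, le]; abel
      map_d := fun (x : ker (h 0)) => by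
        change (H.rem (X.d x) : X.carrier) - l 0 (h 0 (X.d (H.rem (X.d x)))) =
          X.d (x - l 0 (h 0 (X.d x)))
        rw [l_h, X.d_sq, map_smul, mem_ker.1 x.2, smul_zero, map_zero, H.rem_coe, ld, map_sub]
        abel }
  refine ⟨cls s, cls r, ?_⟩
  rw [cls_comp, cls_id]
  refine cls_eq_of_linear (l 0 ∘ₗ h 0) fun x => ?_
  change x = ((H.rem x : X.carrier) - l 0 (h 0 (X.d (H.rem x)))) +
    (X.d (l 0 (h 0 x)) + l 0 (h 0 (X.d x)))
  rw [l_h, H.rem_coe, ld]; abel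

/-- The remaining endomorphisms act on the quotient. -/
lemma division_quot : ∃ P' h' l' : Fin m → LEnd A H.quot.carrier, Division H.quot P' h' l' ∧
      ∀ i x, H.incl (h' i x) = h i.succ (H.incl x) := by
  have ne : ∀ i : Fin m, (0 : Fin (m + 1)) ≠ i.succ := fun i => (Fin.succ_ne_zero i).symm
  let P' : Fin m → LEnd A (ker (h 0)) := fun i =>
    (P i.succ).restrict fun x hx => by
      rw [mem_ker] at hx ⊢; rw [H.h_P _ _ _ (ne i), hx, map_zero]
  let h' : Fin m → LEnd A (ker (h 0)) := fun i =>
    (h i.succ).restrict fun x hx => by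
      rw [mem_ker] at hx ⊢; rw [H.h_h, hx, map_zero]
  have remP : ∀ i x, H.rem (P i.succ x) = P' i (H.rem x) := fun i x => Subtype.ext <| by
    change P i.succ x - P 0 (h 0 (P i.succ x)) = P i.succ (x - P 0 (h 0 x))
    rw [H.h_P _ _ _ (ne i), map_sub, H.P_P]
  let l' : Fin m → LEnd A (ker (h 0)) := fun i =>
    H.rem ∘ₗ l i.succ ∘ₗ (ker (h 0)).subtype
  refine ⟨P', h', l', ⟨?_, ?_, ?_, ?_, ?_, ?_, ?_, ?_⟩, fun i x => rfl⟩
  · exact fun i x => Subtype.ext (H.P_even _ _)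
  · exact fun i x => Subtype.ext (H.h_even _ _)
  · intro i (x : ker (h 0))
    refine Subtype.ext ?_
    have := H.l_odd i.succ x
    change X.even (l i.succ x.1 - P 0 (h 0 (l i.succ x.1))) +
      (l i.succ (X.even x.1) - P 0 (h 0 (l i.succ (X.even x.1)))) =
      l i.succ x.1 - P 0 (h 0 (l i.succ x.1))
    rw [← eq_sub_iff_add_eq'] at this
    rw [this, map_sub, map_sub, map_sub, H.h_even, H.P_even]; abel
  · exact fun i x => Subtype.ext (H.hP _ _)
  · exact fun i j x hij => Subtype.ext (H.h_P _ _ _ fun e => hij (Fin.succ_injective _ e))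
  · exact fun i j x => Subtype.ext (H.h_h _ _ _)
  · intro i j (x : ker (h 0))
    change H.rem (l i.succ (P j.succ x.1)) = P' j (H.rem (l i.succ x.1))
    rw [H.l_P, remP]
  · intro i (x : ker (h 0))
    change H.rem (X.d (H.rem (l i.succ x.1))) + H.rem (l i.succ (H.rem (X.d x.1))) = P' i x
    rw [H.rem_rem X.d (fun x => (H.P_d 0 x).symm), H.rem_rem (l i.succ) (fun x => H.l_P _ _ _),
      ← map_add, H.l_d, remP, H.rem_of_mem]

end Division

lemma Division.exists_retract {m : ℕ} : ∀ {X : LinFact A w} {P h l : Fin m → LEnd A X.carrier},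
    Division X P h l → ∃ (Y : LinFact A w) (j : Y.carrier →ₗ[A] X.carrier),
      Function.Injective j ∧ (∀ x, (∃ y, j y = x) ↔ ∀ i, h i x = 0) ∧
      (∀ y, j (Y.even y) = X.even (j y)) ∧ IsRetract X Y := by
  induction m with
  | zero =>
    intro X P h l _
    exact ⟨X, LinearMap.id, fun _ _ h => h, fun x => ⟨fun _ i => i.elim0, fun _ => ⟨x, rfl⟩⟩,
      fun _ => rfl, IsRetract.refl X⟩
  | succ m ih =>
    intro X P h l H
    obtain ⟨P', h', l', H', hh⟩ := H.division_quot
    obtain ⟨Y, j, h1, h2, h3, h4⟩ := ih H'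
    refine ⟨Y, H.incl ∘ₗ j, ?_, fun x => ?_, fun y => ?_, H.isRetract_quot.trans h4⟩
    · exact (Submodule.injective_subtype _).comp h1
    · constructor
      · rintro ⟨y, rfl⟩ i
        refine Fin.cases ?_ (fun i => ?_) i
        · exact mem_ker.1 (Subtype.property (p := (· ∈ ker (h 0))) (j y))
        · rw [lcomp_apply, ← hh, (h2 (j y)).1 ⟨y, rfl⟩ i, map_zero]
      · intro hx
        obtain ⟨y, hy⟩ := (h2 ⟨x, hx 0⟩).2 fun i =>
          Subtype.ext ((hh i (⟨x, hx 0⟩ : ker (h 0))).trans (hx i.succ))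
        exact ⟨y, by rw [lcomp_apply, hy]; rfl⟩
    · exact congrArg H.incl (h3 y)

end Retracts

end LinFact

namespace LinFact

variable {A : Type u} [CommRing A] {w : A}

section Telescope

/-- The mapping cone of a morphism. -/
def cone {P Q : LinFact A w} (f : Hom P Q) : LinFact A w where
  carrier := Q.carrier × P.carrier
  even := Q.even.prodMap (LinearMap.id - P.even)
  even_even x := Prod.ext (Q.even_even _) <| by
    simp [P.even_even]
  d := LinearMap.prod (Q.d ∘ₗ LinearMap.fst A _ _ + f.map ∘ₗ LinearMap.snd A _ _)
    (-(P.d ∘ₗ LinearMap.snd A _ _))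
  d_odd x := Prod.ext
    (by
      change Q.even (Q.d x.1 + f.map x.2) + (Q.d (Q.even x.1) + f.map (x.2 - P.even x.2)) =
        Q.d x.1 + f.map x.2
      simp only [map_add, map_sub, Q.even_d, f.map_even]
      abel)
    (by
      change (- P.d x.2 - P.even (- P.d x.2)) + - P.d (x.2 - P.even x.2) = - P.d x.2
      simp only [map_sub, map_neg, P.even_d]
      abel)
  d_sq x := Prod.ext
    (by
      change Q.d (Q.d x.1 + f.map x.2) + f.map (- P.d x.2) = w • x.1
      simp only [map_add, map_neg, f.map_d, Q.d_sq]
      abel)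
    (by
      change - P.d (- P.d x.2) = w • x.2
      rw [map_neg, neg_neg, P.d_sq])

/-- A homogeneous basis of the cone. -/
def HomBasis.cone {P Q : LinFact A w} {I J : Type u} (e : P.HomBasis I) (e' : Q.HomBasis J)
    (f : Hom P Q) : (cone f).HomBasis (J ⊕ I) where
  basis := e'.basis.prod e.basis
  par := Sum.elim e'.par fun i => e.par i + 1
  even_basis i := by
    have hp : ∀ p : ZMod 2, (p + 1 = 0) = ¬ (p = 0) := by decide
    rcases i with j | i
    · refine Prod.ext ?_ ?_
      · change Q.even ((e'.basis.prod e.basis (Sum.inl j)).1) =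
          (if e'.par j = 0 then e'.basis.prod e.basis (Sum.inl j) else 0).1
        rw [apply_ite Prod.fst, Basis.prod_apply_inl_fst, e'.even_basis]; rfl
      · change (e'.basis.prod e.basis (Sum.inl j)).2 - P.even (e'.basis.prod e.basis (Sum.inl j)).2 =
          (if e'.par j = 0 then e'.basis.prod e.basis (Sum.inl j) else 0).2
        rw [apply_ite Prod.snd, Basis.prod_apply_inl_snd, map_zero, sub_zero]
        split_ifs <;> rfl
    · refine Prod.ext ?_ ?_
      · change Q.even ((e'.basis.prod e.basis (Sum.inr i)).1) =
          (if e.par i + 1 = 0 then e'.basis.prod e.basis (Sum.inr i) else 0).1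
        rw [apply_ite Prod.fst, Basis.prod_apply_inr_fst, map_zero]
        split_ifs <;> rfl
      · change (e'.basis.prod e.basis (Sum.inr i)).2 - P.even (e'.basis.prod e.basis (Sum.inr i)).2 =
          (if e.par i + 1 = 0 then e'.basis.prod e.basis (Sum.inr i) else 0).2
        rw [apply_ite Prod.snd, Basis.prod_apply_inr_snd, e.even_basis]
        simp only [hp]
        by_cases h : e.par i = 0
        · rw [if_pos h, if_neg (not_not.2 h), sub_self]; rfl
        · rw [if_neg h, if_pos h, sub_zero]

/-- The direct sum of countably many copies of `F`. -/
def copies (F : LinFact A w) : LinFact A w where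
  carrier := ℕ →₀ F.carrier
  even := Finsupp.mapRange.linearMap F.even
  even_even x := Finsupp.ext fun _ => F.even_even _
  d := Finsupp.mapRange.linearMap F.d
  d_odd x := Finsupp.ext fun _ => F.d_odd _
  d_sq x := Finsupp.ext fun _ => F.d_sq _

/-- A homogeneous basis of the direct sum of copies. -/
def HomBasis.copies {F : LinFact A w} {I : Type u} (e : F.HomBasis I) : (copies F).HomBasis (Σ _ : ℕ, I) where
  basis := Finsupp.basis fun _ => e.basis
  par i := e.par i.2
  even_basis i := by
    have h : (Finsupp.basis fun _ : ℕ => e.basis) i = Finsupp.single i.1 (e.basis i.2) := by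
      rw [Finsupp.coe_basis]
    change Finsupp.mapRange.linearMap F.even ((Finsupp.basis fun _ : ℕ => e.basis) i) =
      if e.par i.2 = 0 then (Finsupp.basis fun _ : ℕ => e.basis) i else 0
    rw [h, Finsupp.mapRange.linearMap_apply, mapRange_single, e.even_basis]
    split_ifs
    · rfl
    · exact Finsupp.single_zero _

variable {F Y : LinFact A w}

/-- The `n`-th summand. -/
def copiesInc (F : LinFact A w) (n : ℕ) : Hom F (copies F) where
  map := Finsupp.lsingle n
  map_even x := (mapRange_single (hf := map_zero F.even)).symm
  map_d x := (mapRange_single (hf := map_zero F.d)).symm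

lemma copies_even (n : ℕ) (x : F.carrier) : (copies F).even ((copiesInc F n).map x) = (copiesInc F n).map (F.even x) :=
  ((copiesInc F n).map_even x).symm

lemma copies_d (n : ℕ) (x : F.carrier) : (copies F).d ((copiesInc F n).map x) = (copiesInc F n).map (F.d x) :=
  ((copiesInc F n).map_d x).symm

lemma copies_ext {M : Type u} [AddCommGroup M] [Module A M] {f g : (copies F).carrier →ₗ[A] M}
    (h : ∀ n x, f ((copiesInc F n).map x) = g ((copiesInc F n).map x)) : f = g :=
  Finsupp.lhom_ext' fun n => LinearMap.ext fun x => h n x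

/-- Linear maps out of a direct sum of copies. -/
def copiesLin {M : Type u} [AddCommGroup M] [Module A M] (a : ℕ → F.carrier →ₗ[A] M) :
    (copies F).carrier →ₗ[A] M := Finsupp.lsum A a

lemma copiesLin_inc {M : Type u} [AddCommGroup M] [Module A M] (a : ℕ → F.carrier →ₗ[A] M) (n : ℕ)
    (x : F.carrier) : copiesLin a ((copiesInc F n).map x) = a n x :=
  Finsupp.sum_single_index (map_zero _)

/-- Morphisms out of a direct sum of copies. -/
def copiesHom (a : ℕ → F.carrier →ₗ[A] Y.carrier) (he : ∀ n x, a n (F.even x) = Y.even (a n x))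
    (hd : ∀ n x, a n (F.d x) = Y.d (a n x)) : Hom (copies F) Y where
  map := copiesLin a
  map_even := lcongr_fun (f := copiesLin a ∘ₗ (copies F).even) (g := Y.even ∘ₗ copiesLin a)
    (copies_ext fun n x => by
      rw [lcomp_apply, lcomp_apply, copies_even, copiesLin_inc, copiesLin_inc, he])
  map_d := lcongr_fun (f := copiesLin a ∘ₗ (copies F).d) (g := Y.d ∘ₗ copiesLin a)
    (copies_ext fun n x => by
      rw [lcomp_apply, lcomp_apply, copies_d, copiesLin_inc, copiesLin_inc, hd])

lemma copiesHom_inc (a : ℕ → F.carrier →ₗ[A] Y.carrier)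
    (he : ∀ n x, a n (F.even x) = Y.even (a n x)) (hd : ∀ n x, a n (F.d x) = Y.d (a n x)) (n : ℕ)
    (x : F.carrier) : (copiesHom a he hd).map ((copiesInc F n).map x) = a n x :=
  copiesLin_inc a n x

/-- The complement of a split monomorphism is split by the cone. -/
lemma cone_splitting {P Q : LinFact A w} (f : Hom P Q) (g : Hom Q P)
    (h : P.carrier →ₗ[A] P.carrier) (hodd : ∀ x, P.even (h x) + h (P.even x) = h x)
    (hh : ∀ x, x = g.map (f.map x) + (P.d (h x) + h (P.d x))) :
    ∃ (b : Hom Q (cone f)) (s : Hom (cone f) Q), cls s ≫ cls b = 𝟙 _ ∧ ∀ q, s.map (b.map q) = q - f.map (g.map q) := by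
  have ho : ∀ x, h (P.even x) = h x - P.even (h x) := fun x => eq_sub_of_add_eq' (hodd x)
  have hd : ∀ x, h (P.d x) = x - g.map (f.map x) - P.d (h x) := fun x =>
    eq_sub_of_add_eq' (eq_sub_of_add_eq' (hh x).symm)
  let b : Hom Q (cone f) :=
    { map := LinearMap.inl A Q.carrier P.carrier
      map_even := fun q => by
        change (Q.even q, (0 : P.carrier)) = (Q.even q, 0 - P.even 0)
        rw [map_zero, sub_zero]
      map_d := fun q => by
        change (Q.d q, (0 : P.carrier)) = (Q.d q + f.map 0, - P.d 0)
        rw [map_zero, map_zero, add_zero, neg_zero] }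
  let s : Hom (cone f) Q :=
    { map := (LinearMap.id - f.map ∘ₗ g.map) ∘ₗ LinearMap.fst A _ _ +
        f.map ∘ₗ h ∘ₗ LinearMap.snd A _ _
      map_even := fun x => by
        change (Q.even x.1 - f.map (g.map (Q.even x.1))) + f.map (h (x.2 - P.even x.2)) =
          Q.even ((x.1 - f.map (g.map x.1)) + f.map (h x.2))
        rw [map_sub h, ho, map_sub, map_sub, map_add, map_sub, ← f.map_even, ← f.map_even, g.map_even]
        abel
      map_d := fun x => by
        change ((Q.d x.1 + f.map x.2) - f.map (g.map (Q.d x.1 + f.map x.2))) +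
          f.map (h (- P.d x.2)) = Q.d ((x.1 - f.map (g.map x.1)) + f.map (h x.2))
        simp only [map_neg, hd, map_sub, map_add, ← f.map_d, g.map_d]
        abel }
  refine ⟨b, s, ?_, fun q => ?_⟩
  · rw [cls_comp, cls_id]
    refine cls_eq_of_linear (LinearMap.inr A Q.carrier P.carrier ∘ₗ
      (g.map ∘ₗ LinearMap.fst A _ _ - h ∘ₗ LinearMap.snd A _ _)) fun x => ?_
    refine Prod.ext ?_ ?_
    · change x.1 = (x.1 - f.map (g.map x.1) + f.map (h x.2)) +
        ((Q.d 0 + f.map (g.map x.1 - h x.2)) + 0)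
      rw [map_zero, map_sub]; abel
    · change x.2 = 0 + (- P.d (g.map x.1 - h x.2) + (g.map (Q.d x.1 + f.map x.2) - h (- P.d x.2)))
      simp only [map_add, map_neg, map_sub, hd, g.map_d]; abel
  · change (q - f.map (g.map q)) + f.map (h 0) = _
    rw [map_zero, map_zero, add_zero]

/-- Idempotents of matrix factorisations split in the homotopy category. -/
theorem exists_splitting (hF : F.IsMF) (ε : F ⟶ F) (hε : ε ≫ ε = ε) :
    ∃ Y : LinFact A w, Y.IsMF ∧ ∃ (r : F ⟶ Y) (s : Y ⟶ F), s ≫ r = 𝟙 Y ∧ r ≫ s = ε := by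
  obtain ⟨e, rfl⟩ := cls_surj ε
  obtain ⟨k, k1, k2⟩ := homotopic_of_cls_eq ((cls_comp e e).symm.trans hε)
  have kd : ∀ x, k (F.d x) = e.map x - e.map (e.map x) - F.d (k x) := fun x =>
    eq_sub_of_add_eq' (eq_sub_of_add_eq' (k2 x).symm)
  have ke : ∀ x, k (F.even x) = k x - F.even (k x) := fun x => eq_sub_of_add_eq' (k1 x)
  let f : Hom (copies F) (copies F) := copiesHom (fun n => (copiesInc F n).map - (copiesInc F (n + 1)).map ∘ₗ e.map)
    (fun n x => by
      simp only [lsub_apply, lcomp_apply, map_sub, Hom.map_even])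
    (fun n x => by
      simp only [lsub_apply, lcomp_apply, map_sub, Hom.map_d])
  have hf : ∀ n x, f.map ((copiesInc F n).map x) = (copiesInc F n).map x - (copiesInc F (n + 1)).map (e.map x) :=
    fun n x => copiesHom_inc _ _ _ n x
  let g : Hom (copies F) (copies F) := copiesHom
    (fun n => (copiesInc F n).map ∘ₗ (LinearMap.id - e.map) - ∑ j ∈ range n, (copiesInc F j).map ∘ₗ e.map)
    (fun n x => by
      simp only [lsub_apply, lcomp_apply, map_sub, Hom.map_even, lid_apply, lsum_apply, map_sum])
    (fun n x => by
      simp only [lsub_apply, lcomp_apply, map_sub, Hom.map_d, lid_apply, lsum_apply, map_sum])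
  have hg : ∀ n x, g.map ((copiesInc F n).map x) =
      (copiesInc F n).map x - (copiesInc F n).map (e.map x) - ∑ j ∈ range n, (copiesInc F j).map (e.map x) := fun n x => by
    refine (copiesHom_inc _ _ _ n x).trans ?_
    simp only [lsub_apply, lcomp_apply, map_sub, lid_apply, lsum_apply]
  let K : (ℕ → ℕ) → ℕ → F.carrier →ₗ[A] (copies F).carrier :=
    fun a n => ∑ j ∈ range n, (copiesInc F (a j)).map ∘ₗ k
  have hK : ∀ a n x, K a n x = ∑ j ∈ range n, (copiesInc F (a j)).map (k x) := fun a n x => by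
    simp only [K, lsum_apply, lcomp_apply]
  have hodd : ∀ x, (copies F).even (copiesLin (fun n => K id (n + 2)) x) +
      copiesLin (fun n => K id (n + 2)) ((copies F).even x) =
      copiesLin (fun n => K id (n + 2)) x := fun x => by
    have := copies_ext (f := (copies F).even ∘ₗ copiesLin (fun n => K id (n + 2)) +
      copiesLin (fun n => K id (n + 2)) ∘ₗ (copies F).even)
      (g := copiesLin (fun n => K id (n + 2))) fun n x => by
        rw [ladd_apply, lcomp_apply, lcomp_apply, copies_even,
          copiesLin_inc, copiesLin_inc, hK, hK, map_sum, ← sum_add_distrib]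
        refine sum_congr rfl fun j _ => ?_
        rw [← Hom.map_even, ke, map_sub, add_sub_cancel]
    exact lcongr_fun this x
  obtain ⟨b, s, hsb, hbs⟩ := cone_splitting f g (copiesLin fun n => K id (n + 2)) hodd fun x => by
    have := copies_ext (f := LinearMap.id) (g := g.map ∘ₗ f.map + ((copies F).d ∘ₗ copiesLin (fun n => K id (n + 2)) +
        copiesLin (fun n => K id (n + 2)) ∘ₗ (copies F).d)) fun n x => by
        simp only [ladd_apply, lcomp_apply, lid_apply, copies_d,
          copiesLin_inc, hK, map_sum, hf, map_sub, hg, ← Hom.map_d, kd]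
        simp only [sum_range_succ, Finset.sum_sub_distrib, id]
        abel
    exact lcongr_fun this x
  let t : Hom (copies F) F := copiesHom (fun _ => e.map) (fun _ => e.map_even) (fun _ => e.map_d)
  have ht : ∀ n x, t.map ((copiesInc F n).map x) = e.map x := fun n x => copiesHom_inc _ _ _ n x
  have hit : cls (copiesInc F 0) ≫ cls t = cls e := congrArg cls (Hom.ext' fun x => ht 0 x)
  have hp : cls b ≫ cls s = cls t ≫ cls (copiesInc F 0) := by
    rw [cls_comp, cls_comp]
    refine (cls_eq_of_linear (copiesLin fun n => K Nat.succ (n + 1)) fun x => ?_).symm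
    have := copies_ext (f := s.map ∘ₗ b.map) (g := (copiesInc F 0).map ∘ₗ t.map +
      ((copies F).d ∘ₗ copiesLin (fun n => K Nat.succ (n + 1)) +
        copiesLin (fun n => K Nat.succ (n + 1)) ∘ₗ (copies F).d)) fun n x => by
        simp only [ladd_apply, lcomp_apply, copies_d, copiesLin_inc, hK, ht, hbs,
          hg, map_sub, map_sum, hf, ← Hom.map_d, kd]
        have h1 := Finset.sum_range_succ' (fun j => (copiesInc F j).map (e.map x)) n
        rw [sum_range_succ] at h1
        simp only [Finset.sum_sub_distrib, sum_range_succ, Nat.succ_eq_add_one]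
        linear_combination (norm := abel) h1
    exact lcongr_fun this x
  obtain ⟨I, ⟨B⟩⟩ := hF
  refine ⟨cone f, ⟨_, ⟨B.copies.cone B.copies f⟩⟩, cls (copiesInc F 0) ≫ cls b, cls s ≫ cls t, ?_, ?_⟩
  · rw [assoc, ← assoc (cls t), ← hp, assoc, hsb, Category.comp_id, hsb]
  · rw [assoc, ← assoc (cls b), hp, assoc, ← assoc, hit, hε]

end Telescope

end LinFact


section RetractAdjunction

open Bicategory

variable {C : Type*} [Bicategory C] {a b : C}

lemma conjugateEquiv_counit {f : a ⟶ b} {g : b ⟶ a} (adj : Bicategory.Adjunction f g) (e : f ⟶ f) :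
    conjugateEquiv adj adj e ▷ f ≫ adj.counit = g ◁ e ≫ adj.counit := by
  rw [conjugateEquiv_apply']
  calc
    _ = 𝟙 _ ⊗≫ g ◁ adj.unit ▷ f ⊗≫ g ◁ e ▷ g ▷ f ⊗≫
          (adj.counit ▷ (g ≫ f) ≫ 𝟙 b ◁ adj.counit) ⊗≫ 𝟙 _ := by bicategory
    _ = 𝟙 _ ⊗≫ g ◁ adj.unit ▷ f ⊗≫ g ◁ (e ▷ (g ≫ f) ≫ f ◁ adj.counit) ⊗≫ adj.counit ⊗≫ 𝟙 _ := by
      rw [← whisker_exchange]; bicategory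
    _ = 𝟙 _ ⊗≫ g ◁ (leftZigzag adj.unit adj.counit) ⊗≫ g ◁ e ⊗≫ adj.counit ⊗≫ 𝟙 _ := by
      rw [← whisker_exchange]; bicategory
    _ = _ := by
      rw [adj.left_triangle]; bicategory

/-- Retracts of adjoint 1-morphisms that correspond to mates of each other are adjoint. -/
def adjunctionOfRetract {f f' : a ⟶ b} {g g' : b ⟶ a} (adj : Bicategory.Adjunction f g)
    (s : f' ⟶ f) (r : f ⟶ f') (hsr : s ≫ r = 𝟙 f') (i : g' ⟶ g) (p : g ⟶ g') (hip : i ≫ p = 𝟙 g')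
    (hpi : p ≫ i = conjugateEquiv adj adj (r ≫ s)) : Bicategory.Adjunction f' g' where
  unit := adj.unit ≫ r ▷ g ≫ f' ◁ p
  counit := g' ◁ s ≫ i ▷ f ≫ adj.counit
  left_triangle := by
    have key : p ▷ f' ≫ g' ◁ s ≫ i ▷ f ≫ adj.counit = g ◁ s ≫ adj.counit := by
      rw [← whisker_exchange_assoc, ← comp_whiskerRight_assoc, hpi, conjugateEquiv_counit,
        ← whiskerLeft_comp_assoc, ← assoc s, hsr, id_comp]
    calc
      _ = adj.unit ▷ f' ⊗≫ r ▷ g ▷ f' ⊗≫ f' ◁ (p ▷ f' ≫ g' ◁ s ≫ i ▷ f ≫ adj.counit) := by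
        dsimp only [leftZigzag]; bicategory
      _ = adj.unit ▷ f' ⊗≫ (r ▷ (g ≫ f') ≫ f' ◁ (g ◁ s)) ⊗≫ f' ◁ adj.counit := by
        rw [key]; bicategory
      _ = 𝟙 _ ⊗≫ (adj.unit ▷ f' ≫ (f ≫ g) ◁ s) ⊗≫ (r ▷ (g ≫ f) ≫ f' ◁ adj.counit) ⊗≫ 𝟙 _ := by
        rw [← whisker_exchange]; bicategory
      _ = 𝟙 _ ⊗≫ 𝟙 a ◁ s ⊗≫ leftZigzag adj.unit adj.counit ⊗≫ r ▷ 𝟙 b ⊗≫ 𝟙 _ := by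
        rw [← whisker_exchange, ← whisker_exchange]; dsimp only [leftZigzag]; bicategory
      _ = (λ_ f').hom ≫ (s ≫ r) ≫ (ρ_ f').inv := by
        rw [adj.left_triangle]; bicategory
      _ = _ := by rw [hsr, id_comp]
  right_triangle := by
    calc
      _ = g' ◁ adj.unit ⊗≫ g' ◁ r ▷ g ⊗≫ (g' ◁ (f' ◁ p) ≫ g' ◁ (s ▷ g')) ⊗≫ i ▷ f ▷ g' ⊗≫
          adj.counit ▷ g' := by
        dsimp only [rightZigzag]; bicategory
      _ = g' ◁ adj.unit ⊗≫ g' ◁ (r ≫ s) ▷ g ⊗≫ ((g' ≫ f) ◁ p ≫ i ▷ f ▷ g' ⊗≫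
          adj.counit ▷ g') := by
        rw [← whiskerLeft_comp, whisker_exchange]; bicategory
      _ = g' ◁ adj.unit ⊗≫ g' ◁ (r ≫ s) ▷ g ⊗≫ ((g' ≫ f) ◁ p ≫ (i ▷ f) ▷ g') ⊗≫
          adj.counit ▷ g' := by bicategory
      _ = 𝟙 _ ⊗≫ g' ◁ adj.unit ⊗≫ (g' ◁ (r ≫ s) ▷ g ⊗≫ i ▷ (f ≫ g)) ⊗≫
          ((g ≫ f) ◁ p ≫ adj.counit ▷ g') ⊗≫ 𝟙 _ := by
        rw [whisker_exchange]; bicategory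
      _ = 𝟙 _ ⊗≫ g' ◁ (adj.unit ≫ (r ≫ s) ▷ g) ⊗≫ i ▷ (f ≫ g) ⊗≫ adj.counit ▷ g ⊗≫ p ⊗≫ 𝟙 _ := by
        rw [whisker_exchange]; bicategory
      _ = 𝟙 _ ⊗≫ (g' ◁ (adj.unit ≫ (r ≫ s) ▷ g) ≫ i ▷ (f ≫ g)) ⊗≫ adj.counit ▷ g ⊗≫ p ⊗≫ 𝟙 _ := by
        bicategory
      _ = (ρ_ g').hom ≫ (i ≫ conjugateEquiv adj adj (r ≫ s) ≫ p) ≫ (λ_ g').inv := by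
        rw [whisker_exchange, conjugateEquiv_apply']; bicategory
      _ = _ := by
        rw [← hpi, assoc p, hip, Category.comp_id, hip, id_comp]

/-- A retract of a 1-morphism with a right adjoint has a right adjoint if idempotents split. -/
lemma exists_rightAdjoint_of_retract {f f' : a ⟶ b} {g : b ⟶ a} (adj : Bicategory.Adjunction f g)
    (s : f' ⟶ f) (r : f ⟶ f') (hsr : s ≫ r = 𝟙 f')
    (H : ∀ e : g ⟶ g, e ≫ e = e → ∃ (g' : b ⟶ a) (p : g ⟶ g') (i : g' ⟶ g), i ≫ p = 𝟙 g' ∧ p ≫ i = e) :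
    ∃ g' : b ⟶ a, Nonempty (Bicategory.Adjunction f' g') := by
  obtain ⟨g', p, i, hip, hpi⟩ := H (conjugateEquiv adj adj (r ≫ s)) (by
    rw [Bicategory.conjugateEquiv_comp, assoc, ← assoc s, hsr, id_comp])
  exact ⟨g', ⟨adjunctionOfRetract adj s r hsr i p hip hpi⟩⟩

/-- A retract of a 1-morphism with a left adjoint has a left adjoint if idempotents split. -/
lemma exists_leftAdjoint_of_retract {f : a ⟶ b} {g g' : b ⟶ a} (adj : Bicategory.Adjunction f g)
    (i : g' ⟶ g) (p : g ⟶ g') (hip : i ≫ p = 𝟙 g')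
    (H : ∀ e : f ⟶ f, e ≫ e = e → ∃ (f' : a ⟶ b) (r : f ⟶ f') (s : f' ⟶ f), s ≫ r = 𝟙 f' ∧ r ≫ s = e) :
    ∃ f' : a ⟶ b, Nonempty (Bicategory.Adjunction f' g') := by
  obtain ⟨f', r, s, hsr, hrs⟩ := H ((conjugateEquiv adj adj).symm (p ≫ i)) (by
    rw [Bicategory.conjugateEquiv_symm_comp, assoc, ← assoc i, hip, id_comp])
  exact ⟨f', ⟨adjunctionOfRetract adj s r hsr i p hip (by rw [hrs, Equiv.apply_symm_apply])⟩⟩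

end RetractAdjunction

section SeparateVariables

open MvPolynomial

variable {m : ℕ} {Q : Type u} [CommRing Q]

/-- The product `∏ⱼ g_j(x_j)`. -/
def sepProd : MultilinearMap Q (fun _ : Fin m => Polynomial Q) Pol(m, Q) :=
  (MultilinearMap.mkPiAlgebra Q (Fin m) Pol(m, Q)).compLinearMap
    fun j => (paeval (X j : Pol(m, Q))).toLinearMap

lemma sepProd_apply (g : Fin m → Polynomial Q) : sepProd g = ∏ j, paeval (X j : Pol(m, Q)) (g j) := by
  simp [sepProd]

lemma sepProd_X_pow (e : Fin m →₀ ℕ) : sepProd (fun j => (Polynomial.X : Polynomial Q) ^ e j) = monomial e 1 := by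
  rw [sepProd_apply, monomial_eq, C_1, one_mul, Finsupp.prod_fintype _ _ (fun _ => pow_zero _)]
  simp

lemma map_sepProd {M : Type*} [AddCommGroup M] [Module Q M] (F : Pol(m, Q) →ₗ[Q] M)
    (G : MultilinearMap Q (fun _ : Fin m => Polynomial Q) M)
    (h : ∀ e : Fin m →₀ ℕ, F (monomial e 1) = G fun j => Polynomial.X ^ e j)
    (g : Fin m → Polynomial Q) : F (sepProd g) = G g := by
  have : F.compMultilinearMap sepProd = G :=
    Basis.ext_multilinear (fun _ => Polynomial.basisMonomials Q) fun v => by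
      have := h (Finsupp.equivFunOnFinite.symm v)
      rw [← sepProd_X_pow] at this
      simpa [Polynomial.coe_basisMonomials, Polynomial.monomial_one_right_eq_X_pow] using this
  exact congrArg (fun G => G g) this

lemma sepProd_ext {M : Type*} [AddCommGroup M] [Module Q M] {F G : Pol(m, Q) →ₗ[Q] M}
    (h : ∀ g, F (sepProd g) = G (sepProd g)) : F = G :=
  (basisMonomials (Fin m) Q).ext fun e => by
    rw [coe_basisMonomials]
    simp only [← sepProd_X_pow, h]

lemma sepProd_induction {P : Pol(m, Q) → Prop} (h0 : P 0)
    (h : ∀ (c : Q) g, P (c • sepProd g)) (ha : ∀ f g, P f → P g → P (f + g)) (f : Pol(m, Q)) : P f := by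
  induction f using MvPolynomial.induction_on' with
  | monomial e a =>
    have : monomial e a = a • sepProd (fun j => (Polynomial.X : Polynomial Q) ^ e j) := by
      rw [sepProd_X_pow, smul_monomial, smul_eq_mul, mul_one]
    rw [this]; exact h _ _
  | add f g hf hg => exact ha f g hf hg

lemma aeval_mul_sepProd (p : Polynomial Q) (i : Fin m) (g : Fin m → Polynomial Q) :
    paeval (X i : Pol(m, Q)) p * sepProd g = sepProd (Function.update g i (p * g i)) := by
  rw [sepProd_apply, sepProd_apply, Fintype.prod_eq_mul_prod_compl i,
    Fintype.prod_eq_mul_prod_compl i, update_self, map_mul, mul_assoc]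
  congr 2
  refine Finset.prod_congr rfl fun j hj => ?_
  rw [update_of_ne (by simpa using hj)]

lemma coeff_sepProd (g : Fin m → Polynomial Q) (u : Fin m →₀ ℕ) : coeff u (sepProd g) = ∏ j, (g j).coeff (u j) := by
  have := map_sepProd (lcoeff Q u)
    ((MultilinearMap.mkPiAlgebra Q (Fin m) Q).compLinearMap fun j => Polynomial.lcoeff Q (u j))
    (fun e => by
      simp only [lcoeff_apply, coeff_monomial, MultilinearMap.compLinearMap_apply,
        MultilinearMap.mkPiAlgebra_apply, Polynomial.lcoeff_apply, Polynomial.coeff_X_pow,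
        Finset.prod_ite_zero, Finset.prod_const_one, Finsupp.ext_iff, eq_comm, mem_univ,
        true_implies]) g
  simpa using this

/-- The operator on polynomials in `x_1, …, x_m` that applies `φ` to polynomials in `x_i`. -/
def opX (i : Fin m) (φ : LEnd Q (Polynomial Q)) : LEnd Q Pol(m, Q) :=
  (basisMonomials (Fin m) Q).constr Q fun e =>
    sepProd (Function.update (fun j => Polynomial.X ^ e j) i (φ (Polynomial.X ^ e i)))

lemma opX_sepProd (i : Fin m) (φ : LEnd Q (Polynomial Q)) (g : Fin m → Polynomial Q) :
    opX i φ (sepProd g) = sepProd (Function.update g i (φ (g i))) := by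
  have hu : ∀ g : Fin m → Polynomial Q, Function.update g i (φ (g i)) =
      fun j => (if j = i then φ else LinearMap.id : LEnd Q (Polynomial Q)) (g j) := fun g => by
    ext1 j
    by_cases h : j = i
    · subst h; rw [update_self, if_pos rfl]
    · rw [update_of_ne h, if_neg h]; rfl
  rw [hu, map_sepProd (opX i φ) (sepProd.compLinearMap fun j =>
    (if j = i then φ else LinearMap.id : LEnd Q (Polynomial Q)))]
  · rw [MultilinearMap.compLinearMap_apply]
  · intro e
    rw [MultilinearMap.compLinearMap_apply, ← hu]
    exact (basisMonomials (Fin m) Q).constr_basis Q _ e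

lemma opX_mul (i : Fin m) (φ ψ : LEnd Q (Polynomial Q)) : opX i (φ * ψ) = opX i φ * opX i ψ :=
  sepProd_ext fun g => by
    rw [emul_apply, opX_sepProd, opX_sepProd, opX_sepProd, update_self, Function.update_idem, emul_apply]

lemma opX_one (i : Fin m) : opX i (1 : LEnd Q (Polynomial Q)) = 1 :=
  sepProd_ext fun g => by rw [opX_sepProd, Module.End.one_apply, Function.update_eq_self]; rfl

lemma opX_comm {i j : Fin m} (h : i ≠ j) (φ ψ : LEnd Q (Polynomial Q)) : opX i φ * opX j ψ = opX j ψ * opX i φ :=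
  sepProd_ext fun g => by
    rw [emul_apply, emul_apply, opX_sepProd, opX_sepProd, opX_sepProd,
      opX_sepProd, update_of_ne h, update_of_ne h.symm, Function.update_comm h]

lemma opX_mulLeft (i : Fin m) (p : Polynomial Q) (f : Pol(m, Q)) :
    opX i (LinearMap.mulLeft Q p) f = paeval (X i : Pol(m, Q)) p * f :=
  lcongr_fun (sepProd_ext (F := opX i (LinearMap.mulLeft Q p)) (G := LinearMap.mulLeft Q
    (paeval (X i : Pol(m, Q)) p)) fun g => by
      rw [opX_sepProd, mulLeft_apply, mulLeft_apply, aeval_mul_sepProd]) f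

/-- Division by a monic polynomial, as a linear map. -/
def divMonic (p : Polynomial Q) (hp : p.Monic) : LEnd Q (Polynomial Q) where
  toFun f := f /ₘ p
  map_add' f g := by
    nontriviality Q
    refine (Polynomial.div_modByMonic_unique (f /ₘ p + g /ₘ p) (f %ₘ p + g %ₘ p) hp ⟨?_, ?_⟩).1
    · linear_combination modByMonic_add_div f p + modByMonic_add_div g p
    · rw [← Polynomial.add_modByMonic]; exact Polynomial.degree_modByMonic_lt _ hp
  map_smul' c f := by
    nontriviality Q
    refine (Polynomial.div_modByMonic_unique (c • (f /ₘ p)) (c • (f %ₘ p)) hp ⟨?_, ?_⟩).1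
    · rw [mul_smul_comm, ← smul_add, modByMonic_add_div]
    · rw [← Polynomial.smul_modByMonic]; exact Polynomial.degree_modByMonic_lt _ hp

lemma divMonic_apply (p : Polynomial Q) (hp : p.Monic) (f : Polynomial Q) : divMonic p hp f = f /ₘ p := rfl

lemma divMonic_mulLeft (p : Polynomial Q) (hp : p.Monic) : divMonic p hp * LinearMap.mulLeft Q p = 1 :=
  LinearMap.ext fun f => Polynomial.mul_divByMonic_cancel_left f hp

lemma one_sub_mulLeft_divMonic (p : Polynomial Q) (hp : p.Monic) (f : Polynomial Q) :
    f - p * divMonic p hp f = f %ₘ p := by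
  rw [divMonic_apply]; linear_combination - modByMonic_add_div f p

/-- The polynomials that are reduced modulo `p_i(x_i)` for all `i`. -/
lemma mem_restrictSupport_iff_divMonic (p : Fin m → Polynomial Q) (hp : ∀ i, (p i).Monic)
    (f : Pol(m, Q)) : f ∈ restrictSupport Q {e | ∀ i, e i < (p i).natDegree} ↔
      ∀ i, opX i (divMonic (p i) (hp i)) f = 0 := by
  nontriviality Q
  constructor
  · intro hf i
    rw [restrictSupport_eq_span] at hf
    refine mem_ker.1 ((Submodule.span_le (p := ker
      (opX i (divMonic (p i) (hp i))))).2 ?_ hf)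
    rintro _ ⟨e, he, rfl⟩
    change opX i (divMonic (p i) (hp i)) (monomial e 1) = 0
    rw [← sepProd_X_pow, opX_sepProd, divMonic_apply, (Polynomial.divByMonic_eq_zero_iff (hp i)).2,
      MultilinearMap.map_update_zero]
    rw [Polynomial.degree_X_pow, degree_eq_natDegree (hp i).ne_zero]
    exact_mod_cast he i
  · intro hf
    have key : ∀ s : Finset (Fin m), ∃ g : LEnd Q Pol(m, Q),
        g f = f ∧ ∀ v, g (sepProd v) = sepProd fun j => if j ∈ s then v j %ₘ p j else v j := fun s => by
      induction s using Finset.induction_on with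
      | empty => exact ⟨1, rfl, fun v => by simp⟩
      | insert i s hi ih =>
        obtain ⟨g, h1, h2⟩ := ih
        refine ⟨(1 - opX i (LinearMap.mulLeft Q (p i)) * opX i (divMonic (p i) (hp i))) * g, ?_, ?_⟩
        · rw [emul_apply, h1, lsub_apply, emul_apply, hf, map_zero, sub_zero]; rfl
        · intro v
          rw [emul_apply, h2, lsub_apply, Module.End.one_apply, emul_apply, opX_sepProd, opX_sepProd, update_self,
            Function.update_idem, mulLeft_apply]
          rw [if_neg hi]
          have h3 := (sepProd (m := m) (Q := Q)).map_update_sub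
            (fun j => if j ∈ s then v j %ₘ p j else v j) i (v i) (p i * divMonic (p i) (hp i) (v i))
          rw [one_sub_mulLeft_divMonic] at h3
          have h4 : Function.update (fun j => if j ∈ s then v j %ₘ p j else v j) i (v i) =
              fun j => if j ∈ s then v j %ₘ p j else v j := by
            rw [Function.update_eq_self_iff, if_neg hi]
          rw [h4] at h3
          rw [← h3]
          congr 1; ext1 j
          by_cases h : j = i
          · subst h; rw [update_self, if_pos (Finset.mem_insert_self _ _)]
          · rw [update_of_ne h]; simp [h]
    obtain ⟨g, h1, h2⟩ := key univ
    rw [← h1]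
    clear hf h1 key
    induction f using sepProd_induction with
    | h0 => rw [map_zero]; exact Submodule.zero_mem _
    | ha a b ha hb => rw [map_add]; exact Submodule.add_mem _ ha hb
    | h c v =>
      rw [map_smul, h2]
      refine Submodule.smul_mem _ _ ?_
      rw [mem_restrictSupport_iff]
      intro e he i
      rw [Finset.mem_coe, mem_support_iff, coeff_sepProd] at he
      have h3 : (v i %ₘ p i).coeff (e i) ≠ 0 := fun h =>
        he (Finset.prod_eq_zero (mem_univ i) (by rwa [if_pos (mem_univ i)]))
      have h4 := (Polynomial.le_degree_of_ne_zero h3).trans_lt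
        (Polynomial.degree_modByMonic_lt (v i) (hp i))
      rw [degree_eq_natDegree (hp i).ne_zero] at h4
      exact_mod_cast h4

end SeparateVariables

section TensorBasis

open MvPolynomial LinFact

variable {k T R : Type u} [CommRing k] [CommRing T] [CommRing R] [Algebra k T] [Algebra k R] {m : ℕ}

variable (k T R m) in
/-- The ring `T ⊗ k[z_1, …, z_m] ⊗ R`, as polynomials in `z` over `T ⊗ R`. -/
abbrev MidRing : Type u := MvPolynomial (Fin m) (T ⊗[k] R)

variable (k T R m) in
/-- The inclusion of the first two tensor factors. -/
def midL : T ⊗[k] Pol(m, k) →ₐ[k] MidRing k T R m :=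
  Algebra.TensorProduct.productMap
    ((IsScalarTower.toAlgHom k (T ⊗[k] R) (MidRing k T R m)).comp includeLeft)
    (aeval X)

variable (k T R m) in
/-- The inclusion of the last two tensor factors. -/
def midR : Pol(m, k) ⊗[k] R →ₐ[k] MidRing k T R m :=
  Algebra.TensorProduct.productMap (aeval X)
    ((IsScalarTower.toAlgHom k (T ⊗[k] R) (MidRing k T R m)).comp includeRight)

lemma midL_tmul (t : T) (s : Pol(m, k)) : midL k T R m (t ⊗ₜ s) = C (t ⊗ₜ 1) * aeval X s := rfl

lemma midR_tmul (s : Pol(m, k)) (r : R) : midR k T R m (s ⊗ₜ r) = aeval X s * C (1 ⊗ₜ r) := rfl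

variable {v : T} {w : Pol(m, k)} {u : R} {I J : Type u}
  {Y : LinFact (T ⊗[k] Pol(m, k)) (pot k v w)}
  {X' : LinFact (Pol(m, k) ⊗[k] R) (pot k w u)}

/-- The coordinates of an element of `Y ⊗ X` with respect to bases of `Y` and `X`. -/
def tensorCoord (e : Basis I (T ⊗[k] Pol(m, k)) Y.carrier) (f : Basis J (Pol(m, k) ⊗[k] R) X'.carrier) (i : I) (j : J) :
    (tensor Y X').carrier →ₗ[T ⊗[k] R] MidRing k T R m :=
  tlift (AddMonoidHom.mk' (fun y => AddMonoidHom.mk'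
      (fun x => midL k T R m (e.repr y i) * midR k T R m (f.repr x j))
      (fun x x' => by rw [map_add, fadd_apply, map_add, mul_add]))
      (fun y y' => by
        ext1 x
        rw [AddMonoidHom.add_apply, mk'_apply, mk'_apply, mk'_apply, map_add, fadd_apply, map_add, add_mul]))
    (fun s y x => by
      simp only [mk'_apply, map_smul, fsmul_apply, smul_eq_mul, map_mul, midL_tmul, midR_tmul]
      rw [← tone_def, C_1]; ring)
    (fun t r y x => by
      simp only [mk'_apply, map_smul, fsmul_apply, smul_eq_mul, map_mul,
        midL_tmul, midR_tmul, map_one, one_mul, mul_one]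
      have h : (C (t ⊗ₜ r) : MidRing k T R m) = C (t ⊗ₜ 1) * C (1 ⊗ₜ r) := by
        rw [← C_mul, tmul_mul_tmul, one_mul, mul_one]
      rw [smul_eq_C_mul, h]; ring)

lemma tensorCoord_pt (e : Basis I (T ⊗[k] Pol(m, k)) Y.carrier)
    (f : Basis J (Pol(m, k) ⊗[k] R) X'.carrier) (i : I) (j : J) (y : Y.carrier)
    (x : X'.carrier) : tensorCoord e f i j (pt y x) = midL k T R m (e.repr y i) * midR k T R m (f.repr x j) := rfl

/-- The family `(z^u e_i) ⊗ f_j`. -/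
def tensorVec (e : Basis I (T ⊗[k] Pol(m, k)) Y.carrier) (f : Basis J (Pol(m, k) ⊗[k] R) X'.carrier)
    (q : Σ _ : I × J, (Fin m →₀ ℕ)) : (tensor Y X').carrier :=
  pt (((1 : T) ⊗ₜ[k] (monomial q.2 1 : Pol(m, k))) • e q.1.1) (f q.1.2)

lemma tensorCoord_vec [DecidableEq I] [DecidableEq J] (e : Basis I (T ⊗[k] Pol(m, k)) Y.carrier)
    (f : Basis J (Pol(m, k) ⊗[k] R) X'.carrier) (i : I) (j : J)
    (q : Σ _ : I × J, (Fin m →₀ ℕ)) : tensorCoord e f i j (tensorVec e f q) =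
      if q.1 = (i, j) then monomial q.2 1 else 0 := by
  obtain ⟨⟨i', j'⟩, a⟩ := q
  have h : aeval (X : Fin m → MidRing k T R m) (monomial a 1 : Pol(m, k)) =
      (monomial a 1 : MidRing k T R m) := by
    rw [aeval_monomial, map_one, one_mul, monomial_eq, C_1, one_mul]
  rw [tensorVec, tensorCoord_pt, map_smul, fsmul_apply, repr_self,
    repr_self, single_apply, single_apply, smul_eq_mul, map_mul,
    midL_tmul, h, ← tone_def, C_1, one_mul]
  by_cases h1 : i' = i <;> by_cases h2 : j' = j <;> simp [h1, h2]

lemma smul_eq_zero_of_eq_zero {A M : Type*} [CommRing A] [AddCommGroup M] [Module A M] {a : A}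
    (h : a = 0) (x : M) : a • x = 0 := by rw [h, zero_smul]

lemma span_tensorVec (e : Basis I (T ⊗[k] Pol(m, k)) Y.carrier)
    (f : Basis J (Pol(m, k) ⊗[k] R) X'.carrier) (z : (tensor Y X').carrier) :
    z ∈ Submodule.span (T ⊗[k] R) (Set.range (tensorVec e f)) := by
  set N := Submodule.span (T ⊗[k] R) (Set.range (tensorVec e f)) with hN
  have h1 : ∀ (t : T) (s : Pol(m, k)) (r : R) i j,
      pt ((t ⊗ₜ[k] s) • e i) (((1 : Pol(m, k)) ⊗ₜ[k] r) • f j) ∈ N := by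
    intro t s r i j
    have e1 : (t ⊗ₜ[k] s) • e i = (t ⊗ₜ[k] (1 : Pol(m, k))) •
        (((1 : T) ⊗ₜ[k] s) • e i) := by
      rw [smul_smul, tmul_mul_tmul, one_mul, mul_one]
    rw [e1, ← smul_pt]
    clear e1
    refine N.smul_mem _ ?_
    induction s using MvPolynomial.induction_on' with
    | monomial a c =>
      have e2 : (1 : T) ⊗ₜ[k] (monomial a c : Pol(m, k)) =
          (algebraMap k T c ⊗ₜ[k] (1 : Pol(m, k))) * ((1 : T) ⊗ₜ[k] monomial a 1) := by
        rw [tmul_mul_tmul, one_mul, mul_one,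
          Algebra.algebraMap_eq_smul_one, smul_tmul, smul_monomial, smul_eq_mul, mul_one]
      rw [e2, mul_smul, ← smul_pt_left]
      exact N.smul_mem _ (Submodule.subset_span ⟨⟨(i, j), a⟩, rfl⟩)
    | add p q hp hq =>
      rw [tmul_add, add_smul, map_add, AddMonoidHom.add_apply]
      exact N.add_mem hp hq
  have h2 : ∀ (a : T ⊗[k] Pol(m, k)) (b : Pol(m, k) ⊗[k] R) i j,
      pt (a • e i) (b • f j) ∈ N := by
    intro a b i j
    induction b using tmul_induction with
    | zero =>
      have h0 : (0 : Pol(m, k) ⊗[k] R) • f j = 0 :=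
        smul_eq_zero_of_eq_zero rfl _
      exact (congrArg (fun x => pt (a • e i) x ∈ N) h0).mpr (by rw [map_zero]; exact N.zero_mem)
    | add b b' h h' => rw [add_smul, map_add]; exact N.add_mem h h'
    | tmul s r =>
      have e3 : s ⊗ₜ[k] r = (s ⊗ₜ[k] (1 : R)) * ((1 : Pol(m, k)) ⊗ₜ[k] r) := by
        rw [tmul_mul_tmul, one_mul, mul_one]
      rw [e3, mul_smul, ← pt_balanced, smul_smul]
      generalize (1 : T) ⊗ₜ[k] s * a = a
      induction a using tmul_induction with
      | zero =>
        have h0 : (0 : T ⊗[k] Pol(m, k)) • e i = 0 :=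
          smul_eq_zero_of_eq_zero rfl _
        exact (congrArg (fun y => pt y _ ∈ N) h0).mpr (by
          rw [map_zero, AddMonoidHom.zero_apply]; exact N.zero_mem)
      | add b b' h h' =>
        rw [add_smul, map_add, AddMonoidHom.add_apply]; exact N.add_mem h h'
      | tmul t s => exact h1 t s r i j
  induction z using tind with
  | ha a b ha hb => exact N.add_mem ha hb
  | h y x =>
    rw [← e.linearCombination_repr y, ← f.linearCombination_repr x, Finsupp.linearCombination_apply,
      Finsupp.linearCombination_apply, Finsupp.sum, Finsupp.sum, map_sum]
    refine N.sum_mem fun j _ => ?_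
    rw [map_sum, finsetSum_apply]
    exact N.sum_mem fun i _ => h2 _ _ _ _

/-- The basis `((z^u e_i) ⊗ f_j)` of `Y ⊗ X` over `T ⊗ R`. -/
def tensorBasis (e : Basis I (T ⊗[k] Pol(m, k)) Y.carrier) (f : Basis J (Pol(m, k) ⊗[k] R) X'.carrier) :
    Basis (Σ _ : I × J, (Fin m →₀ ℕ)) (T ⊗[k] R) (tensor Y X').carrier :=
  Basis.mk (v := tensorVec e f)
    (by
      classical
      rw [linearIndependent_iff']
      intro s g hg q hq
      have := congrArg (fun z => coeff q.2 (tensorCoord e f q.1.1 q.1.2 z)) hg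
      simp only [map_sum, map_smul, tensorCoord_vec, map_zero, coeff_sum, coeff_smul, coeff_zero] at this
      rw [sum_eq_single q] at this
      · simpa using this
      · intro q' _ hne
        by_cases h : q'.1 = q.1
        · have h3 : q'.2 ≠ q.2 := fun h3 => hne (by
            obtain ⟨a, b⟩ := q; obtain ⟨a', b'⟩ := q'; cases h; cases h3; rfl)
          rw [if_pos h, coeff_monomial, if_neg h3, smul_zero]
        · rw [if_neg h, coeff_zero, smul_zero]
      · exact fun h => absurd hq h)
    (fun z _ => span_tensorVec e f z)

lemma tensorBasis_apply (e : Basis I (T ⊗[k] Pol(m, k)) Y.carrier) (f : Basis J (Pol(m, k) ⊗[k] R) X'.carrier)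
    (q : Σ _ : I × J, (Fin m →₀ ℕ)) : tensorBasis e f q = tensorVec e f q :=
  Basis.mk_apply _ _ _

lemma even_pt_basis (e : Y.HomBasis I) (f : X'.HomBasis J) (a : T ⊗[k] Pol(m, k))
    (b : Pol(m, k) ⊗[k] R) (i : I) (j : J) : (tensor Y X').even (pt (a • e.basis i) (b • f.basis j)) =
      if e.par i + f.par j = 0 then pt (a • e.basis i) (b • f.basis j) else 0 := by
  rw [even_pt, LinearMap.map_smul Y.even, LinearMap.map_smul X'.even, e.even_basis, f.even_basis]
  have hp : ∀ p q : ZMod 2, p + q = 0 ↔ (p = 0 ↔ q = 0) := by decide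
  simp only [hp]
  by_cases h1 : e.par i = 0 <;> by_cases h2 : f.par j = 0 <;> simp [h1, h2]

lemma isMF_tensor (hY : Y.IsMF) (hX : X'.IsMF) : (tensor Y X').IsMF := by
  obtain ⟨I, ⟨e⟩⟩ := hY
  obtain ⟨J, ⟨f⟩⟩ := hX
  refine ⟨_, ⟨⟨tensorBasis e.basis f.basis, fun q => e.par q.1.1 + f.par q.1.2, fun q => ?_⟩⟩⟩
  rw [tensorBasis_apply, tensorVec]
  have := even_pt_basis e f (1 ⊗ₜ[k] (monomial q.2 1)) 1 q.1.1 q.1.2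
  rwa [one_smul] at this

variable [Fintype I] [Fintype J]

/-- The coordinates identify `Y ⊗ X` with matrices of polynomials. -/
def tensorEquiv (e : Basis I (T ⊗[k] Pol(m, k)) Y.carrier) (f : Basis J (Pol(m, k) ⊗[k] R) X'.carrier) :
    (tensor Y X').carrier ≃ₗ[T ⊗[k] R] (I × J → MidRing k T R m) :=
  (tensorBasis e f).equiv (Pi.basis fun _ => basisMonomials (Fin m) (T ⊗[k] R)) (Equiv.refl _)

lemma tensorEquiv_apply (e : Basis I (T ⊗[k] Pol(m, k)) Y.carrier)
    (f : Basis J (Pol(m, k) ⊗[k] R) X'.carrier) (z : (tensor Y X').carrier)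
    (q : I × J) : tensorEquiv e f z q = tensorCoord e f q.1 q.2 z := by
  classical
  have : LinearMap.proj q ∘ₗ (tensorEquiv e f).toLinearMap = tensorCoord e f q.1 q.2 :=
    (tensorBasis e f).ext fun a => by
      rw [lcomp_apply, LinearEquiv.coe_coe, tensorEquiv, Basis.equiv_apply,
        tensorBasis_apply, tensorCoord_vec, Pi.basis_apply, LinearMap.proj_apply, Equiv.refl_apply,
        coe_basisMonomials, Pi.single_apply]
      exact if_congr eq_comm rfl rfl
  exact lcongr_fun this z

lemma tensorEquiv_pt (e : Basis I (T ⊗[k] Pol(m, k)) Y.carrier)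
    (f : Basis J (Pol(m, k) ⊗[k] R) X'.carrier) (y : Y.carrier) (x : X'.carrier)
    (q : I × J) : tensorEquiv e f (pt y x) q =
      midL k T R m (e.repr y q.1) * midR k T R m (f.repr x q.2) := tensorEquiv_apply e f _ q

end TensorBasis

section KoszulContraction

open MvPolynomial

variable {m : ℕ} {Q : Type u} [CommRing Q]

section Operators

variable {M : Type u} [CommRing M] [Algebra Q M]

/-- The operator `φ` applied to all coefficients. -/
def coeffwise (φ : LEnd Q M) : LEnd Q (Finset (Fin m) → M) := φ.compLeft _

lemma coeffwise_apply (φ : LEnd Q M) (v : Finset (Fin m) → M) (s : Finset (Fin m)) : coeffwise φ v s = φ (v s) := rfl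

lemma map_sg_mul (φ : LEnd Q M) (i : Fin m) (s : Finset (Fin m)) (x : M) : φ (sg M i s * x) = sg M i s * φ x := by
  rw [sg]
  rcases Nat.even_or_odd (s.filter (· < i)).card with h | h
  · rw [h.neg_one_pow, one_mul, one_mul]
  · rw [h.neg_one_pow, neg_one_mul, neg_one_mul, map_neg]

lemma coeffwise_extMul (φ : LEnd Q M) (i : Fin m) (v : Finset (Fin m) → M) :
    coeffwise φ (extMul i v) = extMul i (coeffwise φ v) := by
  ext s
  rw [coeffwise_apply, extMul_apply, extMul_apply]
  split_ifs
  · rw [map_sg_mul, coeffwise_apply]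
  · exact map_zero φ

lemma coeffwise_extContr (φ : LEnd Q M) (i : Fin m) (v : Finset (Fin m) → M) :
    coeffwise φ (extContr i v) = extContr i (coeffwise φ v) := by
  ext s
  rw [coeffwise_apply, extContr_apply, extContr_apply]
  split_ifs
  · exact map_zero φ
  · rw [map_sg_mul, coeffwise_apply]

end Operators

variable (c : Fin m → Q) (a : Q)

/-- Multiplication by `a (x_i - c_i)`. -/
def linMul (i : Fin m) : LEnd Q Pol(m, Q) :=
  opX i (a • LinearMap.mulLeft Q (Polynomial.X - Polynomial.C (c i)))

/-- Division by `x_i - c_i`, multiplied by `a`. -/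
def linDiv (i : Fin m) : LEnd Q Pol(m, Q) :=
  opX i (a • divMonic _ (monic_X_sub_C (c i)))

lemma opX_smul (i : Fin m) (φ : LEnd Q (Polynomial Q)) : opX i (a • φ) = a • opX i φ :=
  sepProd_ext fun g => by
    rw [LinearMap.smul_apply, opX_sepProd, opX_sepProd, LinearMap.smul_apply, MultilinearMap.map_update_smul]

lemma linMul_apply (i : Fin m) (f : Pol(m, Q)) : linMul c a i f = a • (X i - C (c i)) * f := by
  rw [linMul, opX_smul, LinearMap.smul_apply, opX_mulLeft, map_sub, Polynomial.aeval_X,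
    Polynomial.aeval_C, smul_mul_assoc]
  rfl

variable {a} (ha : a * a = 1)
include ha

lemma linDiv_linMul (i : Fin m) : linDiv c a i * linMul c a i = 1 := by
  rw [linDiv, linMul, ← opX_mul, smul_mul_smul_comm, ha, one_smul, divMonic_mulLeft, opX_one]

lemma linMul_linDiv_sepProd (i : Fin m) (g : Fin m → Polynomial Q) : (1 - linMul c a i * linDiv c a i) (sepProd g) =
      sepProd (Function.update g i (Polynomial.C ((g i).eval (c i)))) := by
  have h : linMul c a i * linDiv c a i = opX i (LinearMap.mulLeft Q (Polynomial.X - Polynomial.C (c i)) *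
      divMonic _ (monic_X_sub_C (c i))) := by
    rw [linDiv, linMul, ← opX_mul, smul_mul_smul_comm, ha, one_smul]
  rw [h, lsub_apply, opX_sepProd, emul_apply, mulLeft_apply,
    ← Polynomial.modByMonic_X_sub_C_eq_C_eval, ← one_sub_mulLeft_divMonic _
      (monic_X_sub_C (c i)), MultilinearMap.map_update_sub, Function.update_eq_self]
  rfl

omit ha in
lemma linDiv_linMul_comm {i j : Fin m} (h : i ≠ j) :
    linDiv c a i * linMul c a j = linMul c a j * linDiv c a i := opX_comm h _ _

variable (a) in
omit ha in
/-- The Koszul differential with coefficients `a (x_i - c_i)`. -/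
def koszulLin : LEnd Q (Finset (Fin m) → Pol(m, Q)) :=
  ∑ i, coeffwise (linMul c a i) * (extContr i).restrictScalars Q

omit ha in
lemma koszulLin_apply (v : Finset (Fin m) → Pol(m, Q)) : koszulLin c a v =
    koszulD 0 (fun i => a • (X i - C (c i))) v := by
  rw [koszulLin, koszulD, lsum_apply, lsum_apply]
  refine sum_congr rfl fun i _ => funext fun s => ?_
  rw [emul_apply, coeffwise_apply, linMul_apply]
  simp

omit ha in
lemma koszulLin_sq : koszulLin c a * koszulLin c a = 0 := by
  refine LinearMap.ext fun v => ?_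
  rw [emul_apply, koszulLin_apply, koszulLin_apply]
  have := lcongr_fun (koszulD_sq (0 : Fin m → Pol(m, Q))
    (fun i => a • (X i - C (c i)))) v
  rw [emul_apply] at this
  simp [this]

variable (a) in
omit ha in
/-- The contraction in the direction of `x_i`. -/
def contrOne (i : Fin m) : LEnd Q (Finset (Fin m) → Pol(m, Q)) :=
  coeffwise (linDiv c a i) * (extMul i).restrictScalars Q

lemma koszulLin_contrOne (i : Fin m) (v : Finset (Fin m) → Pol(m, Q)) (s : Finset (Fin m)) :
    (1 - (koszulLin c a * contrOne c a i + contrOne c a i * koszulLin c a)) v s =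
      if i ∈ s then 0 else (1 - linMul c a i * linDiv c a i) (v s) := by
  let κ : Fin m → LEnd Q (Finset (Fin m) → Pol(m, Q)) :=
    fun l => coeffwise (linMul c a l) * (extContr l).restrictScalars Q
  have key : ∀ l, (κ l * contrOne c a i + contrOne c a i * κ l) v s =
      if l = i then (if i ∈ s then v s else (linMul c a i * linDiv c a i) (v s)) else 0 := by
    intro l
    have e1 : (κ l * contrOne c a i) v =
        coeffwise (linMul c a l * linDiv c a i) (extContr l (extMul i v)) := by
      simp only [κ, contrOne, emul_apply, LinearMap.coe_restrictScalars, ← coeffwise_extContr]; rfl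
    have e2 : (contrOne c a i * κ l) v =
        coeffwise (linDiv c a i * linMul c a l) (extMul i (extContr l v)) := by
      simp only [κ, contrOne, emul_apply, LinearMap.coe_restrictScalars, ← coeffwise_extMul]; rfl
    rw [ladd_apply, e1, e2]
    by_cases h : l = i
    · subst h
      rw [if_pos rfl, linDiv_linMul c ha, Pi.add_apply, coeffwise_apply, coeffwise_apply,
        Module.End.one_apply, extContr_apply]
      by_cases hs : l ∈ s
      · rw [if_pos hs, if_pos hs, map_zero, zero_add, extMul_apply, if_pos hs, extContr_apply,
          if_neg (Finset.notMem_erase l s), sg_erase_self, insert_erase hs, ← mul_assoc,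
          sg_mul_self, one_mul]
      · rw [if_neg hs, if_neg hs, extMul_apply,
          if_pos (Finset.mem_insert_self l s), sg_insert_self, Finset.erase_insert hs, ← mul_assoc,
          sg_mul_self, one_mul, extMul_apply, if_neg hs, add_zero]
    · rw [if_neg h, linDiv_linMul_comm c (Ne.symm h), ← map_add, add_comm (extContr l _)]
      have := lcongr_fun (extMul_extContr_anti (A := Pol(m, Q)) (Ne.symm h)) v
      rw [ladd_apply, emul_apply, emul_apply] at this
      rw [this, lzero_apply, map_zero]; rfl
  have h2 : (koszulLin c a * contrOne c a i + contrOne c a i * koszulLin c a) v s =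
      if i ∈ s then v s else (linMul c a i * linDiv c a i) (v s) := by
    rw [koszulLin, sum_mul, mul_sum, ← sum_add_distrib, lsum_apply,
      Finset.sum_apply, sum_congr rfl fun l _ => key l, Finset.sum_ite_eq' univ i,
      if_pos (mem_univ i)]
  rw [lsub_apply, Pi.sub_apply, h2]
  split_ifs
  · exact sub_self _
  · rfl

/-- A contraction of the Koszul complex of `a (x_1 - c_1), …, a (x_m - c_m)` onto the quotient by
these elements. -/
lemma exists_koszulLin_contraction : ∃ H : LEnd Q (Finset (Fin m) → Pol(m, Q)),
      (∃ Φ : Fin m → Finset (Fin m) → LEnd Q Pol(m, Q), ∀ v s, H v s = ∑ i ∈ s, Φ i s (v (s.erase i))) ∧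
      ∀ v, eval c (v ∅) = 0 → koszulLin c a (H v) + H (koszulLin c a v) = v := by
  have key : ∀ t : Finset (Fin m), ∃ H E : LEnd Q (Finset (Fin m) → Pol(m, Q)),
      (∃ Φ : Fin m → Finset (Fin m) → LEnd Q Pol(m, Q), ∀ v s, H v s = ∑ i ∈ s, Φ i s (v (s.erase i))) ∧
      koszulLin c a * H + H * koszulLin c a = 1 - E ∧
      ∃ r : LEnd Q Pol(m, Q),
        (∀ v s, E v s = if (s ∩ t).Nonempty then 0 else r (v s)) ∧
        ∀ g, r (sepProd g) =
          sepProd fun j => if j ∈ t then Polynomial.C ((g j).eval (c j)) else g j := by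
    intro t
    induction t using Finset.induction_on with
    | empty =>
      exact ⟨0, 1, ⟨0, by simp⟩, by simp, 1, by simp, fun g => by simp⟩
    | insert i t hi ih =>
      obtain ⟨H, E, ⟨Φ, hΦ⟩, hH, r, hr, hrs⟩ := ih
      set ε := 1 - (koszulLin c a * contrOne c a i + contrOne c a i * koszulLin c a) with hε
      have h1 : koszulLin c a * ε = ε * koszulLin c a := by
        have h0 := koszulLin_sq c (a := a)
        simp only [hε, mul_sub, sub_mul, mul_add, add_mul, ← mul_assoc, h0]
        simp only [mul_assoc, h0, mul_zero, zero_mul, mul_one, one_mul]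
        abel
      have hεv := fun v s => koszulLin_contrOne c ha i v s
      simp only [← hε] at hεv
      refine ⟨H * ε + contrOne c a i, E * ε, ?_, ?_, r * (1 - linMul c a i * linDiv c a i), ?_, ?_⟩
      · refine ⟨fun l s => (if i ∈ s.erase l then 0 else Φ l s * (1 - linMul c a i * linDiv c a i)) +
          if l = i then sg Q i s • linDiv c a i else 0, fun v s => ?_⟩
        rw [ladd_apply, Pi.add_apply, emul_apply, hΦ]
        simp only [ladd_apply, sum_add_distrib]
        congr 1
        · refine sum_congr rfl fun l _ => ?_
          rw [hεv]
          split_ifs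
          · rw [map_zero]; rfl
          · rfl
        · have : ∀ x, (if x = i then sg Q i s • linDiv c a i else 0 :
              LEnd Q Pol(m, Q)) (v (s.erase x)) =
              if x = i then sg Q i s • linDiv c a i (v (s.erase i)) else 0 := fun x => by
            split_ifs with h
            · rw [h]; rfl
            · rfl
          rw [sum_congr rfl fun x _ => this x, Finset.sum_ite_eq' s i, contrOne,
            emul_apply, coeffwise_apply, LinearMap.coe_restrictScalars, extMul_apply]
          split_ifs
          · rw [map_sg_mul, Algebra.smul_def]; simp [sg]
          · exact map_zero _
      · have : koszulLin c a * contrOne c a i + contrOne c a i * koszulLin c a = 1 - ε := by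
          rw [hε]; abel
        calc _ = (koszulLin c a * H + H * koszulLin c a) * ε +
              (koszulLin c a * contrOne c a i + contrOne c a i * koszulLin c a) := by
              rw [mul_add, add_mul, add_mul, mul_assoc H, mul_assoc H, ← h1, mul_assoc]; abel
          _ = _ := by rw [hH, this, sub_mul, one_mul]; abel
      · intro v s
        rw [emul_apply, hr, hεv]
        by_cases h1 : i ∈ s
        · rw [if_pos h1, if_pos (c := (s ∩ insert i t).Nonempty)
            ⟨i, Finset.mem_inter.2 ⟨h1, Finset.mem_insert_self _ _⟩⟩, map_zero, ite_self]
        · rw [if_neg h1, Finset.inter_insert_of_notMem h1]; rfl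
      · intro g
        rw [emul_apply, linMul_linDiv_sepProd c ha, hrs]
        congr 1; ext1 j
        by_cases h : j = i
        · subst h; simp [hi]
        · simp [h]
  obtain ⟨H, E, hΦ, hH, r, hr, hrs⟩ := key univ
  have hrC : ∀ f, r f = C (eval c f) := fun f => by
    have : r = (Algebra.linearMap Q Pol(m, Q)) ∘ₗ (aeval c).toLinearMap :=
      sepProd_ext fun g => by
        rw [hrs, sepProd_apply, sepProd_apply, lcomp_apply, toLinearMap_apply,
          map_prod, Algebra.linearMap_apply, map_prod]
        refine Finset.prod_congr rfl fun j _ => ?_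
        rw [if_pos (mem_univ j), Polynomial.aeval_C, ← aeval_algHom_apply, aeval_X, Polynomial.coe_aeval_eq_eval]
    rw [this]; rfl
  refine ⟨H, hΦ, fun v hv => ?_⟩
  have h1 : E v = 0 := funext fun s => by
    rw [hr, Finset.inter_univ]
    split_ifs with h
    · rfl
    · rw [Finset.not_nonempty_iff_eq_empty.1 h, hrC, hv, C_0]; rfl
  have h2 := lcongr_fun hH v
  rwa [lsub_apply, h1, sub_zero] at h2

/-- A linear factorisation with an exterior algebra factor is homotopy equivalent to its quotient. -/
lemma isIso_cls_of_koszul {w : Q} {Z X₀ : LinFact Q w} {J : Type u}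
    (E : Z.carrier ≃ₗ[Q] (Finset (Fin m) → J → Pol(m, Q))) (par : J → ZMod 2)
    (hE : ∀ z s j, E (Z.even z) s j = if (s.card : ZMod 2) + par j = 0 then E z s j else 0)
    (rest : Z.carrier → Z.carrier) (hd : ∀ z s j, E (Z.d z) s j = koszulLin c a (fun t => E z t j) s + E (rest z) s j)
    (hrest : ∀ p z, (∀ s j, s.card < p → E z s j = 0) → ∀ s j, s.card < p → E (rest z) s j = 0)
    (π : LinFact.Hom Z X₀) (hπ : ∀ z, π.map z = 0 ↔ ∀ j, eval c (E z ∅ j) = 0)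
    (ι : X₀.carrier →ₗ[Q] Z.carrier) (hι : ∀ x, π.map (ι x) = x) : IsIso (LinFact.cls π) := by
  obtain ⟨H, ⟨Φ, hΦ⟩, hH⟩ := exists_koszulLin_contraction c ha
  let H' : (Finset (Fin m) → J → Pol(m, Q)) →ₗ[Q]
      (Finset (Fin m) → J → Pol(m, Q)) :=
    { toFun := fun v s j => H (fun t => v t j) s
      map_add' := fun v v' => by
        ext1 s; ext1 j
        exact congrFun (map_add H (fun t => v t j) (fun t => v' t j)) s
      map_smul' := fun r v => by
        ext1 s; ext1 j
        exact congrFun (map_smul H r (fun t => v t j)) s }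
  let h : LEnd Q Z.carrier := E.symm.toLinearMap ∘ₗ H' ∘ₗ E.toLinearMap
  have hh : ∀ z s j, E (h z) s j = H (fun t => E z t j) s := fun z s j => by
    change E (E.symm (H' (E z))) s j = _
    rw [apply_symm_apply]; rfl
  have hodd : ∀ x, Z.even (h x) + h (Z.even x) = h x := fun z => by
    refine E.injective (funext fun s => funext fun j => ?_)
    rw [map_add, Pi.add_apply, Pi.add_apply, hE, hh, hh, hΦ, hΦ]
    have hp : ∀ p q : ZMod 2, (p + 1 + q = 0) ↔ ¬ (p + q = 0) := by decide
    have hs : ∀ i ∈ s, ((s.card : ℕ) : ZMod 2) = (s.erase i).card + 1 := fun i hi => by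
      rw [← card_erase_add_one hi]; push_cast; rfl
    by_cases h0 : (s.card : ZMod 2) + par j = 0
    · rw [if_pos h0]
      refine (add_eq_left).2 (sum_eq_zero fun i hi => ?_)
      rw [hE, if_neg, map_zero]
      rwa [hs i hi, hp] at h0
    · rw [if_neg h0, zero_add]
      refine sum_congr rfl fun i hi => ?_
      rw [hE, if_pos]
      rwa [hs i hi, hp, not_not] at h0
  have hcard : ∀ p z, (∀ s j, s.card < p → E z s j = 0) →
      ∀ s j, s.card < p + 1 → E (h z) s j = 0 := fun p z hz s j hs => by
    rw [hh, hΦ]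
    refine sum_eq_zero fun i hi => ?_
    rw [hz, map_zero]
    have := card_erase_add_one hi; omega
  have hmain : ∀ z, π.map z = 0 → ∀ s j, E ((LinFact.perturb h hodd).map z) s j =
      - (E (rest (h z)) s j + E (h (rest z)) s j) := fun z hz s j => by
    have e1 := congrFun (hH (fun t => E z t j) ((hπ z).1 hz j)) s
    have e2 : (fun t => E (Z.d z) t j) =
        koszulLin c a (fun t => E z t j) + (fun t => E (rest z) t j) := funext fun t => hd z t j
    rw [LinFact.perturb_apply, map_sub, map_add, Pi.sub_apply, Pi.sub_apply, Pi.add_apply,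
      Pi.add_apply, hd, hh, e2, map_add, Pi.add_apply, ← hh (rest z)]
    have e3 : (fun t => E (h z) t j) = H (fun t => E z t j) := funext fun t => hh z t j
    rw [e3]
    rw [Pi.add_apply] at e1
    linear_combination - e1
  have hker : ∀ p z, (∀ s j, s.card < p + 1 → E z s j = 0) → π.map z = 0 := fun p z hz =>
    (hπ z).2 fun j => by rw [hz ∅ j (by simp), map_zero]
  refine LinFact.isIso_cls_of_contraction π ι hι h hodd (fun x => hker 0 _ (hcard 0 x (by simp)))
    (m + 2) fun x hx => ?_
  have hstep : ∀ n, ∀ s j, s.card < n + 1 → E ((LinFact.perturb h hodd).map^[n + 1] x) s j = 0 :=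
    fun n => by
    induction n with
    | zero =>
      intro s j hs
      rw [Function.iterate_one, hmain x hx, hrest 1 _ (hcard 0 _ (by simp)) s j hs,
        hcard 0 (rest x) (by simp) s j hs, add_zero, neg_zero]
    | succ n ih =>
      intro s j hs
      rw [iterate_succ_apply', hmain _ (hker n _ ih),
        hrest (n + 2) _ (hcard (n + 1) _ ih) s j hs, hcard (n + 1) _ (hrest (n + 1) _ ih) s j hs,
        add_zero, neg_zero]
  refine E.injective (funext fun s => funext fun j => ?_)
  rw [hstep (m + 1) s j ((Finset.card_le_univ s).trans_lt (by rw [card_fin]; omega)), map_zero]; rfl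

end KoszulContraction

section NullHomotopies

open LinFact

lemma LinFact.HomBasis.repr_even {A : Type u} [CommRing A] {w : A} {X : LinFact A w} {I : Type u}
    (e : X.HomBasis I) (x : X.carrier) (i : I) :
    e.basis.repr (X.even x) i = if e.par i = 0 then e.basis.repr x i else 0 := by
  have : Finsupp.lapply i ∘ₗ e.basis.repr.toLinearMap ∘ₗ X.even =
      if e.par i = 0 then Finsupp.lapply i ∘ₗ e.basis.repr.toLinearMap else 0 :=
    e.basis.ext fun j => by
      rw [lcomp_apply, lcomp_apply, e.even_basis]
      by_cases hij : j = i
      · subst hij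
        split_ifs <;> simp
      · have h0 : e.basis.repr (e.basis j) i = 0 := by
          rw [repr_self, Finsupp.single_eq_of_ne (Ne.symm hij)]
        have h1 : ∀ c : Prop, [Decidable c] →
            e.basis.repr (if c then e.basis j else 0) i = 0 := fun c _ => by
          split_ifs
          · exact h0
          · rw [map_zero]; rfl
        refine (h1 _).trans ?_
        split_ifs
        · exact h0.symm
        · rfl
  have := lcongr_fun this x
  rw [lcomp_apply, lcomp_apply] at this
  refine this.trans ?_
  split_ifs <;> rfl

/-- A derivation `δ` of the ring gives a null-homotopy for the action of `δ w` on a matrix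
factorisation of `w`. -/
lemma exists_isNullHomotopy_of_derivation {A : Type u} [CommRing A] {w : A} (X : LinFact A w)
    {I : Type u} (e : X.HomBasis I) (δ : A →+ A) (hδ : ∀ a b, δ (a * b) = δ a * b + a * δ b) :
    ∃ h, IsNullHomotopy X (δ w) h := by
  let con : X.carrier →+ X.carrier :=
    (e.basis.repr.symm.toLinearMap.toAddMonoidHom.comp (Finsupp.mapRange.addMonoidHom δ)).comp
      e.basis.repr.toLinearMap.toAddMonoidHom
  have repr_con : ∀ x, e.basis.repr (con x) = Finsupp.mapRange δ (map_zero δ) (e.basis.repr x) :=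
    fun x => e.basis.repr.apply_symm_apply _
  have con_smul : ∀ a x, con (a • x) = δ a • x + a • con x := fun a x => by
    refine e.basis.repr.injective (Finsupp.ext fun i => ?_)
    rw [repr_con, mapRange_apply, map_smul, map_add, map_smul, map_smul, repr_con,
      fsmul_apply, fadd_apply, fsmul_apply, fsmul_apply,
      mapRange_apply, smul_eq_mul, smul_eq_mul, smul_eq_mul, hδ]
  have h1 : δ 1 = 0 := by have := hδ 1 1; simpa using this
  have con_basis : ∀ i, con (e.basis i) = 0 := fun i => by
    refine e.basis.repr.injective ?_
    rw [repr_con, repr_self, mapRange_single, h1, Finsupp.single_zero, map_zero]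
  have con_even : ∀ x, con (X.even x) = X.even (con x) := fun x => by
    refine e.basis.repr.injective (Finsupp.ext fun i => ?_)
    rw [repr_con, mapRange_apply, e.repr_even, e.repr_even, repr_con, mapRange_apply]
    split_ifs
    · rfl
    · exact map_zero δ
  refine ⟨{ toFun := fun x => con (X.d x) - X.d (con x), map_add' := fun x y => ?_,
            map_smul' := fun a x => ?_ }, fun x => ?_, fun x => ?_⟩
  · simp only [map_add]; abel
  · rw [map_smul, con_smul, con_smul, map_add, map_smul, map_smul, RingHom.id_apply, smul_sub]; abel
  · change X.even (con (X.d x) - X.d (con x)) + (con (X.d (X.even x)) - X.d (con (X.even x))) =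
      con (X.d x) - X.d (con x)
    have h2 : X.d (X.even x) = X.d x - X.even (X.d x) := by rw [X.even_d]; abel
    rw [h2, con_even, map_sub, map_sub, X.even_d (con x), con_even (X.d x)]
    abel
  · change X.d (con (X.d x) - X.d (con x)) + (con (X.d (X.d x)) - X.d (con (X.d x))) = δ w • x
    rw [X.d_sq, con_smul, map_sub, X.d_sq]; abel

/-- A derivation of the left-hand factor of a tensor product of algebras. -/
lemma rTensor_leibniz {k S R : Type u} [CommRing k] [CommRing S] [CommRing R] [Algebra k S]
    [Algebra k R] (D : Derivation k S S) (a b : S ⊗[k] R) : LinearMap.rTensor R D.toLinearMap (a * b) =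
      LinearMap.rTensor R D.toLinearMap a * b + a * LinearMap.rTensor R D.toLinearMap b := by
  induction a using tmul_induction with
  | zero => simp only [zero_mul, map_zero, add_zero]
  | add a a' h h' => rw [add_mul, map_add, h, h', map_add]; ring
  | tmul s r =>
    induction b using tmul_induction with
    | zero => simp only [mul_zero, map_zero, add_zero]
    | add b b' h h' => rw [mul_add, map_add, h, h', map_add]; ring
    | tmul s' r' =>
      have hD : D.toLinearMap (s * s') = s * D s' + s' * D s := D.leibniz s s'
      rw [tmul_mul_tmul, rTensor_tmul, rTensor_tmul, rTensor_tmul, tmul_mul_tmul, tmul_mul_tmul, hD, add_tmul]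
      rw [mul_comm s' (D s), add_comm]; rfl

lemma exists_isNullHomotopy_left {k : Type u} [CommRing k] {A B : Obj k} (X : Fact A B) {I : Type u}
    (e : X.HomBasis I) (j : Fin B.n) : ∃ h, IsNullHomotopy X (pderiv j B.W ⊗ₜ[k] (1 : A.ring)) h := by
  obtain ⟨h, hh⟩ := exists_isNullHomotopy_of_derivation X e
    (LinearMap.rTensor A.ring (pderiv j).toLinearMap).toAddMonoidHom
    (rTensor_leibniz (k := k) (pderiv j))
  have e1 : LinearMap.rTensor A.ring (pderiv j).toLinearMap (pot k B.W A.W) =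
      pderiv j B.W ⊗ₜ[k] (1 : A.ring) := by
    rw [map_sub, rTensor_tmul, rTensor_tmul]
    have : (pderiv (R := k) j).toLinearMap (1 : B.ring) = 0 :=
      (pderiv j).map_one_eq_zero
    rw [this, zero_tmul, sub_zero]; rfl
  exact ⟨h, e1 ▸ hh⟩

end NullHomotopies

section Eliminants

open MvPolynomial

lemma exists_monic_eq_sum {k : Type u} [CommRing k] (A : Obj k) :
    ∃ pC : (Fin A.n → Polynomial k) × Matrix (Fin A.n) (Fin A.n) Pol(A.n, k),
      (∀ i, (pC.1 i).Monic) ∧ ∀ i, paeval (X i) (pC.1 i) = ∑ j, pC.2 i j * pderiv j A.W := by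
  have := A.isPotential.finite
  have h : ∀ i, ∃ (p : Polynomial k) (c : Fin A.n → Pol(A.n, k)), p.Monic ∧
      paeval (X i : Pol(A.n, k)) p = ∑ j, c j * pderiv j A.W := fun i => by
    obtain ⟨p, hp, hp'⟩ := IsIntegral.of_finite k
      (Ideal.Quotient.mk (jacobianIdeal A.W) (X i : Pol(A.n, k)))
    have h1 : paeval (X i : Pol(A.n, k)) p ∈ jacobianIdeal A.W := by
      rw [← Ideal.Quotient.eq_zero_iff_mem]
      have := aeval_algHom_apply (Ideal.Quotient.mkₐ k (jacobianIdeal A.W))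
        (X i : Pol(A.n, k)) p
      exact this.symm.trans hp'
    obtain ⟨c, hc⟩ := (Ideal.mem_span_range_iff_exists_fun).1 h1
    exact ⟨p, c, hp, hc.symm⟩
  choose p c hp hc using h
  exact ⟨(p, c), hp, hc⟩

end Eliminants

section FiniteSummands

open MvPolynomial LinFact

/-- A homogeneous basis from homogeneous coordinates in a free module. -/
def LinFact.HomBasis.ofEquiv {A : Type u} [CommRing A] {w : A} {X : LinFact A w} {K ι N : Type u}
    [Finite K] [AddCommMonoid N] [Module A N] (b : Basis ι A N) (φ : X.carrier ≃ₗ[A] (K → N))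
    (par : K → ZMod 2) (h : ∀ x q, φ (X.even x) q = if par q = 0 then φ x q else 0) : X.HomBasis (Σ _ : K, ι) where
  basis :=
    letI := Fintype.ofFinite K
    (Pi.basis fun _ => b).map φ.symm
  par q := par q.1
  even_basis q := by
    letI := Fintype.ofFinite K
    classical
    refine φ.injective (funext fun i => ?_)
    rw [h, apply_ite φ, Basis.map_apply, apply_symm_apply, map_zero]
    by_cases hi : i = q.1
    · subst hi; split_ifs <;> rfl
    · have : (Pi.basis fun _ : K => b) q i = 0 := by
        rw [Pi.basis_apply, Pi.single_eq_of_ne hi]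
      rw [this, ite_self, apply_ite (fun f : K → N => f i), this]
      exact (ite_self _).symm

variable {k : Type u} [CommRing k] {A B C : Obj k} {I J : Type u} [Fintype I] [Fintype J]
  {Y : Fact B C} {X : Fact A B}

lemma tensorEquiv_even (e : Y.HomBasis I) (f : X.HomBasis J) (z : (tensor Y X).carrier)
    (q : I × J) : tensorEquiv e.basis f.basis ((tensor Y X).even z) q =
      if e.par q.1 + f.par q.2 = 0 then tensorEquiv e.basis f.basis z q else 0 := by
  have hp : ∀ p q : ZMod 2, p + q = 0 ↔ (p = 0 ↔ q = 0) := by decide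
  induction z using tind with
  | ha a b ha hb =>
    simp only [map_add, Pi.add_apply, ha, hb]; split_ifs <;> simp
  | h y x =>
    rw [even_pt, map_add, Pi.add_apply, tensorEquiv_pt, tensorEquiv_pt, tensorEquiv_pt, map_sub,
      map_sub, Finsupp.sub_apply, Finsupp.sub_apply, e.repr_even, f.repr_even]
    simp only [hp]
    by_cases h1 : e.par q.1 = 0 <;> by_cases h2 : f.par q.2 = 0 <;> simp [h1, h2]

lemma tensorEquiv_middle (e : Y.HomBasis I) (f : X.HomBasis J) (s : B.ring)
    (z : (tensor Y X).carrier) (q : I × J) : tensorEquiv e.basis f.basis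
      (tmap (LinearMap.lsmul _ _ ((1 : C.ring) ⊗ₜ[k] s)) LinearMap.id z) q =
      aeval MvPolynomial.X s * tensorEquiv e.basis f.basis z q := by
  induction z using tind with
  | ha a b ha hb => simp only [map_add, Pi.add_apply, ha, hb, mul_add]
  | h y x =>
    rw [tmap_pt, tensorEquiv_pt, tensorEquiv_pt, lsmul_apply, map_smul,
      fsmul_apply, smul_eq_mul, map_mul, midL_tmul, ← tone_def, C_1,
      one_mul, mul_assoc]
    rfl

lemma tmap_sign_odd {Λ : LEnd (B ⊠[k] A) X.carrier}
    (hΛ : ∀ x, X.even (Λ x) + Λ (X.even x) = Λ x) (z : (tensor Y X).carrier) :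
    (tensor Y X).even (tmap Y.sign Λ z) + tmap Y.sign Λ ((tensor Y X).even z) = tmap Y.sign Λ z := by
  induction z using tind with
  | ha a b ha hb => simp only [map_add]; linear_combination (norm := abel) ha + hb
  | h y x =>
    rw [even_pt, tmap_pt, even_pt, map_add, tmap_pt, tmap_pt, eq_sub_of_add_eq (hΛ x)]
    simp only [even_sign, sign_even, map_sub, AddMonoidHom.sub_apply]
    abel

lemma tmap_sign_d {Λ : LEnd (B ⊠[k] A) X.carrier} {s : B.ring}
    (hΛ : ∀ x, X.d (Λ x) + Λ (X.d x) = (s ⊗ₜ[k] (1 : A.ring)) • x) (z : (tensor Y X).carrier) :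
    (tensor Y X).d (tmap Y.sign Λ z) + tmap Y.sign Λ ((tensor Y X).d z) =
      tmap (LinearMap.lsmul _ _ ((1 : C.ring) ⊗ₜ[k] s)) LinearMap.id z := by
  induction z using tind with
  | ha a b ha hb => simp only [map_add]; linear_combination (norm := abel) ha + hb
  | h y x =>
    rw [d_pt, tmap_pt, d_pt, map_add, tmap_pt, tmap_pt, tmap_pt, sign_sign, sign_d,
      lsmul_apply, lid_apply, pt_balanced, ← hΛ, map_add, map_neg,
      AddMonoidHom.neg_apply]
    abel

lemma tmap_sign_middle (Λ : LEnd (B ⊠[k] A) X.carrier) (s : B.ring) (z : (tensor Y X).carrier) :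
    tmap Y.sign Λ (tmap (LinearMap.lsmul _ _ ((1 : C.ring) ⊗ₜ[k] s)) LinearMap.id z) =
      tmap (LinearMap.lsmul _ _ ((1 : C.ring) ⊗ₜ[k] s)) LinearMap.id (tmap Y.sign Λ z) := by
  induction z using tind with
  | ha a b ha hb => simp only [map_add, ha, hb]
  | h y x =>
    rw [tmap_pt, tmap_pt, tmap_pt, tmap_pt, lsmul_apply, lsmul_apply, LinearMap.map_smul Y.sign]
    rfl

lemma exists_null_homotopy_combination (f : X.HomBasis J) (c : Fin B.n → B.ring) :
    ∃ Λ : LEnd (B ⊠[k] A) X.carrier, (∀ x, X.even (Λ x) + Λ (X.even x) = Λ x) ∧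
      ∀ x, X.d (Λ x) + Λ (X.d x) = ((∑ j, c j * pderiv j B.W) ⊗ₜ[k] (1 : A.ring)) • x := by
  choose μ hμ using fun j => exists_isNullHomotopy_left X f j
  refine ⟨∑ j, (c j ⊗ₜ[k] (1 : A.ring)) • μ j, fun x => ?_, fun x => ?_⟩
  · simp only [lsum_apply, map_sum, LinearMap.smul_apply, map_smul, ← sum_add_distrib, ← smul_add, (hμ _).odd]
  · rw [sum_tmul, sum_smul]
    simp only [lsum_apply, map_sum, LinearMap.smul_apply, map_smul, ← sum_add_distrib, ← smul_add, (hμ _).eq, smul_smul,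
      tmul_mul_tmul, mul_one]

lemma exists_division (e : Y.HomBasis I) (f : X.HomBasis J) :
    ∃ (pq : Fin B.n → Polynomial (C ⊠[k] A)) (hpq : ∀ i, (pq i).Monic)
      (P h l : Fin B.n → LEnd (C ⊠[k] A) (tensor Y X).carrier),
      Division (tensor Y X) P h l ∧ ∀ i z q, tensorEquiv e.basis f.basis (h i z) q =
        opX i (divMonic (pq i) (hpq i)) (tensorEquiv e.basis f.basis z q) := by
  obtain ⟨⟨p, c⟩, hp, hpc⟩ := exists_monic_eq_sum B
  simp only at hp hpc
  choose Λ hΛ hΛ' using fun i => exists_null_homotopy_combination f (c i)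
  let Q := C ⊠[k] A
  let E := tensorEquiv e.basis f.basis
  let pq : Fin B.n → Polynomial Q := fun i => (p i).map (algebraMap k Q)
  have hpq : ∀ i, (pq i).Monic := fun i => (hp i).map _
  let P : Fin B.n → LEnd Q (tensor Y X).carrier := fun i =>
    tmap (LinearMap.lsmul _ _ ((1 : C.ring) ⊗ₜ[k] ∑ j, c i j * pderiv j B.W)) LinearMap.id
  let h : Fin B.n → LEnd Q (tensor Y X).carrier := fun i => E.symm.toLinearMap ∘ₗ
    (opX i (divMonic (pq i) (hpq i))).compLeft (I × J) ∘ₗ E.toLinearMap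
  let l : Fin B.n → LEnd Q (tensor Y X).carrier := fun i => tmap Y.sign (Λ i)
  have hE : ∀ i z q, E (h i z) q = opX i (divMonic (pq i) (hpq i)) (E z q) := fun i z q => by
    change E (E.symm _) q = _
    rw [apply_symm_apply]; rfl
  have hP : ∀ i z q, E (P i z) q = opX i (LinearMap.mulLeft Q (pq i)) (E z q) := fun i z q => by
    refine (tensorEquiv_middle e f _ z q).trans ?_
    rw [opX_mulLeft, ← hpc, ← aeval_algHom_apply, aeval_X, Polynomial.aeval_map_algebraMap]
  have hlP : ∀ i j z, l i (P j z) = P j (l i z) := fun i j z => tmap_sign_middle _ _ _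
  have hld : ∀ i z, (tensor Y X).d (l i z) + l i ((tensor Y X).d z) = P i z :=
    fun i z => tmap_sign_d (hΛ' i) z
  have ext : ∀ {z z'}, (∀ q, E z q = E z' q) → z = z' := fun h => E.injective (funext h)
  have heven : ∀ z q, E ((tensor Y X).even z) q = if e.par q.1 + f.par q.2 = 0 then E z q else 0 :=
    tensorEquiv_even e f
  refine ⟨pq, hpq, P, h, l, ⟨fun i z => ext fun q => ?_, fun i z => ext fun q => ?_,
    fun i z => tmap_sign_odd (hΛ i) z, fun i z => ext fun q => ?_, fun i j z hij => ext fun q => ?_,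
    fun i j z => ext fun q => ?_, hlP, hld⟩, hE⟩
  all_goals clear_value P h E
  · rw [hP, heven, heven, hP]; split_ifs
    · rfl
    · exact map_zero _
  · rw [hE, heven, heven, hE]; split_ifs
    · rfl
    · exact map_zero _
  · rw [hE, hP, ← emul_apply, ← opX_mul, divMonic_mulLeft, opX_one]; rfl
  · rw [hE, hP, hP, hE, ← emul_apply, opX_comm hij]; rfl
  · by_cases hij : i = j
    · rw [hij]
    · rw [hE, hE, hE, hE, ← emul_apply, opX_comm hij]; rfl

/-- The tensor product of finite-rank matrix factorisations is a direct summand of a finite-rank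
matrix factorisation. -/
lemma isSummandOfFinite_tensor_of_basis (e : Y.HomBasis I) (f : X.HomBasis J) : (tensor Y X).IsSummandOfFinite := by
  obtain ⟨pq, hpq, P, h, l, D, hE⟩ := exists_division e f
  obtain ⟨Z, j, hj, hrange, hjeven, hret⟩ := D.exists_retract
  let Q := C ⊠[k] A
  let E := tensorEquiv e.basis f.basis
  have ext : ∀ {z z'}, (∀ q, E z q = E z' q) → z = z' := fun h => E.injective (funext h)
  have heven : ∀ z q, E ((tensor Y X).even z) q = if e.par q.1 + f.par q.2 = 0 then E z q else 0 :=
    tensorEquiv_even e f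
  change ∀ i z q, E (h i z) q = opX i (divMonic (pq i) (hpq i)) (E z q) at hE
  clear_value E
  refine ⟨Z, ?_, hret⟩
  let N := restrictSupport Q {u : Fin B.n →₀ ℕ | ∀ i, u i < (pq i).natDegree}
  have hmem : ∀ y q, E (j y) q ∈ N := fun y q =>
    (mem_restrictSupport_iff_divMonic pq hpq _).2 fun i => by
      rw [← hE, (hrange (j y)).1 ⟨y, rfl⟩ i, map_zero]; rfl
  let φ₀ : Z.carrier →ₗ[Q] (I × J → N) := LinearMap.pi fun q =>
    LinearMap.codRestrict N (LinearMap.proj q ∘ₗ E.toLinearMap ∘ₗ j) fun y => hmem y q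
  have hφ₀ : ∀ y q, (φ₀ y q : MidRing k C.ring A.ring B.n) = E (j y) q := fun y q => rfl
  have hbij : Function.Bijective φ₀ := by
    constructor
    · intro y y' hy
      refine hj (ext fun q => ?_)
      rw [← hφ₀, ← hφ₀, hy]
    · intro v
      obtain ⟨y, hy⟩ := (hrange (E.symm fun q => v q)).2 fun i => ext fun q => by
        rw [hE, apply_symm_apply, map_zero]
        exact (mem_restrictSupport_iff_divMonic pq hpq _).1 (v q).2 i
      refine ⟨y, funext fun q => Subtype.ext ?_⟩
      rw [hφ₀, hy, apply_symm_apply]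
  have hfin : Finite {u : Fin B.n →₀ ℕ | ∀ i, u i < (pq i).natDegree} := by
    refine Set.Finite.to_subtype (Set.Finite.subset (Set.finite_Iic
      (Finsupp.equivFunOnFinite.symm fun i => (pq i).natDegree)) fun u hu i => ?_)
    exact (hu i).le
  let b : Basis (ULift.{u} {u : Fin B.n →₀ ℕ | ∀ i, u i < (pq i).natDegree}) Q N :=
    (basisRestrictSupport Q _).reindex Equiv.ulift.symm
  refine ⟨_, inferInstance, ⟨HomBasis.ofEquiv (X := Z) (K := I × J) (N := N) b
    (LinearEquiv.ofBijective φ₀ hbij) (fun q : I × J => e.par q.1 + f.par q.2) fun x q => ?_⟩⟩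
  refine Subtype.ext ?_
  change E (j (Z.even x)) q = _
  rw [hjeven, heven]
  split_ifs <;> rfl

end FiniteSummands

section UnitActions

open MvPolynomial LinFact

lemma map_sg {A A' : Type u} [CommRing A] [CommRing A'] (φ : A →+* A') {n : ℕ} (i : Fin n)
    (s : Finset (Fin n)) : φ (sg A i s) = sg A' i s := by
  rw [sg, sg, map_pow, map_neg, map_one]

lemma koszulD_apply {A : Type u} [CommRing A] {n : ℕ} (a b : Fin n → A) (ω : Finset (Fin n) → A)
    (s : Finset (Fin n)) : koszulD a b ω s = ∑ i, (a i * (if i ∈ s then sg A i s * ω (s.erase i) else 0) +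
      b i * (if i ∈ s then 0 else sg A i s * ω (insert i s))) := by
  rw [koszulD, lsum_apply, Finset.sum_apply]
  rfl

lemma map_koszulD {A A' : Type u} [CommRing A] [CommRing A'] (φ : A →+* A') {n : ℕ} (a b : Fin n → A)
    (ω : Finset (Fin n) → A) (s : Finset (Fin n)) :
    φ (koszulD a b ω s) = koszulD (fun i => φ (a i)) (fun i => φ (b i)) (fun t => φ (ω t)) s := by
  simp only [koszulD_apply, map_sum, map_add, map_mul, apply_ite φ, map_zero, map_sg]

lemma koszulD_add_coeff {A : Type u} [CommRing A] {n : ℕ} (a b : Fin n → A) :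
    koszulD a b = koszulD 0 b + koszulD a 0 := by
  simp only [koszulD, sum_add_distrib, Pi.zero_apply, zero_smul, sum_const_zero, zero_add, add_zero]
  rw [add_comm]

lemma koszulD_mul_right {A : Type u} [CommRing A] {n : ℕ} (a b : Fin n → A)
    (ω : Finset (Fin n) → A) (c : A) (s : Finset (Fin n)) : koszulD a b ω s * c = koszulD a b (fun t => ω t * c) s := by
  have := congrFun (map_smul (koszulD a b) c ω) s
  rw [Pi.smul_apply, smul_eq_mul, mul_comm] at this
  rw [← this]
  refine congrFun (congrArg _ (funext fun t => ?_)) s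
  rw [Pi.smul_apply, smul_eq_mul, mul_comm]

lemma neg_one_pow_val_add {R : Type*} [CommRing R] (p q : ZMod 2) :
    (-1 : R) ^ (p + q).val = (-1) ^ p.val * (-1) ^ q.val := by
  have h : ∀ p q : ZMod 2, ((p + q).val + (p.val + q.val)) % 2 = 0 := by decide
  rw [← pow_add, neg_one_pow_eq_pow_mod_two, neg_one_pow_eq_pow_mod_two (p.val + q.val)]
  congr 1
  have := h p q
  omega

lemma neg_one_pow_val_natCast {R : Type*} [CommRing R] (n : ℕ) : (-1 : R) ^ (n : ZMod 2).val = (-1) ^ n := by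
  rw [ZMod.val_natCast, ← neg_one_pow_eq_pow_mod_two]

lemma LinFact.HomBasis.repr_sign {A : Type u} [CommRing A] {w : A} {X : LinFact A w} {I : Type u}
    (e : X.HomBasis I) (x : X.carrier) (i : I) :
    e.basis.repr (X.sign x) i = (-1) ^ (e.par i).val * e.basis.repr x i := by
  rw [sign_apply, map_sub, map_add, Finsupp.sub_apply, fadd_apply, e.repr_even]
  have h2 : ∀ p : ZMod 2, p = 0 ∨ p = 1 := by decide
  rcases h2 (e.par i) with h | h
  · rw [h]; simp
  · rw [h]
    have : (1 : ZMod 2).val = 1 := rfl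
    simp [this]

/-- Coordinates of the image under a linear map. -/
lemma repr_map_eq_sum {A M N I J : Type u} [CommRing A] [AddCommGroup M] [AddCommGroup N]
    [Module A M] [Module A N] [Fintype I] (e : Basis I A M) (f : Basis J A N) (g : M →ₗ[A] N)
    (x : M) (j : J) : f.repr (g x) j = ∑ i, f.repr (g (e i)) j * e.repr x i := by
  conv_lhs => rw [← e.sum_repr x]
  simp only [map_sum, map_smul, Finsupp.finsetSum_apply, fsmul_apply, smul_eq_mul, mul_comm]

variable {k : Type u} [CommRing k] {A B : Obj k}

section Left

variable {X : Fact A B} {J : Type u} [Fintype J] (f : X.HomBasis J)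

/-- Coordinates on `Δ ⊗ X`. -/
def lamEquiv : (tensor (delta B) X).carrier ≃ₗ[B ⊠[k] A] (Finset (Fin B.n) → J → MidRing k B.ring A.ring B.n) :=
  tensorEquiv (deltaBasis B).basis f.basis ≪≫ₗ
    (LinearEquiv.funCongrLeft _ _ (Equiv.prodCongr Equiv.ulift.symm (Equiv.refl J))) ≪≫ₗ
      LinearEquiv.curry _ _ _ _

lemma lamEquiv_pt (ω : (delta B).carrier) (x : X.carrier) (s : Finset (Fin B.n)) (j : J) :
    lamEquiv f (pt ω x) s j = midL k B.ring A.ring B.n (ω s) * midR k B.ring A.ring B.n (f.basis.repr x j) :=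
  tensorEquiv_pt _ _ _ _ _

lemma delta_sign_apply (ω : (delta B).carrier) (s : Finset (Fin B.n)) : (delta B).sign ω s = (-1) ^ s.card * ω s := by
  have := (deltaBasis B).repr_sign ω ⟨s⟩
  refine this.trans ?_
  change (-1) ^ ((s.card : ℕ) : ZMod 2).val * _ = _
  rw [neg_one_pow_val_natCast]; rfl

lemma lamEquiv_d (z : (tensor (delta B) X).carrier) (s : Finset (Fin B.n)) (j : J) :
    lamEquiv f ((tensor (delta B) X).d z) s j =
      koszulD (fun i => midL k B.ring A.ring B.n (diffQuot k (varL k) (varR k) i B.W))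
        (fun i => midL k B.ring A.ring B.n (varL k i - varR k i)) (fun t => lamEquiv f z t j) s +
      (-1) ^ s.card * ∑ j', midR k B.ring A.ring B.n (f.basis.repr (X.d (f.basis j')) j) * lamEquiv f z s j' := by
  induction z using tind with
  | ha a b ha hb =>
    have h : (fun t => lamEquiv f (a + b) t j) =
        (fun t => lamEquiv f a t j) + fun t => lamEquiv f b t j := by
      ext1 t; rw [map_add]; rfl
    rw [map_add, map_add, Pi.add_apply, Pi.add_apply, ha, hb, h, map_add, Pi.add_apply]
    simp only [map_add, Pi.add_apply, mul_add, sum_add_distrib]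
    ring
  | h ω x =>
    rw [d_pt, map_add, Pi.add_apply, Pi.add_apply, lamEquiv_pt, lamEquiv_pt, delta_sign_apply]
    have h1 := map_koszulD (midL k B.ring A.ring B.n).toRingHom
      (fun i => diffQuot k (varL k) (varR k) i B.W) (fun i => varL k i - varR k i) ω s
    have h2 := congrArg (midR k B.ring A.ring B.n) (repr_map_eq_sum f.basis f.basis X.d x j)
    simp only [map_sum, map_mul] at h2
    change midL k B.ring A.ring B.n (koszulD _ _ ω s) * _ + _ = _
    change midL k B.ring A.ring B.n (koszulD _ _ ω s) = koszulD _ _ _ s at h1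
    rw [h1, koszulD_mul_right, h2, map_mul, map_pow, map_neg, map_one]
    simp only [lamEquiv_pt]
    rw [mul_assoc, mul_sum]
    refine congrArg₂ _ rfl (congrArg _ (sum_congr rfl fun j' _ => ?_))
    rw [mul_left_comm]

lemma eval_midL (x : B ⊠[k] B) :
    eval (fun i => (MvPolynomial.X i : B.ring) ⊗ₜ[k] (1 : A.ring)) (midL k B.ring A.ring B.n x) =
      mulMap B x ⊗ₜ[k] 1 := by
  induction x using tmul_induction with
  | zero => rw [map_zero, map_zero, map_zero, zero_tmul]
  | add x y hx hy => rw [map_add, map_add, map_add, hx, hy, add_tmul]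
  | tmul s t =>
    rw [midL_tmul, map_mul, eval_C, lmul'_apply_tmul]
    have : ((eval (fun i => (MvPolynomial.X i : B.ring) ⊗ₜ[k] (1 : A.ring))).comp
        (aeval (MvPolynomial.X : Fin B.n → MidRing k B.ring A.ring B.n) : B.ring →ₐ[k] _).toRingHom) =
        (includeLeft : B.ring →ₐ[k] B ⊠[k] A).toRingHom := by
      refine ringHom_ext (fun c => ?_) fun i => ?_
      · change eval _ (aeval MvPolynomial.X (C c)) = (C c) ⊗ₜ 1
        rw [← algebraMap_eq, AlgHom.commutes, IsScalarTower.algebraMap_apply k (B ⊠[k] A)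
          (MidRing k B.ring A.ring B.n), algebraMap_eq, eval_C]; rfl
      · change eval _ (aeval MvPolynomial.X (MvPolynomial.X i)) = (MvPolynomial.X i) ⊗ₜ 1
        rw [aeval_X, eval_X]
    have := RingHom.congr_fun this t
    change eval _ (aeval MvPolynomial.X t) = t ⊗ₜ 1 at this
    rw [this, tmul_mul_tmul, one_mul]

lemma eval_midR (x : B ⊠[k] A) :
    eval (fun i => (MvPolynomial.X i : B.ring) ⊗ₜ[k] (1 : A.ring)) (midR k B.ring A.ring B.n x) = x := by
  have : ((aeval (fun i => (MvPolynomial.X i : B.ring) ⊗ₜ[k] (1 : A.ring))).restrictScalars k).comp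
      (midR k B.ring A.ring B.n) = AlgHom.id k (B ⊠[k] A) := by
    refine Algebra.TensorProduct.ext (algHom_ext fun i => ?_) (AlgHom.ext fun r => ?_)
    · change aeval _ (midR k B.ring A.ring B.n (MvPolynomial.X i ⊗ₜ 1)) = MvPolynomial.X i ⊗ₜ 1
      rw [midR_tmul, map_mul, aeval_X, aeval_X, ← tone_def, C_1, map_one, mul_one]
    · change aeval _ (midR k B.ring A.ring B.n (1 ⊗ₜ r)) = 1 ⊗ₜ r
      rw [midR_tmul, map_one, one_mul, aeval_C]; rfl
  exact AlgHom.congr_fun this x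

lemma repr_lamMap (z : (tensor (delta B) X).carrier) (j : J) : f.basis.repr (lamMap X z) j =
    eval (fun i => (MvPolynomial.X i : B.ring) ⊗ₜ[k] (1 : A.ring)) (lamEquiv f z ∅ j) := by
  induction z using tind with
  | ha a b ha hb => rw [map_add, map_add, map_add, fadd_apply, ha, hb]; exact (map_add _ _ _).symm
  | h ω x =>
    rw [lamMap_pt, lamEquiv_pt, map_smul, fsmul_apply, map_mul, eval_midL, eval_midR]
    rfl

end Left

lemma C_sub_X_eq {Q : Type u} [CommRing Q] {m : ℕ} (c : Q) (i : Fin m) :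
    (C c - MvPolynomial.X i : Pol(m, Q)) = (-1 : Q) • (MvPolynomial.X i - C c) := by
  rw [smul_eq_C_mul, C_neg, C_1]; ring

lemma isIso_lamHom_of_basis {X : Fact A B} {J : Type u} [Fintype J] (f : X.HomBasis J) : IsIso (cls (lamHom X)) := by
  let c : Fin B.n → B ⊠[k] A := fun i => MvPolynomial.X i ⊗ₜ 1
  have hb : (fun i => midL k B.ring A.ring B.n (varL k i - varR k i)) =
      fun i => (-1 : B ⊠[k] A) • (MvPolynomial.X i - C (c i)) := by
    ext1 i
    rw [map_sub, varL, varR, midL_tmul, midL_tmul, map_one, mul_one, aeval_X, ← tone_def, C_1, one_mul]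
    exact C_sub_X_eq _ _
  refine isIso_cls_of_koszul c (a := -1) (by ring) (lamEquiv f) f.par ?_
    (fun z => (lamEquiv f).symm fun s j => koszulD (fun i => midL k B.ring A.ring B.n
      (diffQuot k (varL k) (varR k) i B.W)) 0 (fun t => lamEquiv f z t j) s +
      (-1) ^ s.card * ∑ j', midR k B.ring A.ring B.n (f.basis.repr (X.d (f.basis j')) j) *
        lamEquiv f z s j') ?_ ?_ (lamHom X) ?_
    (f.basis.constr (B ⊠[k] A) fun j =>
      (pt ((deltaBasis B).basis (ULift.up ∅)) (f.basis j) : (tensor (delta B) X).carrier)) ?_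
  · intro z s j
    exact tensorEquiv_even (deltaBasis B) f z (ULift.up s, j)
  · intro z s j
    rw [apply_symm_apply, lamEquiv_d, koszulLin_apply, ← hb, koszulD_add_coeff]
    rw [ladd_apply, Pi.add_apply, add_assoc]
  · intro p z hz s j hs
    rw [apply_symm_apply, koszulD_apply, sum_eq_zero, sum_eq_zero, mul_zero, zero_add]
    · intro j' _
      rw [hz s j' hs, mul_zero]
    · intro i _
      rw [Pi.zero_apply, zero_mul, add_zero]
      split_ifs with h
      · rw [hz _ _ ((Finset.card_erase_le).trans_lt hs), mul_zero, mul_zero]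
      · rw [mul_zero]
  · intro z
    change lamMap X z = 0 ↔ _
    rw [← f.basis.repr.map_eq_zero_iff]
    constructor
    · intro h j
      have := repr_lamMap f z j
      rw [h] at this
      exact this.symm
    · intro h
      refine Finsupp.ext fun j => ?_
      rw [repr_lamMap]; exact h j
  · intro x
    have : (lamHom X).map ∘ₗ (f.basis.constr (B ⊠[k] A) fun j =>
        (pt ((deltaBasis B).basis (ULift.up ∅)) (f.basis j) : (tensor (delta B) X).carrier)) =
        LinearMap.id := by
      refine f.basis.ext fun j => ?_
      rw [lcomp_apply, constr_basis]
      change lamMap X _ = f.basis j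
      rw [lamMap_pt]
      have : counit B ((deltaBasis B).basis ⟨∅⟩) = 1 := by
        change mulMap B ((((Pi.basisFun (B ⊠[k] B) (Finset (Fin B.n))).reindex
          (Equiv.ulift.{u}).symm) ⟨∅⟩) ∅) = 1
        rw [reindex_apply, symm_symm, ulift_apply, Pi.basisFun_apply, Pi.single_eq_same, map_one]
      rw [this]
      exact one_smul _ _
    exact lcongr_fun this x

section Right

variable {X : Fact A B} {I : Type u} [Fintype I] (e : X.HomBasis I)

/-- Coordinates on `X ⊗ Δ`, with a sign twist. -/
def rhoEquiv : (tensor X (delta A)).carrier ≃ₗ[B ⊠[k] A] (Finset (Fin A.n) → I → MidRing k B.ring A.ring A.n) :=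
  tensorEquiv e.basis (deltaBasis A).basis ≪≫ₗ
    (LinearEquiv.funCongrLeft _ _ ((Equiv.prodComm _ _).trans
      (Equiv.prodCongr (Equiv.refl I) Equiv.ulift.symm))) ≪≫ₗ
      LinearEquiv.curry _ _ _ _ ≪≫ₗ
    LinearEquiv.piCongrRight fun s => LinearEquiv.piCongrRight fun i =>
      LinearEquiv.smulOfUnit (((-1 : (B ⊠[k] A)ˣ) ^ (e.par i).val) ^ s.card)

lemma rhoEquiv_eq (z : (tensor X (delta A)).carrier) (s : Finset (Fin A.n)) (i : I) :
    rhoEquiv e z s i = ((-1) ^ (e.par i).val) ^ s.card * tensorEquiv e.basis (deltaBasis A).basis z (i, ⟨s⟩) := by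
  have : rhoEquiv e z s i = (((-1 : (B ⊠[k] A)ˣ) ^ (e.par i).val) ^ s.card) •
    tensorEquiv e.basis (deltaBasis A).basis z (i, ⟨s⟩) := rfl
  rw [this, smul_def, smul_eq_C_mul]
  push_cast
  rw [C_pow, C_pow, C_neg, C_1]

lemma rhoEquiv_pt (ω : (delta A).carrier) (x : X.carrier) (s : Finset (Fin A.n)) (i : I) :
    rhoEquiv e (pt x ω) s i = ((-1) ^ (e.par i).val) ^ s.card *
      (midL k B.ring A.ring A.n (e.basis.repr x i) * midR k B.ring A.ring A.n (ω s)) := by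
  rw [rhoEquiv_eq, tensorEquiv_pt]; rfl

lemma koszulD_twist {A : Type u} [CommRing A] {n : ℕ} (a b : Fin n → A) (ω : Finset (Fin n) → A)
    (s : Finset (Fin n)) {c : A} (hc : c * c = 1) :
    c ^ (s.card + 1) * koszulD a b ω s = koszulD a b (fun t => c ^ t.card * ω t) s := by
  rw [koszulD_apply, koszulD_apply, mul_sum]
  refine sum_congr rfl fun i _ => ?_
  by_cases h : i ∈ s
  · have h1 : c ^ (s.card + 1) = c ^ (s.erase i).card := by
      rw [← card_erase_add_one h, pow_succ, pow_succ, mul_assoc, hc, mul_one]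
    rw [if_pos h, if_pos h, if_pos h, if_pos h, h1]
    ring
  · rw [if_neg h, if_neg h, if_neg h, if_neg h, card_insert_of_notMem h]
    ring

lemma rhoEquiv_d (z : (tensor X (delta A)).carrier) (s : Finset (Fin A.n)) (i : I) :
    rhoEquiv e ((tensor X (delta A)).d z) s i =
      koszulD (fun i => midR k B.ring A.ring A.n (diffQuot k (varL k) (varR k) i A.W))
        (fun i => midR k B.ring A.ring A.n (varL k i - varR k i)) (fun t => rhoEquiv e z t i) s +
      ((-1) ^ (e.par i).val) ^ s.card * ∑ i', midL k B.ring A.ring A.n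
        (e.basis.repr (X.d (e.basis i')) i) * (((-1) ^ (e.par i').val) ^ s.card * rhoEquiv e z s i') := by
  have hs : ∀ (p : ZMod 2) {R : Type u} [CommRing R], ((-1 : R) ^ p.val) * (-1) ^ p.val = 1 :=
    fun p R _ => by rw [← pow_add, ← two_mul, pow_mul]; simp
  induction z using tind with
  | ha a b ha hb =>
    have h : (fun t => rhoEquiv e (a + b) t i) =
        (fun t => rhoEquiv e a t i) + fun t => rhoEquiv e b t i := by
      ext1 t; rw [map_add]; rfl
    rw [map_add, map_add, Pi.add_apply, Pi.add_apply, ha, hb, h, map_add, Pi.add_apply]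
    simp only [map_add, Pi.add_apply, mul_add, sum_add_distrib]
    ring
  | h x ω =>
    rw [d_pt, map_add, Pi.add_apply, Pi.add_apply, rhoEquiv_pt, rhoEquiv_pt, e.repr_sign]
    have h1 := map_koszulD (midR k B.ring A.ring A.n).toRingHom
      (fun i => diffQuot k (varL k) (varR k) i A.W) (fun i => varL k i - varR k i) ω s
    have h2 := congrArg (midL k B.ring A.ring A.n) (repr_map_eq_sum e.basis e.basis X.d x i)
    simp only [map_sum, map_mul] at h2
    change _ + _ * (_ * midR k B.ring A.ring A.n (koszulD _ _ ω s)) = _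
    change midR k B.ring A.ring A.n (koszulD _ _ ω s) = koszulD _ _ _ s at h1
    rw [h1, h2, map_mul, map_pow, map_neg, map_one, add_comm]
    refine congrArg₂ _ ?_ ?_
    · have h3 : (fun t => rhoEquiv e (pt x ω) t i) = midL k B.ring A.ring A.n (e.basis.repr x i) •
          fun t => ((-1) ^ (e.par i).val) ^ t.card * midR k B.ring A.ring A.n (ω t) := by
        ext1 t
        rw [rhoEquiv_pt, Pi.smul_apply, smul_eq_mul, mul_left_comm]
      rw [h3, map_smul, Pi.smul_apply, ← koszulD_twist _ _ _ _ (hs (e.par i)), smul_eq_mul]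
      simp only [AlgHom.toRingHom_eq_coe, RingHom.coe_coe]
      ring
    · rw [sum_mul]
      refine congrArg _ (sum_congr rfl fun i' _ => ?_)
      have h4 : ((((-1) ^ (e.par i').val) ^ s.card) * (((-1) ^ (e.par i').val) ^ s.card) :
          MidRing k B.ring A.ring A.n) = 1 := by rw [← mul_pow, hs, one_pow]
      rw [rhoEquiv_pt]
      generalize (midR k B.ring A.ring A.n) (ω s) = y
      linear_combination (-(midL k B.ring A.ring A.n (e.basis.repr (X.d (e.basis i')) i)) *
        (midL k B.ring A.ring A.n) (e.basis.repr x i') * y) * h4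

lemma eval_midR' (x : A ⊠[k] A) :
    eval (fun i => (1 : B.ring) ⊗ₜ[k] (MvPolynomial.X i : A.ring)) (midR k B.ring A.ring A.n x) =
      1 ⊗ₜ[k] mulMap A x := by
  have : ((aeval (fun i => (1 : B.ring) ⊗ₜ[k] (MvPolynomial.X i : A.ring))).restrictScalars k).comp
      (midR k B.ring A.ring A.n) = (includeRight :
        A.ring →ₐ[k] B ⊠[k] A).comp (mulMap A) := by
    refine Algebra.TensorProduct.ext (algHom_ext fun i => ?_) (AlgHom.ext fun r => ?_)
    · change aeval _ (midR k B.ring A.ring A.n (MvPolynomial.X i ⊗ₜ 1)) = 1 ⊗ₜ mulMap A (MvPolynomial.X i ⊗ₜ 1)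
      rw [midR_tmul, map_mul, aeval_X, aeval_X, ← tone_def, C_1, map_one, mul_one, lmul'_apply_tmul, mul_one]
    · change aeval _ (midR k B.ring A.ring A.n (1 ⊗ₜ r)) = 1 ⊗ₜ mulMap A (1 ⊗ₜ r)
      rw [midR_tmul, map_one, one_mul, aeval_C, lmul'_apply_tmul, one_mul]; rfl
  exact AlgHom.congr_fun this x

lemma eval_midL' (x : B ⊠[k] A) :
    eval (fun i => (1 : B.ring) ⊗ₜ[k] (MvPolynomial.X i : A.ring)) (midL k B.ring A.ring A.n x) = x := by
  have : ((aeval (fun i => (1 : B.ring) ⊗ₜ[k] (MvPolynomial.X i : A.ring))).restrictScalars k).comp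
      (midL k B.ring A.ring A.n) = AlgHom.id k (B ⊠[k] A) := by
    refine Algebra.TensorProduct.ext (AlgHom.ext fun r => ?_) (algHom_ext fun i => ?_)
    · change aeval _ (midL k B.ring A.ring A.n (r ⊗ₜ 1)) = r ⊗ₜ 1
      rw [midL_tmul, map_one, mul_one, aeval_C]; rfl
    · change aeval _ (midL k B.ring A.ring A.n (1 ⊗ₜ MvPolynomial.X i)) = 1 ⊗ₜ MvPolynomial.X i
      rw [midL_tmul, map_mul, aeval_X, aeval_X, ← tone_def, C_1, map_one, one_mul]
  exact AlgHom.congr_fun this x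

lemma repr_rhoMap (z : (tensor X (delta A)).carrier) (i : I) : e.basis.repr (rhoMap X z) i =
    eval (fun i => (1 : B.ring) ⊗ₜ[k] (MvPolynomial.X i : A.ring)) (rhoEquiv e z ∅ i) := by
  induction z using tind with
  | ha a b ha hb => rw [map_add, map_add, map_add, fadd_apply, ha, hb]; exact (map_add _ _ _).symm
  | h x ω =>
    rw [rhoMap_pt, rhoEquiv_pt, map_smul, fsmul_apply, map_mul, map_mul, eval_midL', eval_midR',
      card_empty, pow_zero, map_one, one_mul, mul_comm]
    rfl

end Right

lemma isIso_rhoHom_of_basis {X : Fact A B} {I : Type u} [Fintype I] (e : X.HomBasis I) : IsIso (cls (rhoHom X)) := by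
  let c : Fin A.n → B ⊠[k] A := fun i => 1 ⊗ₜ MvPolynomial.X i
  have hb : (fun i => midR k B.ring A.ring A.n (varL k i - varR k i)) =
      fun i => (1 : B ⊠[k] A) • (MvPolynomial.X i - C (c i)) := by
    ext1 i
    rw [map_sub, varL, varR, midR_tmul, midR_tmul, map_one, one_mul, aeval_X, ← tone_def, C_1, mul_one, one_smul]
  refine isIso_cls_of_koszul c (a := 1) (by ring) (rhoEquiv e) e.par ?_
    (fun z => (rhoEquiv e).symm fun s i => koszulD (fun i => midR k B.ring A.ring A.n
      (diffQuot k (varL k) (varR k) i A.W)) 0 (fun t => rhoEquiv e z t i) s +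
      ((-1) ^ (e.par i).val) ^ s.card * ∑ i', midL k B.ring A.ring A.n
        (e.basis.repr (X.d (e.basis i')) i) * (((-1) ^ (e.par i').val) ^ s.card * rhoEquiv e z s i'))
    ?_ ?_ (rhoHom X) ?_
    (e.basis.constr (B ⊠[k] A) fun j =>
      (pt (e.basis j) ((deltaBasis A).basis (ULift.up ∅)) : (tensor X (delta A)).carrier)) ?_
  · intro z s i
    rw [rhoEquiv_eq, rhoEquiv_eq, tensorEquiv_even]
    change _ * (if e.par i + (s.card : ZMod 2) = 0 then _ else _) = _
    rw [add_comm (e.par i)]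
    split_ifs
    · rfl
    · exact mul_zero _
  · intro z s j
    rw [apply_symm_apply, rhoEquiv_d, koszulLin_apply, ← hb, koszulD_add_coeff]
    rw [ladd_apply, Pi.add_apply, add_assoc]
  · intro p z hz s j hs
    rw [apply_symm_apply, koszulD_apply, sum_eq_zero, sum_eq_zero, mul_zero, zero_add]
    · intro j' _
      rw [hz s j' hs, mul_zero, mul_zero]
    · intro i _
      rw [Pi.zero_apply, zero_mul, add_zero]
      split_ifs with h
      · rw [hz _ _ ((Finset.card_erase_le).trans_lt hs), mul_zero, mul_zero]
      · rw [mul_zero]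
  · intro z
    change rhoMap X z = 0 ↔ _
    rw [← e.basis.repr.map_eq_zero_iff]
    constructor
    · intro h j
      have := repr_rhoMap e z j
      rw [h] at this
      exact this.symm
    · intro h
      refine Finsupp.ext fun j => ?_
      rw [repr_rhoMap]; exact h j
  · intro x
    have : (rhoHom X).map ∘ₗ (e.basis.constr (B ⊠[k] A) fun j =>
        (pt (e.basis j) ((deltaBasis A).basis (ULift.up ∅)) : (tensor X (delta A)).carrier)) =
        LinearMap.id := by
      refine e.basis.ext fun j => ?_
      rw [lcomp_apply, constr_basis]
      change rhoMap X _ = e.basis j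
      rw [rhoMap_pt]
      have : counit A ((deltaBasis A).basis ⟨∅⟩) = 1 := by
        change mulMap A ((((Pi.basisFun (A ⊠[k] A) (Finset (Fin A.n))).reindex
          (Equiv.ulift.{u}).symm) ⟨∅⟩) ∅) = 1
        rw [reindex_apply, symm_symm, ulift_apply, Pi.basisFun_apply, Pi.single_eq_same, map_one]
      rw [this]
      exact one_smul _ _
    exact lcongr_fun this x

end UnitActions

section WellDefined

open LinFact

variable {k : Type u} [CommRing k]

/-- A natural transformation between endofunctors restricts to retracts. -/
lemma isIso_of_retract {C : Type*} [Category C] {X F TX TF : C} {φX : TX ⟶ X} {φF : TF ⟶ F}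
    [IsIso φF] {s : X ⟶ F} {r : F ⟶ X} {ts : TX ⟶ TF} {tr : TF ⟶ TX} (h : s ≫ r = 𝟙 X)
    (ht : ts ≫ tr = 𝟙 TX) (h1 : ts ≫ φF = φX ≫ s) (h2 : tr ≫ φX = φF ≫ r) : IsIso φX := by
  refine ⟨s ≫ inv φF ≫ tr, ?_, ?_⟩
  · rw [← assoc, ← h1, assoc, IsIso.hom_inv_id_assoc, ht]
  · rw [assoc, assoc, h2, IsIso.inv_hom_id_assoc, h]

theorem lgWellDefined (k : Type u) [CommRing k] : LGWellDefined k where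
  isMF_tensor Y X := isMF_tensor Y.isMF X.isMF
  isSummand_tensor Y X := by
    obtain ⟨F, ⟨I, hI, ⟨e⟩⟩, s, r, h⟩ := Y.isSummand
    obtain ⟨G, ⟨J, hJ, ⟨f⟩⟩, s', r', h'⟩ := X.isSummand
    have := Fintype.ofFinite I
    have := Fintype.ofFinite J
    obtain ⟨Z, hZ, t, q, hq⟩ := isSummandOfFinite_tensor_of_basis e f
    refine ⟨Z, hZ, tensorCls s s' ≫ t, q ≫ tensorCls r r', ?_⟩
    rw [assoc, ← assoc t, hq, id_comp, ← tensorCls_comp, h, h', tensorCls_id]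
  isIso_lam X := by
    obtain ⟨G, ⟨J, hJ, ⟨f⟩⟩, s, r, h⟩ := X.isSummand
    have := Fintype.ofFinite J
    have := isIso_lamHom_of_basis f
    refine isIso_of_retract h (ts := tensorCls (𝟙 _) s) (tr := tensorCls (𝟙 _) r) ?_
      (lam_natural s) (lam_natural r)
    rw [← tensorCls_comp, h, Category.comp_id, tensorCls_id]
  isIso_rho X := by
    obtain ⟨G, ⟨J, hJ, ⟨f⟩⟩, s, r, h⟩ := X.isSummand
    have := Fintype.ofFinite J
    have := isIso_rhoHom_of_basis f
    refine isIso_of_retract h (ts := tensorCls s (𝟙 _)) (tr := tensorCls r (𝟙 _)) ?_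
      (rho_natural s) (rho_natural r)
    rw [← tensorCls_comp, h, Category.comp_id, tensorCls_id]

end WellDefined

section OrderedProducts

variable {P : Type*} {𝓐 : Type*} [CommRing P] [Ring 𝓐] [Algebra P 𝓐] {m : ℕ}

/-- The product of the `a i`, `i ∈ s`, in increasing order. -/
def oprod (a : Fin m → 𝓐) (s : Finset (Fin m)) : 𝓐 := (List.ofFn (s.piecewise a 1)).prod

lemma oprod_univ (a : Fin m → 𝓐) : oprod a univ = (List.ofFn a).prod := by
  rw [oprod, Finset.piecewise_univ]

lemma oprod_empty (a : Fin m → 𝓐) : oprod a ∅ = 1 := by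
  rw [oprod, Finset.piecewise_empty]
  refine List.prod_eq_one fun x hx => ?_
  obtain ⟨i, rfl⟩ := (List.mem_ofFn' _ _).1 hx
  rfl

lemma ofFn_update {α : Type*} (v : Fin m → α) (i : Fin m) (c : α) :
    List.ofFn (Function.update v i c) = (List.ofFn v).set i c := by
  refine List.ext_getElem (by simp) fun j h1 h2 => ?_
  rw [getElem_ofFn, List.getElem_set, Function.update_apply]
  by_cases h : (i : ℕ) = j
  · rw [if_pos h, if_pos (Fin.ext h.symm)]
  · rw [if_neg h, if_neg fun h' => h (congrArg Fin.val h').symm, getElem_ofFn]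

lemma prod_ofFn_update (v : Fin m → 𝓐) (i : Fin m) (c : 𝓐) : (List.ofFn (Function.update v i c)).prod =
      ((List.ofFn v).take i).prod * c * ((List.ofFn v).drop (i + 1)).prod := by
  rw [ofFn_update, List.prod_set, if_pos (by simp)]

lemma prod_take_ofFn_succ (v : Fin m → 𝓐) (i : Fin m) : ((List.ofFn v).take (i + 1)).prod =
    ((List.ofFn v).take i).prod * v i := by
  rw [List.prod_take_succ _ _ (by simp), getElem_ofFn]

lemma prod_drop_ofFn (v : Fin m → 𝓐) (i : Fin m) : ((List.ofFn v).drop i).prod =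
    v i * ((List.ofFn v).drop (i + 1)).prod := by
  rw [List.drop_eq_getElem_cons (by simp), prod_cons, getElem_ofFn]

lemma oprod_insert (a : Fin m → 𝓐) (s : Finset (Fin m)) (i : Fin m) : oprod a (insert i s) =
    ((List.ofFn (s.piecewise a 1)).take i).prod * a i * ((List.ofFn (s.piecewise a 1)).drop (i + 1)).prod := by
  rw [oprod, Finset.piecewise_insert, prod_ofFn_update]

lemma piecewise_erase {α : Type*} (a b : Fin m → α) (s : Finset (Fin m)) (i : Fin m) :
    (s.erase i).piecewise a b = Function.update (s.piecewise a b) i (b i) := by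
  ext1 j
  rw [Function.update_apply]
  by_cases h : j = i
  · subst h; simp
  · rw [if_neg h]
    simp [Finset.piecewise, h]

lemma oprod_erase (a : Fin m → 𝓐) (s : Finset (Fin m)) (i : Fin m) : oprod a (s.erase i) =
    ((List.ofFn (s.piecewise a 1)).take i).prod * ((List.ofFn (s.piecewise a 1)).drop (i + 1)).prod := by
  rw [oprod, piecewise_erase, prod_ofFn_update, Pi.one_apply, mul_one]

/-- The sign `(-1)^{#{i ∈ s, i < j}}`. -/
def sgNat (s : Finset (Fin m)) (j : ℕ) : ℤˣ := (-1) ^ (s.filter fun i : Fin m => (i : ℕ) < j).card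

lemma sgNat_succ (s : Finset (Fin m)) (i : Fin m) : sgNat s (i + 1) = if i ∈ s then - sgNat s i else sgNat s i := by
  rw [sgNat, sgNat]
  have h : (s.filter fun j : Fin m => (j : ℕ) < i + 1) =
      if i ∈ s then insert i (s.filter fun j : Fin m => (j : ℕ) < i) else
        s.filter fun j : Fin m => (j : ℕ) < i := by
    ext j
    have key : (j : ℕ) < i + 1 ↔ j = i ∨ (j : ℕ) < i := by rw [Fin.ext_iff]; omega
    split_ifs with hi
    · simp only [mem_filter, Finset.mem_insert, key]
      constructor
      · rintro ⟨h1, h2 | h2⟩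
        · exact Or.inl h2
        · exact Or.inr ⟨h1, h2⟩
      · rintro (rfl | ⟨h1, h2⟩)
        · exact ⟨hi, Or.inl rfl⟩
        · exact ⟨h1, Or.inr h2⟩
    · simp only [mem_filter, key]
      constructor
      · rintro ⟨h1, h2 | h2⟩
        · exact absurd (h2 ▸ h1) hi
        · exact ⟨h1, h2⟩
      · exact fun h => ⟨h.1, Or.inr h.2⟩
  rw [h]
  split_ifs with hi
  · rw [card_insert_of_notMem (by simp), pow_succ, mul_neg, mul_one]
  · rfl

lemma sgNat_zero (s : Finset (Fin m)) : sgNat s 0 = 1 := by simp [sgNat]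

lemma sgNat_of_le (s : Finset (Fin m)) : sgNat s m = (-1) ^ s.card := by
  rw [sgNat, Finset.filter_true_of_mem fun i _ => i.2]

lemma sg_eq_sgNat (s : Finset (Fin m)) (i : Fin m) {A : Type u} [CommRing A] : sg A i s = ((sgNat s i : ℤ) : A) := by
  rw [sg, sgNat]
  push_cast
  rfl

/-- The graded commutator of a deformed element with ordered products. -/
lemma mul_oprod (D : ℕ → 𝓐) (A : Fin m → 𝓐) (t g : Fin m → P) (h1 : ∀ i : Fin m, D i - D (i + 1) = t i • A i)
    (h2 : ∀ i : Fin m, D i * A i + A i * D (i + 1) = algebraMap P 𝓐 (g i)) (s : Finset (Fin m)) :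
    D 0 * oprod A s = ((-1 : ℤˣ) ^ s.card) • (oprod A s * D m) +
      ∑ i : Fin m, sgNat s i • (if i ∈ s then g i • oprod A (s.erase i) else t i • oprod A (insert i s)) := by
  set L := List.ofFn (s.piecewise A 1) with hL
  let T : ℕ → 𝓐 := fun j => sgNat s j • ((L.take j).prod * D j * (L.drop j).prod)
  have hT : ∀ i : Fin m, T i - T (i + 1) = sgNat s i •
      (if i ∈ s then g i • oprod A (s.erase i) else t i • oprod A (insert i s)) := fun i => by
    change sgNat s i • _ - sgNat s (i + 1) • _ = _
    rw [sgNat_succ, hL, prod_take_ofFn_succ, prod_drop_ofFn, ← hL, oprod_erase, oprod_insert, ← hL]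
    split_ifs with hi
    · rw [Finset.piecewise_eq_of_mem _ _ _ hi]
      have := congrArg (fun x => (L.take i).prod * x * (L.drop (i + 1)).prod) (h2 i)
      simp only [Algebra.algebraMap_eq_smul_one, mul_smul_comm, smul_mul_assoc, mul_one] at this
      rw [← this, uneg_smul, sub_neg_eq_add, ← smul_add]
      congr 1
      noncomm_ring
    · rw [Finset.piecewise_eq_of_notMem _ _ _ hi, Pi.one_apply, one_mul, mul_one, ← smul_sub]
      have := congrArg (fun x => (L.take i).prod * x * (L.drop (i + 1)).prod) (h1 i)
      simp only [mul_smul_comm, smul_mul_assoc] at this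
      rw [← this]
      congr 1
      noncomm_ring
  rw [← sum_congr rfl fun i _ => hT i, Fin.sum_univ_eq_sum_range (fun j => T j - T (j + 1)), Finset.sum_range_sub']
  have h0 : T 0 = D 0 * oprod A s := by
    change sgNat s 0 • _ = _
    rw [sgNat_zero, one_smul, List.take_zero, prod_nil, one_mul, drop_zero]; rfl
  have hm : T m = ((-1 : ℤˣ) ^ s.card) • (oprod A s * D m) := by
    change sgNat s m • _ = _
    rw [sgNat_of_le, List.take_of_length_le (by simp [hL]), drop_of_length_le (by simp [hL]), prod_nil, mul_one]; rfl
  rw [h0, hm]; abel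

/-- The product of the `a i`, `i ∈ s`, in decreasing order. -/
def doprod (a : Fin m → 𝓐) (s : Finset (Fin m)) : 𝓐 :=
  MulOpposite.unop (oprod (fun i => MulOpposite.op (a i)) s)

lemma doprod_empty (a : Fin m → 𝓐) : doprod a ∅ = 1 := by
  rw [doprod, oprod_empty, MulOpposite.unop_one]

lemma doprod_mul (D : ℕ → 𝓐) (A : Fin m → 𝓐) (t g : Fin m → P) (h1 : ∀ i : Fin m, D i - D (i + 1) = t i • A i)
    (h2 : ∀ i : Fin m, A i * D i + D (i + 1) * A i = algebraMap P 𝓐 (g i)) (s : Finset (Fin m)) :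
    doprod A s * D 0 = ((-1 : ℤˣ) ^ s.card) • (D m * doprod A s) +
      ∑ i : Fin m, sgNat s i • (if i ∈ s then g i • doprod A (s.erase i) else t i • doprod A (insert i s)) := by
  have := congrArg MulOpposite.unop (mul_oprod (𝓐 := 𝓐ᵐᵒᵖ) (fun i => MulOpposite.op (D i))
    (fun i => MulOpposite.op (A i)) t g (fun i => by rw [← MulOpposite.op_sub, h1]; rfl)
    (fun i => by rw [← MulOpposite.op_mul, ← MulOpposite.op_mul, ← MulOpposite.op_add, h2]; rfl) s)
  rw [MulOpposite.unop_mul, MulOpposite.unop_add, MulOpposite.unop_smul, MulOpposite.unop_mul, Finset.unop_sum] at this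
  refine this.trans (congrArg₂ _ rfl (sum_congr rfl fun i _ => ?_))
  rw [MulOpposite.unop_smul]
  split_ifs <;> rfl

lemma prod_ofFn_mul (u v : Fin m → 𝓐) (h : ∀ i j, Commute (u i) (v j)) :
    (List.ofFn fun i => u i * v i).prod = (List.ofFn u).prod * (List.ofFn v).prod := by
  induction m with
  | zero => simp
  | succ m ih =>
    rw [ofFn_succ, ofFn_succ, ofFn_succ, prod_cons, prod_cons, prod_cons, ih _ _ fun i j => h _ _]
    have : Commute (List.ofFn fun i : Fin m => u i.succ).prod (v 0) :=
      Commute.list_prod_left _ _ fun x hx => by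
        obtain ⟨i, rfl⟩ := (List.mem_ofFn' _ _).1 hx
        exact h _ _
    rw [mul_assoc, mul_assoc, ← mul_assoc (v 0), ← this.eq, mul_assoc]

lemma prod_ofFn_add (u v : Fin m → 𝓐) (h : ∀ i j, Commute (u i) (v j)) :
    (List.ofFn fun i => u i + v i).prod = ∑ s, oprod u s * oprod v sᶜ := by
  have := (MultilinearMap.mkPiAlgebraFin ℤ m 𝓐).map_add_univ u v
  simp only [MultilinearMap.mkPiAlgebraFin_apply] at this
  refine this.trans (sum_congr rfl fun s _ => ?_)
  rw [oprod, oprod, ← prod_ofFn_mul]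
  · congr 2
    ext1 i
    by_cases hi : i ∈ s <;> simp [hi]
  · intro i j
    by_cases hi : i ∈ s <;> by_cases hj : j ∈ s <;> simp [hi, hj, h]

lemma map_oprod {𝓑 : Type*} [Ring 𝓑] (φ : 𝓐 →+* 𝓑) (a : Fin m → 𝓐) (s : Finset (Fin m)) :
    φ (oprod a s) = oprod (fun i => φ (a i)) s := by
  rw [oprod, oprod, map_list_prod, List.map_ofFn]
  congr 2
  ext1 i
  by_cases hi : i ∈ s <;> simp [hi]

lemma map_doprod {𝓑 : Type*} [Ring 𝓑] (φ : 𝓐 →+* 𝓑) (a : Fin m → 𝓐) (s : Finset (Fin m)) :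
    φ (doprod a s) = doprod (fun i => φ (a i)) s := by
  have := map_oprod φ.op (fun i => MulOpposite.op (a i)) s
  exact congrArg MulOpposite.unop this

lemma oprod_smul (c : Fin m → ℤˣ) (a : Fin m → 𝓐) (s : Finset (Fin m)) :
    oprod (fun i => c i • a i) s = (∏ i ∈ s, c i) • oprod a s := by
  have h1 : ∀ (v : Fin m → ℤˣ) (w : Fin m → 𝓐), (List.ofFn fun i => v i • w i).prod =
      (∏ i, v i) • (List.ofFn w).prod := fun v w => by
    clear c a s
    induction m with
    | zero => simp
    | succ m ih =>
      rw [ofFn_succ, ofFn_succ, prod_cons, prod_cons, ih, Fin.prod_univ_succ, smul_mul_smul_comm]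
  have h2 : (s.piecewise (fun i => c i • a i) 1) =
      fun i => (if i ∈ s then c i else 1) • s.piecewise a 1 i := by
    ext1 i
    by_cases hi : i ∈ s <;> simp [hi]
  rw [oprod, oprod, h2, h1]
  congr 1
  rw [Finset.prod_ite_mem, Finset.univ_inter]

lemma oprod_mulLeft (a : Fin m → 𝓐) (s : Finset (Fin m)) (y : 𝓐) : oprod (fun i => mulLeft (a i)) s y = oprod a s * y :=
  (DFunLike.congr_fun (map_oprod (Module.toAddMonoidEnd 𝓐 𝓐) a s) y).symm

lemma oprod_mulRight (a : Fin m → 𝓐) (s : Finset (Fin m)) (y : 𝓐) :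
    oprod (fun i => mulRight (a i)) s y = y * doprod a s :=
  (DFunLike.congr_fun (map_oprod (Module.toAddMonoidEnd 𝓐ᵐᵒᵖ 𝓐)
    (fun i => MulOpposite.op (a i)) s) y).symm

lemma doprod_mulLeft (a : Fin m → 𝓐) (s : Finset (Fin m)) (y : 𝓐) :
    doprod (fun i => mulLeft (a i)) s y = doprod a s * y :=
  (DFunLike.congr_fun (map_doprod (Module.toAddMonoidEnd 𝓐 𝓐) a s) y).symm

lemma doprod_op (a : Fin m → 𝓐) (s : Finset (Fin m)) :
    doprod (fun i => MulOpposite.op (a i)) s = MulOpposite.op (oprod a s) := by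
  have := congrArg MulOpposite.unop (map_oprod (RingEquiv.opOp 𝓐).toRingHom a s)
  exact this.symm

lemma doprod_mulRight (a : Fin m → 𝓐) (s : Finset (Fin m)) (y : 𝓐) :
    doprod (fun i => mulRight (a i)) s y = y * oprod a s := by
  have := DFunLike.congr_fun (map_doprod (Module.toAddMonoidEnd 𝓐ᵐᵒᵖ 𝓐)
    (fun i => MulOpposite.op (a i)) s) y
  rw [doprod_op] at this
  exact this.symm

lemma doprod_smul (c : Fin m → ℤˣ) (a : Fin m → 𝓐) (s : Finset (Fin m)) :
    doprod (fun i => c i • a i) s = (∏ i ∈ s, c i) • doprod a s :=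
  congrArg MulOpposite.unop (oprod_smul c (fun i => MulOpposite.op (a i)) s)

lemma prod_ofFn_add_reverse (u v : Fin m → 𝓐) (h : ∀ i j, Commute (u i) (v j)) :
    (List.ofFn fun i => u i + v i).reverse.prod = ∑ s, doprod v sᶜ * doprod u s := by
  have := congrArg MulOpposite.unop (prod_ofFn_add (fun i => MulOpposite.op (u i))
    (fun i => MulOpposite.op (v i)) fun i j => (h i j).op)
  rw [Finset.unop_sum, MulOpposite.unop_list_prod, List.map_ofFn] at this
  exact this

/-- Nested sums of left and right multiplications. -/
lemma prod_ofFn_mulLeft_add_mulRight (c : Fin m → ℤˣ) (a : Fin m → 𝓐) (x : 𝓐) :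
    (List.ofFn fun i => mulLeft (a i) + c i • mulRight (a i)).prod x =
      ∑ s, (∏ i ∈ sᶜ, c i) • (oprod a s * x * doprod a sᶜ) := by
  rw [prod_ofFn_add]
  · refine (finsetSum_apply _ _ _).trans (sum_congr rfl fun s _ => ?_)
    rw [oprod_smul]
    change oprod (fun i => mulLeft (a i)) s
      ((∏ i ∈ sᶜ, c i) • oprod (fun i => mulRight (a i)) sᶜ x) = _
    rw [oprod_mulLeft, oprod_mulRight, mul_smul_comm, mul_assoc]
  · intro i j
    refine AddMonoidHom.ext fun y => ?_
    change a i * (c j • (y * a j)) = c j • ((a i * y) * a j)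
    rw [mul_smul_comm, mul_assoc]

lemma prod_reverse_ofFn_mulLeft_add_mulRight (c : Fin m → ℤˣ) (a : Fin m → 𝓐) (x : 𝓐) :
    (List.ofFn fun i => mulLeft (a i) + c i • mulRight (a i)).reverse.prod x =
      ∑ s, (∏ i ∈ s, c i) • (doprod a sᶜ * x * oprod a s) := by
  rw [prod_ofFn_add_reverse]
  · refine (finsetSum_apply _ _ _).trans ?_
    rw [← (compl_bijective (α := Finset (Fin m))).sum_comp]
    refine sum_congr rfl fun s _ => ?_
    rw [doprod_smul, compl_compl]
    change (∏ i ∈ s, c i) • doprod (fun i => mulRight (a i)) s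
      (doprod (fun i => mulLeft (a i)) sᶜ x) = _
    rw [doprod_mulLeft, doprod_mulRight]
  · intro i j
    refine AddMonoidHom.ext fun y => ?_
    change a i * (c j • (y * a j)) = c j • ((a i * y) * a j)
    rw [mul_smul_comm, mul_assoc]

end OrderedProducts

section NestedCommutators

variable {P : Type*} {𝓐 : Type*} [CommRing P] [Ring 𝓐] [Algebra P 𝓐] {m : ℕ}

lemma mulLeft_add_mulRight_boundary {D E A : 𝓐} {t g : P} (e : ℤˣ) (h0 : D - E = t • A)
    (h1 : D * A + A * E = algebraMap P 𝓐 g) (h2 : A * D + E * A = algebraMap P 𝓐 g) (H : 𝓐) :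
    A * (E * H - e • (H * E)) + e • ((E * H - e • (H * E)) * A) =
      D * (e • (H * A) - A * H) + e • ((e • (H * A) - A * H) * D) := by
  have hE : E = D - t • A := by rw [← h0]; abel
  have a1 : A * E = algebraMap P 𝓐 g - D * A := by rw [← h1]; abel
  have a2 : E * A = algebraMap P 𝓐 g - A * D := by rw [← h2]; abel
  have c1 : algebraMap P 𝓐 g * H = H * algebraMap P 𝓐 g := Algebra.commutes _ _
  have ht : t • (A * H * A) = A * H * (t • A) ∧ t • (A * H * A) = (t • A) * (H * A) := by
    constructor
    · rw [mul_smul_comm]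
    · rw [smul_mul_assoc, mul_assoc]
  have ee : e = 1 ∨ e = -1 := Int.units_eq_one_or e
  have b1 : A * (E * H) = algebraMap P 𝓐 g * H - D * A * H := by rw [← mul_assoc, a1, sub_mul]
  have b2 : H * E * A = H * algebraMap P 𝓐 g - H * A * D := by
    rw [mul_assoc, a2, mul_sub, mul_assoc]
  have b3 : A * (H * E) = A * H * D - t • (A * H * A) := by
    rw [← mul_assoc, hE, mul_sub, ← ht.1]
  have b4 : E * H * A = D * (H * A) - t • (A * H * A) := by
    rw [mul_assoc, hE, sub_mul, ← ht.2]
  rcases ee with rfl | rfl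
  · simp only [one_smul, mul_sub, sub_mul, b1, b2, b3, b4, c1]
    noncomm_ring
  · simp only [uneg_smul, one_smul, sub_neg_eq_add, mul_add, add_mul, mul_sub, sub_mul, b1, b2, b3, b4, c1]
    noncomm_ring

/-- Congruence modulo a subgroup and graded commutators with `D`. -/
def CommRel (N : AddSubgroup 𝓐) (D : 𝓐) (e : ℤˣ) (x y : 𝓐) : Prop :=
  ∃ H, x - y - (D * H + e • (H * D)) ∈ N

lemma ideal_smul_mul_mem {J : Ideal P} {x : 𝓐} (hx : x ∈ J • (⊤ : Submodule P 𝓐)) (a b : 𝓐) :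
    a * x * b ∈ J • (⊤ : Submodule P 𝓐) := by
  induction hx using Submodule.smul_induction_on' with
  | smul r hr n _ =>
    rw [mul_smul_comm, smul_mul_assoc]
    exact smul_mem_smul hr trivial
  | add x _ y _ hx hy => rw [mul_add, add_mul]; exact Submodule.add_mem _ hx hy

lemma commRel_step {J : Ideal P} {φf φt δ : 𝓐 →+ 𝓐} {M : 𝓐} {t g : P} {e : ℤˣ}
    (hδ₁ : ∀ x, δ (M * x) = δ M * φf x + φt M * δ x) (hδ₂ : ∀ x, δ (x * M) = δ x * φt M + φf x * δ M)
    (h0 : φt M - φf M = t • δ M) (h1 : φt M * δ M + δ M * φf M = algebraMap P 𝓐 g)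
    (h2 : δ M * φt M + φf M * δ M = algebraMap P 𝓐 g) {Γ' Γ n : 𝓐} {p r : P}
    (hΓ : M * Γ' + e • (Γ' * M) = p • Γ + n) (hn : δ n ∈ J • (⊤ : Submodule P 𝓐))
    (hp : δ (p • Γ) - r • φt Γ ∈ J • (⊤ : Submodule P 𝓐)) {x : 𝓐} {ρ : P}
    (hx : CommRel (J • (⊤ : Submodule P 𝓐)).toAddSubgroup (φf M) (-e) x (ρ • φf Γ')) :
    CommRel (J • (⊤ : Submodule P 𝓐)).toAddSubgroup (φt M) e
      ((mulLeft (δ M) + e • mulRight (δ M)) x) ((ρ * r) • φt Γ) := by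
  obtain ⟨H, hH⟩ := hx
  have key := congrArg δ hΓ
  rw [map_add, map_add, smul_def, map_zsmul, ← smul_def, hδ₁, hδ₂] at key
  have hb := mulLeft_add_mulRight_boundary e h0 h1 h2 H
  refine ⟨(e • (H * δ M) - δ M * H) - ρ • δ Γ', ?_⟩
  set N := J • (⊤ : Submodule P 𝓐)
  set v := x - ρ • φf Γ' - (φf M * H + -e • (H * φf M)) with hv
  have hv' : δ M * v + e • (v * δ M) ∈ N := by
    refine N.add_mem ?_ ?_
    · have := ideal_smul_mul_mem hH (δ M) 1
      rwa [mul_one] at this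
    · have := ideal_smul_mul_mem hH 1 (δ M)
      rw [one_mul] at this
      rw [smul_def]
      exact N.toAddSubgroup.zsmul_mem this _
  have h3 := N.add_mem hv' (N.add_mem (N.smul_mem ρ hn) (N.smul_mem ρ hp))
  refine (congrArg (· ∈ N) ?_).mp h3
  have hx : x = v + ρ • φf Γ' + (φf M * H - e • (H * φf M)) := by
    rw [hv, uneg_smul]; abel
  change _ = (δ M * x + e • (x * δ M)) - (ρ * r) • φt Γ - (φt M * ((e • (H * δ M) - δ M * H) - ρ • δ Γ') +
    e • (((e • (H * δ M) - δ M * H) - ρ • δ Γ') * φt M))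
  have hk := congrArg (fun y => ρ • y) key
  simp only [smul_add, smul_comm ρ e] at hk
  have e1 : δ M * x + e • (x * δ M) = (δ M * v + e • (v * δ M)) +
      (ρ • (δ M * φf Γ') + e • ρ • (φf Γ' * δ M)) +
      (φt M * (e • (H * δ M) - δ M * H) + e • ((e • (H * δ M) - δ M * H) * φt M)) := by
    rw [← hb, hx]
    simp only [mul_add, add_mul, smul_add, mul_smul_comm, smul_mul_assoc]
    abel
  rw [e1, smul_sub, mul_smul]
  simp only [mul_sub, sub_mul, smul_sub, mul_smul_comm, smul_mul_assoc] at hk ⊢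
  rcases Int.units_eq_one_or e with he | he
  · simp only [he, one_smul] at hk ⊢
    linear_combination (norm := module) -hk
  · simp only [he, one_smul, uneg_smul] at hk ⊢
    linear_combination (norm := module) -hk

/-- Nested commutators, taken in decreasing order. -/
lemma exists_nested {J : Ideal P} (φ : ℕ → 𝓐 →+ 𝓐) (δ : Fin m → 𝓐 →+ 𝓐) (M : 𝓐) (t g : Fin m → P)
    (hδ₁ : ∀ (i : Fin m) x, δ i (M * x) = δ i M * φ (i + 1) x + φ i M * δ i x)
    (hδ₂ : ∀ (i : Fin m) x, δ i (x * M) = δ i x * φ i M + φ (i + 1) x * δ i M)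
    (h0 : ∀ i : Fin m, φ i M - φ (i + 1) M = t i • δ i M)
    (h1 : ∀ i : Fin m, φ i M * δ i M + δ i M * φ (i + 1) M = algebraMap P 𝓐 (g i))
    (h2 : ∀ i : Fin m, δ i M * φ i M + φ (i + 1) M * δ i M = algebraMap P 𝓐 (g i)) (Γ : ℕ → 𝓐) (p r : Fin m → P)
    (hΓ : ∀ i : Fin m, ∃ n, M * Γ (i + 1) + ((-1 : ℤˣ) ^ (i : ℕ)) • (Γ (i + 1) * M) = p i • Γ i + n ∧
      δ i n ∈ J • (⊤ : Submodule P 𝓐)) (hp : ∀ i x, δ i (p i • x) - r i • φ i x ∈ J • (⊤ : Submodule P 𝓐)) :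
    CommRel (J • (⊤ : Submodule P 𝓐)).toAddSubgroup (φ 0 M) 1 ((List.ofFn fun i : Fin m => mulLeft (δ i M) +
        ((-1 : ℤˣ) ^ (i : ℕ)) • mulRight (δ i M)).prod (φ m (Γ m))) ((∏ i, r i) • φ 0 (Γ 0)) := by
  set L := List.ofFn fun i : Fin m => mulLeft (δ i M) +
    ((-1 : ℤˣ) ^ (i : ℕ)) • mulRight (δ i M) with hL
  have key : ∀ i ≤ m, CommRel (J • (⊤ : Submodule P 𝓐)).toAddSubgroup (φ i M) ((-1) ^ i)
      ((L.drop i).prod (φ m (Γ m))) (((List.ofFn r).drop i).prod • φ i (Γ i)) := by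
    intro i hi
    induction hi using Nat.decreasingInduction with
    | self =>
      rw [drop_of_length_le (by simp [hL]), drop_of_length_le (by simp), prod_nil, prod_nil, one_smul]
      refine ⟨0, ?_⟩
      simp
    | of_succ i hi ih =>
      obtain ⟨n, hn, hn'⟩ := hΓ ⟨i, hi⟩
      have e1 := prod_drop_ofFn (fun i : Fin m => mulLeft (δ i M) + ((-1 : ℤˣ) ^ (i : ℕ)) • mulRight (δ i M)) ⟨i, hi⟩
      have e2 := prod_drop_ofFn r ⟨i, hi⟩
      rw [← hL] at e1
      simp only at e1 e2
      rw [e1, e2, mul_comm (r _)]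
      rw [pow_succ, mul_neg, mul_one] at ih
      exact commRel_step (hδ₁ ⟨i, hi⟩) (hδ₂ ⟨i, hi⟩) (h0 ⟨i, hi⟩) (h1 ⟨i, hi⟩) (h2 ⟨i, hi⟩) hn hn'
        (hp ⟨i, hi⟩ _) ih
  have := key 0 (Nat.zero_le _)
  rwa [drop_zero, drop_zero, List.prod_ofFn, pow_zero] at this

/-- Nested commutators, taken in increasing order. -/
lemma exists_nested_reverse {J : Ideal P} (φ : ℕ → 𝓐 →+ 𝓐) (δ : Fin m → 𝓐 →+ 𝓐) (M : 𝓐) (t g : Fin m → P)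
    (hδ₁ : ∀ (i : Fin m) x, δ i (M * x) = δ i M * φ i x + φ (i + 1) M * δ i x)
    (hδ₂ : ∀ (i : Fin m) x, δ i (x * M) = δ i x * φ (i + 1) M + φ i x * δ i M)
    (h0 : ∀ i : Fin m, φ i M - φ (i + 1) M = t i • δ i M)
    (h1 : ∀ i : Fin m, φ i M * δ i M + δ i M * φ (i + 1) M = algebraMap P 𝓐 (g i))
    (h2 : ∀ i : Fin m, δ i M * φ i M + φ (i + 1) M * δ i M = algebraMap P 𝓐 (g i)) (Γ : ℕ → 𝓐) (p r : Fin m → P)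
    (hΓ : ∀ i : Fin m, ∃ n, M * Γ i + ((-1 : ℤˣ) ^ (i + m + 1 : ℕ)) • (Γ i * M) = p i • Γ (i + 1) + n ∧
      δ i n ∈ J • (⊤ : Submodule P 𝓐)) (hp : ∀ i x, δ i (p i • x) - r i • φ (i + 1) x ∈ J • (⊤ : Submodule P 𝓐)) :
    CommRel (J • (⊤ : Submodule P 𝓐)).toAddSubgroup (φ m M) 1 ((List.ofFn fun i : Fin m => mulLeft (δ i M) +
        ((-1 : ℤˣ) ^ (i + m + 1 : ℕ)) • mulRight (δ i M)).reverse.prod (φ 0 (Γ 0))) ((∏ i, r i) • φ m (Γ m)) := by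
  set L := List.ofFn fun i : Fin m => mulLeft (δ i M) +
    ((-1 : ℤˣ) ^ (i + m + 1 : ℕ)) • mulRight (δ i M) with hL
  have key : ∀ i ≤ m, CommRel (J • (⊤ : Submodule P 𝓐)).toAddSubgroup (φ i M) ((-1) ^ (i + m))
      ((L.take i).reverse.prod (φ 0 (Γ 0))) (((List.ofFn r).take i).prod • φ i (Γ i)) := by
    intro i hi
    induction i with
    | zero =>
      rw [List.take_zero, List.take_zero, List.reverse_nil, prod_nil, prod_nil, one_smul]
      refine ⟨0, ?_⟩
      simp
    | succ i ih =>
      obtain ⟨n, hn, hn'⟩ := hΓ ⟨i, hi⟩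
      have e1 : (L.take (i + 1)).reverse.prod = (mulLeft (δ ⟨i, hi⟩ M) +
          ((-1 : ℤˣ) ^ (i + m + 1 : ℕ)) • mulRight (δ ⟨i, hi⟩ M)) *
            (L.take i).reverse.prod := by
        rw [List.take_succ_eq_append_getElem (by simpa [hL] using hi), List.reverse_append,
          List.prod_append, List.reverse_singleton, List.prod_singleton]
        simp [hL]
      have e2 := prod_take_ofFn_succ r ⟨i, hi⟩
      simp only at e2
      rw [e1, e2]
      have ih := ih (Nat.le_of_succ_le hi)
      have e3 : ((-1 : ℤˣ) ^ (i + m)) = - (-1) ^ (i + m + 1) := by rw [pow_succ, mul_neg, mul_one, neg_neg]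
      rw [e3] at ih
      rw [add_right_comm]
      refine commRel_step (t := - t ⟨i, hi⟩) (g := g ⟨i, hi⟩) (hδ₁ ⟨i, hi⟩) (hδ₂ ⟨i, hi⟩) ?_ ?_ ?_ hn hn'
        (hp ⟨i, hi⟩ _) ih
      · rw [neg_smul, ← h0, neg_sub]
      · rw [← h2 ⟨i, hi⟩, add_comm]
      · rw [← h1 ⟨i, hi⟩, add_comm]
  have := key m le_rfl
  rwa [List.take_of_length_le (by simp [hL]), List.take_of_length_le (by simp), List.prod_ofFn,
    Even.neg_one_pow ⟨m, rfl⟩] at this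

end NestedCommutators

section PartialSubstitution

open MvPolynomial

variable {K : Type u} [CommRing K] {m : ℕ} (b : Fin m → K)

/-- The substitution of the constants `b j` for the first `i` variables. -/
def subst (i : ℕ) : Pol(m, K) →ₐ[K] Pol(m, K) :=
  aeval fun j : Fin m => if (j : ℕ) < i then C (b j) else X j

/-- The `i`-th difference quotient between the variables and the constants `b j`. -/
def dquot (i : Fin m) : Pol(m, K) →ₗ[K] Pol(m, K) :=
  diffQuot K X (fun j => C (b j)) i

lemma subst_zero (f : Pol(m, K)) : subst b 0 f = f := by
  have : subst b 0 = AlgHom.id K _ := algHom_ext fun i => by rw [subst, aeval_X]; simp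
  rw [this]; rfl

lemma subst_last (f : Pol(m, K)) : subst b m f = C (eval b f) := by
  have : subst b m = (Algebra.ofId K Pol(m, K)).comp (aeval b) :=
    algHom_ext fun i => by
      rw [subst, aeval_X, if_pos i.2, AlgHom.comp_apply, aeval_X]; rfl
  rw [this]; rfl

lemma X_sub_C_mul_dquot (i : Fin m) (f : Pol(m, K)) :
    (X i - C (b i)) * dquot b i f = subst b i f - subst b (i + 1) f := by
  refine (diffQuot_mul X (fun j => C (b j)) i f).trans ?_
  rw [subst, subst]
  simp only [Fin.lt_def, Fin.le_def, Nat.lt_succ_iff]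

lemma X_sub_C_mul_cancel (i : Fin m) {f g : Pol(m, K)} (h : (X i - C (b i)) * f = (X i - C (b i)) * g) : f = g := by
  have key : ∀ f, linDiv b (1 : K) i ((X i - C (b i)) * f) = f := fun f => by
    have := lcongr_fun (linDiv_linMul b (a := (1 : K)) (by ring) i) f
    rwa [emul_apply, linMul_apply, one_smul] at this
  rw [← key f, h, key]

lemma dquot_mul (i : Fin m) (f g : Pol(m, K)) :
    dquot b i (f * g) = dquot b i f * subst b (i + 1) g + subst b i f * dquot b i g := by
  refine X_sub_C_mul_cancel b i ?_
  rw [mul_add, ← mul_assoc, mul_left_comm _ (subst b i f), X_sub_C_mul_dquot, X_sub_C_mul_dquot,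
    X_sub_C_mul_dquot, map_mul, map_mul]
  ring

lemma dquot_mul' (i : Fin m) (f g : Pol(m, K)) :
    dquot b i (f * g) = dquot b i f * subst b i g + subst b (i + 1) f * dquot b i g := by
  rw [mul_comm, dquot_mul]; ring

lemma subst_aeval_X (i : ℕ) (j : Fin m) (p : Polynomial K) : subst b i (paeval (X j) p) =
      paeval (if (j : ℕ) < i then C (b j) else X j : Pol(m, K)) p := by
  rw [← aeval_algHom_apply, subst, aeval_X]

lemma dquot_aeval_of_ne {i j : Fin m} (h : j ≠ i) (p : Polynomial K) : dquot b i (paeval (X j) p) = 0 := by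
  refine X_sub_C_mul_cancel b i ?_
  rw [X_sub_C_mul_dquot, subst_aeval_X, subst_aeval_X, mul_zero, sub_eq_zero]
  have : ((j : ℕ) < i + 1) ↔ (j : ℕ) < i := by
    have : (j : ℕ) ≠ i := fun h' => h (Fin.ext h')
    omega
  simp only [this]

lemma dquot_aeval_self (i : Fin m) (p : Polynomial K) : dquot b i (paeval (X i) p) =
    ∑ n ∈ range (p.natDegree + 1), C (p.coeff n) * ∑ s ∈ range n, X i ^ s * C (b i) ^ (n - 1 - s) := by
  refine X_sub_C_mul_cancel b i ?_
  rw [X_sub_C_mul_dquot, subst_aeval_X, subst_aeval_X, if_neg (lt_irrefl _), if_pos (Nat.lt_succ_self _),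
    Polynomial.aeval_eq_sum_range, Polynomial.aeval_eq_sum_range, ← Finset.sum_sub_distrib,
    mul_sum]
  refine sum_congr rfl fun n _ => ?_
  rw [smul_eq_C_mul, smul_eq_C_mul, ← mul_sub, mul_left_comm, ← geom_sum₂_mul, mul_comm (X i - C (b i))]

variable {I : Type u} [Fintype I] [DecidableEq I]

/-- Substitution in matrices. -/
def substMat (i : ℕ) : Matrix I I Pol(m, K) →+* Matrix I I Pol(m, K) :=
  (subst b i).toRingHom.mapMatrix

/-- Difference quotients of matrices. -/
def dquotMat (i : Fin m) : Matrix I I Pol(m, K) →+ Matrix I I Pol(m, K) :=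
  (dquot b i).toAddMonoidHom.mapMatrix

lemma substMat_apply (i : ℕ) (M : Matrix I I Pol(m, K)) (p q : I) : substMat b i M p q = subst b i (M p q) := rfl

lemma dquotMat_apply (i : Fin m) (M : Matrix I I Pol(m, K)) (p q : I) : dquotMat b i M p q = dquot b i (M p q) := rfl

lemma substMat_zero (M : Matrix I I Pol(m, K)) : substMat b 0 M = M := by
  refine Matrix.ext fun p q => ?_
  rw [substMat_apply, subst_zero]

lemma substMat_smul (i : ℕ) (c : Pol(m, K)) (M : Matrix I I Pol(m, K)) :
    substMat b i (c • M) = subst b i c • substMat b i M := by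
  refine Matrix.ext fun p q => ?_
  rw [substMat_apply, msmul_apply, msmul_apply, smul_eq_mul, smul_eq_mul, map_mul]; rfl

lemma X_sub_C_smul_dquotMat (i : Fin m) (M : Matrix I I Pol(m, K)) :
    substMat b i M - substMat b (i + 1) M = (X i - C (b i) : Pol(m, K)) • dquotMat b i M := by
  refine Matrix.ext fun p q => ?_
  rw [Matrix.sub_apply, msmul_apply, smul_eq_mul, dquotMat_apply, X_sub_C_mul_dquot]; rfl

lemma dquotMat_mul (i : Fin m) (M N : Matrix I I Pol(m, K)) :
    dquotMat b i (M * N) = dquotMat b i M * substMat b (i + 1) N + substMat b i M * dquotMat b i N := by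
  refine Matrix.ext fun p q => ?_
  rw [dquotMat_apply, mmul_apply, map_sum, Matrix.add_apply, mmul_apply, mmul_apply, ← sum_add_distrib]
  exact sum_congr rfl fun j _ => dquot_mul b i _ _

lemma dquotMat_mul' (i : Fin m) (M N : Matrix I I Pol(m, K)) :
    dquotMat b i (M * N) = dquotMat b i M * substMat b i N + substMat b (i + 1) M * dquotMat b i N := by
  refine Matrix.ext fun p q => ?_
  rw [dquotMat_apply, mmul_apply, map_sum, Matrix.add_apply, mmul_apply, mmul_apply, ← sum_add_distrib]
  exact sum_congr rfl fun j _ => dquot_mul' b i _ _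

lemma dquotMat_smul (i : Fin m) (c : Pol(m, K)) (M : Matrix I I Pol(m, K)) :
    dquotMat b i (c • M) = dquot b i c • substMat b (i + 1) M + subst b i c • dquotMat b i M := by
  refine Matrix.ext fun p q => ?_
  rw [dquotMat_apply, msmul_apply, smul_eq_mul, dquot_mul]; rfl

lemma dquotMat_smul' (i : Fin m) (c : Pol(m, K)) (M : Matrix I I Pol(m, K)) :
    dquotMat b i (c • M) = dquot b i c • substMat b i M + subst b (i + 1) c • dquotMat b i M := by
  refine Matrix.ext fun p q => ?_
  rw [dquotMat_apply, msmul_apply, smul_eq_mul, dquot_mul']; rfl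

lemma dquotMat_algebraMap (i : Fin m) (c : Pol(m, K)) :
    dquotMat b i (algebraMap _ (Matrix I I Pol(m, K)) c) = algebraMap _ _ (dquot b i c) := by
  refine Matrix.ext fun p q => ?_
  rw [dquotMat_apply, Matrix.algebraMap_matrix_apply, Matrix.algebraMap_matrix_apply]
  split_ifs
  · rfl
  · exact map_zero (dquot b i)

variable {M : Matrix I I Pol(m, K)} {w : Pol(m, K)}

lemma substMat_mul_dquotMat (h : M * M = algebraMap _ _ w) (i : Fin m) :
    substMat b i M * dquotMat b i M + dquotMat b i M * substMat b (i + 1) M = algebraMap _ _ (dquot b i w) := by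
  rw [← dquotMat_algebraMap, ← h, dquotMat_mul, add_comm]

lemma dquotMat_mul_substMat (h : M * M = algebraMap _ _ w) (i : Fin m) :
    dquotMat b i M * substMat b i M + substMat b (i + 1) M * dquotMat b i M = algebraMap _ _ (dquot b i w) := by
  rw [← dquotMat_algebraMap, ← h, dquotMat_mul']

end PartialSubstitution

section SumsOverSubsets

variable {m : ℕ} {N : Type*} [AddCommMonoid N]

lemma sum_erase_eq_sum_insert (F : Fin m → Finset (Fin m) → Finset (Fin m) → N) :
    (∑ s, ∑ i, if i ∈ s then F i s (s.erase i) else 0) = ∑ s, ∑ i, if i ∈ s then 0 else F i (insert i s) s := by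
  rw [sum_comm, sum_comm (s := univ) (t := univ)
    (f := fun s i => if i ∈ s then 0 else F i (insert i s) s)]
  refine sum_congr rfl fun i _ => ?_
  rw [← Finset.sum_filter]
  have : ∀ s : Finset (Fin m), (if i ∈ s then 0 else F i (insert i s) s) =
      if i ∉ s then F i (insert i s) s else 0 := fun s => by split_ifs <;> simp_all
  rw [sum_congr rfl fun s _ => this s, ← Finset.sum_filter]
  refine Finset.sum_nbij' (fun s => s.erase i) (fun s => insert i s) ?_ ?_ ?_ ?_ ?_
  · intro s _; simp
  · intro s _; simp
  · intro s hs; exact insert_erase (mem_filter.1 hs).2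
  · intro s hs; exact Finset.erase_insert (mem_filter.1 hs).2
  · intro s hs; rw [insert_erase (mem_filter.1 hs).2]

end SumsOverSubsets

section KoszulFamilies

variable {P : Type u} {𝓐 : Type u} [CommRing P] [Ring 𝓐] [Algebra P 𝓐] {m : ℕ}

/-- A family `L_S` with `L_∅ = 1` whose graded commutators with `M` are those of the products
`∏_{i ∈ S} λ_i`, where `M λ_i + λ_i M = f_i`. -/
structure KoszulFamily (M : 𝓐) (f : Fin m → P) (L : Finset (Fin m) → 𝓐) : Prop where
  empty : L ∅ = 1
  comm : ∀ s, M * L s = ((-1 : ℤˣ) ^ s.card) • (L s * M) +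
    ∑ i : Fin m, if i ∈ s then sgNat s i • f i • L (s.erase i) else 0

/-- The linear map that sends `θ_S` to `L_S`. -/
def extProd (L : Finset (Fin m) → 𝓐) : (Finset (Fin m) → P) →ₗ[P] 𝓐 :=
  ∑ s, (LinearMap.proj s).smulRight (L s)

lemma extProd_apply (L : Finset (Fin m) → 𝓐) (ω : Finset (Fin m) → P) : extProd L ω = ∑ s, ω s • L s := by
  rw [extProd, lsum_apply]; rfl

lemma sgNat_smul_mul_self (s : Finset (Fin m)) (j : ℕ) : sgNat s j * sgNat s j = 1 :=
  units_mul_self _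

lemma koszulFamily_oprod {M : 𝓐} {lam : Fin m → 𝓐} {f : Fin m → P}
    (h : ∀ i, M * lam i + lam i * M = algebraMap P 𝓐 (f i)) : KoszulFamily M f (oprod lam) := by
  refine ⟨oprod_empty _, fun s => ?_⟩
  refine (mul_oprod (fun _ => M) lam 0 f (fun i => by simp) h s).trans
    (congrArg₂ _ rfl (sum_congr rfl fun i _ => ?_))
  split_ifs
  · rfl
  · simp

lemma sgNat_insert_self (s : Finset (Fin m)) (i : Fin m) : sgNat (insert i s) i = sgNat s i := by
  rw [sgNat, sgNat, Finset.filter_insert, if_neg (lt_irrefl _)]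

lemma sg_smul_eq {N : Type*} [AddCommGroup N] [Module P N] (s : Finset (Fin m)) (i : Fin m) (x : N) :
    sg P i s • x = sgNat s i • x := by
  rw [sg_eq_sgNat, smul_def, Int.cast_smul_eq_zsmul]

lemma commutator_extProd {M : 𝓐} {L : Finset (Fin m) → 𝓐} {f : Fin m → P} (h : KoszulFamily M f L) {p : ℕ} {ω : Finset (Fin m) → P}
    (hω : ∀ s, s.card ≠ p → ω s = 0) :
    M * extProd L ω = ((-1 : ℤˣ) ^ p) • (extProd L ω * M) + extProd L (koszulD 0 f ω) := by
  have h1 : extProd L (koszulD 0 f ω) = ∑ s : Finset (Fin m), ∑ i : Fin m,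
      if i ∈ s then ω s • sgNat s i • f i • L (s.erase i) else 0 := by
    rw [sum_erase_eq_sum_insert fun i s t => ω s • sgNat s i • f i • L t, extProd_apply]
    refine sum_congr rfl fun s _ => ?_
    rw [koszulD_apply, sum_smul]
    refine sum_congr rfl fun i _ => ?_
    rw [Pi.zero_apply, zero_mul, zero_add]
    split_ifs with hi
    · rw [mul_zero, zero_smul]
    · rw [sgNat_insert_self, ← sg_smul_eq (P := P), smul_smul, smul_smul]
      congr 1; ring
  rw [h1, extProd_apply, mul_sum, sum_mul, smul_sum, ← sum_add_distrib]
  refine sum_congr rfl fun s _ => ?_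
  by_cases hs : s.card = p
  · rw [mul_smul_comm, h.comm, smul_add, hs, smul_mul_assoc, smul_comm, smul_sum]
    refine congrArg₂ _ rfl (sum_congr rfl fun i _ => ?_)
    split_ifs
    · rfl
    · rw [smul_zero]
  · rw [hω s hs]
    simp

/-- Left multiplication by `∑ⱼ uⱼ θⱼ`. -/
def extMulVec (u : Fin m → P) : LEnd P (Finset (Fin m) → P) := koszulD u 0

lemma koszulD_extMulVec (f u : Fin m → P) (ω : Finset (Fin m) → P) :
    koszulD 0 f (extMulVec u ω) = (∑ i, u i * f i) • ω - extMulVec u (koszulD 0 f ω) := by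
  have h1 := koszulD_sq u f
  have h2 := koszulD_sq u (0 : Fin m → P)
  have h3 := koszulD_sq (0 : Fin m → P) f
  rw [koszulD_add_coeff] at h1
  simp only [Pi.zero_apply, mul_zero, zero_mul, sum_const_zero, map_zero] at h2 h3
  have := lcongr_fun h1 ω
  rw [mul_add, add_mul, add_mul, h2, h3, Module.algebraMap_end_apply] at this
  rw [← this, extMulVec]
  simp only [ladd_apply, emul_apply, lzero_apply]
  abel

lemma extMulVec_card {u : Fin m → P} {p : ℕ} {ω : Finset (Fin m) → P}
    (hω : ∀ s, s.card ≠ p → ω s = 0) (s : Finset (Fin m)) (hs : s.card ≠ p + 1) : extMulVec u ω s = 0 := by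
  rw [extMulVec, koszulD_apply]
  refine sum_eq_zero fun i _ => ?_
  rw [Pi.zero_apply, zero_mul, add_zero]
  split_ifs with hi
  · rw [hω, mul_zero, mul_zero]
    intro h
    exact hs (by rw [← h, card_erase_add_one hi])
  · rw [mul_zero]

lemma extMulVec_linear (u v : Fin m → P) (c : P) :
    extMulVec (u + v) = extMulVec u + extMulVec v ∧ extMulVec (c • u) = c • extMulVec u := by
  constructor
  · simp only [extMulVec, koszulD, Pi.add_apply, Pi.zero_apply, zero_smul, add_zero, add_smul, sum_add_distrib]
  · simp only [extMulVec, koszulD, Pi.smul_apply, Pi.zero_apply, zero_smul, add_zero, smul_eq_mul, mul_smul, smul_sum]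

variable (P m) in
/-- `extMulVec` as a linear map. -/
def extMulVecLin : (Fin m → P) →ₗ[P] LEnd P (Finset (Fin m) → P) where
  toFun := extMulVec
  map_add' u v := (extMulVec_linear u v 0).1
  map_smul' c u := (extMulVec_linear u u c).2

lemma extMulVec_sq (u : Fin m → P) : extMulVec u * extMulVec u = 0 := by
  have := koszulD_sq u (0 : Fin m → P)
  simpa [extMulVec] using this

lemma extMulVec_anti (u v : Fin m → P) : extMulVec u * extMulVec v = - (extMulVec v * extMulVec u) := by
  have h := extMulVec_sq (u + v)
  rw [(extMulVec_linear u v 0).1, mul_add, add_mul, add_mul, extMulVec_sq, extMulVec_sq, zero_add, add_zero] at h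
  exact eq_neg_of_add_eq_zero_right h

variable (P m) in
/-- The unit of the exterior algebra. -/
def extOne : Finset (Fin m) → P := Pi.single ∅ 1

lemma extOne_card (s : Finset (Fin m)) (hs : s.card ≠ 0) : extOne P m s = 0 := by
  rw [extOne, Pi.single_eq_of_ne]
  rintro rfl
  exact hs rfl

lemma extProd_extOne {L : Finset (Fin m) → 𝓐} (h : L ∅ = 1) : extProd L (extOne P m) = 1 := by
  rw [extProd_apply, sum_eq_single ∅]
  · rw [extOne, Pi.single_eq_same, h, one_smul]
  · intro s _ hs
    rw [extOne, Pi.single_eq_of_ne hs, zero_smul]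
  · intro h; exact absurd (mem_univ _) h

lemma koszulD_extOne (f : Fin m → P) : koszulD 0 f (extOne P m) = 0 := by
  ext s
  rw [koszulD_apply]
  refine sum_eq_zero fun i _ => ?_
  rw [Pi.zero_apply, zero_mul, zero_add]
  split_ifs
  · rw [mul_zero]
  · rw [extOne, Pi.single_eq_of_ne (Finset.insert_ne_empty _ _), mul_zero, mul_zero]

lemma prod_extMulVec_univ (u : Fin m → Fin m → P) :
    (List.ofFn fun i => extMulVec (u i)).prod (extOne P m) univ = Matrix.det (Matrix.of u) := by
  let Φ : ExteriorAlgebra P (Fin m → P) →ₐ[P] LEnd P (Finset (Fin m) → P) :=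
    ExteriorAlgebra.lift P ⟨extMulVecLin P m, fun u => extMulVec_sq u⟩
  let ev : LEnd P (Finset (Fin m) → P) →ₗ[P] P :=
    LinearMap.proj univ ∘ₗ LinearMap.applyₗ (extOne P m)
  let g : (Fin m → P) [⋀^Fin m]→ₗ[P] P :=
    (ev ∘ₗ Φ.toLinearMap).compAlternatingMap (ExteriorAlgebra.ιMulti P m)
  have hg : ∀ u, g u = (List.ofFn fun i => extMulVec (u i)).prod (extOne P m) univ := fun u => by
    change ev (Φ (ExteriorAlgebra.ιMulti P m u)) = _
    rw [ExteriorAlgebra.ιMulti_apply, map_list_prod, List.map_ofFn]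
    have : (Φ ∘ fun i => ExteriorAlgebra.ι P (u i)) = fun i => extMulVec (u i) :=
      funext fun i => ExteriorAlgebra.lift_ι_apply _ _ _ _
    rw [this]; rfl
  have h1 : g (Pi.basisFun P (Fin m)) = 1 := by
    rw [hg]
    have key : ∀ i ≤ m, ((List.ofFn fun i => extMulVec (Pi.basisFun P (Fin m) i)).drop i).prod
        (extOne P m) = Pi.single (univ.filter fun j : Fin m => i ≤ (j : ℕ)) 1 := by
      intro i hi
      induction hi using Nat.decreasingInduction with
      | self =>
        rw [drop_of_length_le (by simp), prod_nil, Module.End.one_apply, extOne]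
        congr 1
        rw [eq_comm, Finset.filter_eq_empty_iff]
        intro j _ h
        exact absurd j.2 (by omega)
      | of_succ i hi ih =>
        have e1 := prod_drop_ofFn (fun i => extMulVec (Pi.basisFun P (Fin m) i)) ⟨i, hi⟩
        simp only at e1
        rw [e1, emul_apply, ih]
        ext s
        rw [extMulVec, koszulD_apply, sum_eq_single ⟨i, hi⟩]
        · rw [Pi.zero_apply, zero_mul, add_zero, Pi.basisFun_apply, Pi.single_eq_same, one_mul]
          by_cases hs : s = univ.filter fun j : Fin m => i ≤ (j : ℕ)
          · have e2 : s.erase ⟨i, hi⟩ = univ.filter fun j : Fin m => i + 1 ≤ (j : ℕ) := by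
              ext j
              rw [hs]
              simp only [Finset.mem_erase, mem_filter, mem_univ, true_and, ne_eq, Fin.ext_iff]
              omega
            rw [if_pos (by rw [hs]; simp), e2, Pi.single_eq_same, hs, Pi.single_eq_same, mul_one, sg,
              Finset.filter_eq_empty_iff.2, card_empty, pow_zero]
            intro j hj h
            simp only [mem_filter, mem_univ, true_and] at hj
            have h' : (j : ℕ) < i := h
            omega
          · rw [Pi.single_eq_of_ne hs]
            split_ifs with h
            · rw [Pi.single_eq_of_ne, mul_zero]
              intro h'
              apply hs
              rw [← insert_erase h, h']
              ext j
              simp only [Finset.mem_insert, mem_filter, mem_univ, true_and, Fin.ext_iff]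
              omega
            · rfl
        · intro j _ hj
          rw [Pi.basisFun_apply, Pi.single_eq_of_ne hj]
          simp
        · intro h; exact absurd (mem_univ _) h
    have := key 0 (Nat.zero_le _)
    rw [drop_zero] at this
    rw [this]
    simp
  have h2 := AlternatingMap.eq_smul_basis_det (Pi.basisFun P (Fin m)) g
  rw [← hg, h2, h1, one_smul, Pi.basisFun_det_apply]

end KoszulFamilies

section Eliminations

open MvPolynomial

variable {P : Type u} [CommRing P] {m : ℕ}

lemma prod_take_reverse_succ {𝓐 : Type*} [Monoid 𝓐] (v : Fin m → 𝓐) (i : Fin m) :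
    ((List.ofFn v).take (i + 1)).reverse.prod = v i * ((List.ofFn v).take i).reverse.prod := by
  rw [List.take_succ_eq_append_getElem (by simp), List.reverse_append,
    List.prod_append, List.reverse_singleton, List.prod_singleton]
  simp

lemma extMulVec_mul_prod_take (u : Fin m → Fin m → P) (v : Fin m → P) (j : ℕ) (hj : j ≤ m) :
    extMulVec v * ((List.ofFn fun i => extMulVec (u i)).take j).prod =
      ((-1 : ℤˣ) ^ j) • (((List.ofFn fun i => extMulVec (u i)).take j).prod * extMulVec v) := by
  induction j with
  | zero => simp
  | succ j ih =>
    have e := prod_take_ofFn_succ (fun i => extMulVec (u i)) ⟨j, hj⟩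
    simp only at e
    have hn : ∀ a b : LEnd P (Finset (Fin m) → P), a * (-b) = -(a * b) :=
      fun a b => LinearMap.ext fun x => (a : _ →ₗ[P] _).map_neg (b x)
    rw [e, ← mul_assoc, ih (Nat.le_of_succ_le hj), smul_mul_assoc, mul_assoc, extMulVec_anti, hn,
      pow_succ, mul_neg, mul_one, uneg_smul, smul_neg, mul_assoc]

lemma prod_reverse_extMulVec (u : Fin m → Fin m → P) : (List.ofFn fun i => extMulVec (u i)).reverse.prod =
      (∏ i : Fin m, (-1 : ℤˣ) ^ (i : ℕ)) • (List.ofFn fun i => extMulVec (u i)).prod := by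
  have key : ∀ j ≤ m, ((List.ofFn fun i => extMulVec (u i)).take j).reverse.prod =
      ((List.ofFn fun i : Fin m => (-1 : ℤˣ) ^ (i : ℕ)).take j).prod •
        ((List.ofFn fun i => extMulVec (u i)).take j).prod := by
    intro j hj
    induction j with
    | zero => simp
    | succ j ih =>
      have e1 := prod_take_ofFn_succ (fun i => extMulVec (u i)) ⟨j, hj⟩
      have e2 := List.prod_take_succ (List.ofFn fun i : Fin m => (-1 : ℤˣ) ^ (i : ℕ)) j (by simpa using hj)
      have e3 := prod_take_reverse_succ (fun i => extMulVec (u i)) ⟨j, hj⟩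
      simp only at e1 e3
      rw [e3, e2, e1, ih (Nat.le_of_succ_le hj), mul_smul_comm,
        extMulVec_mul_prod_take _ _ _ (Nat.le_of_succ_le hj), smul_smul, getElem_ofFn]
  have := key m le_rfl
  rwa [List.take_of_length_le (by simp), List.take_of_length_le (by simp), List.prod_ofFn] at this

variable {𝓐 : Type u} [Ring 𝓐] [Algebra P 𝓐] {L : Finset (Fin m) → 𝓐} {f : Fin m → P}

lemma extProd_of_card {ω : Finset (Fin m) → P} (hω : ∀ s, s.card ≠ m → ω s = 0) : extProd L ω = ω univ • L univ := by
  rw [extProd_apply, sum_eq_single univ]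
  · intro s _ hs
    rw [hω s, zero_smul]
    intro h
    exact hs ((Finset.card_eq_iff_eq_univ s).1 (by rw [h, card_fin]))
  · intro h; exact absurd (mem_univ _) h

lemma card_prod_take_reverse (u : Fin m → Fin m → P) (j : ℕ) (hj : j ≤ m) (s : Finset (Fin m)) (hs : s.card ≠ j) :
    ((List.ofFn fun i => extMulVec (u i)).take j).reverse.prod (extOne P m) s = 0 := by
  induction j generalizing s with
  | zero => exact extOne_card s hs
  | succ j ih =>
    have e := prod_take_reverse_succ (fun i => extMulVec (u i)) ⟨j, hj⟩
    simp only at e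
    rw [e]
    exact extMulVec_card (ih (Nat.le_of_succ_le hj)) s hs

lemma card_prod_drop (u : Fin m → Fin m → P) (j : ℕ) (hj : j ≤ m) (s : Finset (Fin m)) (hs : s.card + j ≠ m) :
    ((List.ofFn fun i => extMulVec (u i)).drop j).prod (extOne P m) s = 0 := by
  induction hj using Nat.decreasingInduction generalizing s with
  | self =>
    rw [drop_of_length_le (by simp)]
    exact extOne_card s (by omega)
  | of_succ j hj ih =>
    have e := prod_drop_ofFn (fun i => extMulVec (u i)) ⟨j, hj⟩
    simp only at e
    rw [e]
    refine extMulVec_card (p := m - (j + 1)) (fun t ht => ih t ?_) s ?_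
    · omega
    · omega

lemma koszulD_prod_take_reverse (u : Fin m → Fin m → P) (j : ℕ) (hj : j ≤ m) :
    ∃ v : Fin m → Finset (Fin m) → P, koszulD 0 f
      (((List.ofFn fun i => extMulVec (u i)).take j).reverse.prod (extOne P m)) =
        ∑ i : Fin m, if (i : ℕ) < j then (∑ l, u i l * f l) • v i else 0 := by
  induction j with
  | zero => exact ⟨0, by simp [koszulD_extOne]⟩
  | succ j ih =>
    obtain ⟨v, hv⟩ := ih (Nat.le_of_succ_le hj)
    have e := prod_take_reverse_succ (fun i => extMulVec (u i)) ⟨j, hj⟩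
    simp only at e
    refine ⟨fun i => if (i : ℕ) < j then - extMulVec (u ⟨j, hj⟩) (v i) else
      ((List.ofFn fun i => extMulVec (u i)).take j).reverse.prod (extOne P m), ?_⟩
    rw [e, emul_apply, koszulD_extMulVec, hv, map_sum, sub_eq_add_neg, ← Finset.sum_neg_distrib]
    generalize hr : (fun i => ∑ l, u i l * f l) = r
    replace hr : ∀ i, ∑ l, u i l * f l = r i := fun i => congrFun hr i
    simp only [hr]
    rw [Fintype.sum_eq_add_sum_compl (⟨j, hj⟩ : Fin m), Fintype.sum_eq_add_sum_compl (⟨j, hj⟩ : Fin m)]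
    rw [if_neg (lt_irrefl _), map_zero, neg_zero, zero_add, if_pos (Nat.lt_succ_self _), if_neg (lt_irrefl _)]
    refine congrArg₂ _ rfl (sum_congr rfl fun i hi => ?_)
    have hi : (i : ℕ) ≠ j := fun h => by simp [Fin.ext_iff, h] at hi
    have : ((i : ℕ) < j + 1) ↔ (i : ℕ) < j := by omega
    simp only [this]
    split_ifs
    · rw [map_smul, smul_neg]
    · rw [map_zero, neg_zero]

lemma koszulD_prod_drop (u : Fin m → Fin m → P) (j : ℕ) (hj : j ≤ m) : ∃ v : Fin m → Finset (Fin m) → P, koszulD 0 f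
      (((List.ofFn fun i => extMulVec (u i)).drop j).prod (extOne P m)) =
        ∑ i : Fin m, if j ≤ (i : ℕ) then (∑ l, u i l * f l) • v i else 0 := by
  induction hj using Nat.decreasingInduction with
  | self =>
    refine ⟨0, ?_⟩
    rw [drop_of_length_le (by simp)]
    simp [koszulD_extOne]
  | of_succ j hj ih =>
    obtain ⟨v, hv⟩ := ih
    have e := prod_drop_ofFn (fun i => extMulVec (u i)) ⟨j, hj⟩
    simp only at e
    refine ⟨fun i => if j + 1 ≤ (i : ℕ) then - extMulVec (u ⟨j, hj⟩) (v i) else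
      ((List.ofFn fun i => extMulVec (u i)).drop (j + 1)).prod (extOne P m), ?_⟩
    rw [e, emul_apply, koszulD_extMulVec, hv, map_sum, sub_eq_add_neg, ← Finset.sum_neg_distrib]
    generalize hr : (fun i => ∑ l, u i l * f l) = r
    replace hr : ∀ i, ∑ l, u i l * f l = r i := fun i => congrFun hr i
    simp only [hr]
    rw [Fintype.sum_eq_add_sum_compl (⟨j, hj⟩ : Fin m), Fintype.sum_eq_add_sum_compl (⟨j, hj⟩ : Fin m)]
    rw [if_neg (Nat.not_succ_le_self _), map_zero, neg_zero, zero_add, if_pos le_rfl, if_neg (Nat.not_succ_le_self _)]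
    refine congrArg₂ _ rfl (sum_congr rfl fun i hi => ?_)
    have hi : (i : ℕ) ≠ j := fun h => by simp [Fin.ext_iff, h] at hi
    have : (j ≤ (i : ℕ)) ↔ j + 1 ≤ (i : ℕ) := by omega
    simp only [this]
    split_ifs
    · rw [map_smul, smul_neg]
    · rw [map_zero, neg_zero]

lemma signs_prod_compl (c : Fin m → ℤˣ) (s : Finset (Fin m)) : ∏ i ∈ sᶜ, c i = (∏ i, c i) * ∏ i ∈ s, c i := by
  rw [← Finset.prod_mul_prod_compl s c, mul_right_comm, units_mul_self, one_mul]

end Eliminations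

section NestedResults

open MvPolynomial

variable {K : Type u} [CommRing K] {m : ℕ} (b : Fin m → K) {I : Type u} [Fintype I] [DecidableEq I]
  {M : Matrix I I Pol(m, K)} {w : Pol(m, K)}
  {L : Finset (Fin m) → Matrix I I Pol(m, K)} {f : Fin m → Pol(m, K)}
  {p : Fin m → Polynomial K} {c : Fin m → Fin m → Pol(m, K)}

/-- The alternating sum `∑ ± A_s Λ(b) A_{s^c}` is homotopic to the product of the difference quotients
of the `p i`, up to multiples of the `p i (b i)`. -/
lemma commRel_sum_oprod (hM : M * M = algebraMap _ _ w) (hL : KoszulFamily M f L)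
    (hp : ∀ i, paeval (X i) (p i) = ∑ j, c i j * f j) :
    CommRel (Ideal.span (Set.range fun i => (C (Polynomial.eval (b i) (p i)) : Pol(m, K))) •
      (⊤ : Submodule Pol(m, K) (Matrix I I Pol(m, K)))).toAddSubgroup M 1
      (subst b m (Matrix.of c).det • ∑ s : Finset (Fin m), (∏ i ∈ s, (-1 : ℤˣ) ^ (i : ℕ)) • (oprod (fun i => dquotMat b i M) s *
        substMat b m (L univ) * doprod (fun i => dquotMat b i M) sᶜ))
      ((∏ i, dquot b i (paeval (X i) (p i))) • (1 : Matrix I I Pol(m, K))) := by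
  set J := Ideal.span (Set.range fun i => (C (Polynomial.eval (b i) (p i)) : Pol(m, K))) with hJ
  have hJmem : ∀ i, paeval (C (b i) : Pol(m, K)) (p i) ∈ J := fun i => by
    have : paeval (C (b i) : Pol(m, K)) (p i) = C (Polynomial.eval (b i) (p i)) := by
      have := Polynomial.aeval_algebraMap_apply Pol(m, K) (b i) (p i)
      rwa [algebraMap_eq, Polynomial.coe_aeval_eq_eval] at this
    rw [this]
    exact Ideal.subset_span ⟨i, rfl⟩
  let Γ : ℕ → Matrix I I Pol(m, K) := fun j => extProd L
    (((List.ofFn fun i => extMulVec (c i)).take j).reverse.prod (extOne _ m))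
  have h0 : Γ 0 = 1 := by
    change extProd L (extOne _ m) = 1
    exact extProd_extOne hL.empty
  have hm : Γ m = (∏ i : Fin m, (-1 : ℤˣ) ^ (i : ℕ)) • (Matrix.of c).det • L univ := by
    change extProd L _ = _
    rw [extProd_of_card (card_prod_take_reverse _ _ le_rfl), List.take_of_length_le (by simp),
      prod_reverse_extMulVec, ← smul_assoc]
    refine congrArg (· • _) ?_
    have := prod_extMulVec_univ (fun i => c i)
    change ((∏ i : Fin m, (-1 : ℤˣ) ^ (i : ℕ)) •
      ((List.ofFn fun i => extMulVec (c i)).prod (extOne _ m) univ)) = _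
    rw [this]
  have key := exists_nested (J := J) (fun i => (substMat (I := I) b i).toAddMonoidHom) (dquotMat b) M
    (fun i => X i - C (b i)) (fun i => dquot b i w)
    (fun i x => dquotMat_mul b i M x) (fun i x => dquotMat_mul' b i x M)
    (fun i => X_sub_C_smul_dquotMat b i M) (substMat_mul_dquotMat b hM) (dquotMat_mul_substMat b hM)
    Γ (fun i => paeval (X i) (p i)) (fun i => dquot b i (paeval (X i) (p i)))
    (fun i => by
      obtain ⟨v, hv⟩ := koszulD_prod_take_reverse (f := f) (fun i => c i) i i.2.le
      have e := prod_take_reverse_succ (fun i => extMulVec (c i)) i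
      have h1 := commutator_extProd hL (card_prod_take_reverse (fun i => c i) (i + 1) i.2)
      refine ⟨- extProd L (extMulVec (c i) (koszulD 0 f
        (((List.ofFn fun i => extMulVec (c i)).take i).reverse.prod (extOne _ m)))), ?_, ?_⟩
      · change M * Γ (i + 1) = (-1) ^ ((i : ℕ) + 1) • (Γ (i + 1) * M) + _ at h1
        rw [h1, e, emul_apply, koszulD_extMulVec, ← hp, map_sub, map_smul, pow_succ, mul_neg, mul_one, uneg_smul]
        change _ = paeval (X i) (p i) • Γ i + _
        abel
      · rw [hv, map_sum, map_sum, map_neg, map_sum]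
        refine Submodule.neg_mem _ (Submodule.sum_mem _ fun j _ => ?_)
        split_ifs with hj
        · rw [map_smul, map_smul, ← hp, dquotMat_smul', dquot_aeval_of_ne _ (fun h => by
            rw [h] at hj; exact lt_irrefl _ hj), zero_smul, zero_add, subst_aeval_X,
            if_pos (Nat.lt_succ_of_lt hj)]
          exact smul_mem_smul (hJmem j) trivial
        · simp only [map_zero]; exact Submodule.zero_mem _)
    (fun i x => by
      rw [dquotMat_smul', subst_aeval_X, if_pos (Nat.lt_succ_self _)]
      change _ • substMat b i x + _ - _ • substMat b i x ∈ _
      rw [add_sub_cancel_left]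
      exact smul_mem_smul (hJmem i) trivial)
  have e1 : ∀ y, substMat (I := I) b 0 y = y := substMat_zero b
  change CommRel _ (substMat b 0 M) 1 (_ : Matrix I I Pol(m, K))
    (_ • substMat b 0 (Γ 0)) at key
  rw [e1, e1, h0, prod_ofFn_mulLeft_add_mulRight, hm] at key
  refine (congrArg (fun x => CommRel _ M 1 x _) ?_).mp key
  rw [smul_sum]
  refine sum_congr rfl fun s _ => ?_
  change (∏ i ∈ sᶜ, (-1 : ℤˣ) ^ (i : ℕ)) • (_ * substMat b m (_ • (Matrix.of c).det • _) * _) = _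
  rw [signs_prod_compl, smul_def (∏ i : Fin m, (-1 : ℤˣ) ^ (i : ℕ)) ((Matrix.of c).det • _), map_zsmul,
    ← smul_def, substMat_smul, mul_smul_comm, smul_mul_assoc, smul_smul, mul_smul_comm,
    smul_mul_assoc, mul_right_comm, units_mul_self, one_mul, smul_comm]

set_option maxHeartbeats 1000000 in
lemma commRel_sum_doprod (hM : M * M = algebraMap _ _ w) (hL : KoszulFamily M f L)
    (hp : ∀ i, paeval (X i) (p i) = ∑ j, c i j * f j) :
    CommRel (Ideal.span (Set.range fun i => (paeval (X i) (p i) : Pol(m, K))) •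
      (⊤ : Submodule Pol(m, K) (Matrix I I Pol(m, K)))).toAddSubgroup (substMat b m M) 1
      ((Matrix.of c).det • ∑ s : Finset (Fin m), (∏ i ∈ s, (-1 : ℤˣ) ^ (i + m + 1 : ℕ)) • (doprod (fun i => dquotMat b i M) sᶜ *
        L univ * oprod (fun i => dquotMat b i M) s))
      ((∏ i, dquot b i (paeval (X i) (p i))) • (1 : Matrix I I Pol(m, K))) := by
  set J := Ideal.span (Set.range fun i => (paeval (X i) (p i) : Pol(m, K))) with hJ
  have hJmem : ∀ i, (paeval (X i) (p i) : Pol(m, K)) ∈ J :=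
    fun i => Ideal.subset_span ⟨i, rfl⟩
  let Γ : ℕ → Matrix I I Pol(m, K) := fun j => extProd L
    (((List.ofFn fun i => extMulVec (c i)).drop j).prod (extOne _ m))
  have hm : Γ m = 1 := by
    change extProd L _ = 1
    rw [drop_of_length_le (by simp)]
    exact extProd_extOne hL.empty
  have h0 : Γ 0 = (Matrix.of c).det • L univ := by
    change extProd L _ = _
    rw [extProd_of_card fun s hs => card_prod_drop _ 0 (Nat.zero_le _) s (by simpa using hs), drop_zero]
    refine congrArg (· • _) ?_
    exact prod_extMulVec_univ (fun i => c i)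
  have key := exists_nested_reverse (J := J) (fun i => (substMat (I := I) b i).toAddMonoidHom)
    (dquotMat b) M
    (fun i => X i - C (b i)) (fun i => dquot b i w)
    (fun i x => dquotMat_mul' b i M x) (fun i x => dquotMat_mul b i x M)
    (fun i => X_sub_C_smul_dquotMat b i M) (substMat_mul_dquotMat b hM) (dquotMat_mul_substMat b hM)
    Γ (fun i => paeval (X i) (p i)) (fun i => dquot b i (paeval (X i) (p i)))
    (fun i => by
      obtain ⟨v, hv⟩ := koszulD_prod_drop (f := f) (fun i => c i) (i + 1) i.2
      have e := prod_drop_ofFn (fun i => extMulVec (c i)) i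
      have h1 := commutator_extProd hL (p := m - i) fun s hs =>
        card_prod_drop (fun i => c i) i i.2.le s (by omega)
      refine ⟨- extProd L (extMulVec (c i) (koszulD 0 f
        (((List.ofFn fun i => extMulVec (c i)).drop (i + 1)).prod (extOne _ m)))), ?_, ?_⟩
      · change M * Γ i = (-1) ^ (m - (i : ℕ)) • (Γ i * M) + _ at h1
        have hs : ((-1 : ℤˣ) ^ (i + m + 1 : ℕ)) = - (-1) ^ (m - (i : ℕ)) := by
          have : (i + m + 1 : ℕ) = (m - i) + 2 * i + 1 := by omega
          rw [this, pow_succ, pow_add, pow_mul]; simp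
        rw [h1, e, emul_apply, koszulD_extMulVec, ← hp, map_sub, map_smul, hs, uneg_smul]
        change _ = paeval (X i) (p i) • Γ (i + 1) + _
        abel
      · rw [hv, map_sum, map_sum, map_neg, map_sum]
        refine Submodule.neg_mem _ (Submodule.sum_mem _ fun j _ => ?_)
        split_ifs with hj
        · rw [map_smul, map_smul, ← hp, dquotMat_smul', dquot_aeval_of_ne _ (fun h => by
            rw [h] at hj; omega), zero_smul, zero_add, subst_aeval_X, if_neg (by omega)]
          exact smul_mem_smul (hJmem j) trivial
        · simp only [map_zero]; exact Submodule.zero_mem _)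
    (fun i x => by
      rw [dquotMat_smul, subst_aeval_X, if_neg (lt_irrefl _)]
      change _ • substMat b (i + 1) x + _ - _ • substMat b (i + 1) x ∈ _
      rw [add_sub_cancel_left]
      exact smul_mem_smul (hJmem i) trivial)
  have e1 : ∀ y, substMat (I := I) b 0 y = y := substMat_zero b
  change CommRel _ (substMat b m M) 1 ((List.ofFn fun i : Fin m =>
    mulLeft (dquotMat b i M) + ((-1 : ℤˣ) ^ (i + m + 1 : ℕ)) •
      mulRight (dquotMat b i M)).reverse.prod (substMat b 0 (Γ 0)))
    ((∏ i, dquot b i (paeval (X i) (p i))) • substMat b m (Γ m)) at key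
  have e2 : substMat (I := I) b m 1 = 1 := map_one (substMat b m)
  rw [e1, hm, h0, e2, prod_reverse_ofFn_mulLeft_add_mulRight] at key
  refine (congrArg (fun x => CommRel _ _ 1 x _) ?_).mp key
  rw [smul_sum]
  refine sum_congr rfl fun s _ => ?_
  rw [mul_smul_comm, smul_mul_assoc, smul_comm]

end NestedResults

section ResMonic

open MvPolynomial

variable {k : Type u} [CommRing k] {m : ℕ} {p : Fin m → Polynomial k}

lemma resMonic_sepProd (g : Fin m → Polynomial k) :
    resMonic p (sepProd g) = ∏ i, (g i %ₘ p i).coeff ((p i).natDegree - 1) := by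
  refine map_sepProd (resMonic p) ((MultilinearMap.mkPiAlgebra k (Fin m) k).compLinearMap fun i =>
      Polynomial.lcoeff k ((p i).natDegree - 1) ∘ₗ Polynomial.modByMonicHom (p i)) (fun e => ?_) g
  change resMonic p (basisMonomials (Fin m) k e) = _
  rw [resMonic, constr_basis]
  rfl

lemma resMonic_aeval_mul (hp : ∀ i, (p i).Monic) (i : Fin m) (h : Pol(m, k)) :
    resMonic p (paeval (X i) (p i) * h) = 0 := by
  induction h using sepProd_induction with
  | h0 => rw [mul_zero, map_zero]
  | ha a b ha hb => rw [mul_add, map_add, ha, hb, add_zero]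
  | h c g =>
    rw [mul_smul_comm, map_smul, aeval_mul_sepProd, resMonic_sepProd, Finset.prod_eq_zero (mem_univ i), smul_zero]
    rw [update_self, (Polynomial.modByMonic_eq_zero_iff_dvd (hp i)).2 (Dvd.intro _ rfl), Polynomial.coeff_zero]

end ResMonic

open LinFact

section TripleTensor

variable (k T S R : Type u) [CommRing k] [CommRing T] [CommRing S] [CommRing R]
  [Algebra k T] [Algebra k S] [Algebra k R]

/-- The tensor product of three rings, with the middle factor moved to the right. -/
abbrev Mid : Type u := (T ⊗[k] R) ⊗[k] S

/-- The inclusion of the first two factors. -/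
def in12 : T ⊗[k] S →ₐ[k] Mid k T S R :=
  Algebra.TensorProduct.map includeLeft (AlgHom.id k S)

/-- The inclusion of the last two factors. -/
def in23 : S ⊗[k] R →ₐ[k] Mid k T S R :=
  (Algebra.TensorProduct.map includeRight (AlgHom.id k S)).comp
    (Algebra.TensorProduct.comm k S R).toAlgHom

/-- The inclusion of the outer factors. -/
def in13 : T ⊗[k] R →ₐ[k] Mid k T S R := includeLeft

variable {k T S R}

lemma in12_tmul (t : T) (s : S) : in12 k T S R (t ⊗ₜ s) = (t ⊗ₜ 1) ⊗ₜ s := rfl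

lemma in23_tmul (s : S) (r : R) : in23 k T S R (s ⊗ₜ r) = (1 ⊗ₜ r) ⊗ₜ s := rfl

lemma in13_apply (a : T ⊗[k] R) : in13 k T S R a = a ⊗ₜ 1 := rfl

lemma in12_one_tmul (s : S) : in12 k T S R (1 ⊗ₜ s) = 1 ⊗ₜ s := rfl

/-- Contraction of the middle factor with a functional. -/
def resMid (ρ : S →ₗ[k] k) : Mid k T S R →ₗ[k] T ⊗[k] R :=
  (TensorProduct.rid k (T ⊗[k] R)).toLinearMap ∘ₗ LinearMap.lTensor (T ⊗[k] R) ρ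

lemma resMid_tmul (ρ : S →ₗ[k] k) (a : T ⊗[k] R) (s : S) : resMid ρ (a ⊗ₜ s : Mid k T S R) = ρ s • a := rfl

lemma resMid_in13_mul (ρ : S →ₗ[k] k) (a : T ⊗[k] R) (P : Mid k T S R) :
    resMid ρ (in13 k T S R a * P) = a * resMid ρ P := by
  induction P using tmul_induction with
  | zero => rw [mul_zero, map_zero, mul_zero]
  | add x y hx hy => rw [mul_add, map_add, hx, hy, map_add, mul_add]
  | tmul b s =>
    rw [in13_apply, tmul_mul_tmul, one_mul, resMid_tmul, resMid_tmul, mul_smul_comm]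

lemma resMid_mul_eq_zero {ρ : S →ₗ[k] k} {g : S} (hg : ∀ s, ρ (g * s) = 0) (P : Mid k T S R) :
    resMid ρ ((1 ⊗ₜ g) * P) = 0 := by
  induction P using tmul_induction with
  | zero => rw [mul_zero, map_zero]
  | add x y hx hy => rw [mul_add, map_add, hx, hy, add_zero]
  | tmul b s => rw [tmul_mul_tmul, resMid_tmul, hg, zero_smul]

lemma resMid_comp {ρ ρ' : S →ₗ[k] k} {g : S} (hg : ∀ s, ρ' s = ρ (g * s)) (P : Mid k T S R) :
    resMid ρ' P = resMid ρ ((1 ⊗ₜ g) * P) := by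
  induction P using tmul_induction with
  | zero => rw [mul_zero, map_zero, map_zero]
  | add x y hx hy => rw [mul_add, map_add, map_add, hx, hy]
  | tmul b s => rw [tmul_mul_tmul, resMid_tmul, resMid_tmul, hg, one_mul]

variable {v : T} {w : S} {u : R} {Y : LinFact (T ⊗[k] S) (pot k v w)}
  {X : LinFact (S ⊗[k] R) (pot k w u)}

/-- The action of the middle factor on a tensor product. -/
def midAct : S →+ LEnd (T ⊗[k] R) (tensor Y X).carrier :=
  AddMonoidHom.mk' (fun s => tmap (LinearMap.lsmul _ _ ((1 : T) ⊗ₜ[k] s)) LinearMap.id) fun s s' => by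
    refine LinearMap.ext fun z => ?_
    induction z using tind with
    | ha a b ha hb => rw [map_add, ha, hb, map_add]
    | h y x =>
      rw [ladd_apply, tmap_pt, tmap_pt, tmap_pt, tmul_add, map_add, ladd_apply, map_add]
      rfl

lemma midAct_pt (s : S) (y : Y.carrier) (x : X.carrier) : midAct s (pt y x) = pt (((1 : T) ⊗ₜ[k] s) • y) x := rfl

/-- The action of the threefold tensor product on a tensor product of modules. -/
def act3 : Mid k T S R →+ LEnd (T ⊗[k] R) (tensor Y X).carrier :=
  TensorProduct.liftAddHom (R := k)
    (AddMonoidHom.mk' (fun a => AddMonoidHom.mk' (fun s => a • midAct s)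
      (fun s s' => by rw [map_add, smul_add]))
      (fun a a' => AddMonoidHom.ext fun s => add_smul a a' (midAct s)))
    (fun c a s => by
      refine LinearMap.ext fun z => ?_
      change (c • a) • midAct s z = a • midAct (c • s) z
      induction z using tind with
      | ha x y hx hy => rw [map_add, map_add, smul_add, smul_add, hx, hy]
      | h y x =>
        rw [midAct_pt, midAct_pt]
        have h1 : (c • a : T ⊗[k] R) = a * (algebraMap k T c ⊗ₜ 1) := by
          rw [← Algebra.TensorProduct.algebraMap_apply, Algebra.smul_def, mul_comm]
        have h2 : ((1 : T) ⊗ₜ[k] (c • s)) = (algebraMap k T c ⊗ₜ 1) * (1 ⊗ₜ s) := by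
          rw [← Algebra.TensorProduct.algebraMap_apply, ← Algebra.smul_def, tmul_smul]
        rw [h1, h2, mul_smul, mul_smul, smul_pt_left])

lemma act3_tmul (a : T ⊗[k] R) (s : S) (z : (tensor Y X).carrier) :
    act3 (a ⊗ₜ s : Mid k T S R) z = a • midAct s z := rfl

lemma act3_in13 (a : T ⊗[k] R) (z : (tensor Y X).carrier) : act3 (in13 k T S R a) z = a • z := by
  rw [in13_apply, act3_tmul]
  congr 1
  induction z using tind with
  | ha x y hx hy => rw [map_add, hx, hy]
  | h y x => rw [midAct_pt, ← tone_def, one_smul]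

lemma midAct_mul (s s' : S) (z : (tensor Y X).carrier) : midAct (s * s') z = midAct s (midAct s' z) := by
  induction z using tind with
  | ha x y hx hy => rw [map_add, hx, hy, map_add, map_add]
  | h y x =>
    rw [midAct_pt, midAct_pt, midAct_pt, smul_smul, tmul_mul_tmul, one_mul]

lemma act3_mul (P Q : Mid k T S R) (z : (tensor Y X).carrier) : act3 (P * Q) z = act3 P (act3 Q z) := by
  induction P using tmul_induction with
  | zero => rw [zero_mul, map_zero]; rfl
  | add x y hx hy =>
    rw [add_mul, map_add, map_add, ladd_apply, ladd_apply, hx, hy]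
  | tmul a s =>
    induction Q using tmul_induction with
    | zero => rw [mul_zero, map_zero, lzero_apply, map_zero]
    | add x y hx hy =>
      rw [mul_add, map_add, map_add, ladd_apply, ladd_apply, hx, hy, map_add]
    | tmul b s' =>
      rw [tmul_mul_tmul, act3_tmul, act3_tmul, act3_tmul, midAct_mul, mul_smul, map_smul]

lemma act3_in12 (a : T ⊗[k] S) (y : Y.carrier) (x : X.carrier) : act3 (in12 k T S R a) (pt y x) = pt (a • y) x := by
  induction a using tmul_induction with
  | zero => rw [map_zero, map_zero, zero_smul, map_zero]; rfl
  | add a b ha hb =>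
    rw [map_add, map_add, ladd_apply, ha, hb, add_smul, map_add, AddMonoidHom.add_apply]
  | tmul t s =>
    rw [in12_tmul, act3_tmul, midAct_pt, smul_pt_left, smul_smul, tmul_mul_tmul, mul_one, one_mul]

lemma act3_in23 (b : S ⊗[k] R) (y : Y.carrier) (x : X.carrier) : act3 (in23 k T S R b) (pt y x) = pt y (b • x) := by
  induction b using tmul_induction with
  | zero => rw [map_zero, map_zero, zero_smul, map_zero]; rfl
  | add a b ha hb =>
    rw [map_add, map_add, ladd_apply, ha, hb, add_smul, map_add]
  | tmul s r =>
    rw [in23_tmul, act3_tmul, midAct_pt, smul_pt_right, pt_balanced, smul_smul, tmul_mul_tmul, mul_one, one_mul]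

lemma act3_d (P : Mid k T S R) (z : (tensor Y X).carrier) : (tensor Y X).d (act3 P z) = act3 P ((tensor Y X).d z) := by
  induction z using tind with
  | ha x y hx hy => rw [map_add, map_add, hx, hy, map_add, map_add]
  | h y x =>
    induction P using tmul_induction with
    | zero => rw [map_zero, lzero_apply, lzero_apply, map_zero]
    | add x y hx hy => rw [map_add, ladd_apply, map_add, hx, hy, ladd_apply]
    | tmul a s =>
      rw [act3_tmul, act3_tmul, map_smul, midAct_pt, d_pt, d_pt, LinearMap.map_smul Y.d,
        LinearMap.map_smul Y.sign, map_add, midAct_pt,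
        midAct_pt]

lemma act3_even (P : Mid k T S R) (z : (tensor Y X).carrier) :
    (tensor Y X).even (act3 P z) = act3 P ((tensor Y X).even z) := by
  induction z using tind with
  | ha x y hx hy => rw [map_add, map_add, hx, hy, map_add, map_add]
  | h y x =>
    induction P using tmul_induction with
    | zero => rw [map_zero, lzero_apply, lzero_apply, map_zero]
    | add x y hx hy => rw [map_add, ladd_apply, map_add, hx, hy, ladd_apply]
    | tmul a s =>
      rw [act3_tmul, act3_tmul, map_smul, midAct_pt, even_pt, even_pt, map_smul, map_add, midAct_pt,
        midAct_pt, smul_sub]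

end TripleTensor

section TriRings

open MvPolynomial

variable {k : Type u} [CommRing k] (O M : Obj k)

/-- `O ⊗ M ⊗ O` with the middle factor moved to the right. -/
def triMid : Tri O M →ₐ[k] Mid k O.ring M.ring O.ring :=
  aevalTower (in23 k O.ring M.ring O.ring) fun i => in12 k O.ring M.ring O.ring (X i ⊗ₜ 1)

/-- `O ⊗ M ⊗ O` with the last factor as the middle factor. -/
def triLast : Tri O M →ₐ[k] Mid k O.ring O.ring M.ring :=
  aevalTower ((in23 k O.ring O.ring M.ring).comp swap(k, M, O).toAlgHom)
    fun i => in13 k O.ring O.ring M.ring (X i ⊗ₜ 1)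

/-- `O ⊗ M ⊗ O` with the first factor as the middle factor. -/
def triFirst : Tri O M →ₐ[k] Mid k M.ring O.ring O.ring :=
  aevalTower (in13 k M.ring O.ring O.ring) fun i => 1 ⊗ₜ X i

variable {O M}

lemma embL_tmul (a : O.ring) (b : M.ring) : embL O M (a ⊗ₜ b) = aeval X a * C (b ⊗ₜ 1) := rfl

lemma embR_apply (b : M ⊠[k] O) : embR O M b = C b := rfl

lemma embOut_tmul (a c : O.ring) : embOut O M (a ⊗ₜ c) = aeval X a * C (1 ⊗ₜ c) := rfl

lemma aeval_X_monomial (s : Fin O.n →₀ ℕ) : (aeval X (monomial s 1 : O.ring) : Tri O M) = monomial s 1 := by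
  rw [aeval_monomial, map_one, monomial_eq, C_1]

lemma monomial_eq_embL_mul (s : Fin O.n →₀ ℕ) (c : M ⊠[k] O) :
    (monomial s c : Tri O M) = embL O M (monomial s 1 ⊗ₜ 1) * embR O M c := by
  rw [embL_tmul, embR_apply, aeval_X_monomial, ← tone_def, C_1, mul_one, mul_comm, C_mul_monomial, mul_one]

@[elab_as_elim]
lemma tri_induction {p : Tri O M → Prop} (h : ∀ a b, p (embL O M a * embR O M b))
    (ha : ∀ x y, p x → p y → p (x + y)) (P : Tri O M) : p P := by
  induction P using monomial_add_induction_on with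
  | C a => simpa [embR_apply] using h 1 a
  | monomial_add s c f _ _ hf =>
    refine ha _ _ ?_ hf
    rw [monomial_eq_embL_mul]
    exact h _ _

lemma aevalTower_aeval_X {N : Type u} [CommRing N] [Algebra k N] (f : M ⊠[k] O →ₐ[k] N)
    (g : O.ring →ₐ[k] N) (a : O.ring) : aevalTower f (fun i => g (X i)) (aeval X a : Tri O M) = g a := by
  have : ((aevalTower f (fun i => g (X i))).comp ((aeval X : O.ring →ₐ[k] Tri O M))) = g :=
    algHom_ext fun i => by rw [AlgHom.comp_apply, aeval_X, aevalTower_X]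
  exact DFunLike.congr_fun this a

lemma triMid_aeval_X (a : O.ring) : triMid O M (aeval X a) = (a ⊗ₜ 1) ⊗ₜ 1 :=
  aevalTower_aeval_X _ ((in12 k O.ring M.ring O.ring).comp includeLeft) a

lemma triLast_aeval_X (a : O.ring) : triLast O M (aeval X a) = (a ⊗ₜ 1) ⊗ₜ 1 :=
  aevalTower_aeval_X _ ((in13 k O.ring O.ring M.ring).comp includeLeft) a

lemma triFirst_aeval_X (a : O.ring) : triFirst O M (aeval X a) = 1 ⊗ₜ a :=
  aevalTower_aeval_X (in13 k M.ring O.ring O.ring)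
    (includeRight : O.ring →ₐ[k] Mid k M.ring O.ring O.ring) a

lemma triMid_C (c : M ⊠[k] O) : triMid O M (C c) = in23 k O.ring M.ring O.ring c :=
  aevalTower_C _ _ _

lemma triLast_C (c : M ⊠[k] O) : triLast O M (C c) = in23 k O.ring O.ring M.ring (swap(k, M, O) c) := aevalTower_C _ _ _

lemma triFirst_C (c : M ⊠[k] O) : triFirst O M (C c) = in13 k M.ring O.ring O.ring c :=
  aevalTower_C _ _ _

lemma triMid_embR (c : M ⊠[k] O) : triMid O M (embR O M c) = in23 k O.ring M.ring O.ring c :=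
  triMid_C c

lemma triLast_embR (c : M ⊠[k] O) : triLast O M (embR O M c) =
    in23 k O.ring O.ring M.ring (swap(k, M, O) c) := triLast_C c

lemma triFirst_embR (c : M ⊠[k] O) : triFirst O M (embR O M c) = in13 k M.ring O.ring O.ring c := triFirst_C c

lemma triMid_embL (a : O ⊠[k] M) : triMid O M (embL O M a) = in12 k O.ring M.ring O.ring a := by
  induction a using tmul_induction with
  | zero => simp only [map_zero]
  | add x y hx hy => simp only [map_add, hx, hy]
  | tmul a b =>
    rw [embL_tmul, map_mul, triMid_aeval_X, triMid_C, in23_tmul, in12_tmul,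
      tmul_mul_tmul, tmul_mul_tmul, mul_one, one_mul, one_mul]

lemma triMid_embOut (a : O ⊠[k] O) : triMid O M (embOut O M a) = in13 k O.ring M.ring O.ring a := by
  induction a using tmul_induction with
  | zero => simp only [map_zero]
  | add x y hx hy => simp only [map_add, hx, hy]
  | tmul a b =>
    rw [embOut_tmul, map_mul, triMid_aeval_X, triMid_C, in23_tmul, in13_apply,
      tmul_mul_tmul, tmul_mul_tmul, mul_one, one_mul, one_mul]

lemma triLast_embL (a : O ⊠[k] M) : triLast O M (embL O M a) = in13 k O.ring O.ring M.ring a := by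
  induction a using tmul_induction with
  | zero => simp only [map_zero]
  | add x y hx hy => simp only [map_add, hx, hy]
  | tmul a b =>
    rw [embL_tmul, map_mul, triLast_aeval_X, triLast_C, tcomm_tmul, in23_tmul, in13_apply,
      tmul_mul_tmul, tmul_mul_tmul, mul_one, one_mul, one_mul]

lemma triLast_embOut (a : O ⊠[k] O) : triLast O M (embOut O M a) = in12 k O.ring O.ring M.ring a := by
  induction a using tmul_induction with
  | zero => simp only [map_zero]
  | add x y hx hy => simp only [map_add, hx, hy]
  | tmul a b =>
    rw [embOut_tmul, map_mul, triLast_aeval_X, triLast_C, tcomm_tmul, in23_tmul, in12_tmul,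
      tmul_mul_tmul, tmul_mul_tmul, mul_one, one_mul, one_mul]

lemma triFirst_embL (a : O ⊠[k] M) : triFirst O M (embL O M a) = in12 k M.ring O.ring O.ring (swap(k, O, M) a) := by
  induction a using tmul_induction with
  | zero => simp only [map_zero]
  | add x y hx hy => simp only [map_add, hx, hy]
  | tmul a b =>
    rw [embL_tmul, map_mul, triFirst_aeval_X, triFirst_C, tcomm_tmul, in12_tmul, in13_apply,
      tmul_mul_tmul, mul_one, one_mul]

lemma triFirst_embOut (a : O ⊠[k] O) : triFirst O M (embOut O M a) = in23 k M.ring O.ring O.ring a := by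
  induction a using tmul_induction with
  | zero => simp only [map_zero]
  | add x y hx hy => simp only [map_add, hx, hy]
  | tmul a b =>
    rw [embOut_tmul, map_mul, triFirst_aeval_X, triFirst_C, in23_tmul, in13_apply, tmul_mul_tmul, mul_one, one_mul]

variable {Y : Fact M O} {Z : Fact O M}

lemma triSmul_eq (P : Tri O M) (y : Y.carrier) (z : Z.carrier) : triSmul P y z = act3 (triMid O M P) (pt y z) := by
  conv_rhs => rw [← support_sum_monomial_coeff P]
  rw [triSmul, map_sum, map_sum, lsum_apply]
  refine sum_congr rfl fun s _ => ?_
  rw [monomial_eq_embL_mul, map_mul, act3_mul, triMid_embR, act3_in23, triMid_embL, act3_in12]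

lemma midRes_eq (P : Tri O M) : midRes P = resMid (residue fun i => pderiv i M.W) (triMid O M P) := by
  conv_rhs => rw [← support_sum_monomial_coeff P]
  rw [midRes, map_sum, map_sum]
  refine sum_congr rfl fun s _ => ?_
  rw [monomial_eq_embL_mul, map_mul, triMid_embR, triMid_embL, in12_tmul]
  generalize coeff s P = c
  induction c using tmul_induction with
  | zero => simp only [map_zero, mul_zero, tmul_zero]
  | add x y hx hy => simp only [map_add, mul_add, tmul_add, hx, hy]
  | tmul a b =>
    rw [in23_tmul, tmul_mul_tmul, tmul_mul_tmul, resMid_tmul,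
      rTensor_tmul, TensorProduct.lid_tmul, one_mul, mul_one, one_mul, tmul_smul]

end TriRings

section ResidueFacts

open MvPolynomial

variable {k : Type u} [CommRing k]

lemma exists_residue (A : Obj k) : ∃ (p : Fin A.n → Polynomial k)
    (c : Matrix (Fin A.n) (Fin A.n) Pol(A.n, k)), (∀ i, (p i).Monic) ∧
    (∀ i, paeval (X i) (p i) = ∑ j, c i j * pderiv j A.W) ∧
    (∀ g, residue (fun i => pderiv i A.W) g = resMonic p (c.det * g)) ∧
    ∀ j g, residue (fun i => pderiv i A.W) (pderiv j A.W * g) = 0 := by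
  have h := exists_monic_eq_sum A
  obtain ⟨h1, h2⟩ := h.choose_spec
  have h3 : ∀ g, residue (fun i => pderiv i A.W) g = resMonic h.choose.1 (h.choose.2.det * g) := by
    intro g
    rw [residue, dif_pos h]; rfl
  refine ⟨h.choose.1, h.choose.2, h1, h2, h3, fun j g => ?_⟩
  rw [h3]
  generalize h.choose.1 = p at *
  generalize h.choose.2 = c at *
  have e : c.det * pderiv j A.W = ∑ i, paeval (X i) (p i) * c.adjugate j i := by
    have := congrFun (congrArg (fun N => N.mulVec fun l => pderiv l A.W) c.adjugate_mul) j
    simp only [← mulVec_mulVec, smul_mulVec, Matrix.one_mulVec, Pi.smul_apply, smul_eq_mul] at this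
    rw [← this, Matrix.mulVec, dotProduct]
    refine sum_congr rfl fun i _ => ?_
    rw [h2, mul_comm]; rfl
  rw [← mul_assoc, e, sum_mul, map_sum]
  refine sum_eq_zero fun i _ => ?_
  rw [mul_assoc, resMonic_aeval_mul h1]

/-- The difference quotient `(p(a) - p(y)) / (a - y)`. -/
def polyQuot {P : Type u} [CommRing P] [Algebra k P] (p : Polynomial k) (a y : P) : P :=
  ∑ n ∈ range (p.natDegree + 1), algebraMap k P (p.coeff n) *
    ∑ s ∈ range n, a ^ s * y ^ (n - 1 - s)

section

variable {P P' : Type u} [CommRing P] [Algebra k P] [CommRing P'] [Algebra k P']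

lemma polyQuot_comm (p : Polynomial k) (a y : P) : polyQuot p a y = polyQuot p y a := by
  rw [polyQuot, polyQuot]
  refine sum_congr rfl fun n _ => congrArg _ ?_
  rw [← Finset.sum_range_reflect]
  refine sum_congr rfl fun s hs => ?_
  have hs := mem_range.1 hs
  rw [mul_comm, show n - 1 - (n - 1 - s) = s by omega]

lemma map_polyQuot (φ : P →ₐ[k] P') (p : Polynomial k) (a y : P) : φ (polyQuot p a y) = polyQuot p (φ a) (φ y) := by
  simp only [polyQuot, map_sum, map_mul, map_pow, AlgHom.commutes]

/-- The coefficients of `polyQuot` as a polynomial in the second argument. -/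
def polyQuotCoeff (p : Polynomial k) (a : P) (j : ℕ) : P :=
  ∑ n ∈ range (p.natDegree + 1), if j < n then algebraMap k P (p.coeff n) * a ^ (n - 1 - j) else 0

lemma polyQuot_eq (p : Polynomial k) (a y : P) :
    polyQuot p a y = ∑ j ∈ range p.natDegree, polyQuotCoeff p a j * y ^ j := by
  rw [polyQuot_comm, polyQuot]
  simp only [polyQuotCoeff, sum_mul]
  rw [sum_comm]
  refine sum_congr rfl fun n hn => ?_
  have hn := mem_range.1 hn
  have : range n = (range p.natDegree).filter (· < n) := by
    ext j; simp only [mem_range, mem_filter]; omega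
  rw [this, Finset.sum_filter, mul_sum]
  refine sum_congr rfl fun j _ => ?_
  split_ifs
  · ring
  · ring

lemma polyQuotCoeff_pred {p : Polynomial k} (hp : p.Monic) (h : p.natDegree ≠ 0) (a : P) :
    polyQuotCoeff p a (p.natDegree - 1) = 1 := by
  rw [polyQuotCoeff, sum_eq_single p.natDegree]
  · rw [if_pos (by omega), hp.coeff_natDegree, map_one, one_mul, Nat.sub_self, pow_zero]
  · intro n hn hn'
    have hn := mem_range.1 hn
    rw [if_neg (by omega)]
  · intro h; simp at h

end

lemma resMonic_prod_X_pow {m : ℕ} {p : Fin m → Polynomial k} (hp : ∀ i, (p i).Monic) (e : Fin m → ℕ)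
    (he : ∀ i, e i < (p i).natDegree) : resMonic p (∏ i, X i ^ e i) =
      if e = (fun i => (p i).natDegree - 1) then 1 else 0 := by
  have h1 : (∏ i, X i ^ e i : Pol(m, k)) = sepProd fun i => Polynomial.X ^ e i := by
    rw [sepProd_apply]; simp
  rw [h1, resMonic_sepProd]
  have h2 : ∀ i, ((Polynomial.X ^ e i : Polynomial k) %ₘ p i).coeff ((p i).natDegree - 1) =
      if e i = (p i).natDegree - 1 then 1 else 0 := fun i => by
    nontriviality k
    rw [(Polynomial.modByMonic_eq_self_iff (hp i)).2, Polynomial.coeff_X_pow]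
    · simp only [eq_comm]
    · rw [Polynomial.degree_X_pow, degree_eq_natDegree (hp i).ne_zero]
      exact_mod_cast he i
  simp only [h2]
  rw [Finset.prod_ite_zero]
  simp [funext_iff]

lemma prod_tmul {T R : Type u} [CommRing T] [CommRing R] [Algebra k T] [Algebra k R] {ι : Type*}
    (s : Finset ι) (a : ι → T) (b : ι → R) : ∏ i ∈ s, (a i ⊗ₜ[k] b i) = (∏ i ∈ s, a i) ⊗ₜ[k] (∏ i ∈ s, b i) := by
  classical
  induction s using Finset.induction_on with
  | empty => simp only [Finset.prod_empty]; rfl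
  | insert i s hi ih =>
    rw [Finset.prod_insert hi, Finset.prod_insert hi, Finset.prod_insert hi, ih, tmul_mul_tmul]

lemma resMid_prod_polyQuot {T R : Type u} [CommRing T] [CommRing R] [Algebra k T] [Algebra k R] {m : ℕ}
    {p : Fin m → Polynomial k} (hp : ∀ i, (p i).Monic) (h0 : ∀ i, (p i).natDegree ≠ 0) (a : Fin m → T ⊗[k] R) :
    resMid (resMonic p) (∏ i, polyQuot (p i) (in13 k T Pol(m, k) R (a i)) (1 ⊗ₜ X i)) = 1 := by
  have h1 : ∀ i, polyQuot (p i) (in13 k T Pol(m, k) R (a i)) (1 ⊗ₜ X i) =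
      ∑ j ∈ range (p i).natDegree, (polyQuotCoeff (p i) (a i) j ⊗ₜ (X i ^ j) :
        Mid k T Pol(m, k) R) := fun i => by
    rw [polyQuot_eq]
    refine sum_congr rfl fun j _ => ?_
    have : polyQuotCoeff (p i) (in13 k T Pol(m, k) R (a i)) j =
        in13 k T Pol(m, k) R (polyQuotCoeff (p i) (a i) j) := by
      simp only [polyQuotCoeff, map_sum, apply_ite (in13 k T Pol(m, k) R), map_zero, map_mul, map_pow, AlgHom.commutes]
    rw [this, in13_apply, tmul_pow, one_pow, tmul_mul_tmul, mul_one, one_mul]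
  simp only [h1]
  rw [Finset.prod_univ_sum, map_sum]
  have h2 : ∀ e ∈ Fintype.piFinset fun i => range (p i).natDegree,
      resMid (resMonic p) (∏ i, (polyQuotCoeff (p i) (a i) (e i) ⊗ₜ (X i ^ e i) :
        Mid k T Pol(m, k) R)) =
      if e = (fun i => (p i).natDegree - 1) then 1 else 0 := fun e he => by
    rw [Fintype.mem_piFinset] at he
    rw [prod_tmul, resMid_tmul, resMonic_prod_X_pow hp e fun i =>
      mem_range.1 (he i)]
    split_ifs with h
    · rw [h, one_smul]
      exact Finset.prod_eq_one fun i _ => polyQuotCoeff_pred (hp i) (h0 i) _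
    · rw [zero_smul]
  rw [sum_congr rfl h2, Finset.sum_ite_eq', if_pos]
  rw [Fintype.mem_piFinset]
  intro i
  rw [mem_range]
  have := h0 i
  omega

lemma aeval_map_algebraMap_X {K : Type u} [CommRing K] [Algebra k K] {m : ℕ} (p : Polynomial k) (i : Fin m) :
    paeval (X i : Pol(m, K)) (p.map (algebraMap k K)) =
      paeval (X i : Pol(m, K)) p := Polynomial.aeval_map_algebraMap _ _ _

lemma dquot_aeval_map {K : Type u} [CommRing K] [Algebra k K] {m : ℕ} (b : Fin m → K) (i : Fin m)
    {p : Polynomial k} (hp : p.Monic) : dquot b i (paeval (X i) (p.map (algebraMap k K))) =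
      polyQuot p (X i) (C (b i)) := by
  nontriviality K
  rw [dquot_aeval_self, polyQuot, hp.natDegree_map]
  refine sum_congr rfl fun n _ => ?_
  rw [Polynomial.coeff_map]; rfl

end ResidueFacts

section ClosedForms

variable {K T : Type u} [CommRing K] [CommRing T] [Algebra K T]

namespace Forms

lemma mk_one : (Submodule.Quotient.mk 1 : BarMod K T) = 0 :=
  (Submodule.Quotient.mk_eq_zero _).2 ⟨1, (algebraMap K T).map_one⟩

lemma d_one_tmul (t : TensorAlgebra K (BarMod K T)) : Forms.d K T (1 ⊗ₜ t) = 0 := by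
  rw [d_tmul, mk_one, map_zero, zero_mul, tmul_zero]

lemma d_d (ω : Forms K T) : Forms.d K T (Forms.d K T ω) = 0 := by
  induction ω using tmul_induction with
  | zero => rw [map_zero, map_zero]
  | add x y hx hy => rw [map_add, map_add, hx, hy, add_zero]
  | tmul a t => rw [d_tmul, d_one_tmul]

lemma leftD_mk (b : T) (ω : Forms K T) : leftD K T (Submodule.Quotient.mk b) ω =
    Forms.d K T (b • ω) - b • Forms.d K T ω := rfl

lemma leftD_mk_one_tmul (b : T) (t : TensorAlgebra K (BarMod K T)) : leftD K T (Submodule.Quotient.mk b) (1 ⊗ₜ t) =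
      1 ⊗ₜ (tι K (Submodule.Quotient.mk b) * t) := by
  rw [leftD_mk, d_one_tmul, smul_zero, sub_zero, smul_tmul', smul_eq_mul, mul_one, d_tmul]

lemma leftD_mk_d (b : T) (ω : Forms K T) : Forms.d K T (leftD K T (Submodule.Quotient.mk b) ω) =
    - leftD K T (Submodule.Quotient.mk b) (Forms.d K T ω) := by
  rw [leftD_mk, leftD_mk, d_d, map_sub, d_d, smul_zero, sub_zero, zero_sub]

lemma lift_leftD_one_tmul (t t' : TensorAlgebra K (BarMod K T)) : tlift K (leftD K T) t (1 ⊗ₜ t') = 1 ⊗ₜ (t * t') := by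
  induction t using TensorAlgebra.induction generalizing t' with
  | algebraMap r =>
    rw [AlgHom.commutes, Module.algebraMap_end_apply, ← tmul_smul, Algebra.smul_def]
  | ι x =>
    obtain ⟨b, rfl⟩ := Submodule.Quotient.mk_surjective _ x
    rw [tlift_ι, leftD_mk_one_tmul]
  | mul a b ha hb => rw [map_mul, emul_apply, hb, ha, mul_assoc]
  | add a b ha hb => rw [map_add, ladd_apply, ha, hb, add_mul, tmul_add]

lemma d_lift_leftD (t : TensorAlgebra K (BarMod K T)) (ω : Forms K T) :
    Forms.d K T (tlift K (leftD K T) t ω) = tlift K (leftD K T) (tlift K (-tι K) t) (Forms.d K T ω) := by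
  induction t using TensorAlgebra.induction generalizing ω with
  | algebraMap r =>
    rw [AlgHom.commutes, AlgHom.commutes, AlgHom.commutes, Module.algebraMap_end_apply,
      Module.algebraMap_end_apply, map_smul]
  | ι x =>
    obtain ⟨b, rfl⟩ := Submodule.Quotient.mk_surjective _ x
    rw [tlift_ι, tlift_ι, LinearMap.neg_apply, map_neg, tlift_ι, leftD_mk_d]
    rfl
  | mul a b ha hb => rw [map_mul, emul_apply, ha, hb, map_mul, map_mul]; rfl
  | add a b ha hb =>
    rw [map_add, ladd_apply, map_add, ha, hb, map_add, map_add, ladd_apply]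

lemma mul_tmul (a : T) (t : TensorAlgebra K (BarMod K T)) (ω : Forms K T) :
    mul K T (a ⊗ₜ t) ω = a • tlift K (leftD K T) t ω := rfl

lemma sign_tmul (a : T) (t : TensorAlgebra K (BarMod K T)) : Forms.sign K T (a ⊗ₜ t) = a ⊗ₜ tlift K (-tι K) t := rfl

lemma lift_neg_lift_neg (t : TensorAlgebra K (BarMod K T)) : tlift K (-tι K) (tlift K (-tι K) t) = t := by
  have : (tlift K (-tι K)).comp (tlift K (-tι K)) =
      AlgHom.id K (TensorAlgebra K (BarMod K T)) := by
    refine TensorAlgebra.hom_ext (LinearMap.ext fun x => ?_)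
    change tlift K (-tι K) (tlift K (-tι K)
      (tι K x)) = tι K x
    rw [tlift_ι, LinearMap.neg_apply, map_neg, tlift_ι, LinearMap.neg_apply, neg_neg]
  exact DFunLike.congr_fun this t

/-- The commutator of `d` with right multiplication by a function. -/
lemma d_mul_sign_add (ω : Forms K T) (b : T) : Forms.d K T (mul K T (Forms.sign K T ω) (Forms.of K b)) +
      mul K T (Forms.sign K T (Forms.d K T ω)) (Forms.of K b) = mul K T ω (1 ⊗ₜ tι K (Submodule.Quotient.mk b)) := by
  induction ω using tmul_induction with
  | zero => simp only [map_zero, lzero_apply, add_zero]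
  | add x y hx hy =>
    simp only [map_add, ladd_apply]
    rw [← hx, ← hy]; abel
  | tmul a t =>
    have e1 := leftD_mk a (tlift K (leftD K T)
      (tlift K (-tι K) t) (Forms.of K b))
    rw [sign_tmul, mul_tmul, d_tmul, sign_tmul, mul_tmul, one_smul, map_mul, tlift_ι,
      map_mul, emul_apply, LinearMap.neg_apply,
      map_neg (tlift K (leftD K T)), tlift_ι,
      LinearMap.neg_apply, e1, d_lift_leftD, lift_neg_lift_neg, mul_tmul, Forms.of, d_tmul, mul_one]
    abel

end Forms

variable {J : Type u} [Fintype J] [DecidableEq J]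

/-- The matrix of the forms `dD_{ij}`. -/
def dMat (D : J → J → T) : Matrix J J (TensorAlgebra K (BarMod K T)) :=
  Matrix.of fun i j => tι K (Submodule.Quotient.mk (D i j))

lemma sign_dMat_pow (D : J → J → T) (l : ℕ) (i j : J) : tlift K (-tι K) ((dMat (K := K) D ^ l) i j) =
      (-1 : K) ^ l • (dMat (K := K) D ^ l) i j := by
  have h : (tlift K (-tι K)).mapMatrix (dMat (K := K) D) =
      (-1 : K) • dMat D := by
    refine Matrix.ext fun p q => ?_
    change tlift K (-tι K) (tι K (Submodule.Quotient.mk (D p q))) =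
      (-1 : K) • tι K (Submodule.Quotient.mk (D p q))
    rw [tlift_ι, neg_smul, one_smul]; rfl
  have h2 : (tlift K (-tι K)).mapMatrix (dMat (K := K) D ^ l) =
      (-1 : K) ^ l • dMat D ^ l := by rw [map_pow, h, smul_pow]
  exact congrFun (congrFun h2 i) j

lemma atiyahL_iterate (D : J → J → T) (g : J → T) (l : ℕ) (i : J) :
    (atiyahL (K := K) D)^[l] (fun q => Forms.of K (g q)) i =
      ∑ q, g q ⊗ₜ (((dMat (K := K) fun p q => D q p) ^ l) q i) := by
  induction l generalizing i with
  | zero =>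
    simp only [Function.iterate_zero, id, pow_zero]
    rw [sum_eq_single i, one_apply_eq]
    · rfl
    · intro j _ hj; rw [one_apply_ne hj, tmul_zero]
    · intro h; exact absurd (mem_univ _) h
  | succ l ih =>
    rw [iterate_succ_apply', atiyahL, map_sum, ← sum_add_distrib]
    simp only [Forms.d_mul_sign_add]
    simp only [ih, map_sum, lsum_apply, Forms.mul_tmul, Forms.lift_leftD_one_tmul, smul_tmul', smul_eq_mul, mul_one]
    rw [sum_comm]
    refine sum_congr rfl fun q _ => ?_
    rw [← tmul_sum, pow_succ, mmul_apply]
    rfl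

lemma atiyahArrow_one_tmul (par : J → ZMod 2) (D : J → J → T) (hD : ∀ i j, par i ≠ par j + 1 → D i j = 0)
    (t : J → TensorAlgebra K (BarMod K T)) (l : ℕ) (ht : ∀ j, tlift K (-tι K) (t j) = (-1 : K) ^ l • t j) (i : J) :
    atiyahArrow (K := K) par D (fun j => 1 ⊗ₜ t j) i =
      1 ⊗ₜ ((-1 : K) ^ l • ∑ j, dMat (K := K) D i j * t j) := by
  have h2 : ∀ p : ZMod 2, p = 0 ∨ p = 1 := by decide
  have e1 : ∀ j, gradedTwist (K := K) par (fun j => (1 : T) ⊗ₜ t j) j =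
      1 ⊗ₜ (((-1 : K) ^ l) ^ (par j).val • t j) := fun j => by
    rw [gradedTwist]
    rcases h2 (par j) with h | h
    · rw [h, if_pos rfl, ZMod.val_zero, pow_zero, one_smul]
    · rw [h, if_neg (by decide), Forms.sign_tmul, ht, val_one, pow_one]
  have e2 : atiyahR (K := K) par D (gradedTwist par fun j => (1 : T) ⊗ₜ t j) i =
      (1 : T) ⊗ₜ ((-1 : K) ^ (par i).val • ((-1 : K) ^ l) ^ (par i + 1).val •
        ∑ j, dMat (K := K) D i j * t j) := by
    have e3 : ∀ j, D i j • gradedTwist (K := K) par (fun j => (1 : T) ⊗ₜ t j) j =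
        D i j ⊗ₜ (((-1 : K) ^ l) ^ (par i + 1).val • t j) := fun j => by
      rw [e1, smul_tmul', smul_eq_mul, mul_one]
      by_cases h : par i = par j + 1
      · have : par i + 1 = par j := by
          rw [h]
          have : ∀ p : ZMod 2, p + 1 + 1 = p := by decide
          exact this _
        rw [this]
      · rw [hD i j h, zero_tmul, zero_tmul]
    rw [atiyahR]
    have e5 : ∀ j, D i j • ((-1 : ℤ) ^ (par j).val •
        Forms.d K T (gradedTwist (K := K) par (fun j => (1 : T) ⊗ₜ t j) j)) = 0 := fun j => by
      rw [e1, Forms.d_one_tmul, smul_zero, smul_zero]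
    rw [sum_eq_zero fun j _ => e5 j, add_zero, sum_congr rfl fun j _ => e3 j, map_sum,
      sum_congr rfl fun j _ => Forms.d_tmul K _ _ _, ← tmul_sum]
    have e6 : ∑ j, tι K (Submodule.Quotient.mk (D i j)) *
        ((-1 : K) ^ l) ^ (par i + 1).val • t j =
        ((-1 : K) ^ l) ^ (par i + 1).val • ∑ j, dMat (K := K) D i j * t j := by
      simp only [mul_smul_comm, smul_sum]; rfl
    rw [e6]
    rcases h2 (par i) with h | h
    · simp only [h, ZMod.val_zero, pow_zero, one_smul]
    · simp only [h, val_one, pow_one, neg_smul, one_smul, tmul_neg]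
  rw [atiyahArrow, gradedTwist, e2]
  have e4 : tlift K (-tι K) (∑ j, dMat (K := K) D i j * t j) =
      (-1 : K) ^ (l + 1) • ∑ j, dMat (K := K) D i j * t j := by
    rw [map_sum, smul_sum]
    refine sum_congr rfl fun j _ => ?_
    have := sign_dMat_pow (K := K) D 1 i j
    rw [pow_one, pow_one] at this
    rw [map_mul, ht, this, smul_mul_smul_comm, pow_succ']
  rcases h2 (par i) with h | h
  · rw [h, if_pos rfl]
    simp [val_one]
  · rw [h, if_neg (by decide), Forms.sign_tmul, map_smul, map_smul, e4]
    have : ((1 : ZMod 2) + 1).val = 0 := by decide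
    rw [this, pow_zero, one_smul, smul_smul, val_one, pow_one, pow_succ]
    congr 2; ring

lemma atiyahArrow_iterate (par : J → ZMod 2) (D : J → J → T)
    (hD : ∀ i j, par i ≠ par j + 1 → D i j = 0) (c : J → K) (l : ℕ) (i : J) :
    (atiyahArrow (K := K) par D)^[l] (fun q => Forms.of K (algebraMap K T (c q))) i =
      1 ⊗ₜ ((-1 : K) ^ (∑ r ∈ range l, r) • ∑ q, c q • (dMat (K := K) D ^ l) i q) := by
  induction l generalizing i with
  | zero =>
    simp only [Function.iterate_zero, id, pow_zero, Finset.range_zero, sum_empty, one_smul]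
    rw [sum_eq_single i, one_apply_eq, Forms.of, Algebra.algebraMap_eq_smul_one, smul_tmul]
    · intro j _ hj; rw [one_apply_ne hj.symm, smul_zero]
    · intro h; exact absurd (mem_univ _) h
  | succ l ih =>
    rw [iterate_succ_apply', funext ih, atiyahArrow_one_tmul par D hD _ l]
    · congr 1
      simp only [mul_smul_comm, mul_sum]
      rw [← smul_sum, smul_smul, sum_range_succ, ← pow_add, add_comm l, sum_comm]
      congr 1
      refine sum_congr rfl fun q _ => ?_
      rw [pow_succ', mmul_apply, smul_sum]
    · intro j
      rw [map_smul, map_sum, smul_comm ((-1 : K) ^ l)]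
      simp only [map_smul, sign_dMat_pow, smul_comm (c _) ((-1 : K) ^ l), ← smul_sum]

end ClosedForms

section PsiMatrices

open MvPolynomial

variable {n : ℕ} {K : Type u} [CommRing K] (b : Fin n → Pol(n, K))

lemma psi_tmul (s : Finset (Fin n)) (a : Pol(n, K))
    (t : TensorAlgebra K (BarMod K Pol(n, K))) : psi b s (a ⊗ₜ t) = a * psiCoeff b s t := rfl

lemma psiCoeff_tprod {s : Finset (Fin n)} {l : ℕ} (h : s.card = l) (v : Fin l → BarMod K Pol(n, K)) :
    psiCoeff b s (TensorAlgebra.tprod K _ l v) = ∏ j, diffQuotBar b (s.orderEmbOfFin h j) (v j) := by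
  subst h
  have := TensorAlgebra.toDirectSum_tensorPower_tprod (R := K) v
  rw [psiCoeff, lcomp_apply, lcomp_apply, toLinearMap_apply, this]
  rw [← DirectSum.lof_eq_of K, DirectSum.component.lof_self, PiTensorProduct.lift.tprod]
  rfl

lemma psiCoeff_tprod_of_ne {s : Finset (Fin n)} {l : ℕ} (h : s.card ≠ l) (v : Fin l → BarMod K Pol(n, K)) :
    psiCoeff b s (TensorAlgebra.tprod K _ l v) = 0 := by
  have := TensorAlgebra.toDirectSum_tensorPower_tprod (R := K) v
  rw [psiCoeff, lcomp_apply, lcomp_apply, toLinearMap_apply, this,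
    ← DirectSum.lof_eq_of K, DirectSum.component.of, dif_neg h.symm, map_zero]

lemma tensorAlgebra_induction_tprod {M : Type u} [AddCommGroup M] [Module K M]
    {p : TensorAlgebra K M → Prop} (h : ∀ (c : K) l v, p (c • TensorAlgebra.tprod K M l v))
    (ha : ∀ x y, p x → p y → p (x + y)) (t : TensorAlgebra K M) : p t := by
  rw [← TensorAlgebra.ofDirectSum_toDirectSum t]
  induction TensorAlgebra.toDirectSum t using DirectSum.induction_on with
  | zero => simpa using h 0 0 0
  | add x y hx hy => rw [map_add]; exact ha _ _ hx hy
  | of l x =>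
    induction x using PiTensorProduct.induction_on with
    | smul_tprod c v =>
      rw [← DirectSum.lof_eq_of K, map_smul, map_smul, DirectSum.lof_eq_of, TensorAlgebra.ofDirectSum_of_tprod]
      exact h c l v
    | add x y hx hy => rw [map_add, map_add]; exact ha _ _ hx hy

lemma ι_mul_tprod {M : Type u} [AddCommGroup M] [Module K M] (a : M) {l : ℕ} (v : Fin l → M) :
    tι K a * TensorAlgebra.tprod K M l v = TensorAlgebra.tprod K M (l + 1) (Fin.cons a v) := by
  rw [TensorAlgebra.tprod_apply, TensorAlgebra.tprod_apply, ofFn_succ, prod_cons, Fin.cons_zero]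
  simp only [cons_succ]

lemma psiCoeff_empty_ι_mul (a : BarMod K Pol(n, K)) (t : TensorAlgebra K (BarMod K Pol(n, K))) :
    psiCoeff b ∅ (tι K a * t) = 0 := by
  induction t using tensorAlgebra_induction_tprod with
  | ha x y hx hy => rw [mul_add, map_add, hx, hy, add_zero]
  | h c l v =>
    rw [mul_smul_comm, map_smul, ι_mul_tprod, psiCoeff_tprod_of_ne b (by simp), smul_zero]

lemma psiCoeff_insert_ι_mul {i : Fin n} {s : Finset (Fin n)} (hi : ∀ j ∈ s, i < j)
    (a : BarMod K Pol(n, K)) (t : TensorAlgebra K (BarMod K Pol(n, K))) :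
    psiCoeff b (insert i s) (tι K a * t) = diffQuotBar b i a * psiCoeff b s t := by
  have hni : i ∉ s := fun h => lt_irrefl _ (hi i h)
  induction t using tensorAlgebra_induction_tprod with
  | ha x y hx hy => rw [mul_add, map_add, hx, hy, map_add, mul_add]
  | h c l v =>
    rw [mul_smul_comm, map_smul, map_smul, mul_smul_comm, ι_mul_tprod]
    congr 1
    by_cases hl : s.card = l
    · have hl' : (insert i s).card = l + 1 := by rw [card_insert_of_notMem hni, hl]
      have e : (Fin.cons i (s.orderEmbOfFin hl) : Fin (l + 1) → Fin n) = (insert i s).orderEmbOfFin hl' := by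
        refine Finset.orderEmbOfFin_unique hl' (fun x => ?_) ?_
        · refine Fin.cases ?_ (fun j => ?_) x
          · rw [Fin.cons_zero]; exact Finset.mem_insert_self _ _
          · rw [cons_succ]; exact Finset.mem_insert_of_mem (Finset.orderEmbOfFin_mem _ _ _)
        · intro x y hxy
          induction y using Fin.cases with
          | zero => exact absurd hxy (Fin.not_lt_zero _)
          | succ y =>
            induction x using Fin.cases with
            | zero =>
              rw [Fin.cons_zero, cons_succ]
              exact hi _ (Finset.orderEmbOfFin_mem _ _ _)
            | succ x =>
              rw [cons_succ, cons_succ]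
              exact (s.orderEmbOfFin hl).strictMono (Fin.succ_lt_succ_iff.1 hxy)
      rw [psiCoeff_tprod b hl', psiCoeff_tprod b hl, Fin.prod_univ_succ, ← e]
      simp only [Fin.cons_zero, cons_succ]
    · rw [psiCoeff_tprod_of_ne b hl, mul_zero, psiCoeff_tprod_of_ne]
      rw [card_insert_of_notMem hni]
      omega

lemma psiCoeff_one (s : Finset (Fin n)) : psiCoeff b s 1 = if s = ∅ then 1 else 0 := by
  have h : (1 : TensorAlgebra K (BarMod K Pol(n, K))) =
    TensorAlgebra.tprod K _ 0 Fin.elim0 := by rw [TensorAlgebra.tprod_apply]; simp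
  rw [h]
  split_ifs with hs
  · subst hs; rw [psiCoeff_tprod b (l := 0) rfl]; simp
  · rw [psiCoeff_tprod_of_ne]; rwa [Ne, Finset.card_eq_zero]

lemma oprod_insert_of_lt {𝓐 : Type*} [Ring 𝓐] (A : Fin n → 𝓐) {i : Fin n} {s : Finset (Fin n)}
    (hi : ∀ j ∈ s, i < j) : oprod A (insert i s) = A i * oprod A s := by
  have h1 : ((List.ofFn (s.piecewise A 1)).take i).prod = 1 := by
    refine List.prod_eq_one fun x hx => ?_
    obtain ⟨j, hj, rfl⟩ := List.mem_take_iff_getElem.1 hx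
    rw [getElem_ofFn, Finset.piecewise_eq_of_notMem, Pi.one_apply]
    intro h
    have h2 := hi _ h
    have h3 : (i : ℕ) < j := h2
    have := lt_min_iff.1 hj
    omega
  have hni : i ∉ s := fun h => lt_irrefl _ (hi i h)
  have h2 := oprod_erase A s i
  rw [Finset.erase_eq_of_notMem hni, h1, one_mul] at h2
  rw [oprod_insert, h1, one_mul, h2]

variable {J : Type u} [Fintype J] [DecidableEq J]

lemma psiCoeff_dMat_pow (D : J → J → Pol(n, K)) (s : Finset (Fin n)) (l : ℕ) (p q : J) :
    psiCoeff b s ((dMat (K := K) D ^ l) p q) = if l = s.card then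
      oprod (fun i => (Matrix.of fun p q => diffQuot K X b i (D p q) :
        Matrix J J Pol(n, K))) s p q else 0 := by
  induction s using Finset.induction_on_min generalizing l p with
  | empty =>
    cases l with
    | zero =>
      rw [pow_zero, card_empty, if_pos rfl, oprod_empty]
      by_cases h : p = q
      · rw [h, one_apply_eq, one_apply_eq, psiCoeff_one, if_pos rfl]
      · rw [one_apply_ne h, one_apply_ne h, map_zero]
    | succ l =>
      rw [pow_succ', mmul_apply, map_sum, card_empty, if_neg (Nat.succ_ne_zero _)]
      exact sum_eq_zero fun r _ => psiCoeff_empty_ι_mul b _ _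
  | insert i s hi ih =>
    have hni : i ∉ s := fun h => lt_irrefl _ (hi i h)
    rw [card_insert_of_notMem hni]
    cases l with
    | zero =>
      rw [pow_zero, if_neg (Nat.succ_ne_zero _).symm]
      by_cases h : p = q
      · rw [h, one_apply_eq, psiCoeff_one, if_neg (Finset.insert_ne_empty _ _)]
      · rw [one_apply_ne h, map_zero]
    | succ l =>
      rw [pow_succ', mmul_apply, map_sum, oprod_insert_of_lt _ hi, mmul_apply]
      simp only [Nat.succ_inj]
      have h1 : ∀ r, psiCoeff b (insert i s) (dMat (K := K) D p r * (dMat (K := K) D ^ l) r q) =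
          diffQuot K X b i (D p r) * psiCoeff b s ((dMat (K := K) D ^ l) r q) :=
        fun r => psiCoeff_insert_ι_mul b hi _ _
      simp only [h1, ih]
      split_ifs
      · rfl
      · simp only [mul_zero, sum_const_zero]

end PsiMatrices

open LinFact MvPolynomial

section DifferentialMatrices

variable {A : Type u} [CommRing A] {w : A} {X : LinFact A w} {I : Type u} [Fintype I]

/-- The matrix of the differential. -/
def LinFact.HomBasis.mat (e : X.HomBasis I) : Matrix I I A :=
  Matrix.of fun i j => e.basis.repr (X.d (e.basis j)) i

lemma LinFact.HomBasis.repr_d (e : X.HomBasis I) (x : X.carrier) (i : I) :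
    e.basis.repr (X.d x) i = ∑ j, e.mat i j * e.basis.repr x j := repr_map_eq_sum e.basis e.basis X.d x i

lemma LinFact.HomBasis.d_basis (e : X.HomBasis I) (j : I) :
    X.d (e.basis j) = ∑ i, e.mat i j • e.basis i := (e.basis.sum_repr _).symm

lemma LinFact.HomBasis.mat_mul_mat [DecidableEq I] (e : X.HomBasis I) : e.mat * e.mat = algebraMap A (Matrix I I A) w := by
  refine Matrix.ext fun i j => ?_
  rw [mmul_apply]
  have h := e.repr_d (X.d (e.basis j)) i
  rw [X.d_sq, map_smul, fsmul_apply, e.basis.repr_self, smul_eq_mul] at h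
  refine h.symm.trans ?_
  rw [Matrix.algebraMap_matrix_apply, single_apply]
  by_cases hij : i = j
  · rw [if_pos hij, if_pos hij.symm, mul_one]; rfl
  · rw [if_neg hij, if_neg (Ne.symm hij), mul_zero]

lemma LinFact.HomBasis.sign_basis (e : X.HomBasis I) (i : I) :
    X.sign (e.basis i) = ((-1 : A) ^ (e.par i).val) • e.basis i := by
  have h2 : ∀ p : ZMod 2, p = 0 ∨ p = 1 := by decide
  rw [sign_apply, e.even_basis]
  rcases h2 (e.par i) with h | h
  · rw [h, if_pos rfl, ZMod.val_zero, pow_zero, one_smul]; abel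
  · rw [h, if_neg (by decide), val_one, pow_one, neg_smul, one_smul]; abel

lemma LinFact.HomBasis.mat_eq_zero (e : X.HomBasis I) {i j : I} (h : e.par i ≠ e.par j + 1) : e.mat i j = 0 := by
  have h1 := congrArg (fun x => e.basis.repr x i) (X.d_odd (e.basis j))
  simp only [map_add, fadd_apply, e.repr_even, e.even_basis] at h1
  change (if e.par i = 0 then e.mat i j else 0) + _ = e.mat i j at h1
  have h2 : ∀ p : ZMod 2, p = 0 ∨ p = 1 := by decide
  rcases h2 (e.par i) with hi | hi <;> rcases h2 (e.par j) with hj | hj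
  · rw [if_pos hi, if_pos hj] at h1
    exact left_eq_add.1 h1.symm
  · exact absurd (by rw [hi, hj]; decide) h
  · exact absurd (by rw [hi, hj]; decide) h
  · rw [if_neg (by rw [hi]; decide), if_neg (by rw [hj]; decide), map_zero, map_zero, Finsupp.zero_apply,
      add_zero] at h1
    exact h1.symm

end DifferentialMatrices

section Kronecker

open scoped Kronecker

variable {R : Type*} [CommRing R] (I J : Type*) [Fintype I] [DecidableEq I] [Fintype J] [DecidableEq J]

/-- The ring homomorphism `M ↦ M ⊗ 1`. -/
def kronOne : Matrix I I R →+* Matrix (I × J) (I × J) R where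
  toFun M := M ⊗ₖ 1
  map_one' := Matrix.one_kronecker_one
  map_mul' M N := by rw [← Matrix.mul_kronecker_mul, one_mul]
  map_zero' := Matrix.zero_kronecker _
  map_add' M N := Matrix.add_kronecker _ _ _

lemma kronOne_apply (M : Matrix I I R) (p q : I × J) : kronOne I J M p q = if p.2 = q.2 then M p.1 q.1 else 0 := by
  change M p.1 q.1 * (1 : Matrix J J R) p.2 q.2 = _
  rw [Matrix.one_apply, mul_ite, mul_one, mul_zero]

lemma oprod_kronOne {n : ℕ} (a : Fin n → Matrix I I R) (s : Finset (Fin n)) (p q : I × J) :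
    oprod (fun i => kronOne I J (a i)) s p q = if p.2 = q.2 then oprod a s p.1 q.1 else 0 := by
  rw [← kronOne_apply, map_oprod]

end Kronecker

section Formulas

variable {k : Type u} [CommRing k] {O M : Obj k} {I J : Type u} [Fintype I] [DecidableEq I] [Fintype J]
  [DecidableEq J] {Y : Fact M O} {Z : Fact O M}

variable (O M) in
/-- The constants `x'` in `M ⊗ O`. -/
def outVar (i : Fin O.n) : M ⊠[k] O := 1 ⊗ₜ X i

/-- The matrix of a 1-morphism over the ring of a composite. -/
def matL : Matrix I I (O ⊠[k] M) →+* Matrix I I (Tri O M) := (embL O M).toRingHom.mapMatrix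

/-- The difference quotients of a matrix in the variables of the first factor. -/
def quotL (N : Matrix I I (O ⊠[k] M)) (i : Fin O.n) : Matrix I I (Tri O M) :=
  dquotMat (outVar O M) i (matL N)

lemma matProd_eq_zero (e : Y.HomBasis I) (f : Z.HomBasis J) (p q : I × J)
    (h : parProd e f p ≠ parProd e f q + 1) : matProd e f p q = 0 := by
  rw [matProd]
  rw [parProd, parProd] at h
  have h1 : (if p.2 = q.2 then embL O M (e.basis.repr (Y.d (e.basis q.1)) p.1) else 0) = 0 := by
    split_ifs with h2
    · rw [h2] at h
      have : e.mat p.1 q.1 = 0 := e.mat_eq_zero fun h' => h (by rw [h']; ring)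
      exact (congrArg _ this).trans (map_zero _)
    · rfl
  have h3 : (if p.1 = q.1 then (-1) ^ (e.par q.1).val *
      embR O M (f.basis.repr (Z.d (f.basis q.2)) p.2) else 0) = 0 := by
    split_ifs with h2
    · rw [h2] at h
      have : f.mat p.2 q.2 = 0 := f.mat_eq_zero fun h' => h (by rw [h']; ring)
      exact (congrArg (fun x => (-1) ^ (e.par q.1).val * embR O M x) this).trans (by rw [map_zero, mul_zero])
    · rfl
  rw [h1, h3, add_zero]

lemma dquot_C {K : Type u} [CommRing K] {m : ℕ} (b : Fin m → K) (i : Fin m) (c : K) : dquot b i (C c) = 0 :=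
  diffQuot_algebraMap _ _ _ _

lemma dquot_matProd (e : Y.HomBasis I) (f : Z.HomBasis J) (i : Fin O.n) :
    (Matrix.of fun p q => diffQuot (M ⊠[k] O) X (varOut O M) i (matProd e f p q)) = kronOne I J (quotL e.mat i) := by
  refine Matrix.ext fun p q => ?_
  rw [kronOne_apply, of_apply, matProd, map_add]
  have h : diffQuot (M ⊠[k] O) X (varOut O M) i (if p.1 = q.1 then (-1) ^ (e.par q.1).val *
      embR O M (f.basis.repr (Z.d (f.basis q.2)) p.2) else 0) = 0 := by
    split_ifs
    · have h1 : ((-1) ^ (e.par q.1).val * embR O M (f.basis.repr (Z.d (f.basis q.2)) p.2) : Tri O M) =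
          C ((-1) ^ (e.par q.1).val * f.basis.repr (Z.d (f.basis q.2)) p.2) := by
        rw [C_mul, C_pow, C_neg, C_1]; rfl
      rw [h1]; exact diffQuot_algebraMap _ _ _ _
    · exact map_zero _
  rw [h, add_zero]
  split_ifs
  · rfl
  · exact map_zero _

lemma psi_one_tmul {n : ℕ} {K : Type u} [CommRing K] (b : Fin n → Pol(n, K)) (s : Finset (Fin n))
    (t : TensorAlgebra K (BarMod K Pol(n, K))) : psi b s (1 ⊗ₜ t) = psiCoeff b s t := by
  rw [psi_tmul, one_mul]

lemma psiAt_C (e : Y.HomBasis I) (f : Z.HomBasis J) (c : I × J → M ⊠[k] O) (l : ℕ) (p : I × J)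
    (s : Finset (Fin O.n)) : psiAt e f (fun q => C (c q)) l p s = if l = s.card then
      (-1) ^ (∑ r ∈ range l, r) * ∑ r, oprod (quotL e.mat) s p.1 r * C (c (r, p.2)) else 0 := by
  have h1 := atiyahArrow_iterate (K := M ⊠[k] O) (parProd e f) (matProd e f)
    (matProd_eq_zero e f) c l p
  rw [psiAt]
  refine (congrArg _ h1).trans ?_
  rw [psi_one_tmul, map_smul, map_sum, Algebra.smul_def, map_pow, map_neg, map_one]
  simp only [map_smul, psiCoeff_dMat_pow, dquot_matProd, oprod_kronOne]
  split_ifs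
  · congr 1
    rw [Fintype.sum_prod_type]
    refine sum_congr rfl fun r _ => ?_
    rw [sum_eq_single p.2]
    · rw [if_pos rfl, Algebra.smul_def, mul_comm]; rfl
    · intro j _ hj; rw [if_neg hj.symm]; exact smul_zero _
    · intro h; exact absurd (mem_univ _) h
  · simp only [smul_zero, sum_const_zero, mul_zero]

/-- The sign of the coefficient of `γ_s` in the coevaluation. -/
lemma card_inversions_compl {n : ℕ} (t : Finset (Fin n)) :
    ((-1 : ℤˣ)) ^ ((tᶜ ×ˢ t).filter fun p : Fin n × Fin n => p.2 < p.1).card * (-1) ^ (∑ r ∈ range t.card, r) *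
      (-1) ^ (t.card + n * t.card) = (-1) ^ (∑ i ∈ t, (i : ℕ)) := by
  have h1 : ∀ t : Finset (Fin n), ((t ×ˢ t).filter fun p : Fin n × Fin n => p.2 < p.1).card =
      ∑ r ∈ range t.card, r := by
    intro t
    induction t using Finset.induction_on_max with
    | empty => simp
    | insert a s ha ih =>
      have hna : a ∉ s := fun h => lt_irrefl _ (ha a h)
      rw [card_insert_of_notMem hna, sum_range_succ, ← ih]
      have : ((insert a s ×ˢ insert a s).filter fun p : Fin n × Fin n => p.2 < p.1) =
          ((s ×ˢ s).filter fun p : Fin n × Fin n => p.2 < p.1) ∪ s.image fun x => (a, x) := by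
        ext ⟨x, y⟩
        simp only [mem_filter, Finset.mem_product, Finset.mem_insert, Finset.mem_union, Finset.mem_image, Prod.mk.injEq]
        constructor
        · rintro ⟨⟨rfl | hx, rfl | hy⟩, h⟩
          · exact absurd h (lt_irrefl _)
          · exact Or.inr ⟨y, hy, rfl, rfl⟩
          · exact absurd h (ha x hx).not_gt
          · exact Or.inl ⟨⟨hx, hy⟩, h⟩
        · rintro (⟨⟨hx, hy⟩, h⟩ | ⟨z, hz, rfl, rfl⟩)
          · exact ⟨⟨Or.inr hx, Or.inr hy⟩, h⟩
          · exact ⟨⟨Or.inl rfl, Or.inr hz⟩, ha _ hz⟩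
      rw [this, Finset.card_union_of_disjoint, Finset.card_image_of_injective _ (Prod.mk_right_injective a)]
      rw [Finset.disjoint_left]
      rintro ⟨x, y⟩ h h'
      simp only [mem_filter, Finset.mem_product] at h
      obtain ⟨z, _, h''⟩ := Finset.mem_image.1 h'
      rw [Prod.mk.injEq] at h''
      exact hna (h''.1 ▸ h.1.1)
  have h2 : ((tᶜ ×ˢ t).filter fun p : Fin n × Fin n => p.2 < p.1).card +
      ((t ×ˢ t).filter fun p : Fin n × Fin n => p.2 < p.1).card + ∑ i ∈ t, ((i : ℕ) + 1) = n * t.card := by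
    have e1 : ((univ ×ˢ t).filter fun p : Fin n × Fin n => p.2 < p.1) =
        ((tᶜ ×ˢ t).filter fun p : Fin n × Fin n => p.2 < p.1) ∪
          ((t ×ˢ t).filter fun p : Fin n × Fin n => p.2 < p.1) := by
      rw [← Finset.filter_union, ← Finset.union_product, Finset.union_comm, Finset.union_compl]
    have e2 : Disjoint ((tᶜ ×ˢ t).filter fun p : Fin n × Fin n => p.2 < p.1)
        ((t ×ˢ t).filter fun p : Fin n × Fin n => p.2 < p.1) := by
      rw [Finset.disjoint_left]
      rintro ⟨x, y⟩ h h'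
      simp only [mem_filter, Finset.mem_product, Finset.mem_compl] at h h'
      exact h.1.1 h'.1.1
    rw [← Finset.card_union_of_disjoint e2, ← e1, Finset.card_filter, Finset.sum_product_right,
      ← sum_add_distrib, Finset.sum_const_nat (m := n), mul_comm]
    intro i _
    rw [← Finset.card_filter]
    have : (univ.filter fun x : Fin n => i < x) = Finset.Ioi i := by ext; simp
    rw [this, Fin.card_Ioi]
    omega
  rw [h1 t, sum_add_distrib, Finset.sum_const, smul_eq_mul, mul_one] at h2
  rw [← h2, ← pow_add, ← pow_add]
  set a := ((tᶜ ×ˢ t).filter fun p : Fin n × Fin n => p.2 < p.1).card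
  set b := ∑ r ∈ range t.card, r
  have : a + b + (t.card + (a + b + (∑ i ∈ t, (i : ℕ) + t.card))) =
      2 * (a + b + t.card) + ∑ i ∈ t, (i : ℕ) := by ring
  rw [this, pow_add, pow_mul]
  simp

/-- The coevaluation in terms of ordered products of difference quotients. -/
lemma coevFormula_eq (e : Y.HomBasis I) (f : Z.HomBasis I) (ι : I → M ⊠[k] O) (c : ℕ)
    (γ : Finset (Fin O.n) → O ⊠[k] O) :
    coevFormula e f (fun p => if p.1 = p.2 then C (ι p.1) else 0) c γ = ∑ s : Finset (Fin O.n), γ s • ∑ p, ∑ q,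
      act3 (triMid O M (((-1) ^ c * (-1) ^ (∑ i ∈ sᶜ, (i : ℕ))) *
        (oprod (quotL e.mat) sᶜ p q * C (ι q)))) (pt (e.basis p) (f.basis q)) := by
  have h0 : (fun p : I × I => if p.1 = p.2 then (C (ι p.1) : Tri O M) else 0) =
      fun p => C (if p.1 = p.2 then ι p.1 else 0) := by
    ext1 p; split_ifs; exacts [rfl, C_0.symm]
  rw [h0, coevFormula, Fintype.sum_prod_type]
  simp only [smul_sum]
  conv_rhs => rw [sum_comm]
  refine sum_congr rfl fun p _ => ?_
  conv_rhs => rw [sum_comm]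
  refine sum_congr rfl fun q _ => ?_
  rw [triSmul_eq]
  simp only [← act3_in13, ← act3_mul, ← triMid_embOut, ← map_mul]
  rw [← lsum_apply, ← map_sum, ← map_sum]
  congr 3
  simp only [wedge, Finset.powerset_univ, mul_sum]
  rw [sum_comm]
  refine sum_congr rfl fun s _ => ?_
  rw [← Finset.compl_eq_univ_sdiff]
  have hs : sᶜ.card ∈ range (O.n + 1) := by
    rw [mem_range, Nat.lt_succ_iff]
    exact (Finset.card_le_univ _).trans (by simp)
  rw [Finset.sum_eq_single_of_mem _ hs]
  · rw [psiAt_C, if_pos rfl, sum_eq_single q]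
    · rw [if_pos rfl]
      have h1 := congrArg (fun x : ℤˣ => ((x : ℤ) : Tri O M)) (card_inversions_compl sᶜ)
      push_cast at h1
      rw [compl_compl] at h1
      rw [← h1]
      simp only [pow_add]
      ring
    · intro r _ hr; rw [if_neg hr, C_0, mul_zero]
    · intro h; exact absurd (mem_univ _) h
  · intro l _ hl
    rw [psiAt_C, if_neg hl, mul_zero, mul_zero, mul_zero]

/-- The evaluation in terms of ordered products of difference quotients. -/
lemma evFormula_eq (e : Y.HomBasis I) (f : Z.HomBasis I) (c : I → ℤ) (y : Y.carrier) (z : Z.carrier)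
    (s : Finset (Fin O.n)) : evFormula e f c y z s = midRes (∑ p, ∑ q, c q •
      (embL O M (e.basis.repr y p) * oprod (quotL e.mat.transpose) s p q * embR O M (f.basis.repr z q))) := by
  rw [evFormula]
  congr 1
  have hs : s.card ∈ range (O.n + 1) := by
    rw [mem_range, Nat.lt_succ_iff]
    exact (Finset.card_le_univ _).trans (by simp)
  have h1 : ∀ l (q : I), psi (varOut O M) s ((atiyahL (matProd e f))^[l]
      (fun q => Forms.of (M ⊠[k] O)
      (embL O M (e.basis.repr y q.1) * embR O M (f.basis.repr z q.2))) (q, q)) = if l = s.card then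
      ∑ p, embL O M (e.basis.repr y p) * oprod (quotL e.mat.transpose) s p q * embR O M (f.basis.repr z q)
      else 0 := fun l q => by
    have h2 := atiyahL_iterate (K := M ⊠[k] O) (matProd e f)
      (fun q => embL O M (e.basis.repr y q.1) * embR O M (f.basis.repr z q.2)) l (q, q)
    refine (congrArg _ h2).trans ?_
    have h3 : ∀ i, (Matrix.of fun p q => diffQuot (M ⊠[k] O) X (varOut O M) i (matProd e f q p)) =
        kronOne I I (quotL e.mat.transpose i) := fun i => by
      refine Matrix.ext fun p q => ?_
      have := congrFun (congrFun (dquot_matProd e f i) q) p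
      refine this.trans ?_
      rw [kronOne_apply, kronOne_apply]
      simp only [eq_comm (a := q.2)]
      rfl
    rw [map_sum]
    simp only [psi_tmul, psiCoeff_dMat_pow, h3, oprod_kronOne]
    split_ifs
    · rw [Fintype.sum_prod_type]
      refine sum_congr rfl fun r _ => ?_
      rw [sum_eq_single q]
      · rw [if_pos rfl]; ring
      · intro j _ hj; rw [if_neg hj]; exact mul_zero _
      · intro h; exact absurd (mem_univ _) h
    · simp only [mul_zero, sum_const_zero]
  rw [Finset.sum_eq_single_of_mem _ hs]
  · rw [map_sum, sum_comm]
    refine sum_congr rfl fun q _ => ?_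
    rw [map_zsmul, h1, if_pos rfl, smul_sum]
  · intro l _ hl
    rw [map_sum]
    refine sum_eq_zero fun q _ => ?_
    rw [map_zsmul, h1, if_neg hl, smul_zero]

end Formulas

section TensorSums

variable {k T S R : Type u} [CommRing k] [CommRing T] [CommRing S] [CommRing R]
  [Algebra k T] [Algebra k S] [Algebra k R] {v : T} {w : S} {u : R} {Y : LinFact (T ⊗[k] S) (pot k v w)}
  {X : LinFact (S ⊗[k] R) (pot k w u)} {I J : Type u} [Fintype I] [Fintype J]

/-- The element of `Y ⊗ X` with given coefficients. -/
def tsum (e : Y.HomBasis I) (f : X.HomBasis J) (r : I → J → Mid k T S R) : (tensor Y X).carrier :=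
  ∑ p, ∑ q, act3 (r p q) (pt (e.basis p) (f.basis q))

variable (e : Y.HomBasis I) (f : X.HomBasis J)

lemma tsum_add (r r' : I → J → Mid k T S R) : tsum e f (r + r') = tsum e f r + tsum e f r' := by
  simp only [tsum, Pi.add_apply, map_add, ladd_apply, sum_add_distrib]

lemma tsum_zero : tsum e f (0 : I → J → Mid k T S R) = 0 := by
  simp only [tsum, Pi.zero_apply, map_zero, lzero_apply, sum_const_zero]

lemma smul_tsum (a : T ⊗[k] R) (r : I → J → Mid k T S R) :
    a • tsum e f r = tsum e f (fun p q => in13 k T S R a * r p q) := by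
  simp only [tsum, smul_sum, act3_mul, act3_in13]

lemma tsum_d (r : I → J → Mid k T S R) : (tensor Y X).d (tsum e f r) = tsum e f fun p q =>
    ∑ p', in12 k T S R (e.mat p p') * r p' q + (-1) ^ (e.par p).val * ∑ q', in23 k T S R (f.mat q q') * r p q' := by
  have h1 : ∀ p q, act3 (r p q) (pt (Y.d (e.basis p)) (f.basis q)) =
      ∑ p', act3 (in12 k T S R (e.mat p' p) * r p q) (pt (e.basis p') (f.basis q)) := fun p q => by
    rw [e.d_basis, map_sum, finsetSum_apply, map_sum]
    refine sum_congr rfl fun p' _ => ?_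
    rw [mul_comm, act3_mul, act3_in12]
  have h2 : ∀ p q, act3 (r p q) (pt (Y.sign (e.basis p)) (X.d (f.basis q))) =
      ∑ q', act3 ((-1) ^ (e.par p).val * (in23 k T S R (f.mat q' q) * r p q))
        (pt (e.basis p) (f.basis q')) := fun p q => by
    rw [f.d_basis, e.sign_basis, map_sum, map_sum]
    refine sum_congr rfl fun q' _ => ?_
    have : ((-1) ^ (e.par p).val : Mid k T S R) = in12 k T S R ((-1) ^ (e.par p).val) := by
      rw [map_pow, map_neg, map_one]
    rw [this, mul_comm (in23 _ _ _ _ _), ← mul_assoc, act3_mul, act3_in23, mul_comm, act3_mul, act3_in12]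
  simp only [tsum, map_sum, act3_d, d_pt, map_add, h1, h2, lsum_apply, ladd_apply, mul_sum, sum_add_distrib]
  congr 1
  · calc _ = ∑ q, ∑ p, ∑ p', act3 (in12 k T S R (e.mat p' p) * r p q) (pt (e.basis p') (f.basis q)) :=
          sum_comm
      _ = ∑ q, ∑ p', ∑ p, act3 (in12 k T S R (e.mat p' p) * r p q) (pt (e.basis p') (f.basis q)) :=
          sum_congr rfl fun q _ => sum_comm
      _ = _ := sum_comm
  · exact sum_congr rfl fun p _ => sum_comm

lemma tsum_even (r : I → J → Mid k T S R) : (tensor Y X).even (tsum e f r) =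
    tsum e f fun p q => if e.par p + f.par q = 0 then r p q else 0 := by
  simp only [tsum, map_sum, act3_even, even_pt]
  refine sum_congr rfl fun p _ => sum_congr rfl fun q _ => ?_
  have h2 : ∀ p : ZMod 2, p = 0 ∨ p = 1 := by decide
  rw [e.even_basis, f.even_basis]
  rcases h2 (e.par p) with h | h <;> rcases h2 (f.par q) with h' | h' <;> rw [h, h']
  · rw [if_pos rfl, if_pos rfl, if_pos (by decide), sub_self, sub_self, map_zero, add_zero]
  · rw [if_pos rfl, if_neg (by decide), if_neg (by decide), sub_self, map_zero, map_zero,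
      AddMonoidHom.zero_apply, map_zero, zero_add, map_zero, lzero_apply]
  · rw [if_pos rfl, if_neg (by decide), if_neg (by decide), sub_self, map_zero, map_zero,
      AddMonoidHom.zero_apply, map_zero, zero_add, map_zero, lzero_apply]
  · rw [if_neg (by decide), if_neg (by decide), if_pos (by decide), sub_zero, sub_zero, map_zero, zero_add]

end TensorSums

section HomogeneousMatrices

variable {R : Type*} [CommRing R] {I : Type*} [Fintype I] [DecidableEq I] (par : I → ZMod 2)

/-- A matrix of degree `d` with respect to the parities `par`. -/
def IsHomMat (d : ZMod 2) (Q : Matrix I I R) : Prop := ∀ p q, par p ≠ par q + d → Q p q = 0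

variable {par}

lemma IsHomMat.mul {d d' : ZMod 2} {Q Q' : Matrix I I R} (h : IsHomMat par d Q) (h' : IsHomMat par d' Q') :
    IsHomMat par (d + d') (Q * Q') := fun p q hpq => by
  rw [mmul_apply]
  refine sum_eq_zero fun r _ => ?_
  by_cases hr : par p = par r + d
  · rw [h' r q fun h2 => hpq (by rw [hr, h2]; ring), mul_zero]
  · rw [h p r hr, zero_mul]

lemma isHomMat_one : IsHomMat par 0 (1 : Matrix I I R) := fun p q h =>
  one_apply_ne fun h' => h (by rw [h', add_zero])

lemma isHomMat_oprod {n : ℕ} {a : Fin n → Matrix I I R} (h : ∀ i, IsHomMat par 1 (a i)) (s : Finset (Fin n)) :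
    IsHomMat par s.card (oprod a s) := by
  induction s using Finset.induction_on_min with
  | empty => rw [oprod_empty, card_empty, Nat.cast_zero]; exact isHomMat_one
  | insert i s hi ih =>
    rw [oprod_insert_of_lt a hi, card_insert_of_notMem fun h => lt_irrefl _ (hi i h), cast_add, Nat.cast_one, add_comm]
    exact (h i).mul ih

lemma doprod_insert_of_lt {𝓐 : Type*} [Ring 𝓐] {n : ℕ} (A : Fin n → 𝓐) {i : Fin n} {s : Finset (Fin n)}
    (hi : ∀ j ∈ s, i < j) : doprod A (insert i s) = doprod A s * A i := by
  rw [doprod, oprod_insert_of_lt _ hi]; rfl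

lemma isHomMat_doprod {n : ℕ} {a : Fin n → Matrix I I R} (h : ∀ i, IsHomMat par 1 (a i))
    (s : Finset (Fin n)) : IsHomMat par s.card (doprod a s) := by
  induction s using Finset.induction_on_min with
  | empty => rw [doprod_empty, card_empty, Nat.cast_zero]; exact isHomMat_one
  | insert i s hi ih =>
    rw [doprod_insert_of_lt a hi, card_insert_of_notMem fun h => lt_irrefl _ (hi i h), cast_add, Nat.cast_one]
    exact ih.mul (h i)

variable (R par) in
/-- The matrix of the grading operator. -/
def signMat : Matrix I I R := Matrix.diagonal fun i => (-1) ^ (par i).val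

lemma signMat_mul_self : signMat R par * signMat R par = 1 := by
  rw [signMat, Matrix.diagonal_mul_diagonal, ← Matrix.diagonal_one]
  congr 1
  ext1 i
  rw [← mul_pow, neg_one_mul, neg_neg, one_pow]

lemma neg_one_pow_units_smul {N : Type*} [AddCommGroup N] [Module R N] (n : ℕ) (x : N) :
    ((-1 : ℤˣ) ^ n) • x = ((-1 : R) ^ n) • x := by
  rcases Nat.even_or_odd n with h | h
  · rw [h.neg_one_pow, h.neg_one_pow, one_smul, one_smul]
  · rw [h.neg_one_pow, h.neg_one_pow, neg_smul, uneg_smul, one_smul, one_smul]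

lemma IsHomMat.signMat_mul {n : ℕ} {Q : Matrix I I R} (h : IsHomMat par (n : ZMod 2) Q) :
    signMat R par * Q = ((-1 : ℤˣ) ^ n) • (Q * signMat R par) := by
  rw [neg_one_pow_units_smul (R := R)]
  refine Matrix.ext fun p q => ?_
  rw [msmul_apply, signMat, Matrix.diagonal_mul, Matrix.mul_diagonal, smul_eq_mul]
  by_cases hpq : par p = par q + n
  · rw [hpq, neg_one_pow_val_add, neg_one_pow_val_natCast]; ring
  · rw [h p q hpq]; ring

end HomogeneousMatrices

section DifferenceQuotientMatrices

open MvPolynomial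

variable {k : Type u} [CommRing k]

lemma map_diffQuot {n : ℕ} {T T' : Type u} [CommRing T] [CommRing T'] [Algebra k T] [Algebra k T'] (φ : T →ₐ[k] T')
    (a b : Fin n → T) (i : Fin n) (f : Pol(n, k)) :
    φ (diffQuot k a b i f) = diffQuot k (fun j => φ (a j)) (fun j => φ (b j)) i f := by
  have : φ.toLinearMap ∘ₗ diffQuot k a b i = diffQuot k (fun j => φ (a j)) (fun j => φ (b j)) i := by
    refine (basisMonomials (Fin n) k).ext fun e => ?_
    rw [lcomp_apply, diffQuot, diffQuot, constr_basis, constr_basis, toLinearMap_apply, map_prod]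
    refine Finset.prod_congr rfl fun j _ => ?_
    split_ifs <;> simp only [map_pow, map_sum, map_mul]
  exact lcongr_fun this f

lemma diffQuot_baseChange {n : ℕ} {K T : Type u} [CommRing K] [CommRing T] [Algebra k K] [Algebra k T]
    [Algebra K T] [IsScalarTower k K T] (a b : Fin n → T) (i : Fin n) (f : Pol(n, k)) :
    diffQuot K a b i (aeval X f) = diffQuot k a b i f := by
  have : (diffQuot K a b i).restrictScalars k ∘ₗ (aeval X : Pol(n, k) →ₐ[k]
      Pol(n, K)).toLinearMap = diffQuot k a b i := by
    refine (basisMonomials (Fin n) k).ext fun e => ?_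
    have h : (aeval X (basisMonomials (Fin n) k e) : Pol(n, K)) = basisMonomials (Fin n) K e := by
      rw [coe_basisMonomials, aeval_monomial, map_one, coe_basisMonomials]
      exact (monomial_eq.trans (by rw [C_1])).symm
    rw [lcomp_apply, LinearMap.restrictScalars_apply, toLinearMap_apply, h, diffQuot, diffQuot,
      constr_basis, constr_basis]
  exact lcongr_fun this f

variable {O M : Obj k} {I : Type u} [Fintype I] [DecidableEq I]

lemma dquot_embL_pot (i : Fin O.n) : dquot (outVar O M) i (embL O M (pot k O.W M.W)) =
    embOut O M (diffQuot k (varL k) (varR k) i O.W) := by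
  have h1 : embL O M (pot k O.W M.W) = aeval X O.W - C (M.W ⊗ₜ 1) := by
    change embL O M (O.W ⊗ₜ 1 - 1 ⊗ₜ M.W) = _
    rw [map_sub, embL_tmul, embL_tmul, ← tone_def, C_1, mul_one, map_one, one_mul]
  have h2 : ∀ j, embOut O M (varL k j) = X j := fun j => by
    rw [varL, embOut_tmul, aeval_X, ← tone_def, C_1, mul_one]
  have h3 : ∀ j, embOut O M (varR k j) = C (outVar O M j) := fun j => by
    rw [varR, embOut_tmul, map_one, one_mul, outVar]
  rw [h1, map_sub, dquot_C, sub_zero]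
  have h4 := map_diffQuot (T := O ⊠[k] O) (T' := Tri O M) (embOut O M) (varL k) (varR k) i O.W
  refine Eq.trans ?_ h4.symm
  simp only [h2, h3]
  exact diffQuot_baseChange _ _ _ _

lemma eval_embL (a : O ⊠[k] M) : eval (outVar O M) (embL O M a) = swap(k, O, M) a := by
  induction a using tmul_induction with
  | zero => simp only [map_zero]
  | add x y hx hy => simp only [map_add, hx, hy]
  | tmul a b =>
    rw [embL_tmul, map_mul, eval_C, tcomm_tmul]
    have : ((eval (outVar O M)).comp ((aeval X : O.ring →ₐ[k] Tri O M) : O.ring →+* Tri O M)) =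
        ((includeRight : O.ring →ₐ[k] M ⊠[k] O) : O.ring →+* M ⊠[k] O) := by
      refine ringHom_ext (fun r => ?_) fun i => ?_
      · have e1 : (aeval X (C r) : Tri O M) = C (algebraMap k _ r) := aeval_C _ _
        rw [RingHom.comp_apply, AlgHom.coe_toRingHom, e1, eval_C]
        exact ((includeRight : O.ring →ₐ[k] M ⊠[k] O).commutes r).symm
      · rw [RingHom.comp_apply, AlgHom.coe_toRingHom, aeval_X, eval_X]; rfl
    have h1 : eval (outVar O M) (aeval X a : Tri O M) = 1 ⊗ₜ a := RingHom.congr_fun this a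
    rw [h1, tmul_mul_tmul, one_mul, mul_one]

/-- A matrix over the last two factors as a matrix over the ring of a composite. -/
def matR : Matrix I I (M ⊠[k] O) →+* Matrix I I (Tri O M) := (embR O M).toRingHom.mapMatrix

/-- The interchange of the tensor factors for matrices. -/
def matSwap (O M : Obj k) : Matrix I I (O ⊠[k] M) →+* Matrix I I (M ⊠[k] O) :=
  swap(k, O, M).toAlgHom.toRingHom.mapMatrix

lemma substMat_last (N : Matrix I I (O ⊠[k] M)) : substMat (outVar O M) O.n (matL N) = matR (matSwap O M N) := by
  refine Matrix.ext fun p q => ?_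
  rw [substMat_apply, subst_last]
  exact congrArg C (eval_embL (N p q))

lemma matL_mul_matL {N : Matrix I I (O ⊠[k] M)} {w : O ⊠[k] M}
    (hN : N * N = algebraMap _ _ w) : matL N * matL N = algebraMap _ _ (embL O M w) := by
  rw [← map_mul, hN]
  refine Matrix.ext fun p q => ?_
  change embL O M (algebraMap _ (Matrix I I (O ⊠[k] M)) w p q) = _
  rw [Matrix.algebraMap_matrix_apply, Matrix.algebraMap_matrix_apply]
  split_ifs
  · rfl
  · exact map_zero _

lemma X_sub_C_outVar (i : Fin O.n) : (X i - C (outVar O M i) : Tri O M) = embOut O M (varL k i - varR k i) := by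
  rw [map_sub, varL, varR, embOut_tmul, embOut_tmul, aeval_X, map_one, one_mul, ← tone_def, C_1, mul_one, outVar]

lemma matL_mul_oprod {N : Matrix I I (O ⊠[k] M)} (hN : N * N = algebraMap _ _ (pot k O.W M.W))
    (s : Finset (Fin O.n)) : matL N * oprod (quotL N) s =
      ((-1 : ℤˣ) ^ s.card) • (oprod (quotL N) s * matR (matSwap O M N)) + ∑ i : Fin O.n, sgNat s i •
        (if i ∈ s then embOut O M (diffQuot k (varL k) (varR k) i O.W) • oprod (quotL N) (s.erase i)
          else embOut O M (varL k i - varR k i) • oprod (quotL N) (insert i s)) := by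
  have h1 : ∀ i : Fin O.n, substMat (outVar O M) i (matL N) - substMat (outVar O M) (i + 1) (matL N) =
      (X i - C (outVar O M i) : Tri O M) • quotL N i := fun i => X_sub_C_smul_dquotMat _ i _
  have h2 := substMat_mul_dquotMat (outVar O M) (matL_mul_matL hN)
  have h := mul_oprod (fun i : ℕ => substMat (outVar O M) i (matL N)) (quotL N) _ _ h1 h2 s
  rw [substMat_zero, substMat_last] at h
  simp only [dquot_embL_pot, X_sub_C_outVar] at h
  exact h

lemma doprod_mul_matL {N : Matrix I I (O ⊠[k] M)} (hN : N * N = algebraMap _ _ (pot k O.W M.W))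
    (s : Finset (Fin O.n)) : doprod (quotL N) s * matL N =
      ((-1 : ℤˣ) ^ s.card) • (matR (matSwap O M N) * doprod (quotL N) s) + ∑ i : Fin O.n, sgNat s i •
        (if i ∈ s then embOut O M (diffQuot k (varL k) (varR k) i O.W) • doprod (quotL N) (s.erase i)
          else embOut O M (varL k i - varR k i) • doprod (quotL N) (insert i s)) := by
  have h1 : ∀ i : Fin O.n, substMat (outVar O M) i (matL N) - substMat (outVar O M) (i + 1) (matL N) =
      (X i - C (outVar O M i) : Tri O M) • quotL N i := fun i => X_sub_C_smul_dquotMat _ i _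
  have h2 := dquotMat_mul_substMat (outVar O M) (matL_mul_matL hN)
  have h := doprod_mul (fun i : ℕ => substMat (outVar O M) i (matL N)) (quotL N) _ _ h1 h2 s
  rw [substMat_zero, substMat_last] at h
  simp only [dquot_embL_pot, X_sub_C_outVar] at h
  exact h

end DifferenceQuotientMatrices

section KoszulSums

variable {P : Type u} [CommRing P] {N : Type*} [AddCommGroup N] [Module P N] {n : ℕ}

lemma sum_koszulD_smul (a b : Fin n → P) (ω : Finset (Fin n) → P) (Ψ : Finset (Fin n) → N) :
    ∑ s, koszulD a b ω s • Ψ s = ∑ s : Finset (Fin n), ω s • ∑ i : Fin n, sgNat s i •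
      (if i ∈ s then b i • Ψ (s.erase i) else a i • Ψ (insert i s)) := by
  have h1 : ∀ s, koszulD a b ω s • Ψ s = (∑ i : Fin n, if i ∈ s then (a i * sg P i s * ω (s.erase i)) • Ψ s else 0) +
      ∑ i : Fin n, if i ∈ s then 0 else (b i * sg P i s * ω (insert i s)) • Ψ s := fun s => by
    rw [koszulD_apply, sum_smul, ← sum_add_distrib]
    refine sum_congr rfl fun i _ => ?_
    split_ifs
    · rw [mul_zero, add_zero, add_zero, mul_assoc]
    · rw [mul_zero, zero_add, zero_add, mul_assoc]
  have h2 : ∀ s : Finset (Fin n), ω s • ∑ i : Fin n, sgNat s i •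
      (if i ∈ s then b i • Ψ (s.erase i) else a i • Ψ (insert i s)) =
      (∑ i : Fin n, if i ∈ s then (b i * sg P i s * ω s) • Ψ (s.erase i) else 0) +
      ∑ i : Fin n, if i ∈ s then 0 else (a i * sg P i s * ω s) • Ψ (insert i s) := fun s => by
    rw [smul_sum, ← sum_add_distrib]
    refine sum_congr rfl fun i _ => ?_
    rw [← sg_smul_eq (P := P)]
    split_ifs
    · rw [add_zero, smul_smul, smul_smul]; congr 1; ring
    · rw [zero_add, smul_smul, smul_smul]; congr 1; ring
  simp only [h1, h2, sum_add_distrib]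
  rw [sum_erase_eq_sum_insert fun i s t => (a i * sg P i s * ω t) • Ψ s,
    sum_erase_eq_sum_insert fun i s t => (b i * sg P i s * ω s) • Ψ t, add_comm]
  simp only [sg_insert_self]

end KoszulSums

section CoevaluationMorphism

/-- The linear map on functions with the values `Ψ` at the standard basis. -/
def sumSMul {P N ι : Type*} [CommRing P] [AddCommGroup N] [Module P N] [Fintype ι] (Ψ : ι → N) : (ι → P) →ₗ[P] N where
  toFun ω := ∑ s, ω s • Ψ s
  map_add' ω ω' := by simp only [Pi.add_apply, add_smul, sum_add_distrib]
  map_smul' a ω := by simp only [Pi.smul_apply, smul_eq_mul, mul_smul, smul_sum, RingHom.id_apply]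

variable {k : Type u} [CommRing k] {A B : Obj k} {X : Fact A B} {Z : Fact B A} {I : Type u} [Fintype I]
  [DecidableEq I]

/-- Two homogeneous bases `e` of `X : A → B` and `f` of `Z : B → A` such that `Z` is the left adjoint
of `X` and `f` is the dual basis. -/
structure IsDualBasis (e : X.HomBasis I) (f : Z.HomBasis I) : Prop where
  par : ∀ i, f.par i = e.par i + (B.n : ZMod 2)
  mat : ∀ i j, f.mat i j = -((-1) ^ (e.par j).val * swap(k, B, A) (e.mat j i))

variable {e : X.HomBasis I} {f : Z.HomBasis I}

lemma isHomMat_mat (e : X.HomBasis I) : IsHomMat e.par 1 e.mat := fun _ _ => e.mat_eq_zero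

lemma isHomMat_quotL {O M : Obj k} {par : I → ZMod 2} {d : ZMod 2} {N : Matrix I I (O ⊠[k] M)}
    (h : IsHomMat par d N) (i : Fin O.n) : IsHomMat par d (quotL N i) := fun p q hpq => by
  change dquot _ i (embL O M (N p q)) = 0
  rw [h p q hpq, map_zero, map_zero]

lemma IsDualBasis.transpose_mat (h : IsDualBasis e f) : f.mat.transpose = -(signMat _ e.par * matSwap B A e.mat) := by
  refine Matrix.ext fun i j => ?_
  rw [Matrix.transpose_apply, h.mat, Matrix.neg_apply, signMat, Matrix.diagonal_mul]
  rfl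

/-- The coefficients of the coevaluation. -/
def coevMat (N : Matrix I I (B ⊠[k] A)) (s : Finset (Fin B.n)) : Matrix I I (Tri B A) :=
  ((-1 : ℤˣ) ^ B.n * (-1) ^ (∑ i ∈ sᶜ, (i : ℕ))) • oprod (quotL N) sᶜ

lemma units_smul_apply {R : Type*} [Ring R] (u : ℤˣ) (N : Matrix I I R) (p q : I) : (u • N) p q = u • N p q := rfl

lemma IsHomMat.units_smul {R : Type*} [CommRing R] {par : I → ZMod 2} {d : ZMod 2} {N : Matrix I I R}
    (h : IsHomMat par d N) (u : ℤˣ) : IsHomMat par d (u • N) := fun p q hpq => by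
  rw [units_smul_apply, h p q hpq, smul_zero]

lemma isHomMat_coevMat (e : X.HomBasis I) (s : Finset (Fin B.n)) :
    IsHomMat e.par (sᶜ.card : ZMod 2) (coevMat e.mat s) :=
  (isHomMat_oprod (isHomMat_quotL (isHomMat_mat e)) _).units_smul _

lemma sgNat_compl_mul {n : ℕ} (s : Finset (Fin n)) (i : Fin n) : sgNat sᶜ i * sgNat s i = (-1) ^ (i : ℕ) := by
  rw [sgNat, sgNat, ← pow_add, ← Finset.card_union_of_disjoint, ← Finset.filter_union, Finset.union_comm,
    Finset.union_compl]
  · congr 1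
    refine Eq.trans (congrArg Finset.card (Finset.ext fun j => ?_)) (Fin.card_Iio i)
    simp only [mem_filter, mem_univ, true_and, Finset.mem_Iio, Fin.lt_def]
  · exact Finset.disjoint_filter_filter disjoint_compl_left

lemma units_mul_mul_cancel {G : Type*} [CommGroup G] {u : G} (hu : u * u = 1) (a b c : G) :
    a * (u * b) * (u * c) = c * (a * b) := by
  rw [show a * (u * b) * (u * c) = (u * u) * (c * (a * b)) by
    simp only [mul_comm, mul_left_comm, mul_assoc], hu, one_mul]

lemma matrix_add_sub_cancel_left {R : Type*} [CommRing R] (a b : Matrix I I R) : a + b - a = b :=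
  add_sub_cancel_left a b

lemma matrix_add_mul_mul_neg {R : Type*} [CommRing R] (a b c d : Matrix I I R) :
    a + b * (c * -d) = a - b * (c * d) := by
  rw [mul_neg, mul_neg, sub_eq_add_neg]

lemma commutator_coevMat (e : X.HomBasis I) (s : Finset (Fin B.n)) : matL e.mat * coevMat e.mat s -
    signMat _ e.par * coevMat e.mat s * signMat _ e.par * matR (matSwap B A e.mat) =
      ∑ i : Fin B.n, sgNat s i • (if i ∈ s then embOut B A (varL k i - varR k i) • coevMat e.mat (s.erase i)
        else embOut B A (diffQuot k (varL k) (varR k) i B.W) • coevMat e.mat (insert i s)) := by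
  rw [(isHomMat_coevMat e s).signMat_mul, smul_mul_assoc, mul_assoc (coevMat _ _), signMat_mul_self, mul_one,
    smul_mul_assoc]
  set c := fun s : Finset (Fin B.n) => ((-1 : ℤˣ) ^ B.n * (-1) ^ (∑ i ∈ sᶜ, (i : ℕ))) with hc
  have h0 : ∀ s, coevMat e.mat s = c s • oprod (quotL e.mat) sᶜ := fun s => rfl
  have hsq : ∀ n : ℕ, ((-1 : ℤˣ) ^ n) * (-1) ^ n = 1 := fun n => units_mul_self _
  have h3 : ∀ i : Fin B.n, sgNat sᶜ i = (-1) ^ (i : ℕ) * sgNat s i := fun i => by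
    rw [← sgNat_compl_mul s i, mul_assoc, sgNat_smul_mul_self, mul_one]
  have h1 : ∀ i ∉ s, c s * sgNat sᶜ i = sgNat s i * c (insert i s) := fun i hi => by
    have : ∑ j ∈ sᶜ, (j : ℕ) = i + ∑ j ∈ (insert i s)ᶜ, (j : ℕ) := by
      rw [Finset.compl_insert, Finset.add_sum_erase _ _ (Finset.mem_compl.2 hi)]
    rw [h3, hc]
    dsimp only
    rw [this, pow_add]
    exact units_mul_mul_cancel (hsq i) _ _ _
  have h2 : ∀ i ∈ s, c s * sgNat sᶜ i = sgNat s i * c (s.erase i) := fun i hi => by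
    have : ∑ j ∈ (s.erase i)ᶜ, (j : ℕ) = i + ∑ j ∈ sᶜ, (j : ℕ) := by
      rw [Finset.compl_erase, sum_insert fun h => Finset.mem_compl.1 h hi]
    rw [h3, hc]
    dsimp only
    rw [this, pow_add]
    simp only [mul_comm, mul_left_comm, mul_assoc]
  rw [h0, mul_smul_comm, matL_mul_oprod e.mat_mul_mat, smul_add, smul_mul_assoc, smul_comm _ (c s)]
  refine (matrix_add_sub_cancel_left (R := Tri B A) _ _).trans ?_
  rw [smul_sum]
  refine sum_congr rfl fun i _ => ?_
  by_cases hi : i ∈ s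
  · rw [if_neg (by simpa using hi), if_pos hi, h0, smul_smul, h2 i hi, mul_smul, Finset.compl_erase,
      smul_comm (embOut B A _) (c _)]
  · rw [if_pos (by simpa using hi), if_neg hi, h0, smul_smul, h1 i hi, mul_smul, Finset.compl_insert,
      smul_comm (embOut B A _) (c _)]

/-- The sum with the coefficients given by a matrix. -/
def msum (e : X.HomBasis I) (f : Z.HomBasis I) (Q : Matrix I I (Tri B A)) : (tensor X Z).carrier :=
  tsum e f fun p q => triMid B A (Q p q)

lemma smul_msum (a : B ⊠[k] B) (Q : Matrix I I (Tri B A)) : a • msum e f Q = msum e f (embOut B A a • Q) := by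
  rw [msum, smul_tsum, msum]
  simp only [msmul_apply, smul_eq_mul, map_mul, triMid_embOut]

variable (e f) in
/-- `msum` as an additive map. -/
def msumHom : Matrix I I (Tri B A) →+ (tensor X Z).carrier :=
  AddMonoidHom.mk' (msum e f) fun Q Q' => by
    rw [msum, msum, msum, ← tsum_add]
    simp only [Matrix.add_apply, map_add]; rfl

lemma matR_signMat {O M : Obj k} (par : I → ZMod 2) : matR (signMat (M ⊠[k] O) par) = signMat (Tri O M) par := by
  refine Matrix.ext fun p q => ?_
  change embR O M (signMat _ par p q) = _
  rw [signMat, signMat, diagonal_apply, diagonal_apply]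
  split_ifs
  · rw [map_pow, map_neg, map_one]
  · exact map_zero _

lemma msum_d (h : IsDualBasis e f) (Q : Matrix I I (Tri B A)) : (tensor X Z).d (msum e f Q) =
    msum e f (matL e.mat * Q - signMat _ e.par * Q * signMat _ e.par * matR (matSwap B A e.mat)) := by
  have h1 : matL e.mat * Q - signMat _ e.par * Q * signMat _ e.par * matR (matSwap B A e.mat) =
      matL e.mat * Q + signMat _ e.par * (Q * matR f.mat.transpose) := by
    rw [h.transpose_mat, map_neg, map_mul]
    refine Eq.trans ?_ (matrix_add_mul_mul_neg (R := Tri B A) _ _ _ _).symm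
    refine congrArg (fun t : Matrix I I (Tri B A) => matL e.mat * Q - t) ?_
    rw [matR_signMat]
    simp only [mul_assoc]
  rw [h1, msum, tsum_d, msum]
  congr 1
  refine funext fun p => funext fun q => ?_
  rw [Matrix.add_apply, map_add, mmul_apply, signMat, Matrix.diagonal_mul, mmul_apply, map_sum,
    map_mul, map_sum, map_pow, map_neg, map_one]
  simp only [map_mul]
  congr 1
  · refine sum_congr rfl fun r _ => congrArg (· * _) ?_
    exact (triMid_embL _).symm
  · refine congrArg _ (sum_congr rfl fun r _ => ?_)
    rw [mul_comm]
    refine congrArg (_ * ·) ?_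
    exact (triMid_embR _).symm

lemma msum_even (h : IsDualBasis e f) {d : ℕ} {Q : Matrix I I (Tri B A)} (hQ : IsHomMat e.par (d : ZMod 2) Q) :
    (tensor X Z).even (msum e f Q) = if Even (d + B.n) then msum e f Q else 0 := by
  rw [msum, tsum_even]
  have h1 : (Even (d + B.n)) ↔ ((d : ZMod 2) + B.n = 0) := by
    rw [← cast_add, ZMod.natCast_eq_zero_iff_even]
  have h2 : ∀ p q, e.par p = e.par q + d → e.par p + f.par q = d + B.n := fun p q hpq => by
    rw [hpq, h.par]
    have : ∀ a b c : ZMod 2, a + b + (a + c) = b + c := by decide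
    exact this _ _ _
  split_ifs with hd
  · congr 1
    refine funext fun p => funext fun q => ?_
    by_cases hpq : e.par p = e.par q + d
    · rw [if_pos ((h2 p q hpq).trans (h1.1 hd))]
    · rw [hQ p q hpq, map_zero, ite_self]
  · refine Eq.trans ?_ (tsum_zero e f)
    congr 1
    refine funext fun p => funext fun q => ?_
    by_cases hpq : e.par p = e.par q + d
    · rw [if_neg fun h' => hd (h1.2 ((h2 p q hpq).symm.trans h'))]; rfl
    · rw [hQ p q hpq, map_zero, ite_self]; rfl

lemma sum_even_smul_coevMat (h : IsDualBasis e f) (ω : Finset (Fin B.n) → B ⊠[k] B) :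
    ∑ s : Finset (Fin B.n), (if Even s.card then ω s else 0) • msum e f (coevMat e.mat s) =
      (tensor X Z).even (∑ s : Finset (Fin B.n), ω s • msum e f (coevMat e.mat s)) := by
  rw [map_sum]
  refine sum_congr rfl fun s _ => ?_
  rw [map_smul, msum_even h (isHomMat_coevMat e s)]
  have : Even (sᶜ.card + B.n) ↔ Even s.card := by
    have h1 := Finset.card_add_card_compl s
    rw [card_fin] at h1
    have h2 : Even (s.card + sᶜ.card) ↔ Even B.n := by rw [h1]
    rw [Nat.even_add] at h2 ⊢
    tauto
  simp only [this]
  split_ifs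
  · rfl
  · exact (zero_smul (B ⊠[k] B) (msum e f (coevMat e.mat s))).trans
      (smul_zero (A := (tensor X Z).carrier) (ω s)).symm

lemma sum_koszulD_smul_coevMat (h : IsDualBasis e f) (ω : Finset (Fin B.n) → B ⊠[k] B) :
    ∑ s : Finset (Fin B.n), koszulD (fun i => diffQuot k (varL k) (varR k) i B.W)
        (fun i => varL k i - varR k i) ω s • msum e f (coevMat e.mat s) =
      (tensor X Z).d (∑ s : Finset (Fin B.n), ω s • msum e f (coevMat e.mat s)) := by
  rw [sum_koszulD_smul, map_sum]
  refine sum_congr rfl fun s _ => ?_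
  rw [map_smul, msum_d h, commutator_coevMat]
  refine congrArg _ ?_
  change _ = msumHom e f _
  rw [map_sum]
  refine sum_congr rfl fun i _ => ?_
  rw [smul_def, smul_def, map_zsmul]
  refine congrArg _ ?_
  split_ifs
  · exact smul_msum _ _
  · exact smul_msum _ _

/-- The coevaluation `Δ → X ⊗ Z`. -/
def coevHom (h : IsDualBasis e f) : Hom (delta B) (tensor X Z) where
  map := sumSMul fun s : Finset (Fin B.n) => msum e f (coevMat e.mat s)
  map_even := sum_even_smul_coevMat h
  map_d := sum_koszulD_smul_coevMat h

lemma coevHom_apply (h : IsDualBasis e f) (ω : (delta B).carrier) : (coevHom h).map ω =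
    ∑ s : Finset (Fin B.n), ((ω : Finset (Fin B.n) → B ⊠[k] B) s) • msum e f (coevMat e.mat s) := rfl

end CoevaluationMorphism

section EvaluationMorphism

open MvPolynomial

variable {k : Type u} [CommRing k]

section Coordinates

variable {O M : Obj k} {Y : Fact M O} {Z : Fact O M} {I : Type u} [Fintype I]

/-- The coordinates of an element of the left factor of a composite. -/
def lcoord (f : Y.HomBasis I) : Y.carrier →+ (I → Tri O M) :=
  AddMonoidHom.mk' (fun y p => embL O M (f.basis.repr y p)) fun y y' => funext fun p => by
    rw [map_add, fadd_apply, map_add, Pi.add_apply]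

/-- The coordinates of an element of the right factor of a composite. -/
def rcoord (e : Z.HomBasis I) : Z.carrier →+ (I → Tri O M) :=
  AddMonoidHom.mk' (fun x p => embR O M (e.basis.repr x p)) fun y y' => funext fun p => by
    rw [map_add, fadd_apply, map_add, Pi.add_apply]

variable (f : Y.HomBasis I) (e : Z.HomBasis I)

lemma lcoord_apply (y : Y.carrier) (p : I) : lcoord f y p = embL O M (f.basis.repr y p) := rfl

lemma rcoord_apply (y : Z.carrier) (p : I) : rcoord e y p = embR O M (e.basis.repr y p) := rfl

lemma lcoord_smul (a : O ⊠[k] M) (y : Y.carrier) : lcoord f (a • y) = embL O M a • lcoord f y :=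
  funext fun p => by
    rw [Pi.smul_apply, lcoord_apply, lcoord_apply, map_smul, fsmul_apply, smul_eq_mul, smul_eq_mul, map_mul]

lemma rcoord_smul (a : M ⊠[k] O) (x : Z.carrier) : rcoord e (a • x) = embR O M a • rcoord e x :=
  funext fun p => by
    rw [Pi.smul_apply, rcoord_apply, rcoord_apply, map_smul, fsmul_apply, smul_eq_mul, smul_eq_mul, map_mul]

variable [DecidableEq I]

lemma lcoord_d (y : Y.carrier) : lcoord f (Y.d y) = (matL f.mat).mulVec (lcoord f y) :=
  funext fun p => by
    rw [lcoord_apply, f.repr_d, map_sum, Matrix.mulVec, dotProduct]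
    exact sum_congr rfl fun q _ => map_mul _ _ _

lemma rcoord_d (x : Z.carrier) : rcoord e (Z.d x) = (matR e.mat).mulVec (rcoord e x) :=
  funext fun p => by
    rw [rcoord_apply, e.repr_d, map_sum, Matrix.mulVec, dotProduct]
    exact sum_congr rfl fun q _ => map_mul _ _ _

lemma lcoord_sign (y : Y.carrier) : lcoord f (Y.sign y) = (signMat (Tri O M) f.par).mulVec (lcoord f y) :=
  funext fun p => by
    rw [lcoord_apply, f.repr_sign, signMat, Matrix.mulVec_diagonal, map_mul, map_pow, map_neg, map_one, lcoord_apply]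

lemma embL_one_tmul (b : M.ring) : embL O M (1 ⊗ₜ b) = C (b ⊗ₜ 1) := by
  rw [embL_tmul, map_one, one_mul]

lemma embL_mul_embR_out (t r : O.ring) : embL O M (t ⊗ₜ 1) * embR O M (1 ⊗ₜ r) = embOut O M (t ⊗ₜ r) := by
  rw [embL_tmul, embR_apply, embOut_tmul, ← tone_def, C_1, mul_one]

variable (O M) in
/-- `midRes` as a linear map. -/
def midResLin : Tri O M →ₗ[k] O ⊠[k] O :=
  resMid (residue fun i => pderiv i M.W) ∘ₗ (triMid O M).toLinearMap

lemma midRes_eq_lin (P : Tri O M) : midRes P = midResLin O M P := midRes_eq P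

lemma midResLin_embOut_mul (a : O ⊠[k] O) (P : Tri O M) : midResLin O M (embOut O M a * P) = a * midResLin O M P := by
  change resMid _ (triMid O M _) = a * resMid _ (triMid O M P)
  rw [map_mul, triMid_embOut, resMid_in13_mul]

lemma midResLin_pderiv_mul (j : Fin M.n) (P : Tri O M) : midResLin O M (embL O M (1 ⊗ₜ pderiv j M.W) * P) = 0 := by
  change resMid _ (triMid O M _) = 0
  obtain ⟨p, c, -, -, -, h⟩ := exists_residue M
  rw [map_mul, triMid_embL, in12_one_tmul, resMid_mul_eq_zero (h j)]

variable {f e}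

/-- The pairing of `Y` and `Z` given by a matrix. -/
def evPair (f : Y.HomBasis I) (e : Z.HomBasis I) (E : Matrix I I (Tri O M)) (y : Y.carrier) (x : Z.carrier) :
    Tri O M := dotProduct (lcoord f y) (E.mulVec (rcoord e x))

lemma evPair_eq_sum (E : Matrix I I (Tri O M)) (y : Y.carrier) (x : Z.carrier) : evPair f e E y x =
    ∑ p, ∑ q, embL O M (f.basis.repr y p) * E p q * embR O M (e.basis.repr x q) := by
  simp only [evPair, dotProduct, Matrix.mulVec, mul_sum, mul_assoc]
  rfl

lemma evPair_add (E E' : Matrix I I (Tri O M)) (y : Y.carrier) (x : Z.carrier) :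
    evPair f e (E + E') y x = evPair f e E y x + evPair f e E' y x := by
  rw [evPair, Matrix.add_mulVec, dotProduct_add]; rfl

lemma evPair_smul (a : Tri O M) (E : Matrix I I (Tri O M)) (y : Y.carrier) (x : Z.carrier) :
    evPair f e (a • E) y x = a * evPair f e E y x := by
  rw [evPair, smul_mulVec, dotProduct_smul]; rfl

lemma dotProduct_units_smul_mulVec {R : Type*} [CommRing R] (a : ℤˣ) (E : Matrix I I R) (v w : I → R) :
    dotProduct v ((a • E).mulVec w) = a • dotProduct v (E.mulVec w) := by
  rcases Int.units_eq_one_or a with rfl | rfl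
  · rw [one_smul, one_smul]
  · rw [uneg_smul, uneg_smul, one_smul, one_smul, Matrix.neg_mulVec, dotProduct_neg]

lemma evPair_units_smul (a : ℤˣ) (E : Matrix I I (Tri O M)) (y : Y.carrier) (x : Z.carrier) :
    evPair f e (a • E) y x = a • evPair f e E y x := by
  exact dotProduct_units_smul_mulVec (R := Tri O M) a E (lcoord f y) (rcoord e x)

lemma evPair_sum {ι : Type*} (s : Finset ι) (E : ι → Matrix I I (Tri O M)) (y : Y.carrier) (x : Z.carrier) :
    evPair f e (∑ i ∈ s, E i) y x = ∑ i ∈ s, evPair f e (E i) y x := by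
  classical
  induction s using Finset.induction_on with
  | empty => rw [sum_empty, sum_empty, evPair, Matrix.zero_mulVec, dotProduct_zero]
  | insert i s hi ih => rw [sum_insert hi, sum_insert hi, evPair_add, ih]

lemma evPair_d_left (E : Matrix I I (Tri O M)) (y : Y.carrier) (x : Z.carrier) :
    evPair f e E (Y.d y) x = evPair f e (matL f.mat.transpose * E) y x := by
  have : matL f.mat.transpose = (matL f.mat).transpose := rfl
  rw [evPair, evPair, lcoord_d, this, ← mulVec_mulVec, Matrix.dotProduct_mulVec _ (Matrix.transpose _),
    Matrix.vecMul_transpose]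

lemma evPair_sign_d (E : Matrix I I (Tri O M)) (y : Y.carrier) (x : Z.carrier) :
    evPair f e E (Y.sign y) (Z.d x) = evPair f e (signMat (Tri O M) f.par * E * matR e.mat) y x := by
  have : (signMat (Tri O M) f.par).transpose = signMat (Tri O M) f.par := diagonal_transpose _
  rw [evPair, evPair, lcoord_sign, rcoord_d, mul_assoc, ← mulVec_mulVec, ← mulVec_mulVec,
    Matrix.dotProduct_mulVec _ (signMat _ _), ← this, Matrix.vecMul_transpose, this]

/-- The family of pairings given by a family of matrices, as a map on the composite. -/
def evLin (f : Y.HomBasis I) (e : Z.HomBasis I) (E : Finset (Fin O.n) → Matrix I I (Tri O M)) :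
    (tensor Y Z).carrier →ₗ[O ⊠[k] O] (Finset (Fin O.n) → O ⊠[k] O) :=
  tlift (AddMonoidHom.mk' (fun y => AddMonoidHom.mk' (fun x s => midResLin O M (evPair f e (E s) y x))
      (fun x x' => funext fun s => by rw [evPair, map_add, Matrix.mulVec_add, dotProduct_add, map_add]; rfl))
      (fun y y' => AddMonoidHom.ext fun x => funext fun s => by
        change midResLin O M (dotProduct _ _) = _
        rw [map_add, add_dotProduct, map_add]; rfl))
    (fun b y x => funext fun s => by
      change midResLin O M (dotProduct _ _) = midResLin O M (dotProduct _ _)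
      rw [lcoord_smul, rcoord_smul, mulVec_smul, dotProduct_smul, smul_dotProduct, embL_one_tmul]; rfl)
    (fun t r y x => funext fun s => by
      change midResLin O M (dotProduct _ _) = (t ⊗ₜ r) * midResLin O M (dotProduct _ _)
      rw [lcoord_smul, rcoord_smul, mulVec_smul, dotProduct_smul, smul_dotProduct, smul_eq_mul, smul_eq_mul,
        ← midResLin_embOut_mul, ← embL_mul_embR_out, ← mul_assoc, mul_comm (embR O M _)])

lemma evLin_pt (E : Finset (Fin O.n) → Matrix I I (Tri O M)) (y : Y.carrier) (x : Z.carrier) (s : Finset (Fin O.n)) :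
    evLin f e E (pt y x) s = midResLin O M (evPair f e (E s) y x) := rfl

lemma evLin_d_pt (E : Finset (Fin O.n) → Matrix I I (Tri O M)) (y : Y.carrier) (x : Z.carrier) (s : Finset (Fin O.n)) :
    evLin f e E ((tensor Y Z).d (pt y x)) s = midResLin O M (evPair f e
      (matL f.mat.transpose * E s + signMat (Tri O M) f.par * E s * matR e.mat) y x) := by
  rw [d_pt, map_add, Pi.add_apply, evLin_pt, evLin_pt, evPair_d_left, evPair_sign_d, evPair_add, map_add]

lemma sum_even_part {R N : Type*} [CommRing R] [AddCommGroup N] {ρ : R → N} (hρ : ρ 0 = 0) (a c : I → R)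
    (par par' : I → ZMod 2) (d : ℕ) (E : I → I → R) (hE : ∀ p q, par p + par' q ≠ d → E p q = 0) :
    (∑ p, ∑ q, ρ ((if par p = 0 then a p else 0) * E p q * (if par' q = 0 then c q else 0))) +
      (∑ p, ∑ q, ρ ((if par p = 0 then 0 else a p) * E p q * (if par' q = 0 then 0 else c q))) =
    if Even d then ∑ p, ∑ q, ρ (a p * E p q * c q) else 0 := by
  simp only [← sum_add_distrib]
  have h3 : ∀ p q, par p + par' q = d → (Even d ↔ (par p = 0 ↔ par' q = 0)) := fun p q h => by
    rw [← ZMod.natCast_eq_zero_iff_even, ← h]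
    have : ∀ a b : ZMod 2, a + b = 0 ↔ (a = 0 ↔ b = 0) := by decide
    exact this _ _
  have h4 : ∀ p q, ρ ((if par p = 0 then a p else 0) * E p q * (if par' q = 0 then c q else 0)) +
      ρ ((if par p = 0 then 0 else a p) * E p q * (if par' q = 0 then 0 else c q)) =
      if Even d then ρ (a p * E p q * c q) else 0 := fun p q => by
    by_cases hpq : par p + par' q = d
    · have h3 := h3 p q hpq
      simp only [h3]
      by_cases hp : par p = 0 <;> by_cases hq : par' q = 0 <;>
        simp only [hp, hq, if_true, if_false, hρ, zero_mul, mul_zero, add_zero, zero_add,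
          iff_true, iff_false, not_true, not_false_iff]
    · simp only [hE p q hpq, mul_zero, zero_mul, hρ, add_zero, ite_self]
  simp only [h4]
  split_ifs
  · rfl
  · simp only [sum_const_zero]

lemma evLin_even_pt (E : Finset (Fin O.n) → Matrix I I (Tri O M)) (y : Y.carrier) (x : Z.carrier)
    (s : Finset (Fin O.n)) (hE : ∀ p q, f.par p + e.par q ≠ s.card → E s p q = 0) :
    evLin f e E ((tensor Y Z).even (pt y x)) s = if Even s.card then midResLin O M (evPair f e (E s) y x) else 0 := by
  have h1 : ∀ y' x', midResLin O M (evPair f e (E s) y' x') = ∑ p, ∑ q,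
      midResLin O M (embL O M (f.basis.repr y' p) * E s p q * embR O M (e.basis.repr x' q)) := fun y' x' => by
    rw [evPair_eq_sum]; simp only [map_sum]
  have h2 : ∀ p, embL O M (f.basis.repr (Y.even y) p) = if f.par p = 0 then embL O M (f.basis.repr y p) else 0 :=
    fun p => by rw [f.repr_even, apply_ite (embL O M), map_zero]
  have h3 : ∀ q, embR O M (e.basis.repr (Z.even x) q) = if e.par q = 0 then embR O M (e.basis.repr x q) else 0 :=
    fun q => by rw [e.repr_even, apply_ite (embR O M), map_zero]
  have h4 : ∀ p, embL O M (f.basis.repr (y - Y.even y) p) = if f.par p = 0 then 0 else embL O M (f.basis.repr y p) :=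
    fun p => by
      rw [map_sub, Finsupp.sub_apply, f.repr_even]
      split_ifs
      · rw [sub_self, map_zero]
      · rw [sub_zero]
  have h5 : ∀ q, embR O M (e.basis.repr (x - Z.even x) q) = if e.par q = 0 then 0 else embR O M (e.basis.repr x q) :=
    fun q => by
      rw [map_sub, Finsupp.sub_apply, e.repr_even]
      split_ifs
      · rw [sub_self, map_zero]
      · rw [sub_zero]
  rw [even_pt, map_add, Pi.add_apply, evLin_pt, evLin_pt, h1, h1, h1]
  refine Eq.trans ?_ (sum_even_part (R := Tri O M) (map_zero (midResLin O M)) (fun p => embL O M (f.basis.repr y p))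
    (fun q => embR O M (e.basis.repr x q)) f.par e.par s.card (E s) hE)
  refine congrArg₂ _ (sum_congr rfl fun p _ => sum_congr rfl fun q _ => ?_)
    (sum_congr rfl fun p _ => sum_congr rfl fun q _ => ?_)
  · rw [h2, h3]
  · rw [h4, h5]

end Coordinates

variable {A B : Obj k} {X : Fact A B} {Z : Fact B A} {I : Type u} [Fintype I]
  [DecidableEq I] {e : X.HomBasis I} {f : Z.HomBasis I} {L : Finset (Fin B.n) → Matrix I I (B ⊠[k] A)}

lemma isHomMat_matSwap {O M : Obj k} {par : I → ZMod 2} {d : ZMod 2} {N : Matrix I I (O ⊠[k] M)}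
    (h : IsHomMat par d N) : IsHomMat par d (matSwap O M N) := fun p q hpq => by
  change swap(k, O, M) (N p q) = 0
  rw [h p q hpq, map_zero]

lemma isHomMat_matL {O M : Obj k} {par : I → ZMod 2} {d : ZMod 2} {N : Matrix I I (O ⊠[k] M)}
    (h : IsHomMat par d N) : IsHomMat par d (matL N) := fun p q hpq => by
  change embL O M (N p q) = 0
  rw [h p q hpq, map_zero]

lemma matSwap_smul (O M : Obj k) (a : O.ring) (b : M.ring) (N : Matrix I I (O ⊠[k] M)) :
    matSwap O M ((a ⊗ₜ[k] b) • N) = (b ⊗ₜ[k] a : M ⊠[k] O) • matSwap O M N := by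
  refine Matrix.ext fun p q => ?_
  change swap(k, O, M) ((a ⊗ₜ[k] b) * N p q) =
    (b ⊗ₜ a) * swap(k, O, M) (N p q)
  rw [map_mul, tcomm_tmul]

lemma matL_smul {O M : Obj k} (a : O ⊠[k] M) (N : Matrix I I (O ⊠[k] M)) : matL (a • N) = embL O M a • matL N := by
  refine Matrix.ext fun p q => ?_
  change embL O M (a * N p q) = embL O M a * embL O M (N p q)
  rw [map_mul]

lemma map_units_smul {R R' : Type*} [Ring R] [Ring R'] (φ : R →+* R') (u : ℤˣ) (x : R) : φ (u • x) = u • φ x := by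
  rw [smul_def, smul_def, map_zsmul]

lemma matSwap_matSwap (O M : Obj k) (N : Matrix I I (O ⊠[k] M)) : matSwap M O (matSwap O M N) = N := by
  refine Matrix.ext fun p q => ?_
  change swap(k, M, O) (swap(k, O, M) (N p q)) = N p q
  exact swap(k, O, M).symm_apply_apply _

lemma map_signMat {R R' : Type*} [CommRing R] [CommRing R'] (φ : R →+* R') (par : I → ZMod 2) :
    φ.mapMatrix (signMat R par) = signMat R' par := by
  refine Matrix.ext fun p q => ?_
  rw [RingHom.mapMatrix_apply, map_apply, signMat, signMat, diagonal_apply, diagonal_apply]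
  split_ifs
  · rw [map_pow, map_neg, map_one]
  · exact map_zero _

lemma matrix_neg_mul_neg {R : Type*} [CommRing R] (a b : Matrix I I R) : -(a * -b) = a * b := by
  rw [mul_neg, neg_neg]

lemma IsDualBasis.mat_eq (h : IsDualBasis e f) : e.mat = -(signMat _ e.par * matSwap A B f.mat.transpose) := by
  rw [h.transpose_mat, map_neg, map_mul, matSwap_matSwap]
  have : matSwap A B (signMat (A ⊠[k] B) e.par) = signMat (B ⊠[k] A) e.par := map_signMat _ _
  rw [this]
  refine Eq.trans ?_ (matrix_neg_mul_neg (R := B ⊠[k] A) _ _).symm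
  rw [← mul_assoc, signMat_mul_self, one_mul]

lemma neg_mul_comm_of_comm {R ι : Type*} [CommRing R] [Fintype ι] {u : ℤˣ} {S Λ N : Matrix I I R}
    {K : ι → Matrix I I R} {c : ι → ℤˣ} {g : ι → R} (h2 : S * Λ = u • (Λ * S))
    (h1 : N * Λ = u • (Λ * N) + ∑ i, c i • g i • K i) : -(S * N) * Λ = Λ * -(S * N) + ∑ i, g i • c i • -(S * K i) := by
  rw [neg_mul, mul_assoc, h1, mul_add, mul_smul_comm, ← mul_assoc, h2, smul_mul_assoc, smul_smul, units_mul_self,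
    one_smul, mul_neg, mul_assoc, neg_add, mul_sum, ← Finset.sum_neg_distrib]
  refine congrArg (_ + ·) (sum_congr rfl fun j _ => ?_)
  rw [mul_smul_comm, mul_smul_comm, smul_comm (g j), smul_neg, smul_neg]

lemma IsDualBasis.exists_commutator (h : IsDualBasis e f)
    (hL : KoszulFamily e.mat (fun j => (pderiv j B.W ⊗ₜ[k] 1 : B ⊠[k] A)) L) (hΛ : IsHomMat e.par (B.n : ZMod 2) (L univ)) :
    ∃ K : Fin B.n → Matrix I I (A ⊠[k] B), f.mat.transpose * matSwap B A (L univ) =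
      matSwap B A (L univ) * f.mat.transpose + ∑ j, ((1 : A.ring) ⊗ₜ[k] pderiv j B.W : A ⊠[k] B) • K j := by
  refine ⟨fun j => sgNat (univ : Finset (Fin B.n)) j •
    -(signMat _ e.par * matSwap B A (L (univ.erase j))), ?_⟩
  have h1 := congrArg (matSwap B A) (hL.comm univ)
  simp only [map_mul, map_add, map_sum, map_units_smul, mem_univ, if_true, matSwap_smul, card_univ, card_fin] at h1
  rw [h.transpose_mat]
  exact neg_mul_comm_of_comm (R := A ⊠[k] B) (isHomMat_matSwap (O := B) (M := A) hΛ).signMat_mul h1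

/-- The coefficients of the evaluation. -/
def evMat (N Λ : Matrix I I (A ⊠[k] B)) (s : Finset (Fin A.n)) : Matrix I I (Tri A B) :=
  ((-1 : ℤˣ) ^ B.n) • (matL Λ * oprod (quotL N) s)

lemma isHomMat_evMat (h : IsDualBasis e f) (hΛ : IsHomMat e.par (B.n : ZMod 2) (L univ))
    (s : Finset (Fin A.n)) : IsHomMat e.par ((B.n + s.card : ℕ) : ZMod 2)
      (evMat f.mat.transpose (matSwap B A (L univ)) s) := by
  rw [cast_add]
  refine ((isHomMat_matL (isHomMat_matSwap hΛ)).mul (isHomMat_oprod (fun i => isHomMat_quotL ?_ i) _)).units_smul _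
  intro p q hpq
  refine f.mat_eq_zero fun h' => hpq ?_
  rw [h.par, h.par] at h'
  have : ∀ a b c : ZMod 2, a + c = b + c + 1 → b = a + 1 := by decide
  exact this _ _ _ h'

lemma commutator_mul_of_comm {R : Type*} [CommRing R] {ι : Type*} [Fintype ι] {u c d : ℤˣ} {N S S' Λ O M N' E D : Matrix I I R}
    {K : ι → Matrix I I R} {g : ι → R} (h1 : N * Λ = Λ * N + ∑ i, g i • K i) (h2 : N * O = u • (O * N') + D)
    (h3 : M = -(S * N')) (h4 : S' = c • S) (h5 : S * (Λ * O) = (c * u) • (Λ * O * S)) (h6 : S * S = 1) 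
    (hE : E = d • (Λ * O)) : N * E + S' * E * M = ∑ i, g i • (d • (K i * O)) + d • (Λ * D) := by
  have hc : c * c = 1 := units_mul_self _
  rw [hE, mul_smul_comm, ← mul_assoc, h1, add_mul, mul_assoc, h2, mul_add, h3, h4, smul_mul_assoc, mul_smul_comm, mul_smul_comm d S, h5,
    sum_mul, smul_smul, smul_smul, smul_mul_assoc, mul_neg, mul_assoc (Λ * O), ← mul_assoc S, h6, one_mul,
    smul_add, smul_add, smul_sum, smul_smul, smul_neg]
  have : c * d * (c * u) = d * u := by
    rw [show c * d * (c * u) = c * c * (d * u) by simp only [mul_comm, mul_left_comm, mul_assoc], hc, one_mul]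
  rw [this, mul_assoc]
  have h7 : ∀ i, d • (g i • K i * O) = g i • (d • (K i * O)) := fun i => by rw [smul_mul_assoc, smul_comm]
  simp only [h7]
  abel

lemma commutator_sum_of_comm {R : Type*} [CommRing R] {ι ι' : Type*} [Fintype ι] [Fintype ι'] {u c d : ℤˣ}
    {N S S' Λ O M N' : Matrix I I R} {K : ι → Matrix I I R} {g : ι → R} {σ : ι' → ℤˣ} {P : ι' → Prop} [DecidablePred P]
    {a b : ι' → R} {Q Q' : ι' → Matrix I I R} (h1 : N * Λ = Λ * N + ∑ i, g i • K i)
    (h2 : N * O = u • (O * N') + ∑ i, σ i • (if P i then a i • Q i else b i • Q' i))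
    (h3 : M = -(S * N')) (h4 : S' = c • S) (h5 : S * (Λ * O) = (c * u) • (Λ * O * S)) (h6 : S * S = 1) :
    N * (d • (Λ * O)) + S' * (d • (Λ * O)) * M = ∑ i, g i • (d • (K i * O)) +
      ∑ i, σ i • (if P i then a i • (d • (Λ * Q i)) else b i • (d • (Λ * Q' i))) := by
  rw [commutator_mul_of_comm h1 h2 h3 h4 h5 h6 rfl, mul_sum, smul_sum]
  refine congrArg (_ + ·) (sum_congr rfl fun i _ => ?_)
  rw [mul_smul_comm]
  split_ifs
  · rw [mul_smul_comm, smul_comm d, smul_comm d]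
  · rw [mul_smul_comm, smul_comm d, smul_comm d]

lemma signMat_add {R : Type*} [CommRing R] {par par' : I → ZMod 2} {n : ℕ} (h : ∀ i, par' i = par i + n) :
    signMat R par' = ((-1 : ℤˣ) ^ n) • signMat R par := by
  rw [neg_one_pow_units_smul (R := R)]
  refine Matrix.ext fun p q => ?_
  rw [msmul_apply, signMat, signMat, diagonal_apply, diagonal_apply]
  split_ifs
  · rw [h, neg_one_pow_val_add, neg_one_pow_val_natCast, mul_comm]; rfl
  · rw [smul_zero]

lemma commutator_evMat (h : IsDualBasis e f) (hL : KoszulFamily e.mat (fun j => (pderiv j B.W ⊗ₜ[k] 1 : B ⊠[k] A)) L)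
    (hΛ : IsHomMat e.par (B.n : ZMod 2) (L univ)) (s : Finset (Fin A.n)) :
    ∃ K : Fin B.n → Matrix I I (Tri A B), matL f.mat.transpose * evMat f.mat.transpose (matSwap B A (L univ)) s +
      signMat _ f.par * evMat f.mat.transpose (matSwap B A (L univ)) s * matR e.mat =
      ∑ j, embL A B (1 ⊗ₜ[k] pderiv j B.W) • K j + ∑ i : Fin A.n, sgNat s i •
        (if i ∈ s then embOut A B (diffQuot k (varL k) (varR k) i A.W) •
            evMat f.mat.transpose (matSwap B A (L univ)) (s.erase i)
          else embOut A B (varL k i - varR k i) • evMat f.mat.transpose (matSwap B A (L univ)) (insert i s)) := by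
  obtain ⟨K, hK⟩ := h.exists_commutator hL hΛ
  have h1 := congrArg matL hK
  simp only [map_mul, map_add, map_sum, matL_smul] at h1
  have hN : f.mat.transpose * f.mat.transpose = algebraMap _ _ (pot k A.W B.W) := by
    rw [← transpose_mul, f.mat_mul_mat]
    exact diagonal_transpose _
  have h2 := matL_mul_oprod hN s
  have h3 : (matR e.mat : Matrix I I (Tri A B)) = -(signMat _ e.par * matR (matSwap A B f.mat.transpose)) := by
    conv_lhs => rw [h.mat_eq]
    rw [map_neg, map_mul, matR_signMat]
  have h4 : signMat (Tri A B) f.par = ((-1 : ℤˣ) ^ B.n) • signMat (Tri A B) e.par := signMat_add h.par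
  have h5 := (isHomMat_evMat h hΛ s).signMat_mul (R := Tri A B)
  rw [evMat, mul_smul_comm, smul_mul_assoc, smul_comm _ ((-1 : ℤˣ) ^ B.n), pow_add] at h5
  have h5 := MulAction.injective ((-1 : ℤˣ) ^ B.n) h5
  exact ⟨_, commutator_sum_of_comm (R := Tri A B) (d := (-1) ^ B.n) h1 h2 h3 h4 h5 signMat_mul_self⟩

lemma koszulD_eq_sum {P : Type u} [CommRing P] {n : ℕ} (a b : Fin n → P) (ω : Finset (Fin n) → P) (s : Finset (Fin n)) :
    koszulD a b ω s = ∑ i : Fin n, sgNat s i • (if i ∈ s then a i * ω (s.erase i) else b i * ω (insert i s)) := by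
  rw [koszulD_apply]
  refine sum_congr rfl fun i _ => ?_
  rw [← sg_smul_eq (P := P)]
  split_ifs
  · rw [mul_zero, add_zero, smul_eq_mul]; ring
  · rw [mul_zero, zero_add, smul_eq_mul]; ring

lemma koszulD_evLin (h : IsDualBasis e f) (hL : KoszulFamily e.mat (fun j => (pderiv j B.W ⊗ₜ[k] 1 : B ⊠[k] A)) L)
    (hΛ : IsHomMat e.par (B.n : ZMod 2) (L univ)) (z : (tensor Z X).carrier) :
    evLin f e (evMat f.mat.transpose (matSwap B A (L univ))) ((tensor Z X).d z) =
      koszulD (fun i => diffQuot k (varL k) (varR k) i A.W) (fun i => varL k i - varR k i)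
        (evLin f e (evMat f.mat.transpose (matSwap B A (L univ))) z) := by
  induction z using tind with
  | ha x y hx hy => rw [map_add, map_add, hx, hy, map_add, map_add]
  | h y x =>
    refine funext fun s => ?_
    obtain ⟨K, hK⟩ := commutator_evMat h hL hΛ s
    rw [evLin_d_pt, hK, evPair_add, map_add, evPair_sum, evPair_sum, map_sum, map_sum, koszulD_eq_sum,
      sum_eq_zero fun j _ => by rw [evPair_smul, midResLin_pderiv_mul], zero_add]
    refine sum_congr rfl fun i _ => ?_
    rw [evPair_units_smul, smul_def, smul_def, map_zsmul]
    refine congrArg _ ?_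
    split_ifs
    · rw [evPair_smul, midResLin_embOut_mul]; rfl
    · rw [evPair_smul, midResLin_embOut_mul]; rfl

lemma even_evLin (h : IsDualBasis e f) (hΛ : IsHomMat e.par (B.n : ZMod 2) (L univ))
    (z : (tensor Z X).carrier) : evLin f e (evMat f.mat.transpose (matSwap B A (L univ))) ((tensor Z X).even z) =
      fun s : Finset (Fin A.n) => if Even s.card then
        evLin f e (evMat f.mat.transpose (matSwap B A (L univ))) z s else 0 := by
  induction z using tind with
  | ha x y hx hy =>
    rw [map_add, map_add, hx, hy, map_add]
    refine funext fun s => ?_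
    rw [Pi.add_apply, Pi.add_apply]
    split_ifs
    · rfl
    · exact add_zero _
  | h y x =>
    refine funext fun s => evLin_even_pt _ y x s fun p q hpq => isHomMat_evMat h hΛ s p q fun h' => hpq ?_
    rw [h.par, h', cast_add]
    have : ∀ a b c : ZMod 2, a + (b + c) + b + a = c := by decide
    exact this _ _ _

variable (h : IsDualBasis e f)
  (hL : KoszulFamily e.mat (fun j => (pderiv j B.W ⊗ₜ[k] 1 : B ⊠[k] A)) L)
  (hΛ : IsHomMat e.par (B.n : ZMod 2) (L univ))

/-- The evaluation `Z ⊗ X → Δ`. -/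
def evHom : Hom (tensor Z X) (delta A) where
  map := evLin f e (evMat f.mat.transpose (matSwap B A (L univ)))
  map_even := even_evLin h hΛ
  map_d := koszulD_evLin h hL hΛ

lemma evHom_pt (y : Z.carrier) (x : X.carrier) (s : Finset (Fin A.n)) :
    ((evHom h hL hΛ).map (pt y x) : Finset (Fin A.n) → A ⊠[k] A) s =
      midResLin A B (evPair f e (evMat f.mat.transpose (matSwap B A (L univ)) s) y x) := rfl

end EvaluationMorphism

section PartialResidues

open MvPolynomial

variable {k : Type u} [CommRing k] {O M : Obj k}

lemma embL_tmul_one (a : O.ring) : embL O M (a ⊗ₜ 1) = embOut O M (a ⊗ₜ 1) := rfl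

@[elab_as_elim]
lemma tri_induction_out_right {p : Tri O M → Prop} (h : ∀ a b, p (embOut O M a * embR O M b))
    (ha : ∀ x y, p x → p y → p (x + y)) (P : Tri O M) : p P := by
  induction P using monomial_add_induction_on with
  | C a => simpa [embR_apply] using h 1 a
  | monomial_add s c f _ _ hf =>
    refine ha _ _ ?_ hf
    rw [monomial_eq_embL_mul, embL_tmul_one]
    exact h _ _

@[elab_as_elim]
lemma tri_induction_left_out {p : Tri O M → Prop} (h : ∀ a b, p (embL O M a * embOut O M b))
    (ha : ∀ x y, p x → p y → p (x + y)) (P : Tri O M) : p P := by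
  induction P using tri_induction with
  | ha x y hx hy => exact ha x y hx hy
  | h a b =>
    induction b using tmul_induction with
    | zero =>
      have := h 0 0
      rw [map_zero, zero_mul] at this
      rwa [map_zero, mul_zero]
    | add x y hx hy => rw [map_add, mul_add]; exact ha _ _ hx hy
    | tmul b c =>
      have h1 : embR O M (b ⊗ₜ c) = embL O M (1 ⊗ₜ b) * embOut O M (1 ⊗ₜ c) := by
        rw [embL_tmul, embOut_tmul, embR_apply, map_one, one_mul, one_mul, ← C_mul, tmul_mul_tmul, one_mul, mul_one]
      rw [h1, ← mul_assoc, ← map_mul]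
      exact h _ _

variable (O M) in
/-- The residue with respect to the last variables. -/
def resLast : Tri O M →ₗ[k] O ⊠[k] M :=
  resMid (residue fun i => pderiv i O.W) ∘ₗ (triLast O M).toLinearMap

variable (O M) in
/-- The residue with respect to the first variables. -/
def resFirst : Tri O M →ₗ[k] M ⊠[k] O :=
  resMid (residue fun i => pderiv i O.W) ∘ₗ (triFirst O M).toLinearMap

lemma resLast_apply (P : Tri O M) : resLast O M P = resMid (residue fun i => pderiv i O.W) (triLast O M P) := rfl

lemma resFirst_apply (P : Tri O M) : resFirst O M P = resMid (residue fun i => pderiv i O.W) (triFirst O M P) := rfl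

lemma resLast_embL_mul (a : O ⊠[k] M) (P : Tri O M) : resLast O M (embL O M a * P) = a * resLast O M P := by
  rw [resLast_apply, resLast_apply, map_mul, triLast_embL, resMid_in13_mul]

lemma resFirst_embR_mul (a : M ⊠[k] O) (P : Tri O M) : resFirst O M (embR O M a * P) = a * resFirst O M P := by
  rw [resFirst_apply, resFirst_apply, map_mul, triFirst_embR, resMid_in13_mul]

lemma one_tmul_mulMap_midRes (b : M ⊠[k] O) (c : O ⊠[k] M) :
    (1 ⊗ₜ[k] mulMap M (midResLin M O (embL M O b * embR M O c)) : O ⊠[k] M) =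
      resLast O M (embR O M (b * swap(k, O, M) c)) := by
  induction b using tmul_induction with
  | zero => simp only [map_zero, zero_mul, tmul_zero]
  | add x y hx hy => simp only [map_add, add_mul, tmul_add, hx, hy]
  | tmul a b =>
    induction c using tmul_induction with
    | zero => simp only [map_zero, mul_zero, tmul_zero]
    | add x y hx hy => simp only [map_add, mul_add, tmul_add, hx, hy]
    | tmul b' a' =>
      have h1 : midResLin M O (embL M O (a ⊗ₜ b) * embR M O (b' ⊗ₜ a')) =
          (residue (fun i => pderiv i O.W) (b * b')) • (a ⊗ₜ a') := by
        change resMid _ (triMid M O _) = _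
        rw [map_mul, triMid_embL, triMid_embR, in12_tmul, in23_tmul, tmul_mul_tmul,
          tmul_mul_tmul, mul_one, one_mul, resMid_tmul]
      rw [h1, resLast_apply, triLast_embR, tcomm_tmul, tmul_mul_tmul,
        tcomm_tmul, in23_tmul, resMid_tmul, map_smul, lmul'_apply_tmul,
        tmul_smul]

lemma mulMap_midRes_tmul_one (b : M ⊠[k] O) (c : O ⊠[k] M) :
    (mulMap M (midResLin M O (embL M O b * embR M O c)) ⊗ₜ[k] 1 : M ⊠[k] O) =
      resFirst O M (embL O M (swap(k, M, O) b * c)) := by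
  induction b using tmul_induction with
  | zero => simp only [map_zero, zero_mul, zero_tmul]
  | add x y hx hy => simp only [map_add, add_mul, add_tmul, hx, hy]
  | tmul a b =>
    induction c using tmul_induction with
    | zero => simp only [map_zero, mul_zero, zero_tmul]
    | add x y hx hy => simp only [map_add, mul_add, add_tmul, hx, hy]
    | tmul b' a' =>
      have h1 : midResLin M O (embL M O (a ⊗ₜ b) * embR M O (b' ⊗ₜ a')) =
          (residue (fun i => pderiv i O.W) (b * b')) • (a ⊗ₜ a') := by
        change resMid _ (triMid M O _) = _
        rw [map_mul, triMid_embL, triMid_embR, in12_tmul, in23_tmul, tmul_mul_tmul,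
          tmul_mul_tmul, mul_one, one_mul, resMid_tmul]
      rw [h1, resFirst_apply, triFirst_embL, tcomm_tmul, tmul_mul_tmul,
        tcomm_tmul, in12_tmul, resMid_tmul, map_smul, lmul'_apply_tmul,
        ← smul_tmul']

/-- The evaluation at equal first and last variables. -/
def evalDiag (O M : Obj k) : Tri O M →+* O ⊠[k] M :=
  swap(k, M, O).toAlgHom.toRingHom.comp (eval (outVar O M))

lemma evalDiag_embL (a : O ⊠[k] M) : evalDiag O M (embL O M a) = a := by
  change swap(k, M, O) (eval (outVar O M) (embL O M a)) = a
  rw [eval_embL]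
  exact swap(k, O, M).symm_apply_apply a

lemma evalDiag_embR (b : M ⊠[k] O) : evalDiag O M (embR O M b) = swap(k, M, O) b := by
  change swap(k, M, O) (eval (outVar O M) (C b)) = _
  rw [eval_C]

lemma evalDiag_embOut (a : O ⊠[k] O) : evalDiag O M (embOut O M a) = mulMap O a ⊗ₜ 1 := by
  induction a using tmul_induction with
  | zero => simp only [map_zero, zero_tmul]
  | add x y hx hy => simp only [map_add, add_tmul, hx, hy]
  | tmul a b =>
    have h1 : embOut O M (a ⊗ₜ b) = embL O M (a ⊗ₜ 1) * embR O M (1 ⊗ₜ b) := (embL_mul_embR_out a b).symm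
    rw [h1, map_mul, evalDiag_embL, evalDiag_embR, tcomm_tmul, tmul_mul_tmul, one_mul, lmul'_apply_tmul]

end PartialResidues

section UnitSections

open MvPolynomial

variable {k : Type u} [CommRing k] {A B : Obj k} {X : Fact A B} {I : Type u} [Fintype I] [DecidableEq I]

lemma embOut_deltaBasis_mat {O M : Obj k} (r : Finset (Fin O.n) → Tri O M) (s : Finset (Fin O.n)) :
    ∑ t : ULift.{u} (Finset (Fin O.n)), embOut O M ((deltaBasis O).mat ⟨s⟩ t) * r t.down =
      koszulD (fun i => embOut O M (diffQuot k (varL k) (varR k) i O.W)) (fun i => embOut O M (varL k i - varR k i)) r s := by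
  have h1 : ∀ t : Finset (Fin O.n), embOut O M ((deltaBasis O).mat ⟨s⟩ ⟨t⟩) =
      koszulD (fun i => embOut O M (diffQuot k (varL k) (varR k) i O.W)) (fun i => embOut O M (varL k i - varR k i))
        (Pi.single t 1) s := fun t => by
    have h2 : (deltaBasis O).mat ⟨s⟩ ⟨t⟩ = koszulD (fun i => diffQuot k (varL k) (varR k) i O.W)
        (fun i => varL k i - varR k i) (Pi.single t 1) s := by
      change koszulD _ _ (((Pi.basisFun (O ⊠[k] O) (Finset (Fin O.n))).reindex Equiv.ulift.symm) ⟨t⟩) s = _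
      rw [reindex_apply, symm_symm, ulift_apply, Pi.basisFun_apply]
    rw [h2]
    refine (map_koszulD (A := O ⊠[k] O) (A' := Tri O M) (embOut O M).toRingHom _ _ _ s).trans ?_
    refine congrFun (congrArg _ (funext fun t' => ?_)) s
    change embOut O M _ = _
    rw [Pi.single_apply, Pi.single_apply, apply_ite (embOut O M), map_one, map_zero]
  rw [← Equiv.sum_comp Equiv.ulift.symm]
  have h3 : r = ∑ t, r t • Pi.single t (1 : Tri O M) := by
    refine funext fun t' => ?_
    rw [Finset.sum_apply, sum_eq_single t']
    · rw [Pi.smul_apply, Pi.single_eq_same, smul_eq_mul, mul_one]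
    · intro t _ ht
      rw [Pi.smul_apply, Pi.single_eq_of_ne ht.symm, smul_zero]
    · intro h; exact absurd (mem_univ _) h
  conv_rhs => rw [h3, map_sum, Finset.sum_apply]
  refine sum_congr rfl fun t _ => ?_
  rw [map_smul, Pi.smul_apply, smul_eq_mul, ← h1, mul_comm]
  rfl

/-- The coefficients of the section of the left unit action. -/
def lamSectionVec (e : X.HomBasis I) (s : Finset (Fin B.n)) (x : X.carrier) : I → Tri B A :=
  (doprod (quotL e.mat) s).mulVec (lcoord e x)

lemma lamSectionVec_add (e : X.HomBasis I) (s : Finset (Fin B.n)) (x y : X.carrier) :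
    lamSectionVec e s (x + y) = lamSectionVec e s x + lamSectionVec e s y := by
  rw [lamSectionVec, map_add, Matrix.mulVec_add]; rfl

lemma lamSectionVec_smul (e : X.HomBasis I) (s : Finset (Fin B.n)) (a : B ⊠[k] A) (x : X.carrier) :
    lamSectionVec e s (a • x) = embL B A a • lamSectionVec e s x := by
  rw [lamSectionVec, lcoord_smul, mulVec_smul]; rfl

lemma sum_sgNat_ite_mulVec {R : Type*} [CommRing R] {n : ℕ} (s : Finset (Fin n)) (a b : Fin n → R)
    (D : Finset (Fin n) → Matrix I I R) (l : ℕ) (M N : Matrix I I R) (v : I → R) (i : I)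
    (h : D s * M = ((-1 : ℤˣ) ^ l) • (N * D s) + ∑ j : Fin n, sgNat s j • (if j ∈ s then a j • D (s.erase j) else b j • D (insert j s))) :
    (D s).mulVec (M.mulVec v) i = (-1) ^ l * N.mulVec ((D s).mulVec v) i + ∑ j : Fin n, sgNat s j •
      (if j ∈ s then a j * (D (s.erase j)).mulVec v i else b j * (D (insert j s)).mulVec v i) := by
  have h2 : ∀ (u : ℤˣ) (Q : Matrix I I R), (u • Q).mulVec v i = u • Q.mulVec v i := fun u Q => by
    rcases Int.units_eq_one_or u with rfl | rfl
    · rw [one_smul, one_smul]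
    · rw [uneg_smul, uneg_smul, one_smul, one_smul, Matrix.neg_mulVec, Pi.neg_apply]
  rw [mulVec_mulVec, h, Matrix.add_mulVec, Pi.add_apply, h2, mulVec_mulVec, Matrix.sum_mulVec, Finset.sum_apply,
    neg_one_pow_units_smul (R := R), smul_eq_mul]
  refine congrArg₂ (· + ·) rfl (sum_congr rfl fun j _ => ?_)
  rw [h2]
  split_ifs
  · rw [smul_mulVec, Pi.smul_apply, smul_eq_mul]
  · rw [smul_mulVec, Pi.smul_apply, smul_eq_mul]

lemma lamSectionVec_d (e : X.HomBasis I) (s : Finset (Fin B.n)) (x : X.carrier) (i : I) :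
    lamSectionVec e s (X.d x) i = koszulD (fun i => embOut B A (diffQuot k (varL k) (varR k) i B.W))
      (fun i => embOut B A (varL k i - varR k i)) (fun t => lamSectionVec e t x i) s +
      (-1) ^ s.card * (matR (matSwap B A e.mat)).mulVec (lamSectionVec e s x) i := by
  rw [lamSectionVec, lcoord_d, sum_sgNat_ite_mulVec (R := Tri B A) s _ _ _ _ _ _ _ i (doprod_mul_matL e.mat_mul_mat s),
    koszulD_eq_sum, add_comm]
  rfl

lemma lamSectionVec_even (e : X.HomBasis I) (s : Finset (Fin B.n)) (x : X.carrier) (i : I) :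
    lamSectionVec e s (X.even x) i = if (s.card : ZMod 2) + e.par i = 0 then lamSectionVec e s x i else 0 := by
  have h1 : ∀ y, lamSectionVec e s y i = ∑ j, doprod (quotL e.mat) s i j * embL B A (e.basis.repr y j) := fun y => rfl
  have h2 : ∀ (c : Prop) [Decidable c] (g : I → Tri B A), (if c then ∑ j, g j else 0) = ∑ j, if c then g j else 0 :=
    fun c _ g => by
      split_ifs
      · rfl
      · rw [sum_const_zero]
  rw [h1, h1, h2]
  refine sum_congr rfl fun j _ => ?_
  by_cases h : e.par i = e.par j + s.card
  · rw [e.repr_even, h]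
    have : ∀ a b : ZMod 2, (a + (b + a) = 0) ↔ b = 0 := by decide
    simp only [this]
    split_ifs
    · rfl
    · rw [map_zero, mul_zero]
  · rw [isHomMat_doprod (isHomMat_quotL (isHomMat_mat e)) s i j h, zero_mul, zero_mul, ite_self]

/-- The section of the left unit action. -/
def lamSection (e : X.HomBasis I) : Hom X (tensor (delta B) X) where
  map :=
    { toFun := fun x => tsum (deltaBasis B) e fun s i => triLast B A (lamSectionVec e s.down x i)
      map_add' := fun x y => by
        rw [← tsum_add]
        refine congrArg _ (funext fun s => funext fun i => ?_)
        rw [lamSectionVec_add, Pi.add_apply, map_add]; rfl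
      map_smul' := fun a x => by
        rw [RingHom.id_apply, smul_tsum]
        refine congrArg _ (funext fun s => funext fun i => ?_)
        rw [lamSectionVec_smul, Pi.smul_apply, smul_eq_mul, map_mul, triLast_embL] }
  map_even x := by
    refine Eq.trans ?_ (tsum_even (deltaBasis B) e fun s i => triLast B A (lamSectionVec e s.down x i)).symm
    refine congrArg (tsum (deltaBasis B) e) (funext fun s => funext fun i => ?_)
    rw [lamSectionVec_even, apply_ite (triLast B A), map_zero]
    rfl
  map_d x := by
    refine Eq.trans ?_ (tsum_d (deltaBasis B) e fun s i => triLast B A (lamSectionVec e s.down x i)).symm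
    refine congrArg (tsum (deltaBasis B) e) (funext fun s => funext fun i => ?_)
    rw [lamSectionVec_d, map_add, map_mul, map_pow, map_neg, map_one]
    refine congrArg₂ (· + ·) ?_ (congrArg₂ (· * ·) ?_ ?_)
    · rw [← embOut_deltaBasis_mat, map_sum]
      refine sum_congr rfl fun t _ => ?_
      rw [map_mul, triLast_embOut]
    · change _ = (-1) ^ ((s.down.card : ℕ) : ZMod 2).val
      rw [neg_one_pow_val_natCast]
    · rw [Matrix.mulVec, dotProduct, map_sum]
      refine sum_congr rfl fun j _ => ?_
      rw [map_mul]
      refine congrArg (· * _) ?_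
      refine (triLast_embR _).trans (congrArg _ ?_)
      exact swap(k, B, A).symm_apply_apply _

lemma lamSection_apply (e : X.HomBasis I) (x : X.carrier) :
    (lamSection e).map x = tsum (deltaBasis B) e fun s i => triLast B A (lamSectionVec e s.down x i) := rfl

lemma lamHom_act3 (e : X.HomBasis I) (P : Tri B A) (s : ULift.{u} (Finset (Fin B.n))) (i : I) :
    (lamHom X).map (act3 (triLast B A P) (pt ((deltaBasis B).basis s) (e.basis i))) =
      if s.down = ∅ then evalDiag B A P • e.basis i else 0 := by
  induction P using tri_induction_out_right with
  | ha x y hx hy =>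
    rw [map_add, map_add, ladd_apply, map_add, hx, hy, map_add, add_smul]
    split_ifs
    · rfl
    · exact add_zero _
  | h a b =>
    rw [map_mul, act3_mul, triLast_embOut, triLast_embR, act3_in23, act3_in12]
    change lamMap X (pt _ _) = _
    rw [lamMap_pt, map_mul, evalDiag_embOut, evalDiag_embR]
    have h1 : counit B (a • (deltaBasis B).basis s) = if s.down = ∅ then mulMap B a else 0 := by
      change mulMap B (a * (((Pi.basisFun (B ⊠[k] B) (Finset (Fin B.n))).reindex Equiv.ulift.symm) s) ∅) = _
      rw [reindex_apply, symm_symm, ulift_apply, Pi.basisFun_apply, Pi.single_apply]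
      by_cases h : s.down = ∅
      · rw [if_pos h, if_pos h.symm, mul_one]
      · rw [if_neg h, if_neg (Ne.symm h), mul_zero, map_zero]
    rw [h1]
    split_ifs
    · rw [smul_smul]
    · exact zero_tmul_smul (X := X) (swap(k, A, B) b • e.basis i)

lemma lamSection_comp (e : X.HomBasis I) : (lamSection e).comp (lamHom X) = Hom.id X := Hom.ext' fun x => by
  rw [Hom.comp_map, lamSection_apply, tsum, Hom.id_map, map_sum]
  simp only [map_sum, lamHom_act3]
  rw [sum_eq_single ⟨∅⟩]
  · simp only [if_true]
    conv_rhs => rw [← e.basis.sum_repr x]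
    refine sum_congr rfl fun i _ => ?_
    have h : lamSectionVec e ∅ x i = embL B A (e.basis.repr x i) := by
      rw [lamSectionVec, doprod_empty]
      exact congrFun (Matrix.one_mulVec (lcoord e x)) i
    exact congrArg (· • e.basis i) ((congrArg (evalDiag B A) h).trans (evalDiag_embL _))
  · intro s _ hs
    refine sum_eq_zero fun i _ => if_neg fun h => hs (ULift.ext _ _ h)
  · intro h; exact absurd (mem_univ _) h

end UnitSections

section ResidueOfSums

open MvPolynomial

variable {k : Type u} [CommRing k]

lemma CommRel.exists_resMid_eq {T R T₀ : Type u} [CommRing T] [CommRing R] [CommRing T₀] [Algebra k T] [Algebra k R]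
    {n : ℕ} {I : Type u} [Fintype I] [DecidableEq I] {p : Fin n → Polynomial k} (hp : ∀ i, (p i).Monic)
    (h0 : ∀ i, (p i).natDegree ≠ 0) {δ : Pol(n, k)} {ρ : Pol(n, k) →ₗ[k] k}
    (hρ : ∀ g, ρ g = resMonic p (δ * g)) (τ : T₀ →+* Mid k T Pol(n, k) R) {g q : Fin n → T₀} {d : T₀}
    (a : Fin n → T ⊗[k] R) {D S : Matrix I I T₀} {N : Matrix I I (T ⊗[k] R)}
    (hg : ∀ i, τ (g i) = 1 ⊗ₜ paeval (X i) (p i)) (hd : τ d = 1 ⊗ₜ δ)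
    (hq : ∀ i, τ (q i) = polyQuot (p i) (in13 k T Pol(n, k) R (a i)) (1 ⊗ₜ X i))
    (hD : ∀ i j, τ (D i j) = in13 k T Pol(n, k) R (N i j))
    (h : CommRel (Ideal.span (Set.range g) • (⊤ : Submodule T₀ (Matrix I I T₀))).toAddSubgroup D 1
      (d • S) ((∏ i, q i) • (1 : Matrix I I T₀))) :
    ∃ H : Matrix I I (T ⊗[k] R), S.map (fun P => resMid ρ (τ P)) = 1 + (N * H + H * N) := by
  obtain ⟨H, hH⟩ := h
  let φ : T₀ →+ T ⊗[k] R := (resMid (resMonic p)).toAddMonoidHom.comp τ.toAddMonoidHom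
  have hφ : ∀ P, φ P = resMid (resMonic p) (τ P) := fun _ => rfl
  have h1 : ∀ r ∈ Ideal.span (Set.range g), ∀ P, φ (r * P) = 0 := fun r hr => by
    induction hr using Submodule.span_induction with
    | mem x hx =>
      obtain ⟨i, rfl⟩ := hx
      intro P
      rw [hφ, map_mul, hg]
      exact resMid_mul_eq_zero (resMonic_aeval_mul hp i) _
    | zero => intro P; rw [zero_mul, map_zero]
    | add x y _ _ hx hy => intro P; rw [add_mul, map_add, hx, hy, add_zero]
    | smul b x _ hx => intro P; rw [smul_eq_mul, mul_comm b, mul_assoc, hx]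
  have h2 : ∀ Q ∈ Ideal.span (Set.range g) • (⊤ : Submodule T₀ (Matrix I I T₀)), φ.mapMatrix Q = 0 := fun Q hQ => by
    induction hQ using Submodule.smul_induction_on' with
    | smul r hr Q _ => exact Matrix.ext fun i j => h1 r hr (Q i j)
    | add x _ y _ hx hy => rw [map_add, hx, hy, add_zero]
  have h3 := h2 _ hH
  have h4 : φ.mapMatrix (D * H) = N * φ.mapMatrix H := Matrix.ext fun i j => by
    rw [AddMonoidHom.mapMatrix_apply, map_apply, mmul_apply, map_sum, mmul_apply]
    exact sum_congr rfl fun l _ => by rw [hφ, map_mul, hD, resMid_in13_mul]; rfl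
  have h5 : φ.mapMatrix (H * D) = φ.mapMatrix H * N := Matrix.ext fun i j => by
    rw [AddMonoidHom.mapMatrix_apply, map_apply, mmul_apply, map_sum, mmul_apply]
    exact sum_congr rfl fun l _ => by rw [hφ, mul_comm, map_mul, hD, resMid_in13_mul, mul_comm]; rfl
  have h6 : φ.mapMatrix (d • S) = S.map (fun P => resMid ρ (τ P)) := Matrix.ext fun i j => by
    refine (hφ _).trans ?_
    rw [msmul_apply, smul_eq_mul, map_mul, hd, map_apply]
    exact (resMid_comp hρ _).symm
  have h7 : φ.mapMatrix ((∏ i, q i) • (1 : Matrix I I T₀)) = 1 := Matrix.ext fun i j => by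
    refine (hφ _).trans ?_
    rw [msmul_apply, Matrix.one_apply, Matrix.one_apply]
    split_ifs
    · rw [smul_eq_mul, mul_one, map_prod]
      simp only [hq]
      exact resMid_prod_polyQuot hp h0 a
    · rw [smul_zero, map_zero, map_zero]
  rw [one_smul, map_sub, map_sub, map_add, h4, h5, h6, h7] at h3
  exact ⟨φ.mapMatrix H, by rw [← sub_eq_zero, ← h3]; abel⟩

variable {O M : Obj k} {I : Type u} [Fintype I] [DecidableEq I] {N : Matrix I I (O ⊠[k] M)}
  {L : Finset (Fin O.n) → Matrix I I (O ⊠[k] M)}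

lemma KoszulFamily.map {P P' 𝓐 𝓑 : Type u} [CommRing P] [CommRing P'] [Ring 𝓐] [Ring 𝓑] [Algebra P 𝓐] [Algebra P' 𝓑]
    (Φ : 𝓐 →+* 𝓑) {n : ℕ} {D : 𝓐} {f : Fin n → P} {f' : Fin n → P'} {F : Finset (Fin n) → 𝓐}
    (hf : ∀ j x, Φ (f j • x) = f' j • Φ x) (hF : KoszulFamily D f F) : KoszulFamily (Φ D) f' fun s => Φ (F s) where
  empty := by rw [hF.empty, map_one]
  comm s := by
    rw [← map_mul, hF.comm, map_add, map_units_smul, map_mul, map_sum]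
    refine congrArg₂ (· + ·) rfl (sum_congr rfl fun i _ => ?_)
    split_ifs
    · rw [map_units_smul, hf]
    · exact map_zero _

lemma KoszulFamily.exists_contraction {P 𝓐 : Type u} [CommRing P] [Ring 𝓐] [Algebra P 𝓐] {n : ℕ} {D : 𝓐} {f : Fin n → P}
    {F : Finset (Fin n) → 𝓐} (hF : KoszulFamily D f F) (c : Fin n → P) (hc : ∑ j, c j * f j = 1) :
    ∃ H, D * H + H * D = 1 := by
  have h1 : ∀ j, D * F {j} + F {j} * D = f j • 1 := fun j => by
    rw [hF.comm, Finset.card_singleton, pow_one, uneg_smul, one_smul, sum_eq_single j,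
      if_pos (Finset.mem_singleton_self j), Finset.erase_singleton, hF.empty]
    · have : sgNat ({j} : Finset (Fin n)) j = 1 := by simp [sgNat, Finset.filter_singleton]
      rw [this, one_smul]
      exact neg_add_cancel_comm _ _
    · intro i _ hi
      rw [if_neg (by simpa using hi)]
    · intro h; exact absurd (mem_univ _) h
  refine ⟨∑ j, c j • F {j}, ?_⟩
  rw [mul_sum, sum_mul, ← sum_add_distrib]
  have h2 : ∀ j, D * (c j • F {j}) + (c j • F {j}) * D = (c j * f j) • 1 := fun j => by
    rw [mul_smul_comm, smul_mul_assoc, ← smul_add, h1, smul_smul]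
  simp only [h2]
  rw [← sum_smul, hc, one_smul]

lemma KoszulFamily.map_matL (hL : KoszulFamily N (fun j => (pderiv j O.W ⊗ₜ[k] 1 : O ⊠[k] M)) L) :
    KoszulFamily (matL N : Matrix I I (Tri O M)) (fun j => (aeval X (pderiv j O.W) : Tri O M)) fun s => matL (L s) :=
  KoszulFamily.map (𝓑 := Matrix I I (Tri O M)) (P' := Tri O M) matL (fun j x => by
    rw [matL_smul, embL_tmul, ← tone_def, C_1, mul_one]) hL

lemma aeval_X_det {n : ℕ} {K : Type u} [CommRing K] [Algebra k K] (c : Matrix (Fin n) (Fin n) Pol(n, k)) :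
    (Matrix.of fun i j => (aeval X (c i j) : Pol(n, K))).det = aeval X c.det :=
  ((aeval X : Pol(n, k) →ₐ[k] Pol(n, K)).map_det c).symm

set_option maxHeartbeats 1000000 in
lemma exists_resLast_or (hN : N * N = algebraMap _ _ (pot k O.W M.W))
    (hL : KoszulFamily N (fun j => (pderiv j O.W ⊗ₜ[k] 1 : O ⊠[k] M)) L) : (∃ H, N * H + H * N = 1) ∨
    (∃ H, (∑ s : Finset (Fin O.n), (∏ i ∈ s, (-1 : ℤˣ) ^ (i : ℕ)) • (oprod (quotL N) s *
        matR (matSwap O M (L univ)) * doprod (quotL N) sᶜ)).map (resLast O M) = 1 + (N * H + H * N)) ∧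
    (∃ H, (∑ s : Finset (Fin O.n), (∏ i ∈ s, (-1 : ℤˣ) ^ (i + O.n + 1 : ℕ)) • (doprod (quotL N) sᶜ *
        matL (L univ) * oprod (quotL N) s)).map (resFirst O M) = 1 + (matSwap O M N * H + H * matSwap O M N)) := by
  obtain ⟨p, c, hp, hc, hres, -⟩ := exists_residue O
  by_cases h0 : ∀ i, (p i).natDegree ≠ 0
  · right
    have h1 : ∀ i, paeval (X i : Tri O M) ((p i).map (algebraMap k (M ⊠[k] O))) =
        ∑ j, (aeval X (c i j) : Tri O M) * aeval X (pderiv j O.W) := fun i => by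
      rw [aeval_map_algebraMap_X]
      simp only [← map_mul, ← map_sum]
      rw [← hc, ← aeval_algHom_apply, aeval_X]
    have h2 : ∀ i, paeval (X i : Tri O M) ((p i).map (algebraMap k (M ⊠[k] O))) =
        aeval X (paeval (X i : O.ring) (p i)) := fun i => by
      rw [aeval_map_algebraMap_X, ← aeval_algHom_apply, aeval_X]
    have h3 : ∀ (q : Polynomial k) i, Polynomial.eval (outVar O M i) (q.map (algebraMap k (M ⊠[k] O))) =
        1 ⊗ₜ paeval (X i : O.ring) q := fun q i => by
      rw [Polynomial.eval_map_algebraMap]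
      exact aeval_algHom_apply (includeRight : O.ring →ₐ[k] M ⊠[k] O) (X i) q
    constructor
    · have key := commRel_sum_oprod (outVar O M) (matL_mul_matL hN) hL.map_matL h1
      simp only [substMat_last, aeval_X_det, subst_last, h3] at key
      refine key.exists_resMid_eq hp h0 hres (triLast O M).toRingHom (fun i => X i ⊗ₜ 1) (fun i => ?_) ?_ (fun i => ?_)
        fun i j => triLast_embL _
      · exact triLast_C _
      · have h4 : (aeval X (Matrix.of c).det : Tri O M) = embL O M ((Matrix.of c).det ⊗ₜ 1) := by
          rw [embL_tmul, ← tone_def, C_1, mul_one]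
        exact (triLast_C _).trans (congrArg _ (congrArg _ ((congrArg _ h4).trans (eval_embL _))))
      · rw [dquot_aeval_map _ _ (hp i)]
        refine (map_polyQuot (P := Tri O M) (P' := Mid k O.ring O.ring M.ring) (triLast O M) (p i) (X i)
          (C (outVar O M i))).trans (congrArg₂ _ ?_ ?_)
        · exact aevalTower_X _ _ _
        · exact triLast_C _
    · have key := commRel_sum_doprod (outVar O M) (matL_mul_matL hN) hL.map_matL h1
      simp only [substMat_last, aeval_X_det, h2] at key
      refine key.exists_resMid_eq hp h0 hres (triFirst O M).toRingHom (fun i => 1 ⊗ₜ X i) (fun i => triFirst_aeval_X _)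
        (triFirst_aeval_X _) (fun i => ?_) fun i j => triFirst_embR _
      rw [← h2, dquot_aeval_map _ _ (hp i), polyQuot_comm]
      refine (map_polyQuot (P := Tri O M) (P' := Mid k M.ring O.ring O.ring) (triFirst O M) (p i)
        (C (outVar O M i)) (X i)).trans (congrArg₂ _ ?_ ?_)
      · exact triFirst_C _
      · exact aevalTower_X _ _ _
  · left
    push Not at h0
    obtain ⟨i, hi⟩ := h0
    refine hL.exists_contraction (fun j => c i j ⊗ₜ[k] 1) ?_
    simp only [tmul_mul_tmul, one_mul]
    rw [← TensorProduct.sum_tmul, ← hc, (hp i).natDegree_eq_zero.1 hi, map_one, tone_def]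

end ResidueOfSums

section MatrixHomotopies

variable {A : Type u} [CommRing A] {w : A} {X Y : LinFact A w} {I : Type u} [Fintype I] [DecidableEq I]

lemma LinFact.HomBasis.toLin_mat (e : X.HomBasis I) : Matrix.toLin e.basis e.basis e.mat = X.d :=
  e.basis.ext fun j => by rw [Matrix.toLin_self, e.d_basis]

lemma cls_eq_id_of_mat (e : X.HomBasis I) (c : Hom X X) {Q H : Matrix I I A}
    (hc : ∀ j, c.map (e.basis j) = ∑ p, Q p j • e.basis p) (hQ : Q = 1 + (e.mat * H + H * e.mat)) :
    cls c = cls (Hom.id X) := by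
  refine (cls_eq_of_linear (Matrix.toLin e.basis e.basis H) fun x => ?_).symm
  have h1 : c.map = Matrix.toLin e.basis e.basis Q := e.basis.ext fun j => by rw [hc, Matrix.toLin_self]
  rw [h1, hQ, map_add, map_add, Matrix.toLin_one, Matrix.toLin_mul e.basis e.basis, Matrix.toLin_mul e.basis e.basis,
    e.toLin_mat]
  rfl

lemma cls_eq_of_contraction (e : Y.HomBasis I) {H : Matrix I I A} (hH : e.mat * H + H * e.mat = 1) (f g : Hom X Y) :
    cls f = cls g := by
  have h1 : ∀ y, Y.d (Matrix.toLin e.basis e.basis H y) + Matrix.toLin e.basis e.basis H (Y.d y) = y := fun y => by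
    have := congrArg (fun Q => Matrix.toLin e.basis e.basis Q y) hH
    simp only [map_add, Matrix.toLin_one, Matrix.toLin_mul e.basis e.basis e.basis, e.toLin_mat] at this
    exact this
  refine cls_eq_of_linear (Matrix.toLin e.basis e.basis H ∘ₗ (g.map - f.map)) fun x => ?_
  have h2 : (g.map - f.map) (X.d x) = Y.d ((g.map - f.map) x) := by
    rw [lsub_apply, lsub_apply, map_sub, g.map_d, f.map_d]
  rw [lcomp_apply, lcomp_apply, h2, h1, lsub_apply, add_sub_cancel]

lemma cls_eq_of_section {f g : Hom X Y} (σ : Hom Y X) (hf : IsIso (cls f)) (hσ : cls (σ.comp f) = cls (Hom.id Y))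
    (h : cls (σ.comp g) = cls (Hom.id Y)) : cls g = cls f := by
  have h1 : cls σ ≫ cls f = 𝟙 _ := hσ
  have h2 : cls σ ≫ cls g = 𝟙 _ := h
  have h3 : cls σ = inv (cls f) := (cancel_mono (cls f)).1 (h1.trans (IsIso.inv_hom_id _).symm)
  rw [h3, IsIso.inv_comp_eq, Category.comp_id] at h2
  exact h2

end MatrixHomotopies

section FirstTriangle

open MvPolynomial

variable {k : Type u} [CommRing k] {A B : Obj k} {X : Fact A B} {Z : Fact B A} {I : Type u} [Fintype I]
  [DecidableEq I] {e : X.HomBasis I} {f : Z.HomBasis I} {L : Finset (Fin B.n) → Matrix I I (B ⊠[k] A)}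

lemma evMat_empty (N Λ : Matrix I I (A ⊠[k] B)) : evMat N Λ ∅ = ((-1 : ℤˣ) ^ B.n) • matL Λ := by
  rw [evMat, oprod_empty]
  exact congrArg _ (mul_one (M := Matrix I I (Tri A B)) _)

variable (h : IsDualBasis e f)
  (hL : KoszulFamily e.mat (fun j => (pderiv j B.W ⊗ₜ[k] 1 : B ⊠[k] A)) L)
  (hΛ : IsHomMat e.par (B.n : ZMod 2) (L univ))

lemma counit_evHom (y : Z.carrier) (x : X.carrier) :
    counit A ((evHom h hL hΛ).map (pt y x)) = ((-1 : ℤˣ) ^ B.n) • ∑ i, ∑ j, mulMap A (midResLin A B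
      (embL A B (f.basis.repr y i * matSwap B A (L univ) i j) * embR A B (e.basis.repr x j))) := by
  change mulMap A (((evHom h hL hΛ).map (pt y x) : Finset (Fin A.n) → A ⊠[k] A) ∅) = _
  rw [evHom_pt, evMat_empty, evPair_units_smul, smul_def, map_zsmul, map_zsmul, ← smul_def, evPair_eq_sum]
  refine congrArg _ ?_
  simp only [map_sum]
  refine sum_congr rfl fun i _ => sum_congr rfl fun j _ => ?_
  exact congrArg (fun t => mulMap A (midResLin A B (t * _))) (map_mul (embL A B) _ _).symm

lemma one_tmul_counit_evHom (q i : I) (b b' : A ⊠[k] B) : (1 ⊗ₜ counit A ((evHom h hL hΛ).map (pt (b' • f.basis q)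
      (swap(k, A, B) b • e.basis i))) : B ⊠[k] A) =
    ((-1 : ℤˣ) ^ B.n) • resLast B A (embR B A b' * (embR B A b * matR (matSwap B A (L univ)) q i)) := by
  have h1 : ∀ i', f.basis.repr (b' • f.basis q) i' = if i' = q then b' else 0 := fun i' => by
    rw [map_smul, fsmul_apply, f.basis.repr_self, single_apply, smul_eq_mul, mul_ite, mul_one, mul_zero]
    simp only [eq_comm]
  have h2 : ∀ j, e.basis.repr (swap(k, A, B) b • e.basis i) j =
      if j = i then swap(k, A, B) b else 0 := fun j => by
    rw [map_smul, fsmul_apply, e.basis.repr_self, single_apply, smul_eq_mul, mul_ite, mul_one, mul_zero]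
    simp only [eq_comm]
  rw [counit_evHom]
  simp only [h1, h2]
  refine (map_units_smul (includeRight : A.ring →ₐ[k] B ⊠[k] A).toRingHom _ _).trans
    (congrArg _ ?_)
  rw [sum_eq_single q, sum_eq_single i, if_pos rfl, if_pos rfl]
  · refine (one_tmul_mulMap_midRes _ _).trans (congrArg _ ?_)
    rw [map_mul, map_mul, show swap(k, B, A) (swap(k, A, B) b) = b
      from swap(k, A, B).symm_apply_apply b]
    exact (mul_assoc _ _ _).trans (congrArg _ (mul_comm _ _))
  · intro j _ hj
    rw [if_neg hj, map_zero, mul_zero, map_zero, map_zero]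
  · intro h; exact absurd (mem_univ _) h
  · intro j _ hj
    refine sum_eq_zero fun i' _ => ?_
    rw [if_neg hj, zero_mul, map_zero, zero_mul, map_zero, map_zero]
  · intro h; exact absurd (mem_univ _) h

/-- The composite of a coevaluation and an evaluation in the first triangle identity. -/
def triangleLeft (c : Hom (delta B) (tensor X Z)) (v : Hom (tensor Z X) (delta A)) : Hom (tensor (delta B) X) X :=
  (c.tensor (Hom.id X)).comp ((assocHom X Z X).comp (((Hom.id X).tensor v).comp (rhoHom X)))

/-- The coefficients of the composite in the first triangle identity. -/
def triangleMat (N : Matrix I I (B ⊠[k] A)) (Λ : Matrix I I (B ⊠[k] A)) (s : Finset (Fin B.n)) :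
    Matrix I I (Tri B A) := ((-1 : ℤˣ) ^ B.n) • (coevMat N s * matR (matSwap B A Λ))

lemma tail_act3 (P : Tri B A) (p q i : I) (b : A ⊠[k] B) :
    ((assocHom X Z X).comp (((Hom.id X).tensor (evHom h hL hΛ)).comp (rhoHom X))).map
      (pt (act3 (triMid B A P) (pt (e.basis p) (f.basis q))) (swap(k, A, B) b • e.basis i)) =
    ((-1 : ℤˣ) ^ B.n) • resLast B A (P * (embR B A b * matR (matSwap B A (L univ)) q i)) • e.basis p := by
  induction P using tri_induction with
  | ha x y hx hy =>
    rw [map_add, map_add, ladd_apply, map_add, AddMonoidHom.add_apply, map_add, hx, hy, add_mul, map_add,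
      add_smul, smul_add]
  | h a b' =>
    rw [map_mul, act3_mul, triMid_embL, triMid_embR, act3_in23, act3_in12, Hom.comp_map, assocHom_pt, Hom.comp_map,
      Hom.tensor_pt, Hom.id_map]
    change rhoMap X (pt _ _) = _
    rw [rhoMap_pt, one_tmul_counit_evHom, mul_assoc, resLast_embL_mul, smul_def, smul_assoc, smul_smul,
      ← smul_def, mul_comm a]

lemma coevHom_smul_basis (h : IsDualBasis e f) (a : B ⊠[k] B) (s : ULift.{u} (Finset (Fin B.n))) :
    (coevHom h).map (a • (deltaBasis B).basis s) = msum e f (embOut B A a • coevMat e.mat s.down) := by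
  have h1 : ∀ t, ((deltaBasis B).basis s : Finset (Fin B.n) → B ⊠[k] B) t = if t = s.down then 1 else 0 :=
    fun t => by
      change ((Pi.basisFun (B ⊠[k] B) (Finset (Fin B.n))).reindex Equiv.ulift.symm) s t = _
      rw [reindex_apply, symm_symm, ulift_apply, Pi.basisFun_apply, Pi.single_apply]
  rw [map_smul, ← smul_msum]
  refine congrArg _ ((coevHom_apply h _).trans ?_)
  simp only [h1]
  rw [sum_eq_single s.down]
  · rw [if_pos rfl, one_smul]
  · intro t _ ht
    rw [if_neg ht]
    exact zero_smul (B ⊠[k] B) (msum e f (coevMat e.mat t))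
  · intro h; exact absurd (mem_univ _) h

lemma units_smul_sum_mul_mul {R : Type*} [CommRing R] (u : ℤˣ) (a b : R) (C D : Matrix I I R) (p i : I) :
    u • ∑ q, a * C p q * (b * D q i) = a * b * (u • (C * D)) p i := by
  rw [units_smul_apply, mul_smul_comm, mmul_apply, mul_sum]
  refine congrArg _ (sum_congr rfl fun q _ => ?_)
  ring

lemma units_smul_resLast_sum (u : ℤˣ) (r : I → Tri B A) (x : X.carrier) :
    ∑ q, u • resLast B A (r q) • x = resLast B A (u • ∑ q, r q) • x := by
  have h1 : ∀ q, u • resLast B A (r q) • x = resLast B A (u • r q) • x := fun q => by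
    rw [smul_def, smul_def, map_zsmul, smul_assoc]
  simp only [h1]
  rw [← sum_smul, ← map_sum, ← smul_sum]

lemma triangleLeft_act3 (R : Tri B A) (s : ULift.{u} (Finset (Fin B.n))) (i : I) :
    (triangleLeft (coevHom h) (evHom h hL hΛ)).map (act3 (triLast B A R) (pt ((deltaBasis B).basis s) (e.basis i))) =
      ∑ p, resLast B A (R * triangleMat e.mat (L univ) s.down p i) • e.basis p := by
  induction R using tri_induction_out_right with
  | ha x y hx hy =>
    rw [map_add, map_add, ladd_apply, map_add, hx, hy, ← sum_add_distrib]
    refine sum_congr rfl fun p _ => ?_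
    rw [add_mul, map_add, add_smul]
  | h a b =>
    rw [map_mul, act3_mul, triLast_embR, triLast_embOut, act3_in23, act3_in12, triangleLeft, Hom.comp_map, Hom.tensor_pt,
      Hom.id_map, coevHom_smul_basis, msum, tsum]
    simp only [map_sum, AddMonoidHom.finset_sum_apply, tail_act3 h hL hΛ, msmul_apply, smul_eq_mul]
    refine sum_congr rfl fun p _ => ?_
    refine (units_smul_resLast_sum _ _ _).trans (congrArg (resLast B A · • e.basis p) ?_)
    exact units_smul_sum_mul_mul (R := Tri B A) ((-1) ^ B.n) (embOut B A a) (embR B A b)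
      (coevMat e.mat s.down) (matR (matSwap B A (L univ))) p i

lemma sum_mul_units_smul {R : Type*} [CommRing R] {u v w : ℤˣ} (C D E : Matrix I I R) (hw : w = v) (p j : I) :
    ∑ i, E i j * (u • ((u * v) • C * D)) p i = (w • (C * D * E)) p j := by
  have h1 : u • ((u * v) • C * D) = w • (C * D) := by
    rw [smul_mul_assoc, smul_smul, ← mul_assoc, units_mul_self, one_mul, hw]
  rw [h1, ← smul_mul_assoc w (C * D) E, mmul_apply]
  exact sum_congr rfl fun i _ => mul_comm _ _

lemma lamSectionVec_basis (e : X.HomBasis I) (s : Finset (Fin B.n)) (j i : I) :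
    lamSectionVec e s (e.basis j) i = doprod (quotL e.mat) s i j := by
  have h1 : lcoord e (e.basis j) = (Pi.single j 1 : I → Tri B A) := funext fun l => by
    rw [lcoord_apply, e.basis.repr_self, single_apply, Pi.single_apply, apply_ite (embL B A), map_one, map_zero]
    simp only [eq_comm]
  rw [lamSectionVec, h1]
  exact congrFun (Matrix.mulVec_single_one (R := Tri B A) _ j) i

lemma triangleLeft_section (j : I) : ((lamSection e).comp (triangleLeft (coevHom h) (evHom h hL hΛ))).map (e.basis j) =
      ∑ p, (∑ s : Finset (Fin B.n), (∏ i ∈ s, (-1 : ℤˣ) ^ (i : ℕ)) • (oprod (quotL e.mat) s *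
        matR (matSwap B A (L univ)) * doprod (quotL e.mat) sᶜ)).map (resLast B A) p j • e.basis p := by
  rw [Hom.comp_map, lamSection_apply, tsum, map_sum]
  simp only [map_sum, triangleLeft_act3 h hL hΛ]
  simp only [lamSectionVec_basis]
  refine (sum_congr rfl fun s _ => sum_comm).trans (sum_comm.trans
    (sum_congr rfl fun p _ => ?_))
  simp only [← sum_smul]
  refine congrArg (· • e.basis p) ?_
  rw [map_apply, Matrix.sum_apply, map_sum]
  refine Fintype.sum_equiv (Equiv.ulift.trans (Function.Involutive.toPerm compl compl_involutive)) _ _ fun s => ?_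
  rw [← map_sum]
  refine congrArg (resLast B A) ?_
  change _ = ((∏ i ∈ s.downᶜ, (-1 : ℤˣ) ^ (i : ℕ)) • (oprod (quotL e.mat) s.downᶜ *
        matR (matSwap B A (L univ)) * doprod (quotL e.mat) s.downᶜᶜ)) p j
  rw [compl_compl, triangleMat, coevMat]
  exact sum_mul_units_smul (R := Tri B A) _ _ _ (Finset.prod_pow_eq_pow_sum _ _ _) p j

lemma triangleLeft_eq : cls (triangleLeft (coevHom h) (evHom h hL hΛ)) = cls (lamHom X) := by
  rcases exists_resLast_or e.mat_mul_mat hL with ⟨H, hH⟩ | ⟨⟨H, hH⟩, -⟩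
  · exact cls_eq_of_contraction e hH _ _
  · exact cls_eq_of_section (lamSection e) (isIso_lamHom_of_basis e) (congrArg cls (lamSection_comp e))
      (cls_eq_id_of_mat e _ (triangleLeft_section h hL hΛ) hH)

end FirstTriangle

section RightUnitSections

open MvPolynomial

variable {k : Type u} [CommRing k] {A B : Obj k} {X : Fact A B} {Z : Fact B A} {I : Type u} [Fintype I]
  [DecidableEq I] {e : X.HomBasis I} {f : Z.HomBasis I}

/-- The matrices of the section of the right unit action. -/
def rhoMat (N : Matrix I I (B ⊠[k] A)) (s : Finset (Fin B.n)) : Matrix I I (Tri B A) :=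
  ((-1 : ℤˣ) ^ ((B.n + 1) * s.card)) • (doprod (quotL N) s).transpose

lemma transpose_units_smul {R : Type*} [CommRing R] (u : ℤˣ) (Q : Matrix I I R) : (u • Q).transpose = u • Q.transpose :=
  Matrix.ext fun _ _ => rfl

lemma transpose_commutator {R ι : Type*} [CommRing R] [Fintype ι] {u c : ℤˣ} {σ : ι → ℤˣ} {D Ml Mr S Sf FR FL : Matrix I I R}
    {V T : ι → Matrix I I R} (h1 : D * Ml = u • (Mr * D) + ∑ i, σ i • V i) (hR : FR = -(Mr.transpose * S))
    (hL : FL = -(Ml.transpose * S)) (hS : S * D.transpose = u • (D.transpose * S))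
    (hT : ∀ i, Sf * T i = (c * u) • ((V i).transpose * S)) :
    (c • D.transpose) * FR = FL * (c • D.transpose) + Sf * ∑ i, σ i • T i := by
  have h2 := congrArg (fun Q => Q.transpose * S) h1
  simp only [transpose_mul, Matrix.transpose_add, transpose_units_smul, Matrix.transpose_sum, add_mul,
    smul_mul_assoc, sum_mul] at h2
  rw [hR, hL, mul_sum]
  simp only [mul_smul_comm, hT, smul_mul_assoc, mul_neg, neg_mul]
  rw [mul_assoc Ml.transpose, hS, mul_smul_comm, ← mul_assoc, ← mul_assoc, h2, smul_add, smul_smul, units_mul_self, one_smul,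
    smul_neg, smul_add, neg_add, smul_sum, smul_sum, add_assoc, left_eq_add,
    neg_add_eq_zero]
  refine sum_congr rfl fun i _ => ?_
  rw [smul_smul, smul_smul, smul_smul]
  congr 1
  simp only [mul_comm, mul_left_comm]

lemma isHomMat_transpose {R : Type*} [CommRing R] {par : I → ZMod 2} {d : ZMod 2} {N : Matrix I I R}
    (h : IsHomMat par d N) : IsHomMat par d N.transpose := fun p q hpq => h q p fun h' => hpq <| by
  have : ∀ a b c : ZMod 2, b = a + c → a = b + c := by decide
  exact this _ _ _ h'

lemma IsDualBasis.mat_eq_transpose (h : IsDualBasis e f) :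
    f.mat = -((matSwap B A e.mat).transpose * signMat _ e.par) := by
  have h1 := congrArg Matrix.transpose h.transpose_mat
  rwa [Matrix.transpose_neg, transpose_mul, Matrix.transpose_transpose,
    show (signMat (A ⊠[k] B) e.par).transpose = signMat _ e.par from diagonal_transpose _] at h1

lemma units_mul_smul_mul {R : Type*} [CommRing R] {u v c c' w : ℤˣ} {S D Sf : Matrix I I R} (a : R)
    (hS : S * D = v • (D * S)) (hSf : Sf = w • S) (hu : w * c' * v = c * u) :
    Sf * (a • c' • D) = (c * u) • ((a • D) * S) := by
  rw [hSf, mul_smul_comm, smul_mul_assoc, mul_smul_comm, hS, smul_smul, smul_smul, smul_comm a, smul_mul_assoc, ← hu,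
    mul_assoc]

lemma rhoMat_mul_matR (h : IsDualBasis e f) (s : Finset (Fin B.n)) : rhoMat e.mat s * matR f.mat =
    matL (matSwap A B f.mat) * rhoMat e.mat s + signMat (Tri B A) f.par * ∑ i : Fin B.n, sgNat s i •
      (if i ∈ s then embOut B A (diffQuot k (varL k) (varR k) i B.W) • rhoMat e.mat (s.erase i)
        else embOut B A (varL k i - varR k i) • rhoMat e.mat (insert i s)) := by
  have hS : ∀ t : Finset (Fin B.n), signMat (Tri B A) e.par * (doprod (quotL e.mat) t).transpose =
      ((-1 : ℤˣ) ^ t.card) • ((doprod (quotL e.mat) t).transpose * signMat (Tri B A) e.par) := fun t =>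
    (isHomMat_transpose (isHomMat_doprod (isHomMat_quotL (isHomMat_mat e)) t)).signMat_mul
  have hf : signMat (Tri B A) f.par = ((-1 : ℤˣ) ^ B.n) • signMat (Tri B A) e.par := signMat_add h.par
  have hu : ∀ n c : ℕ, (-1 : ℤˣ) ^ n * (-1) ^ ((n + 1) * (c + 1)) * (-1) ^ (c + 1) = (-1) ^ ((n + 1) * c) * (-1) ^ c :=
    fun n c => by
      rw [← pow_add, ← pow_add, ← pow_add, show n + (n + 1) * (c + 1) + (c + 1) = (n + 1) * c + c + 2 * (n + 1) by ring,
        pow_add _ _ (2 * (n + 1)), pow_mul _ 2, neg_one_sq, one_pow, mul_one]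
  have hu' : ∀ n c : ℕ, (-1 : ℤˣ) ^ n * (-1) ^ ((n + 1) * c) * (-1) ^ c = (-1) ^ ((n + 1) * (c + 1)) * (-1) ^ (c + 1) :=
    fun n c => by
      rw [← pow_add, ← pow_add, ← pow_add, show (n + 1) * (c + 1) + (c + 1) = n + (n + 1) * c + c + 2 * 1 by ring,
        pow_add _ _ (2 * 1), pow_mul _ 2, neg_one_sq, one_pow, mul_one]
  refine transpose_commutator (R := Tri B A) (doprod_mul_matL e.mat_mul_mat s) (S := signMat (Tri B A) e.par) ?_ ?_ (hS s)
    fun i => ?_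
  · rw [h.mat_eq_transpose, map_neg, map_mul, matR_signMat]
    rfl
  · rw [h.mat_eq_transpose, map_neg, map_mul, map_neg, map_mul]
    refine congrArg (fun Q : Matrix I I (Tri B A) => -Q) (congrArg₂ (· * ·) ?_ ?_)
    · change matL (matSwap A B (matSwap B A e.mat)).transpose = _
      rw [matSwap_matSwap]
      rfl
    · have h1 : matSwap A B (signMat (A ⊠[k] B) e.par) = signMat (B ⊠[k] A) e.par := map_signMat _ _
      rw [h1]
      exact map_signMat (I := I) (R := B ⊠[k] A) (R' := Tri B A) (embL B A : B ⊠[k] A →+* Tri B A) e.par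
  · by_cases hi : i ∈ s
    · rw [if_pos hi, if_pos hi]
      refine units_mul_smul_mul (R := Tri B A) _ (hS _) hf ?_
      rw [← card_erase_add_one hi]
      exact hu' _ _
    · rw [if_neg hi, if_neg hi]
      refine units_mul_smul_mul (R := Tri B A) _ (hS _) hf ?_
      rw [card_insert_of_notMem hi]
      exact hu _ _

lemma units_smul_mulVec {R : Type*} [CommRing R] (u : ℤˣ) (Q : Matrix I I R) (v : I → R) (i : I) :
    (u • Q).mulVec v i = u • Q.mulVec v i := by
  rcases Int.units_eq_one_or u with rfl | rfl
  · rw [one_smul, one_smul]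
  · rw [uneg_smul, uneg_smul, one_smul, one_smul, Matrix.neg_mulVec, Pi.neg_apply]

lemma mulVec_of_commutator {R ι : Type*} [CommRing R] [Fintype ι] {T FR FL : Matrix I I R} {par : I → ZMod 2} {σ : ι → ℤˣ}
    {P : ι → Prop} [DecidablePred P] {a b : ι → R} {W W' : ι → Matrix I I R} (v : I → R) (i : I)
    (h : T * FR = FL * T + signMat R par * ∑ j, σ j • (if P j then a j • W j else b j • W' j)) :
    T.mulVec (FR.mulVec v) i = ∑ j, FL i j * T.mulVec v j + (-1) ^ (par i).val *
      ∑ j, σ j • (if P j then a j * (W j).mulVec v i else b j * (W' j).mulVec v i) := by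
  rw [mulVec_mulVec, h, Matrix.add_mulVec, Pi.add_apply, ← mulVec_mulVec, ← mulVec_mulVec, signMat,
    Matrix.mulVec_diagonal, Matrix.sum_mulVec, Finset.sum_apply]
  refine congrArg₂ (· + ·) rfl (congrArg _ (sum_congr rfl fun j _ => ?_))
  rw [units_smul_mulVec]
  split_ifs
  · rw [smul_mulVec, Pi.smul_apply, smul_eq_mul]
  · rw [smul_mulVec, Pi.smul_apply, smul_eq_mul]

/-- The coefficients of the section of the right unit action. -/
def rhoSectionVec (e : X.HomBasis I) (f : Z.HomBasis I) (s : Finset (Fin B.n)) (y : Z.carrier) : I → Tri B A :=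
  (rhoMat e.mat s).mulVec (rcoord f y)

lemma rhoSectionVec_d (h : IsDualBasis e f) (s : Finset (Fin B.n)) (y : Z.carrier) (i : I) :
    rhoSectionVec e f s (Z.d y) i = ∑ j, embL B A (swap(k, A, B) (f.mat i j)) *
      rhoSectionVec e f s y j + (-1) ^ (f.par i).val *
        koszulD (fun i => embOut B A (diffQuot k (varL k) (varR k) i B.W))
      (fun i => embOut B A (varL k i - varR k i)) (fun t => rhoSectionVec e f t y i) s := by
  rw [rhoSectionVec, rcoord_d, mulVec_of_commutator (R := Tri B A) _ i (rhoMat_mul_matR h s), koszulD_eq_sum]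
  rfl

lemma rhoSectionVec_even (h : IsDualBasis e f) (s : Finset (Fin B.n)) (y : Z.carrier) (i : I) :
    rhoSectionVec e f s (Z.even y) i = if f.par i + (s.card : ZMod 2) = 0 then rhoSectionVec e f s y i else 0 := by
  have h1 : ∀ y, rhoSectionVec e f s y i = ∑ j, rhoMat e.mat s i j * embR B A (f.basis.repr y j) := fun y => rfl
  have h3 : ∀ (c : Prop) [Decidable c] (g : I → Tri B A), (if c then ∑ j, g j else 0) = ∑ j, if c then g j else 0 :=
    fun c _ g => by
      split_ifs
      · rfl
      · rw [sum_const_zero]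
  rw [h1, h1, h3]
  refine sum_congr rfl fun j _ => ?_
  by_cases hij : e.par i = e.par j + s.card
  · rw [f.repr_even, h.par, h.par, hij]
    have : ∀ a b c : ZMod 2, (a + b + c + b = 0) ↔ a + c = 0 := by decide
    simp only [this]
    split_ifs
    · rfl
    · rw [map_zero, mul_zero]
  · have h2 : rhoMat e.mat s i j = 0 :=
      (isHomMat_transpose (isHomMat_doprod (isHomMat_quotL (isHomMat_mat e)) s)).units_smul _ i j hij
    rw [h2, zero_mul, zero_mul, ite_self]

/-- The section of the right unit action. -/
def rhoSection (h : IsDualBasis e f) : Hom Z (tensor Z (delta B)) where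
  map :=
    { toFun := fun y => tsum f (deltaBasis B) fun i s => triFirst B A (rhoSectionVec e f s.down y i)
      map_add' := fun x y => by
        rw [← tsum_add]
        refine congrArg _ (funext fun i => funext fun s => ?_)
        rw [rhoSectionVec, map_add, Matrix.mulVec_add, Pi.add_apply, map_add]; rfl
      map_smul' := fun a x => by
        rw [RingHom.id_apply, smul_tsum]
        refine congrArg _ (funext fun i => funext fun s => ?_)
        rw [rhoSectionVec, rcoord_smul, mulVec_smul, Pi.smul_apply, smul_eq_mul, map_mul, triFirst_embR]; rfl }
  map_even y := by
    refine Eq.trans ?_ (tsum_even f (deltaBasis B) fun i s => triFirst B A (rhoSectionVec e f s.down y i)).symm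
    refine congrArg (tsum f (deltaBasis B)) (funext fun i => funext fun s => ?_)
    rw [rhoSectionVec_even h, apply_ite (triFirst B A), map_zero]
    rfl
  map_d y := by
    refine Eq.trans ?_ (tsum_d f (deltaBasis B) fun i s => triFirst B A (rhoSectionVec e f s.down y i)).symm
    refine congrArg (tsum f (deltaBasis B)) (funext fun i => funext fun s => ?_)
    rw [rhoSectionVec_d h, map_add, map_mul, map_pow, map_neg, map_one]
    refine congrArg₂ (· + ·) ?_ (congrArg _ ?_)
    · rw [map_sum]
      refine sum_congr rfl fun j _ => ?_
      rw [map_mul]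
      refine congrArg (· * _) ((triFirst_embL _).trans (congrArg _ ?_))
      exact swap(k, A, B).symm_apply_apply _
    · rw [← embOut_deltaBasis_mat, map_sum]
      refine sum_congr rfl fun t _ => ?_
      rw [map_mul, triFirst_embOut]

lemma rhoHom_act3 (f : Z.HomBasis I) (P : Tri B A) (s : ULift.{u} (Finset (Fin B.n))) (i : I) :
    (rhoHom Z).map (act3 (triFirst B A P) (pt (f.basis i) ((deltaBasis B).basis s))) =
      if s.down = ∅ then swap(k, B, A) (evalDiag B A P) • f.basis i else 0 := by
  induction P using tri_induction_left_out with
  | ha x y hx hy =>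
    rw [map_add, map_add, ladd_apply, map_add, hx, hy, map_add, map_add, add_smul]
    split_ifs
    · rfl
    · exact add_zero _
  | h a b =>
    rw [map_mul, act3_mul, triFirst_embOut, triFirst_embL, act3_in23, act3_in12]
    change rhoMap Z (pt _ _) = _
    rw [rhoMap_pt, map_mul, evalDiag_embOut, evalDiag_embL]
    have h1 : counit B (b • (deltaBasis B).basis s) = if s.down = ∅ then mulMap B b else 0 := by
      change mulMap B (b * (((Pi.basisFun (B ⊠[k] B) (Finset (Fin B.n))).reindex Equiv.ulift.symm) s) ∅) = _
      rw [reindex_apply, symm_symm, ulift_apply, Pi.basisFun_apply, Pi.single_apply]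
      by_cases h : s.down = ∅
      · rw [if_pos h, if_pos h.symm, mul_one]
      · rw [if_neg h, if_neg (Ne.symm h), mul_zero, map_zero]
    rw [h1]
    split_ifs
    · rw [smul_smul, map_mul, tcomm_tmul, mul_comm]
    · exact tmul_zero_smul (X := Z) _

lemma rhoSectionVec_basis (e : X.HomBasis I) (f : Z.HomBasis I) (s : Finset (Fin B.n)) (j i : I) :
    rhoSectionVec e f s (f.basis j) i = rhoMat e.mat s i j := by
  have h1 : rcoord f (f.basis j) = (Pi.single j 1 : I → Tri B A) := funext fun l => by
    rw [rcoord_apply, f.basis.repr_self, single_apply, Pi.single_apply, apply_ite (embR B A), map_one, map_zero]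
    simp only [eq_comm]
  rw [rhoSectionVec, h1]
  exact congrFun (Matrix.mulVec_single_one (R := Tri B A) _ j) i

lemma rhoSection_basis (h : IsDualBasis e f) (j : I) : (rhoSection h).map (f.basis j) =
    ∑ i, ∑ s : ULift.{u} (Finset (Fin B.n)),
      act3 (triFirst B A (rhoMat e.mat s.down i j)) (pt (f.basis i) ((deltaBasis B).basis s)) := by
  change tsum f (deltaBasis B) (fun i s => triFirst B A (rhoSectionVec e f s.down (f.basis j) i)) = _
  simp only [rhoSectionVec_basis]
  rfl

lemma rhoMat_empty (N : Matrix I I (B ⊠[k] A)) : rhoMat N ∅ = 1 := by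
  rw [rhoMat, card_empty, mul_zero, pow_zero, one_smul, doprod_empty]
  exact transpose_one

lemma rhoSection_comp (h : IsDualBasis e f) : (rhoSection h).comp (rhoHom Z) = Hom.id Z :=
  Hom.ext' fun y => lcongr_fun (f.basis.ext (f₁ := ((rhoSection h).comp (rhoHom Z)).map) (f₂ := LinearMap.id)
    fun j => by
      rw [Hom.comp_map, rhoSection_basis, map_sum]
      simp only [map_sum, rhoHom_act3]
      rw [sum_eq_single j]
      · rw [sum_eq_single ⟨∅⟩, if_pos rfl, rhoMat_empty, one_apply_eq, map_one, map_one, one_smul]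
        · rfl
        · intro s _ hs
          exact if_neg fun h => hs (ULift.ext _ _ h)
        · intro h; exact absurd (mem_univ _) h
      · intro i _ hi
        refine sum_eq_zero fun s _ => ?_
        split_ifs with hs
        · rw [hs, rhoMat_empty, one_apply_ne hi, map_zero, map_zero, zero_smul]
        · rfl
      · intro h; exact absurd (mem_univ _) h) y

end RightUnitSections

section TransposedHomotopies

variable {R : Type*} [CommRing R] {I : Type*} [Fintype I] [DecidableEq I] {par : I → ZMod 2}

lemma exists_isHomMat_of_commutator {N E H : Matrix I I R} (hN : IsHomMat par 1 N) (hE : IsHomMat par 0 E)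
    (h : E = N * H + H * N) : ∃ H', IsHomMat par 1 H' ∧ E = N * H' + H' * N := by
  refine ⟨Matrix.of fun p q => if par p = par q + 1 then H p q else 0, fun p q hpq => if_neg hpq, ?_⟩
  refine Matrix.ext fun p q => ?_
  have h1 : ∀ a b c : ZMod 2, a = b → a = c + 1 → c = b + 1 := by decide
  have h2 : ∀ a b c : ZMod 2, c = b + 1 → a = c + 1 → a = b + 0 := by decide
  have h3 : ∀ a b c : ZMod 2, a = b → c = b + 1 → a = c + 1 := by decide
  rw [Matrix.add_apply, mmul_apply, mmul_apply]
  by_cases hpq : par p = par q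
  · rw [h, Matrix.add_apply, mmul_apply, mmul_apply]
    refine congrArg₂ _ (sum_congr rfl fun l _ => ?_) (sum_congr rfl fun l _ => ?_)
    · by_cases hl : par p = par l + 1
      · rw [of_apply, if_pos (h1 _ _ _ hpq hl)]
      · rw [hN p l hl, zero_mul, zero_mul]
    · by_cases hl : par l = par q + 1
      · rw [of_apply, if_pos (h3 _ _ _ hpq hl)]
      · rw [hN l q hl, mul_zero, mul_zero]
  · rw [hE p q fun h' => hpq (by rw [h', add_zero]), ← sum_add_distrib]
    refine (sum_eq_zero fun l _ => ?_).symm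
    have h4 : N p l * (Matrix.of fun p q => if par p = par q + 1 then H p q else 0) l q = 0 := by
      by_cases hl : par p = par l + 1
      · rw [of_apply, if_neg fun h' => hpq ((h2 _ _ _ h' hl).trans (add_zero _)), mul_zero]
      · rw [hN p l hl, zero_mul]
    have h5 : (Matrix.of fun p q => if par p = par q + 1 then H p q else 0) p l * N l q = 0 := by
      by_cases hl : par l = par q + 1
      · rw [of_apply, if_neg fun h' => hpq ((h2 _ _ _ hl h').trans (add_zero _)), zero_mul]
      · rw [hN l q hl, mul_zero]
    rw [h4, h5, add_zero]

lemma exists_transpose_commutator {N E H F : Matrix I I R} (hN : IsHomMat par 1 N) (hE : IsHomMat par 0 E)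
    (hF : F = -(N.transpose * signMat R par)) (h : E = N * H + H * N) : ∃ K, E.transpose = F * K + K * F := by
  obtain ⟨H', hH', h'⟩ := exists_isHomMat_of_commutator hN hE h
  refine ⟨-(signMat R par * H'.transpose), ?_⟩
  have h1 : signMat R par * (N * H').transpose = (N * H').transpose * signMat R par := by
    have := (isHomMat_transpose (hN.mul hH')).signMat_mul (n := 2)
    rwa [neg_one_sq, one_smul] at this
  rw [transpose_mul] at h1
  rw [h', hF, Matrix.transpose_add, transpose_mul, transpose_mul, neg_mul_neg, neg_mul_neg, mul_assoc,
    ← mul_assoc (signMat R par), signMat_mul_self, one_mul, ← mul_assoc, mul_assoc (signMat R par), h1, mul_assoc,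
    signMat_mul_self, mul_one, add_comm]

end TransposedHomotopies

section SecondTriangle

open MvPolynomial

variable {k : Type u} [CommRing k] {A B : Obj k} {X : Fact A B} {Z : Fact B A} {I : Type u} [Fintype I]
  [DecidableEq I] {e : X.HomBasis I} {f : Z.HomBasis I} {L : Finset (Fin B.n) → Matrix I I (B ⊠[k] A)}

/-- The composite of a coevaluation and an evaluation in the second triangle identity. -/
def triangleRight (c : Hom (delta B) (tensor X Z)) (v : Hom (tensor Z X) (delta A)) : Hom (tensor Z (delta B)) Z :=
  ((Hom.id Z).tensor c).comp ((assocInv Z X Z).comp ((v.tensor (Hom.id Z)).comp (lamHom Z)))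

variable (h : IsDualBasis e f)
  (hL : KoszulFamily e.mat (fun j => (pderiv j B.W ⊗ₜ[k] 1 : B ⊠[k] A)) L)
  (hΛ : IsHomMat e.par (B.n : ZMod 2) (L univ))

lemma counit_evHom_tmul_one (p i : I) (a c : B ⊠[k] A) :
    (counit A ((evHom h hL hΛ).map (pt (swap(k, B, A) c • f.basis i) (a • e.basis p))) ⊗ₜ 1 : A ⊠[k] B) =
    ((-1 : ℤˣ) ^ B.n) • resFirst B A (embL B A c * matL (L univ) i p * embL B A a) := by
  have h1 : ∀ i', f.basis.repr (swap(k, B, A) c • f.basis i) i' =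
      if i' = i then swap(k, B, A) c else 0 := fun i' => by
    rw [map_smul, fsmul_apply, f.basis.repr_self, single_apply, smul_eq_mul, mul_ite, mul_one, mul_zero]
    simp only [eq_comm]
  have h2 : ∀ j, e.basis.repr (a • e.basis p) j = if j = p then a else 0 := fun j => by
    rw [map_smul, fsmul_apply, e.basis.repr_self, single_apply, smul_eq_mul, mul_ite, mul_one, mul_zero]
    simp only [eq_comm]
  rw [counit_evHom]
  simp only [h1, h2]
  refine (map_units_smul (includeLeft : A.ring →ₐ[k] A ⊠[k] B).toRingHom _ _).trans
    (congrArg _ ?_)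
  rw [sum_eq_single i, sum_eq_single p, if_pos rfl, if_pos rfl]
  · refine (mulMap_midRes_tmul_one _ _).trans (congrArg _ ?_)
    have h3 : swap(k, A, B) (matSwap B A (L univ) i p) = L univ i p :=
      swap(k, B, A).symm_apply_apply _
    rw [map_mul, map_mul, map_mul, h3, show swap(k, A, B)
      (swap(k, B, A) c) = c from swap(k, B, A).symm_apply_apply c]
    rfl
  · intro j _ hj
    rw [if_neg hj, map_zero, mul_zero, map_zero, map_zero]
  · intro h; exact absurd (mem_univ _) h
  · intro j _ hj
    refine sum_eq_zero fun i' _ => ?_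
    rw [if_neg hj, zero_mul, map_zero, zero_mul, map_zero, map_zero]
  · intro h; exact absurd (mem_univ _) h

lemma tail_pt_act3 (P : Tri B A) (p q i : I) (c : B ⊠[k] A) :
    ((assocInv Z X Z).comp (((evHom h hL hΛ).tensor (Hom.id Z)).comp (lamHom Z))).map
      (pt (swap(k, B, A) c • f.basis i) (act3 (triMid B A P) (pt (e.basis p) (f.basis q)))) =
    ((-1 : ℤˣ) ^ B.n) • resFirst B A (embL B A c * matL (L univ) i p * P) • f.basis q := by
  induction P using tri_induction with
  | ha x y hx hy =>
    rw [map_add, map_add, ladd_apply, map_add, map_add, hx, hy, mul_add, map_add, add_smul, smul_add]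
  | h a b =>
    rw [map_mul, act3_mul, triMid_embL, triMid_embR, act3_in23, act3_in12, Hom.comp_map, assocInv_pt, Hom.comp_map,
      Hom.tensor_pt, Hom.id_map]
    change lamMap Z (pt _ _) = _
    rw [lamMap_pt, counit_evHom_tmul_one, smul_def, smul_assoc, smul_smul, ← smul_def, ← mul_assoc,
      mul_comm _ (embR B A b), resFirst_embR_mul, mul_comm b]

lemma units_smul_resFirst_sum (u : ℤˣ) (r : I → Tri B A) (x : Z.carrier) :
    ∑ q, u • resFirst B A (r q) • x = resFirst B A (u • ∑ q, r q) • x := by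
  have h1 : ∀ q, u • resFirst B A (r q) • x = resFirst B A (u • r q) • x := fun q => by
    rw [smul_def, smul_def, map_zsmul, smul_assoc]
  simp only [h1]
  rw [← sum_smul, ← map_sum, ← smul_sum]

lemma units_smul_sum_mul_mul' {R : Type*} [CommRing R] (u : ℤˣ) (a b : R) (C D : Matrix I I R) (i q : I) :
    u • ∑ p, a * C i p * (b * D p q) = a * b * (u • (C * D)) i q := by
  rw [units_smul_apply, mul_smul_comm, mmul_apply, mul_sum]
  refine congrArg _ (sum_congr rfl fun q _ => ?_)
  ring

lemma triangleRight_act3 (R : Tri B A) (s : ULift.{u} (Finset (Fin B.n))) (i : I) :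
    (triangleRight (coevHom h) (evHom h hL hΛ)).map (act3 (triFirst B A R) (pt (f.basis i) ((deltaBasis B).basis s))) =
      ∑ q, resFirst B A (R * (((-1 : ℤˣ) ^ B.n) • (matL (L univ) * coevMat e.mat s.down)) i q) • f.basis q := by
  induction R using tri_induction_left_out with
  | ha x y hx hy =>
    rw [map_add, map_add, ladd_apply, map_add, hx, hy, ← sum_add_distrib]
    refine sum_congr rfl fun p _ => ?_
    rw [add_mul, map_add, add_smul]
  | h a b =>
    rw [map_mul, act3_mul, triFirst_embL, triFirst_embOut, act3_in23, act3_in12, triangleRight, Hom.comp_map, Hom.tensor_pt,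
      Hom.id_map, coevHom_smul_basis, msum, tsum]
    simp only [map_sum, tail_pt_act3 h hL hΛ, msmul_apply, smul_eq_mul]
    refine sum_comm.trans (sum_congr rfl fun q _ => ?_)
    refine (units_smul_resFirst_sum _ _ _).trans (congrArg (resFirst B A · • f.basis q) ?_)
    exact units_smul_sum_mul_mul' (R := Tri B A) ((-1) ^ B.n) (embL B A a) (embOut B A b)
      (matL (L univ)) (coevMat e.mat s.down) i q

lemma sum_transpose_mul_units_smul {R : Type*} [CommRing R] {u v w x : ℤˣ} (C D E : Matrix I I R) (hw : x * v = w) (p j : I) :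
    ∑ i, (x • E.transpose) i j * (u • (C * (u * v) • D)) i p = (w • (E * C * D)) j p := by
  have h1 : u • (C * (u * v) • D) = v • (C * D) := by
    rw [mul_smul_comm, smul_smul, ← mul_assoc, units_mul_self, one_mul]
  have h2 : w • (E * C * D) = (x • E) * (v • (C * D)) := by
    rw [smul_mul_assoc, mul_smul_comm, smul_smul, hw, mul_assoc]
  rw [h1, h2, mmul_apply]
  rfl

lemma neg_one_pow_mul_card_compl {n : ℕ} (s : Finset (Fin n)) :
    (-1 : ℤˣ) ^ ((n + 1) * sᶜ.card) * (-1) ^ (∑ i ∈ s, (i : ℕ)) = ∏ i ∈ s, (-1 : ℤˣ) ^ (i + n + 1 : ℕ) := by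
  have h1 : sᶜ.card + s.card = n := by rw [add_comm, Finset.card_add_card_compl, card_fin]
  rw [Finset.prod_pow_eq_pow_sum]
  simp only [add_assoc, sum_add_distrib, Finset.sum_const, smul_eq_mul]
  rw [pow_add, mul_comm]
  refine congrArg _ ?_
  have h2 : Even ((n + 1) * sᶜ.card + (s.card * n + s.card * 1)) := by
    have : (n + 1) * sᶜ.card + (s.card * n + s.card * 1) = (sᶜ.card + s.card) * (n + 1) := by ring
    rw [this, h1]
    exact Nat.even_mul_succ_self n
  have h3 := h2.neg_one_pow (α := ℤˣ)
  rw [pow_add] at h3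
  rw [mul_eq_one_iff_eq_inv.1 h3, Int.units_inv_eq_self]

/-- The matrix of the composite of the section and the second triangle. -/
def triangleSum (N Λ : Matrix I I (B ⊠[k] A)) : Matrix I I (Tri B A) :=
  ∑ s : Finset (Fin B.n), (∏ i ∈ s, (-1 : ℤˣ) ^ (i + B.n + 1 : ℕ)) • (doprod (quotL N) sᶜ * matL Λ * oprod (quotL N) s)

lemma triangleRight_section (j : I) :
    ((rhoSection h).comp (triangleRight (coevHom h) (evHom h hL hΛ))).map (f.basis j) =
      ∑ p, ((triangleSum e.mat (L univ)).map (resFirst B A)).transpose p j • f.basis p := by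
  rw [Hom.comp_map, rhoSection_basis, map_sum]
  simp only [map_sum, triangleRight_act3 h hL hΛ]
  refine sum_comm.trans ((sum_congr rfl fun s _ => sum_comm).trans (sum_comm.trans
    (sum_congr rfl fun p _ => ?_)))
  simp only [← sum_smul]
  refine congrArg (· • f.basis p) ?_
  rw [Matrix.transpose_apply, map_apply, triangleSum, Matrix.sum_apply, map_sum]
  refine Fintype.sum_equiv (Equiv.ulift.trans (Function.Involutive.toPerm compl compl_involutive)) _ _ fun s => ?_
  rw [← map_sum]
  refine congrArg (resFirst B A) ?_
  change _ = ((∏ i ∈ s.downᶜ, (-1 : ℤˣ) ^ (i + B.n + 1 : ℕ)) • (doprod (quotL e.mat) s.downᶜᶜ *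
        matL (L univ) * oprod (quotL e.mat) s.downᶜ)) j p
  rw [← neg_one_pow_mul_card_compl, compl_compl, rhoMat, coevMat]
  exact sum_transpose_mul_units_smul (R := Tri B A) _ _ _ rfl p j

lemma isHomMat_triangleSum (hΛ : IsHomMat e.par (B.n : ZMod 2) (L univ)) :
    IsHomMat e.par 0 ((triangleSum e.mat (L univ)).map (resFirst B A)) := fun p q hpq => by
  have h1 : ∀ s : Finset (Fin B.n), IsHomMat e.par 0
      (doprod (quotL e.mat) sᶜ * matL (L univ) * oprod (quotL e.mat) s : Matrix I I (Tri B A)) := fun s => by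
    have h2 := ((isHomMat_doprod (isHomMat_quotL (isHomMat_mat e)) sᶜ).mul (isHomMat_matL hΛ)).mul
      (isHomMat_oprod (isHomMat_quotL (isHomMat_mat e)) s)
    have h3 : (sᶜ.card : ZMod 2) + B.n + s.card = 0 := by
      rw [← cast_add, ← cast_add, add_right_comm, Finset.card_compl_add_card, card_fin, cast_add]
      exact CharTwo.add_self_eq_zero _
    rwa [h3] at h2
  rw [map_apply, triangleSum, Matrix.sum_apply, sum_eq_zero fun s _ => (h1 s).units_smul _ p q hpq, map_zero]

lemma triangleRight_eq : cls (triangleRight (coevHom h) (evHom h hL hΛ)) = cls (rhoHom Z) := by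
  have hN := isHomMat_matSwap (isHomMat_mat e)
  rcases exists_resLast_or e.mat_mul_mat hL with ⟨H, hH⟩ | ⟨-, H, hH⟩
  · have h1 := congrArg (matSwap B A) hH
    rw [map_add, map_mul, map_mul, map_one] at h1
    obtain ⟨K, hK⟩ := exists_transpose_commutator hN isHomMat_one h.mat_eq_transpose h1.symm
    exact cls_eq_of_contraction f (hK.symm.trans transpose_one) _ _
  · have h1 : (triangleSum e.mat (L univ)).map (resFirst B A) - 1 =
        matSwap B A e.mat * H + H * matSwap B A e.mat := sub_eq_iff_eq_add'.2 hH
    have h2 : IsHomMat e.par 0 ((triangleSum e.mat (L univ)).map (resFirst B A) - 1) := fun p q hpq => by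
      rw [Matrix.sub_apply, isHomMat_triangleSum hΛ p q hpq, isHomMat_one p q hpq, sub_zero]
    obtain ⟨K, hK⟩ := exists_transpose_commutator hN h2 h.mat_eq_transpose h1
    rw [Matrix.transpose_sub, transpose_one] at hK
    exact cls_eq_of_section (rhoSection h) (isIso_rhoHom_of_basis f) (congrArg cls (rhoSection_comp h))
      (cls_eq_id_of_mat f _ (triangleRight_section h hL hΛ) (sub_eq_iff_eq_add'.1 hK))

end SecondTriangle

section BicategoricalAdjunction

section

variable {C : Type*} [Bicategory C] {a b : C} {f : a ⟶ b} {g : b ⟶ a} (η : 𝟙 a ⟶ f ≫ g) (θ : g ≫ f ⟶ 𝟙 b)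

open Bicategory

lemma leftZigzag_eq : leftZigzag η θ = η ▷ f ≫ (α_ f g f).hom ≫ f ◁ θ := by
  dsimp only [leftZigzag]; bicategory

lemma rightZigzag_eq : rightZigzag η θ = g ◁ η ≫ (α_ g f g).inv ≫ θ ▷ g := by
  dsimp only [rightZigzag]; bicategory

end

variable {k : Type u} [CommRing k] {h0 : LGWellDefined k} {A B : LG h0} {X : Fact A.obj B.obj} {Z : Fact B.obj A.obj}
  {I J : Type u} [Finite I] [Finite J]

/-- The triangle identities up to homotopy give an adjunction in the bicategory. -/
lemma exists_adjunction (e : X.HomBasis I) (f : Z.HomBasis J) (c : Hom (delta B.obj) (tensor X Z))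
    (v : Hom (tensor Z X) (delta A.obj)) (h1 : cls (triangleLeft c v) = cls (lamHom X))
    (h2 : cls (triangleRight c v) = cls (rhoHom Z)) :
    ∃ adj : Bicategory.Adjunction (LG.mor (A := B) (B := A) f) (LG.mor (A := A) (B := B) e),
      adj.unit = cls c ∧ adj.counit = cls v := by
  refine ⟨{ unit := cls c, counit := cls v, left_triangle := ?_, right_triangle := ?_ }, rfl, rfl⟩
  · refine (leftZigzag_eq _ _).trans ((Iso.eq_comp_inv (h0.lamIso (LG.mor (A := B) (B := A) f))).2 ?_)
    exact h2
  · refine (rightZigzag_eq _ _).trans ((Iso.eq_comp_inv (h0.rhoIso (LG.mor (A := A) (B := B) e))).2 ?_)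
    exact h1

end BicategoricalAdjunction

section TransposedKoszul

variable {P 𝓐 : Type u} [CommRing P] [Ring 𝓐] [Algebra P 𝓐] {n : ℕ} {D E : 𝓐} {f : Fin n → P} {F : Finset (Fin n) → 𝓐}

lemma mul_pow_of_anticommute (hD : D * E = -(E * D)) (m : ℕ) : D * E ^ m = ((-1 : ℤˣ) ^ m) • (E ^ m * D) := by
  induction m with
  | zero => simp
  | succ m ih => rw [pow_succ, ← mul_assoc, ih, smul_mul_assoc, mul_assoc, hD, pow_succ (-1 : ℤˣ), mul_smul, uneg_smul,
      one_smul, mul_neg, mul_assoc]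

/-- A family that satisfies the opposite Koszul relations, corrected by a grading operator `E`. -/
lemma koszulFamily_of_op (hE : E * E = 1) (hD : D * E = -(E * D)) (h0 : F ∅ = 1)
    (hF : ∀ s, F s * E = ((-1 : ℤˣ) ^ s.card) • (E * F s)) (h : ∀ s, F s * D = ((-1 : ℤˣ) ^ s.card) • (D * F s) +
      ∑ i : Fin n, if i ∈ s then sgNat s i • f i • F (s.erase i) else 0) :
    KoszulFamily (D * E) f fun s => E ^ s.card * F s := by
  refine ⟨by rw [card_empty, pow_zero, one_mul, h0], fun s => ?_⟩
  have h1 : F s * (D * E) = -((-1 : ℤˣ) ^ s.card • (E * (F s * D))) := by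
    rw [hD, mul_neg, ← mul_assoc, hF, smul_mul_assoc, mul_assoc]
  have h2 : D * E * (E ^ s.card * F s) = -((-1 : ℤˣ) ^ s.card • (E ^ (s.card + 1) * (D * F s))) := by
    rw [mul_assoc, ← mul_assoc E, ← pow_succ', ← mul_assoc, mul_pow_of_anticommute hD, smul_mul_assoc, pow_succ (-1 : ℤˣ),
      mul_smul, uneg_smul, one_smul, mul_assoc, smul_neg]
  have h3 : ∑ i : Fin n, (if i ∈ s then sgNat s i • f i • (E ^ (s.erase i).card * F (s.erase i)) else 0) =
      E ^ (s.card + 1) * ∑ i : Fin n, if i ∈ s then sgNat s i • f i • F (s.erase i) else 0 := by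
    rw [mul_sum]
    refine sum_congr rfl fun i _ => ?_
    split_ifs with hi
    · rw [mul_smul_comm, mul_smul_comm, ← card_erase_add_one hi, pow_succ, pow_succ, mul_assoc (E ^ _), hE, mul_one]
    · rw [mul_zero]
  rw [h3, h2, mul_assoc (E ^ _), h1, mul_neg, smul_neg, mul_smul_comm, smul_smul, units_mul_self, one_smul, ← mul_assoc (E ^ _) E,
    ← pow_succ, h, mul_add, mul_smul_comm, neg_add, neg_add_cancel_right]

end TransposedKoszul

section HomotopyMatrices

variable {R : Type u} [CommRing R] {w : R} {X : LinFact R w} {I : Type u} [Fintype I] [DecidableEq I] (e : X.HomBasis I)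

lemma toMatrix_d : toMatrixAlgEquiv e.basis X.d = e.mat :=
  Matrix.ext fun i j => toMatrixAlgEquiv_apply _ _ _ _

lemma isHomMat_toMatrix {h : LEnd R X.carrier} (hh : ∀ x, X.even (h x) + h (X.even x) = h x) :
    IsHomMat e.par 1 (toMatrixAlgEquiv e.basis h) := fun i j hij => by
  rw [toMatrixAlgEquiv_apply]
  have h1 := congrArg (fun x => e.basis.repr x i) (hh (e.basis j))
  simp only [map_add, fadd_apply, e.repr_even, e.even_basis, apply_ite h, apply_ite e.basis.repr, map_zero] at h1
  have h2 : ∀ p : ZMod 2, p = 0 ∨ p = 1 := by decide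
  rcases h2 (e.par i) with hi | hi <;> rcases h2 (e.par j) with hj | hj <;> rw [hi, hj] at hij h1
  · simpa using h1
  · exact absurd (by decide) hij
  · exact absurd (by decide) hij
  · simpa using h1.symm

variable {n : ℕ} {f : Fin n → R} {lam : Fin n → LEnd R X.carrier}

/-- The matrices of the ordered products of null-homotopies. -/
def homotopyMat (lam : Fin n → LEnd R X.carrier) : Finset (Fin n) → Matrix I I R :=
  oprod fun i => toMatrixAlgEquiv e.basis (lam i)

lemma koszulFamily_homotopyMat (h : ∀ i, IsNullHomotopy X (f i) (lam i)) : KoszulFamily e.mat f (homotopyMat e lam) :=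
  koszulFamily_oprod fun i => by
    rw [← toMatrix_d, ← map_mul, ← map_mul, ← map_add, ← (toMatrixAlgEquiv e.basis).commutes]
    exact congrArg _ (LinearMap.ext (h i).eq)

lemma isHomMat_homotopyMat (h : ∀ i, IsNullHomotopy X (f i) (lam i)) (s : Finset (Fin n)) :
    IsHomMat e.par (s.card : ZMod 2) (homotopyMat e lam s) :=
  isHomMat_oprod (fun i => isHomMat_toMatrix e (h i).odd) s

lemma homotopyMat_univ (lam : Fin n → LEnd R X.carrier) :
    homotopyMat e lam univ = toMatrixAlgEquiv e.basis (List.ofFn lam).prod := by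
  rw [← oprod_univ]
  exact (map_oprod (toMatrixAlgEquiv e.basis).toAlgHom.toRingHom lam _).symm

lemma repr_eq_mulVec (Λ : LEnd R X.carrier) (x : X.carrier) (i : I) :
    e.basis.repr (Λ x) i = ∑ j, toMatrixAlgEquiv e.basis Λ i j * e.basis.repr x j :=
  (repr_map_eq_sum e.basis e.basis Λ x i).trans (sum_congr rfl fun j _ => by rw [toMatrixAlgEquiv_apply])

end HomotopyMatrices

section DualBases

section

variable {R : Type u} [CommRing R] {w : R} {X : LinFact R w} {I : Type u} (e : X.HomBasis I)

lemma LinFact.HomBasis.repr_dual [Finite I] (ν : Module.Dual R X.carrier) (i : I) :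
    e.dual.basis.repr ν i = ν (e.basis i) := by
  classical exact Basis.dualBasis_repr e.basis ν i

lemma LinFact.HomBasis.mat_dual [Fintype I] (i j : I) : e.dual.mat i j = -((-1) ^ (e.par j).val * e.mat j i) := by
  classical
  refine (e.repr_dual _ i).trans ?_
  change -(e.basis.dualBasis j) (X.sign (X.d (e.basis i))) = _
  rw [Basis.dualBasis_apply, e.repr_sign]
  rfl

lemma LinFact.HomBasis.restrict_basis {R' : Type u} [CommRing R'] (φ : R' ≃+* R) {w' : R'} (hw : φ w' = w) (i : I) :
    (e.restrict φ hw).basis i = e.basis i :=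
  letI : Module R' X.carrier := Module.compHom X.carrier φ.toRingHom
  Basis.mapCoeffs_apply e.basis φ.symm (fun c x => congrArg (· • x) (φ.apply_symm_apply c)) i

lemma LinFact.HomBasis.repr_restrict {R' : Type u} [CommRing R'] (φ : R' ≃+* R) {w' : R'} (hw : φ w' = w)
    (x : X.carrier) (i : I) : (e.restrict φ hw).basis.repr x i = φ.symm (e.basis.repr x i) :=
  rfl

end

variable {k : Type u} [CommRing k] {A B : Obj k} {X : Fact A B} {I : Type u} [Fintype I] [DecidableEq I] (e : X.HomBasis I)

lemma repr_dualFactBasis (ν : X.carrier →ₗ[B ⊠[k] A] B ⊠[k] A) (i : I) :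
    (dualFactBasis e).basis.repr (toDual ν) i = swap(k, B, A) (ν (e.basis i)) :=
  (e.dual.repr_restrict swap(k, A, B).toRingEquiv (swap_pot A B) _ _).trans (congrArg swap(k, B, A) (e.repr_dual ν i))

lemma mat_dualFactBasis (i j : I) : (dualFactBasis e).mat i j =
    -((-1) ^ (e.par j).val * swap(k, B, A) (e.mat j i)) := by
  have h1 : (dualFactBasis e).mat i j = swap(k, B, A) (e.dual.mat i j) := by
    refine (e.dual.repr_restrict swap(k, A, B).toRingEquiv (swap_pot A B) _ _).trans (congrArg swap(k, B, A) ?_)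
    exact congrArg (fun x => e.dual.basis.repr (X.dual.d x) i) (e.dual.restrict_basis swap(k, A, B).toRingEquiv (swap_pot A B) j)
  rw [h1, e.mat_dual, map_neg, map_mul, map_pow, map_neg, map_one]

lemma isDualBasis_left : IsDualBasis e (leftAdjBasis e) := ⟨fun _ => rfl, mat_dualFactBasis e⟩

end DualBases

section AdjunctionFormulas

variable {k : Type u} [CommRing k] {O M : Obj k} {I : Type u} [Fintype I] [DecidableEq I] {Y Y' : Fact M O} {Z : Fact O M}

lemma evPair_mulVec {e : Y.HomBasis I} {e' : Y'.HomBasis I} (f : Z.HomBasis I) {T : Matrix I I (Tri O M)} {y : Y.carrier}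
    {y' : Y'.carrier} (h : lcoord e' y' = T.transpose.mulVec (lcoord e y)) (E : Matrix I I (Tri O M)) (z : Z.carrier) :
    evPair e' f E y' z = evPair e f (T * E) y z := by
  rw [evPair, h, evPair, ← mulVec_mulVec, Matrix.dotProduct_mulVec _ T, Matrix.mulVec_transpose]

lemma evFormula_eq_evPair (e : Y.HomBasis I) (f : Z.HomBasis I) (c : I → ℤ) (y : Y.carrier) (z : Z.carrier)
    (s : Finset (Fin O.n)) : evFormula e f c y z s = midResLin O M (evPair e f
      (oprod (quotL e.mat.transpose) s * Matrix.diagonal fun q => (c q : Tri O M)) y z) := by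
  rw [evFormula_eq, midRes_eq_lin, evPair_eq_sum]
  refine congrArg _ (sum_congr rfl fun p _ => sum_congr rfl fun q _ => ?_)
  rw [Matrix.mul_diagonal, zsmul_eq_mul]
  ring

lemma lcoord_map (e : Y.HomBasis I) (Λ : LEnd (O ⊠[k] M) Y.carrier) (y : Y.carrier) :
    lcoord e (Λ y) = (matL (toMatrixAlgEquiv e.basis Λ)).mulVec (lcoord e y) :=
  funext fun p => by
    rw [lcoord_apply, repr_eq_mulVec, map_sum, Matrix.mulVec, dotProduct]
    exact sum_congr rfl fun q _ => map_mul _ _ _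

lemma units_smul_midResLin (n : ℕ) (P : Tri O M) :
    midResLin O M (((-1 : ℤˣ) ^ n) • P) = ((-1 : ℤ) ^ n) • midResLin O M P := by
  rw [smul_def, map_zsmul]; norm_num

lemma map_mul_C_neg_one_pow {σ R V N : Type*} [CommRing R] [AddCommGroup V] [Module R V] [AddCommGroup N]
    {φ : MvPolynomial σ R → N} {ψ : V →+ N} {P : MvPolynomial σ R} {z : V} (hφ : φ (-P) = -φ P) (h : φ P = ψ z) (n : ℕ) :
    φ (P * MvPolynomial.C ((-1) ^ n)) = ψ ((-1 : R) ^ n • z) := by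
  rcases neg_one_pow_eq_or R n with hn | hn
  · rw [hn, one_smul, map_one, mul_one, h]
  · rw [hn, neg_smul, one_smul, map_neg, map_one, mul_neg, mul_one, map_neg, hφ, h]

lemma act3_triMid_mul_C (n : ℕ) (P : Tri O M) (y : Y.carrier) (z : Z.carrier) :
    act3 (triMid O M (P * MvPolynomial.C ((-1) ^ n))) (pt y z) = act3 (triMid O M P) (pt y ((-1 : M ⊠[k] O) ^ n • z)) :=
  map_mul_C_neg_one_pow (φ := fun P => act3 (triMid O M P) (pt y z))
    (ψ := (LinearMap.toAddMonoidHom (act3 (triMid O M P))).comp (pt y)) (P := P) (z := z) (by rw [map_neg, map_neg]; rfl) rfl n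

lemma neg_one_pow_units_smul_eq_mul {R : Type*} [CommRing R] (a b : ℕ) (x : R) :
    ((-1 : ℤˣ) ^ a * (-1) ^ b) • x = ((-1) ^ a * (-1) ^ b) * x := by
  rw [← pow_add, neg_one_pow_units_smul (R := R), smul_eq_mul, pow_add]

end AdjunctionFormulas

section LeftAdjoint

variable {k : Type u} [CommRing k] {A B : Obj k} {X : Fact A B} {I : Type u} [Fintype I] [DecidableEq I] (e : X.HomBasis I)

lemma coevHom_left (γ : (delta B).carrier) : (coevHom (isDualBasis_left e)).map γ = coevLeft X e γ := by
  rw [coevHom_apply]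
  have h1 : (fun p : I × I => if p.1 = p.2 then (1 : Tri B A) else 0) =
      fun p => if p.1 = p.2 then MvPolynomial.C ((fun _ => 1 : I → A ⊠[k] B) p.1) else 0 := by simp only [map_one]
  rw [coevLeft, h1]
  refine Eq.trans ?_ (coevFormula_eq e (leftAdjBasis e) (fun _ => 1) B.n γ).symm
  refine sum_congr rfl fun s _ => congrArg (γ s • ·) (sum_congr rfl fun p _ => sum_congr rfl fun q _ => ?_)
  refine congrArg (fun P => act3 (triMid B A P) (pt (e.basis p) ((leftAdjBasis e).basis q))) ?_
  refine (neg_one_pow_units_smul_eq_mul (R := Tri B A) _ _ (oprod (quotL e.mat) sᶜ p q)).trans ?_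
  rw [map_one, mul_one]

variable {mu : Fin B.n → LEnd (B ⊠[k] A) X.carrier}

lemma lcoord_comp (Λ : LEnd (B ⊠[k] A) X.carrier) (ν : X.carrier →ₗ[B ⊠[k] A] B ⊠[k] A) :
    lcoord (dualFactBasis e) (toDual (ν ∘ₗ Λ)) = (matL (matSwap B A (toMatrixAlgEquiv e.basis Λ))).transpose.mulVec
      (lcoord (dualFactBasis e) (toDual ν)) := funext fun p => by
  rw [lcoord_apply, repr_dualFactBasis, lcomp_apply, ← e.basis.sum_repr (Λ (e.basis p)), map_sum, map_sum, map_sum,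
    Matrix.mulVec, dotProduct]
  refine sum_congr rfl fun q _ => ?_
  rw [map_smul, smul_eq_mul, map_mul, map_mul, lcoord_apply, repr_dualFactBasis, ← toMatrixAlgEquiv_apply]
  rfl

lemma evHom_left (h : ∀ j, IsNullHomotopy X (pderiv j B.W ⊗ₜ[k] 1) (mu j))
    (hΛ : IsHomMat e.par (B.n : ZMod 2) (homotopyMat e mu univ)) (ν : X.carrier →ₗ[B ⊠[k] A] B ⊠[k] A) (η : X.carrier) :
    (evHom (isDualBasis_left e) (koszulFamily_homotopyMat e h) hΛ).map (pt (toLeft ν) η) =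
      evLeft X e (List.ofFn mu).prod ν η := funext fun s => by
  refine (evHom_pt _ _ _ _ _ s).trans ?_
  rw [evMat, evPair_units_smul, units_smul_midResLin, homotopyMat_univ]
  refine congrArg (((-1 : ℤ) ^ B.n) • ·) ?_
  refine Eq.trans ?_ (evFormula_eq_evPair _ _ _ _ _ s).symm
  rw [evPair_mulVec _ (lcoord_comp e _ ν)]
  have h1 : (Matrix.diagonal fun _ : I => ((1 : ℤ) : Tri A B)) = 1 := by simp only [Int.cast_one]; exact Matrix.diagonal_one
  rw [h1, mul_one]
  rfl

end LeftAdjoint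

section SignedBasis

variable {R : Type u} [CommRing R] {w : R} {X : LinFact R w} {I : Type u} (e : X.HomBasis I) (q : I → ZMod 2)

/-- The basis `(-1)^{q_i} e_i`. -/
def LinFact.HomBasis.twist : X.HomBasis I where
  basis := e.basis.unitsSMul fun i => (-1) ^ (q i).val
  par := e.par
  even_basis i := by
    rw [Basis.unitsSMul_apply, smul_def, map_smul, e.even_basis]
    split_ifs
    · rfl
    · exact smul_zero _

lemma LinFact.HomBasis.twist_basis (i : I) : (e.twist q).basis i = (-1 : R) ^ (q i).val • e.basis i := by
  refine (Basis.unitsSMul_apply (v := e.basis) i).trans ?_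
  rw [smul_def, Units.val_pow_eq_pow_val, Units.val_neg, Units.val_one]

lemma LinFact.HomBasis.twist_repr (x : X.carrier) (i : I) :
    (e.twist q).basis.repr x i = (-1) ^ (q i).val * e.basis.repr x i := by
  refine (Basis.repr_unitsSMul e.basis _ x i).trans ?_
  rw [← inv_pow, inv_neg_one, smul_def, Units.val_pow_eq_pow_val, Units.val_neg, Units.val_one, smul_eq_mul]

lemma LinFact.HomBasis.twist_mat [Fintype I] (i j : I) :
    (e.twist q).mat i j = (-1) ^ (q i).val * (-1) ^ (q j).val * e.mat i j := by
  refine (e.twist_repr q _ i).trans ?_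
  rw [e.twist_basis, map_smul, map_smul, fsmul_apply, smul_eq_mul, mul_assoc]
  rfl

lemma LinFact.HomBasis.twist_mat_par [Fintype I] (n : ZMod 2) : (e.twist fun i => e.par i + n).mat = -e.mat := by
  refine Matrix.ext fun i j => ?_
  rw [e.twist_mat, Matrix.neg_apply]
  by_cases h : e.par i = e.par j + 1
  · have h2 : ∀ x : R, x * x = 1 → -x * x = -1 := fun x hx => by rw [neg_mul, hx]
    rw [h, add_right_comm, neg_one_pow_val_add _ 1, val_one, pow_one, mul_neg_one, h2, neg_one_mul]
    rw [← mul_pow, neg_one_mul, neg_neg, one_pow]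
  · rw [e.mat_eq_zero h, mul_zero, neg_zero]

end SignedBasis

section RightAdjoint

variable {k : Type u} [CommRing k] {A B : Obj k} {X : Fact A B} {I : Type u} [Fintype I] [DecidableEq I] (e : X.HomBasis I)

/-- The basis of `X` that is dual to the basis of `X^†`. -/
def rightDualBasis : X.HomBasis I := e.twist fun i => e.par i + (A.n : ZMod 2)

lemma mat_rightAdjBasis (i j : I) : (rightAdjBasis e).mat i j = (-1) ^ A.n * (dualFactBasis e).mat i j := by
  change (dualFactBasis e).basis.repr ((-1 : A ⊠[k] B) ^ A.n • (dualFact X).d ((dualFactBasis e).basis j)) i = _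
  rw [map_smul, fsmul_apply, smul_eq_mul]
  rfl

lemma isDualBasis_right : IsDualBasis (rightAdjBasis e) (rightDualBasis e) where
  par i := by
    have : ∀ a b : ZMod 2, a = a + b + b := by decide
    exact this _ _
  mat i j := by
    refine (e.twist_mat _ i j).trans ?_
    have h1 : (rightAdjBasis e).par j = e.par j + (A.n : ZMod 2) := rfl
    have h2 := neg_one_pow_val_natCast (R := B ⊠[k] A) A.n
    have h3 : swap(k, A, B) (swap(k, B, A) (e.mat i j)) =
      e.mat i j := swap(k, B, A).symm_apply_apply _
    rw [h1, mat_rightAdjBasis, mat_dualFactBasis]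
    simp only [neg_one_pow_val_add, map_mul, map_neg, map_pow, map_one, h2, h3]
    ring

/-- The matrix `(-1)^{n+1} (-1)^{|e_i|}`. -/
def rightSign : Matrix I I (A ⊠[k] B) := ((-1 : ℤˣ) ^ (A.n + 1)) • signMat _ e.par

lemma mat_rightAdjBasis_eq : (rightAdjBasis e).mat = (matSwap B A e.mat).transpose * rightSign e := by
  refine Matrix.ext fun i j => ?_
  rw [mat_rightAdjBasis, mat_dualFactBasis, rightSign, mul_smul_comm, units_smul_apply, neg_one_pow_units_smul (R := A ⊠[k] B),
    signMat, Matrix.mul_diagonal, smul_eq_mul, pow_succ]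
  change _ = _ * (swap(k, B, A) (e.mat j i) * _)
  ring

lemma rightSign_mul_self : rightSign e * rightSign e = 1 := by
  rw [rightSign, smul_mul_assoc, mul_smul_comm, smul_smul, units_mul_self, one_smul, signMat_mul_self]

lemma units_smul_mul_comm {R : Type*} [CommRing R] {u c : ℤˣ} {S Q : Matrix I I R} (h : S * Q = c • (Q * S)) :
    Q * (u • S) = c • ((u • S) * Q) := by
  rw [smul_mul_assoc, h, mul_smul_comm, smul_comm c, smul_smul c, units_mul_self, one_smul]

lemma IsHomMat.mul_rightSign {d : ℕ} {Q : Matrix I I (A ⊠[k] B)} (h : IsHomMat e.par (d : ZMod 2) Q) :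
    Q * rightSign e = ((-1 : ℤˣ) ^ d) • (rightSign e * Q) :=
  units_smul_mul_comm (R := A ⊠[k] B) h.signMat_mul

/-- The transposed null-homotopies of `X^†`. -/
def rightHomotopyMat (L : Finset (Fin A.n) → Matrix I I (B ⊠[k] A)) (s : Finset (Fin A.n)) :
    Matrix I I (A ⊠[k] B) := rightSign e ^ s.card * (matSwap B A (L s)).transpose

variable {L : Finset (Fin A.n) → Matrix I I (B ⊠[k] A)}

lemma transpose_eq_of_comm {R : Type*} [CommRing R] {ι : Type*} [Fintype ι] {u : ℤˣ} {N F : Matrix I I R} {σ : ι → ℤˣ} {P : ι → Prop}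
    [DecidablePred P] {a : ι → R} {Q : ι → Matrix I I R}
    (h : N * F = u • (F * N) + ∑ i, if P i then σ i • a i • Q i else 0) :
    F.transpose * N.transpose = u • (N.transpose * F.transpose) + ∑ i, if P i then σ i • a i • (Q i).transpose else 0 := by
  rw [← transpose_mul, h, Matrix.transpose_add, transpose_units_smul, transpose_mul, Matrix.transpose_sum]
  refine congrArg₂ _ rfl (sum_congr rfl fun i _ => ?_)
  split_ifs
  · rfl
  · exact Matrix.transpose_zero

lemma koszulFamily_right (hL : KoszulFamily e.mat (fun i => (1 ⊗ₜ[k] pderiv i A.W : B ⊠[k] A)) L)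
    (hH : ∀ s, IsHomMat e.par (s.card : ZMod 2) (L s)) :
    KoszulFamily (rightAdjBasis e).mat (fun i => (pderiv i A.W ⊗ₜ[k] 1 : A ⊠[k] B)) (rightHomotopyMat e L) := by
  have h1 := KoszulFamily.map (𝓐 := Matrix I I (B ⊠[k] A)) (𝓑 := Matrix I I (A ⊠[k] B))
    (P := B ⊠[k] A) (P' := A ⊠[k] B) (f' := fun i => pderiv i A.W ⊗ₜ[k] 1) (matSwap B A)
    (fun j x => matSwap_smul B A 1 (pderiv j A.W) x) hL
  have h2 : ∀ s, IsHomMat e.par (s.card : ZMod 2) (matSwap B A (L s)).transpose :=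
    fun s => isHomMat_transpose (isHomMat_matSwap (hH s))
  have h4 := fun s : Finset (Fin A.n) => transpose_eq_of_comm (R := A ⊠[k] B) (ι := Fin A.n)
    (a := fun i : Fin A.n => pderiv i A.W ⊗ₜ[k] 1)
    (N := matSwap B A e.mat) (F := matSwap B A (L s)) (Q := fun i => matSwap B A (L (s.erase i)))
    (P := fun i : Fin A.n => i ∈ s) (σ := fun i : Fin A.n => sgNat s i) (u := (-1) ^ s.card) (h1.comm s)
  rw [mat_rightAdjBasis_eq]
  refine koszulFamily_of_op (rightSign_mul_self e) ?_ ?_ (fun s => IsHomMat.mul_rightSign e (h2 s))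
    fun s => h4 s
  · have h3 := IsHomMat.mul_rightSign e (d := 1) (Q := (matSwap B A e.mat).transpose) (by
      rw [Nat.cast_one]; exact isHomMat_transpose (isHomMat_matSwap (isHomMat_mat e)))
    rw [h3, pow_one, uneg_smul, one_smul]
  · rw [hL.empty, map_one]; exact transpose_one

lemma isHomMat_rightSign_pow (m : ℕ) : IsHomMat e.par 0 (rightSign e ^ m) := by
  induction m with
  | zero => rw [pow_zero]; exact isHomMat_one
  | succ m ih =>
    rw [pow_succ, ← add_zero (0 : ZMod 2)]
    refine ih.mul (IsHomMat.units_smul (fun p q hpq => ?_) _)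
    rw [signMat, Matrix.diagonal_apply_ne]
    rintro rfl
    exact hpq (add_zero _).symm

lemma isHomMat_rightHomotopyMat (hL : IsHomMat e.par (A.n : ZMod 2) (L univ)) :
    IsHomMat (rightAdjBasis e).par (A.n : ZMod 2) (rightHomotopyMat e L univ) := fun p q hpq => by
  have h1 := (isHomMat_rightSign_pow e (univ : Finset (Fin A.n)).card).mul (isHomMat_transpose (isHomMat_matSwap hL))
  rw [zero_add] at h1
  refine h1 p q fun h2 => hpq ?_
  change e.par p + (A.n : ZMod 2) = e.par q + (A.n : ZMod 2) + (A.n : ZMod 2)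
  rw [h2]

lemma coevHom_right (γ : (delta A).carrier) : (coevHom (isDualBasis_right e)).map γ = coevRight X e γ := by
  rw [coevHom_apply]
  have h1 : (fun p : I × I => if p.1 = p.2 then (-1 : Tri A B) ^ (e.par p.1).val else 0) =
      fun p => if p.1 = p.2 then MvPolynomial.C ((fun i => (-1 : B ⊠[k] A) ^ (e.par i).val) p.1) else 0 := by
    simp only [map_pow, map_neg, map_one]
  rw [coevRight, h1]
  refine Eq.trans ?_ (coevFormula_eq (rightAdjBasis e) e (fun i => (-1 : B ⊠[k] A) ^ (e.par i).val) 0 γ).symm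
  refine sum_congr rfl fun s _ => congrArg (γ s • ·) (sum_congr rfl fun p _ => sum_congr rfl fun q _ => ?_)
  refine Eq.trans ?_ (congrArg (fun P => act3 (triMid A B P) (pt ((rightAdjBasis e).basis p) (e.basis q)))
    (mul_assoc (G := Tri A B) _ _ _))
  refine Eq.trans ?_ (act3_triMid_mul_C _ _ _ _).symm
  have h2 : (rightDualBasis e).basis q = (-1 : B ⊠[k] A) ^ A.n • (-1 : B ⊠[k] A) ^ (e.par q).val • e.basis q := by
    rw [rightDualBasis, e.twist_basis, neg_one_pow_val_add, neg_one_pow_val_natCast, mul_comm, mul_smul]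
  rw [h2]
  refine (act3_triMid_mul_C _ _ _ _).symm.trans ?_
  refine congrArg (fun P => act3 (triMid A B P) (pt ((rightAdjBasis e).basis p) ((-1 : B ⊠[k] A) ^ (e.par q).val • e.basis q))) ?_
  refine (congrArg (· * MvPolynomial.C ((-1 : B ⊠[k] A) ^ A.n))
    (neg_one_pow_units_smul_eq_mul (R := Tri A B) _ _ (oprod (quotL (rightAdjBasis e).mat) sᶜ p q))).trans ?_
  have h3 : ∀ (R : Type u) [CommRing R] (a b : R) (n : ℕ), (-1) ^ n * a * b * (-1) ^ n = (-1) ^ 0 * a * b := fun R _ a b n => by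
    have : (-1 : R) ^ n * (-1) ^ n = 1 := by rw [← mul_pow, neg_one_mul, neg_neg, one_pow]
    linear_combination (a * b) * this
  rw [map_pow, map_neg, map_one]
  exact h3 (Tri A B) _ _ _

lemma neg_one_units_smul_apply {R : Type*} [CommRing R] (N : Matrix I I R) (p q : I) : ((-1 : ℤˣ) • N) p q = -N p q := by
  rw [units_smul_apply, uneg_smul, one_smul]

lemma oprod_quotL_neg {O M : Obj k} (N : Matrix I I (O ⊠[k] M)) (s : Finset (Fin O.n)) :
    oprod (quotL (-N)) s = ((-1 : ℤˣ) ^ s.card) • oprod (quotL N) s := by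
  have h1 : ∀ i, quotL (-N) i = (-1 : ℤˣ) • quotL N i := fun i => by
    refine Matrix.ext fun p q => Eq.trans ?_ (neg_one_units_smul_apply (R := Tri O M) (quotL N i) p q).symm
    change dquot _ i (embL O M (-N p q)) = -dquot _ i (embL O M (N p q))
    rw [map_neg, map_neg]
  rw [funext h1, oprod_smul, Finset.prod_const]

lemma signed_mul_mul {R : Type*} [CommRing R] {u v c : ℤˣ} {S Λ Q : Matrix I I R} {n : ℕ} (hΛ : S * Λ = u • (Λ * S))
    (hQ : S * Q = v • (Q * S)) (hc : c ^ n = 1) : (u • S) * ((c • S) ^ n * Λ * (v • Q)) = S ^ n * Λ * (Q * S) := by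
  rw [smul_pow, hc, one_smul, mul_smul_comm, mul_smul_comm, smul_mul_assoc, ← mul_assoc, ← mul_assoc, ← pow_succ', pow_succ,
    mul_assoc (S ^ n), hΛ, mul_smul_comm, smul_mul_assoc, smul_smul u, units_mul_self, one_smul, mul_assoc, mul_assoc Λ, hQ,
    mul_smul_comm, mul_smul_comm, smul_smul, units_mul_self, one_smul, mul_assoc]

lemma lcoord_sign_iterate {O M : Obj k} {Y : Fact M O} (f : Y.HomBasis I) (n : ℕ) (y : Y.carrier) :
    lcoord f (Y.sign^[n] y) = (signMat (Tri O M) f.par ^ n).mulVec (lcoord f y) := by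
  induction n with
  | zero => rw [pow_zero, Matrix.one_mulVec]; rfl
  | succ n ih => rw [iterate_succ_apply', lcoord_sign, ih, mulVec_mulVec, pow_succ']

lemma transpose_signMat_pow {R : Type*} [CommRing R] (par : I → ZMod 2) (n : ℕ) :
    (signMat R par ^ n).transpose = signMat R par ^ n := by
  rw [Matrix.transpose_pow, signMat, diagonal_transpose]

variable {lam : Fin A.n → LEnd (B ⊠[k] A) X.carrier}

lemma lcoord_rightDualBasis (η : X.carrier) : lcoord (rightDualBasis e) η =
    (((-1 : ℤˣ) ^ A.n) • signMat (Tri B A) e.par).transpose.mulVec (lcoord e η) := by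
  rw [← signMat_add (R := Tri B A) (par' := fun i => e.par i + (A.n : ZMod 2)) fun i => rfl]
  refine funext fun p => ?_
  rw [signMat, diagonal_transpose, Matrix.mulVec_diagonal, lcoord_apply, lcoord_apply, rightDualBasis, e.twist_repr, map_mul, map_pow,
    map_neg, map_one]

lemma matL_rightHomotopyMat : matL (matSwap A B (rightHomotopyMat e L univ)) =
    (((-1 : ℤˣ) ^ (A.n + 1)) • signMat (Tri B A) e.par) ^ A.n * matL (L univ).transpose := by
  have h1 : matSwap A B (matSwap B A (L univ)).transpose = (L univ).transpose :=
    matSwap_matSwap B A (L univ).transpose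
  have h2 : matSwap A B (rightSign e) = ((-1 : ℤˣ) ^ (A.n + 1)) • signMat (B ⊠[k] A) e.par :=
    (map_units_smul (R := Matrix I I (A ⊠[k] B)) (R' := Matrix I I (B ⊠[k] A)) (matSwap A B) _ _).trans
      (congrArg (((-1 : ℤˣ) ^ (A.n + 1)) • ·) (map_signMat (I := I) (R := A ⊠[k] B) (R' := B ⊠[k] A)
        swap(k, A, B).toAlgHom.toRingHom e.par))
  have h3 : matL (((-1 : ℤˣ) ^ (A.n + 1)) • signMat (B ⊠[k] A) e.par) =
      ((-1 : ℤˣ) ^ (A.n + 1)) • signMat (Tri B A) e.par :=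
    (map_units_smul (R := Matrix I I (B ⊠[k] A)) (R' := Matrix I I (Tri B A)) matL _ _).trans
      (congrArg (((-1 : ℤˣ) ^ (A.n + 1)) • ·) (map_signMat (I := I) (R := B ⊠[k] A) (R' := Tri B A)
        (embL B A : _ →+* Tri B A) e.par))
  rw [rightHomotopyMat, map_mul, h1, map_mul, map_pow, map_pow, card_univ, card_fin, h2, h3]

lemma evHom_right (h : ∀ i, IsNullHomotopy X (1 ⊗ₜ[k] pderiv i A.W) (lam i))
    (η : X.carrier) (ν : X.carrier →ₗ[B ⊠[k] A] B ⊠[k] A)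
    (hΛ : IsHomMat (rightAdjBasis e).par (A.n : ZMod 2) (rightHomotopyMat e (homotopyMat e lam) univ)) :
    (evHom (isDualBasis_right e) (koszulFamily_right e (koszulFamily_homotopyMat e h) (isHomMat_homotopyMat e h)) hΛ).map
      (pt η (toRight ν)) = evRight X e (List.ofFn lam).prod η ν := funext fun s => by
  refine (evHom_pt _ _ _ _ _ s).trans ?_
  rw [evMat, evPair_units_smul, units_smul_midResLin]
  refine congrArg (((-1 : ℤ) ^ A.n) • ·) ?_
  refine Eq.trans ?_ (evFormula_eq_evPair _ _ _ _ _ s).symm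
  have hΛ' := isHomMat_homotopyMat e h univ
  rw [card_univ, card_fin] at hΛ'
  have h1 : lcoord e ((List.ofFn lam).prod (X.sign^[A.n] η)) =
      (signMat (Tri B A) e.par ^ A.n * matL (homotopyMat e lam univ).transpose).transpose.mulVec (lcoord e η) := by
    rw [lcoord_map, lcoord_sign_iterate, mulVec_mulVec, ← homotopyMat_univ, transpose_mul, transpose_signMat_pow]
    rfl
  have h2 : (Matrix.diagonal fun q : I => (((-1) ^ (e.par q).val : ℤ) : Tri B A)) = signMat (Tri B A) e.par := by
    simp only [Int.cast_pow, Int.cast_neg, Int.cast_one]; rfl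
  have h3 := signed_mul_mul (R := Tri B A) (c := (-1) ^ (A.n + 1)) (n := A.n)
    (isHomMat_matL (isHomMat_transpose hΛ')).signMat_mul
    (isHomMat_oprod (fun i => isHomMat_quotL (isHomMat_transpose (isHomMat_mat e)) i) s).signMat_mul (by
      rw [← pow_mul, mul_comm]; exact (Nat.even_mul_succ_self _).neg_one_pow)
  rw [evPair_mulVec _ (lcoord_rightDualBasis e η), evPair_mulVec _ h1, h2, ← h3, matL_rightHomotopyMat]
  have h4 : (rightDualBasis e).mat.transpose = -e.mat.transpose := congrArg Matrix.transpose (e.twist_mat_par _)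
  rw [h4, oprod_quotL_neg]
  rfl

end RightAdjoint

lemma exists_isNullHomotopy_right {k : Type u} [CommRing k] {A B : Obj k} (X : Fact A B) {I : Type u}
    (e : X.HomBasis I) (i : Fin A.n) : ∃ h, IsNullHomotopy X (1 ⊗ₜ[k] pderiv i A.W : B ⊠[k] A) h := by
  let σ := swap(k, B, A)
  let τ := swap(k, A, B)
  let D := LinearMap.rTensor B.ring (pderiv (R := k) i).toLinearMap
  obtain ⟨h, hh⟩ := exists_isNullHomotopy_of_derivation X e
    (-(τ.toLinearMap ∘ₗ D ∘ₗ σ.toLinearMap)).toAddMonoidHom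
    fun a b => by
      change -τ (D (σ (a * b))) = -τ (D (σ a)) * b + a * -τ (D (σ b))
      rw [map_mul, rTensor_leibniz, map_add, map_mul, map_mul, show τ (σ b) = b from σ.symm_apply_apply b,
        show τ (σ a) = a from σ.symm_apply_apply a]
      ring
  have e1 : -τ (D (σ (pot k B.W A.W))) = 1 ⊗ₜ[k] pderiv i A.W := by
    have : (pderiv (R := k) i).toLinearMap (1 : A.ring) = 0 := (pderiv i).map_one_eq_zero
    rw [map_sub, tcomm_tmul, tcomm_tmul, map_sub, rTensor_tmul,
      rTensor_tmul, this, zero_tmul, zero_sub, map_neg, neg_neg, tcomm_tmul]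
    rfl
  exact ⟨h, e1 ▸ hh⟩

section Adjoints

variable {k : Type u} [CommRing k] {h0 : LGWellDefined k} {A B : LG h0} {X : Fact A.obj B.obj} {I : Type u} [Fintype I]
  [DecidableEq I] (e : X.HomBasis I)

theorem exists_adjunction_right {lam : Fin A.obj.n → LEnd (B.obj.ring ⊗[k] A.obj.ring) X.carrier}
    (h : ∀ i, IsNullHomotopy X (1 ⊗ₜ[k] pderiv i A.obj.W) (lam i)) :
    ∃ (coev : Hom (delta A.obj) (tensor (rightAdj X) X)) (ev : Hom (tensor X (rightAdj X)) (delta B.obj)),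
      (∀ γ, coev.map γ = coevRight X e γ) ∧ (∀ η ν, ev.map (pt η (toRight ν)) = evRight X e (List.ofFn lam).prod η ν) ∧
      ∃ adj : Bicategory.Adjunction (LG.mor (A := A) (B := B) e) (LG.right e),
        adj.unit = cls coev ∧ adj.counit = cls ev := by
  have hΛ := isHomMat_homotopyMat e h univ
  rw [card_univ, card_fin] at hΛ
  have hΛ' := isHomMat_rightHomotopyMat e hΛ
  refine ⟨coevHom (isDualBasis_right e), evHom (isDualBasis_right e)
    (koszulFamily_right e (koszulFamily_homotopyMat e h) (isHomMat_homotopyMat e h)) hΛ', coevHom_right e,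
    fun η ν => evHom_right e h η ν hΛ', ?_⟩
  exact exists_adjunction (A := B) (B := A) (rightAdjBasis e) (rightDualBasis e) _ _ (triangleLeft_eq _ _ _)
    (triangleRight_eq _ _ _)

theorem exists_adjunction_left {mu : Fin B.obj.n → LEnd (B.obj.ring ⊗[k] A.obj.ring) X.carrier}
    (h : ∀ j, IsNullHomotopy X (pderiv j B.obj.W ⊗ₜ[k] 1) (mu j)) :
    ∃ (coev : Hom (delta B.obj) (tensor X (leftAdj X))) (ev : Hom (tensor (leftAdj X) X) (delta A.obj)),
      (∀ γ, coev.map γ = coevLeft X e γ) ∧ (∀ ν η, ev.map (pt (toLeft ν) η) = evLeft X e (List.ofFn mu).prod ν η) ∧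
      ∃ adj : Bicategory.Adjunction (LG.left (A := A) (B := B) e) (LG.mor e),
        adj.unit = cls coev ∧ adj.counit = cls ev := by
  have hΛ := isHomMat_homotopyMat e h univ
  rw [card_univ, card_fin] at hΛ
  exact ⟨coevHom (isDualBasis_left e), evHom (isDualBasis_left e) (koszulFamily_homotopyMat e h) hΛ, coevHom_left e,
    evHom_left e h hΛ, exists_adjunction e (leftAdjBasis e) _ _ (triangleLeft_eq _ _ _) (triangleRight_eq _ _ _)⟩

/-- Idempotent 2-morphisms split. -/
lemma exists_splitting_oneMor (F : A ⟶ B) (ε : F ⟶ F) (hε : ε ≫ ε = ε) :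
    ∃ (G : A ⟶ B) (r : F ⟶ G) (s : G ⟶ F), s ≫ r = 𝟙 G ∧ r ≫ s = ε := by
  obtain ⟨Y, hY, r, s, hsr, hrs⟩ := exists_splitting F.isMF ε hε
  obtain ⟨P, hP, s', r', hsr'⟩ := F.isSummand
  refine ⟨⟨Y, hY, P, hP, s ≫ s', r' ≫ r, ?_⟩, r, s, hsr, hrs⟩
  rw [assoc, ← assoc s', hsr', id_comp, hsr]

theorem exists_adjoints (X : A ⟶ B) :
    (∃ Y : B ⟶ A, Nonempty (Bicategory.Adjunction Y X)) ∧ (∃ Y : B ⟶ A, Nonempty (Bicategory.Adjunction X Y)) := by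
  classical
  obtain ⟨F, ⟨I, hI, ⟨e⟩⟩, s, r, hsr⟩ := X.isSummand
  have := Fintype.ofFinite I
  choose mu hmu using exists_isNullHomotopy_left F e
  choose lam hlam using exists_isNullHomotopy_right F e
  obtain ⟨-, -, -, -, adj, -⟩ := exists_adjunction_left e hmu
  obtain ⟨-, -, -, -, adj', -⟩ := exists_adjunction_right e hlam
  exact ⟨exists_leftAdjoint_of_retract adj (g' := X) s r hsr fun ε => exists_splitting_oneMor _ ε,
    exists_rightAdjoint_of_retract adj' (f' := X) s r hsr fun ε => exists_splitting_oneMor _ ε⟩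

end Adjoints

end LGModels

end

open LGModels LGModels.LinFact CategoryTheory TensorProduct in
theorem theorem6p9 (k : Type u) [CommRing k] :
    ∃ h : LGWellDefined k,
      (∀ (A B : LG h) (X : A ⟶ B),
        (∃ Y : B ⟶ A, Nonempty (Bicategory.Adjunction Y X)) ∧
        (∃ Y : B ⟶ A, Nonempty (Bicategory.Adjunction X Y))) ∧
      ∀ (A B : LG h) (X : Fact A.obj B.obj) (I : Type u) [Fintype I] [DecidableEq I]
        (e : X.HomBasis I)
        (lam : Fin A.obj.n → Module.End (B.obj.ring ⊗[k] A.obj.ring) X.carrier)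
        (_ : ∀ i, IsNullHomotopy X (1 ⊗ₜ[k] MvPolynomial.pderiv i A.obj.W) (lam i))
        (mu : Fin B.obj.n → Module.End (B.obj.ring ⊗[k] A.obj.ring) X.carrier)
        (_ : ∀ j, IsNullHomotopy X (MvPolynomial.pderiv j B.obj.W ⊗ₜ[k] 1) (mu j)),
        (∃ (coev : Hom (delta A.obj) (tensor (rightAdj X) X))
            (ev : Hom (tensor X (rightAdj X)) (delta B.obj)),
          (∀ γ, coev.map γ = coevRight X e γ) ∧
          (∀ η ν, ev.map (pt η (toRight ν)) = evRight X e (List.ofFn lam).prod η ν) ∧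
          ∃ adj : Bicategory.Adjunction (LG.mor (A := A) (B := B) e) (LG.right e),
            adj.unit = cls coev ∧ adj.counit = cls ev) ∧
        (∃ (coev : Hom (delta B.obj) (tensor X (leftAdj X)))
            (ev : Hom (tensor (leftAdj X) X) (delta A.obj)),
          (∀ γ, coev.map γ = coevLeft X e γ) ∧
          (∀ ν η, ev.map (pt (toLeft ν) η) = evLeft X e (List.ofFn mu).prod ν η) ∧
          ∃ adj : Bicategory.Adjunction (LG.left (A := A) (B := B) e) (LG.mor e),
            adj.unit = cls coev ∧ adj.counit = cls ev) := by
  exact ⟨lgWellDefined k, fun _ _ X => exists_adjoints X, fun _ _ _ _ _ _ e _ hlam _ hmu =>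
    ⟨exists_adjunction_right e hlam, exists_adjunction_left e hmu⟩⟩
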